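/- **Setting.** A family of Banach spaces $(X^s,|\cdot|_s)_{s\in\mathbb R}$ is a Banach scale if (a) for $s\le s'$, $X^{s'}\subset X^s$ and $|\cdot|_s\le|\cdot|_{s'}$; (b) there are linear smoothing operators $\mathcal S_\theta$ ($\theta\ge1$), mapping every $X^s$ into every $X^{s'}$, with $|(1-\mathcal S_\theta)u|_s\le C_{s,s'}\theta^{s-s'}|u|_{s'}$ for $s<s'$, $u\in X^{s'}$, and $|\mathcal S_\theta u|_{s'}\le C_{s,s'}\theta^{s'-s}|u|_s$ for $s\le s'$, $u\in X^s$; (c) $|u|_{s''}\le C_{s,s',s''}|u|_s^{\mu}|u|_{s'}^{1-\mu}$ for $s\le s''\le s'$, $u\in X^{s'}$, where $\mu\in[0,1]$ and $\mu s+(1-\mu)s'=s''$. Let $(X^s)$ be a Banach scale, $\varepsilon_0>0$, $T>0$, $p\in\mathbb N$ ($p=0$ allowed), $s_0\in\mathbb R$, $m,d_1,d_1'\ge0$. For $0<\varepsilon<\varepsilon_0$ let $\mathcal L^\varepsilon(t):X^{s+m}\to X^s$ ($t\in\mathbb R$, $s\ge s_0$) be linear and $\mathcal F^\varepsilon[t,\cdot]:X^{s+m}\to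 X^s$ ($t\in[0,T]$, $s\ge s_0$) be nonlinear, and consider $$\partial_t u^\varepsilon+\tfrac1\varepsilon\mathcal L^\varepsilon(t)u^\varepsilon+\mathcal F^\varepsilon[t,u^\varepsilon]=h^\varepsilon,\qquad u^\varepsilon|_{t=0}=u_0^\varepsilon.\tag{1}$$ Write $|f|_{X^s_T}=\sup_{[0,T]}|f(t)|_s$. Let $X^s_{(j)}=\bigcap_{k=0}^jC^k([0,T];X^{s-km})$ with $|u|_{X^s_{(j)}}=\sum_{k=0}^j|(\varepsilon\partial_t)^ku|_{X^{s-km}_T}$; let $F^s_{(p)}=\{(f,g): f\in X^s_{(p)},\ g\in X^{s+m}\}$ with $|(f,g)|_{F^s_{(p)}}=|f|_{X^s_{(p)}}+|g|_{s+m}$; and let $$\mathcal I^s_{(p)}(t,f,g)=|g|_{s+m}+\int_0^t\sum_{i=0}^p\sup_{0\le t''\le t'}|(\varepsilon\partial_t)^if(t'')|_{s-im}\,dt'.$$ Below, $C(\cdot)$ denotes constants that are independent of $\varepsilon\in(0,\varepsilon_0)$ (they may depend on $\varepsilon_0$, $s$, $T$) and nondecreasing in the displayed argument. Assume: 1. For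 all $s\ge s_0$: $\mathcal L^\varepsilon\in C^p(\mathbb R;\mathfrak L(X^{s+m};X^s))$ and, for $0\le i\le p$, $(\varepsilon^i\partial_t^i\mathcal L^\varepsilon)_{0<\varepsilon<\varepsilon_0}$ is bounded in $C([0,T];\mathfrak L(X^{s+m};X^s))$. Moreover one can define an evolution operator $U^\varepsilon(t)\in\mathfrak L(X^s,X^s)$, $t\in\mathbb R$, continuous in $t$ (in the sense that $t\mapsto U^\varepsilon(t)g$ is continuous for every $g\in X^s$) and bounded in $\mathfrak L(X^s,X^s)$ uniformly in $|t|\le T$ and $\varepsilon$, such that $u^\varepsilon(t)=U^\varepsilon(t)g$ solves $\partial_tu^\varepsilon+\frac1\varepsilon\mathcal L^\varepsilon(t)u^\varepsilon=0$, $u^\varepsilon|_{t=0}=g$. 2. For all $0\le i\le p$, $0\le i+j\le p+2$ and $s\ge s_0+im$, one has $\mathcal F^\varepsilon\in C^i([0,T];C^j(X^{s+m},X^{s-im}))$ and, for all $u,v_1,\dots,v_j\in X^{s+m}$, with $\sigma=s_0+(i+1)m$, $$\sup_{t\in[0,T]}\big|\varepsilon^i\partial_t^i\partial_u^j\mathcal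 F^\varepsilon[t,u](v_1,\dots,v_j)\big|_{s-im}\le C(|u|_{\sigma})\Big(\sum_{k=1}^j|v_k|_{s+m}\prod_{l\ne k}|v_l|_{\sigma}+|u|_{s+m}\prod_{k=1}^j|v_k|_{\sigma}\Big).$$ 3. For all $s\ge s_0+m$, $\varepsilon\in(0,\varepsilon_0)$, $u\in X^{s+d_1}_{(p+1)}$ and $(f,g)\in F^{s+d_1'}_{(p)}$, the problem $\partial_tv+\frac1\varepsilon\mathcal L^\varepsilon(t)v+\mathcal F^\varepsilon_u[t,u]v=f$, $v|_{t=0}=g$, has a unique solution $v\in C([0,T];X^s)$, and for all $t\in[0,T]$ $$|v(t)|_s\le C\big(|u|_{X^{s_0+m+d_1}_{(p+1)}}\big)\Big(\mathcal I^{s+d_1'}_{(p)}(t,f,g)+|u|_{X^{s+d_1}_{(p+1)}}\,\mathcal I^{s_0+m+d_1'}_{(p)}(t,f,g)\Big).$$ **Theorem 1'.** Let $\delta=\max\{d_1,d_1'+m\}$, $D>\delta$, $q=D-m-d_1'$, $P>P_{min}:=\delta+\frac Dq\big(\sqrt\delta+\sqrt{2(\delta+q)}\big)^2$, $s\ge s_0+(p+1)m$,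 and let $(h^\varepsilon,u_0^\varepsilon)_{0<\varepsilon<\varepsilon_0}$ be bounded in $F^{s+P}_{(p)}$. Then there exist $0<\underline T\le T$ (independent of $\varepsilon$) and a unique family $(u^\varepsilon)_{0<\varepsilon<\varepsilon_0}$ that is bounded in $C([0,\underline T];X^{s+D})$ and solves the problems (1) on $[0,\underline T]$ for all $0<\varepsilon<\varepsilon_0$. -/

import Mathlib

open Set

/-- A Banach scale `(X s)_{s ∈ ℝ}`: the inclusions `X s' ⊂ X s` for `s ≤ s'` (coherent injective
linear maps that do not increase the norm), the linear smoothing operators `S_θ`, `θ ≥ 1`, and the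
convexity inequality of the norms. The operator `S_θ` maps every `X s` into every `X s'`;
`smooth θ s s'` is `S_θ` seen as a map from `X s` to `X s'`. -/
structure BanachScale (X : ℝ → Type*) [∀ s, NormedAddCommGroup (X s)]
    [∀ s, NormedSpace ℝ (X s)] where
  incl : ∀ {s s' : ℝ}, s ≤ s' → (X s' →L[ℝ] X s)
  incl_refl : ∀ (s : ℝ) (u : X s), incl (le_refl s) u = u
  incl_incl : ∀ {r s s' : ℝ} (h : r ≤ s) (h' : s ≤ s') (u : X s'),
    incl h (incl h' u) = incl (h.trans h') u
  incl_injective : ∀ {s s' : ℝ} (h : s ≤ s'), Function.Injective (incl h)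
  norm_incl_le : ∀ {s s' : ℝ} (h : s ≤ s') (u : X s'), ‖incl h u‖ ≤ ‖u‖
  smooth : ℝ → ∀ s s' : ℝ, X s →ₗ[ℝ] X s'
  smooth_incl : ∀ (θ : ℝ), 1 ≤ θ → ∀ {r s : ℝ} (h : r ≤ s) (s' : ℝ) (u : X s),
    smooth θ r s' (incl h u) = smooth θ s s' u
  incl_smooth : ∀ (θ : ℝ), 1 ≤ θ → ∀ (s : ℝ) {r' s' : ℝ} (h : r' ≤ s') (u : X s),
    incl h (smooth θ s s' u) = smooth θ s r' u
  norm_sub_smooth_le : ∀ {s s' : ℝ} (h : s < s'), ∃ C : ℝ, ∀ θ : ℝ, 1 ≤ θ → ∀ u : X s',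
    ‖incl h.le u - smooth θ s' s u‖ ≤ C * θ ^ (s - s') * ‖u‖
  norm_smooth_le : ∀ {s s' : ℝ}, s ≤ s' → ∃ C : ℝ, ∀ θ : ℝ, 1 ≤ θ → ∀ u : X s,
    ‖smooth θ s s' u‖ ≤ C * θ ^ (s' - s) * ‖u‖
  convexity : ∀ {s s'' s' : ℝ} (h : s ≤ s'') (h' : s'' ≤ s') (μ : ℝ), 0 ≤ μ → μ ≤ 1 →
    μ * s + (1 - μ) * s' = s'' → ∃ C : ℝ, ∀ u : X s',
      ‖incl h' u‖ ≤ C * ‖incl (h.trans h') u‖ ^ μ * ‖u‖ ^ (1 - μ)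

/-- `sup_{0 ≤ t' ≤ t} ‖f t'‖`. -/
noncomputable def supNorm {E : Type*} [NormedAddCommGroup E] (t : ℝ) (f : ℝ → E) : ℝ :=
  sSup ((fun t' => ‖f t'‖) '' Icc 0 t)

/-- The `i`-th derivative in time of `t ↦ Φ[t, ·]` on `[0, T]`. -/
noncomputable def timeDeriv {E G : Type*} [NormedAddCommGroup G] [NormedSpace ℝ G]
    (T : ℝ) (i : ℕ) (Φ : ℝ → E → G) (t : ℝ) (u : E) : G :=
  iteratedDerivWithin i (fun τ => Φ τ u) (Icc 0 T) t

/-- `Φ ∈ C^i([0, T]; C^j(E; G))`, where `C^j(E; G)` carries the topology of locally uniform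
(compact-open) convergence of the derivatives of order `≤ j`: the derivatives of order `≤ i` in
time exist, are of class `C^j` in `u`, and their `u`-derivatives of order `≤ j` are jointly
continuous in `(t, u)`. -/
def TimeSmooth {E G : Type*} [NormedAddCommGroup E] [NormedSpace ℝ E]
    [NormedAddCommGroup G] [NormedSpace ℝ G] (T : ℝ) (i j : ℕ) (Φ : ℝ → E → G) : Prop :=
  (∀ u : E, ContDiffOn ℝ i (fun t => Φ t u) (Icc 0 T)) ∧
  (∀ l : ℕ, l ≤ i →
    (∀ t ∈ Icc 0 T, ContDiff ℝ j (timeDeriv T l Φ t)) ∧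
    (∀ k : ℕ, k ≤ j → ContinuousOn
      (fun q : ℝ × E => iteratedFDeriv ℝ k (timeDeriv T l Φ q.1) q.2) (Icc 0 T ×ˢ univ)))

theorem sub_nat_mul_le {m : ℝ} (hm : 0 ≤ m) (k : ℕ) (s : ℝ) : s - k * m ≤ s :=
  sub_le_self s (mul_nonneg (Nat.cast_nonneg k) hm)

theorem add_succ_mul_le {s₀ m s : ℝ} {i : ℕ} (h : s₀ + i * m ≤ s) :
    s₀ + (i + 1) * m ≤ s + m := by linarith

/-- `δ = max {d₁, d₂ + m}`. -/
noncomputable def lossIndex (m d₁ d₂ : ℝ) : ℝ := max d₁ (d₂ + m)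

/-- `P_min = δ + (D / q) (√δ + √(2 (δ + q)))²` with `q = D - m - d₂`. -/
noncomputable def Pmin (m d₁ d₂ D : ℝ) : ℝ :=
  lossIndex m d₁ d₂ + D / (D - m - d₂) *
    (√(lossIndex m d₁ d₂) + √(2 * (lossIndex m d₁ d₂ + (D - m - d₂)))) ^ 2

theorem le_of_Pmin_lt {m d₁ d₂ D P : ℝ} (hm : 0 ≤ m) (hd₂ : 0 ≤ d₂)
    (hD : lossIndex m d₁ d₂ < D) (hP : Pmin m d₁ d₂ D < P) : D ≤ P := by
  have h1 : d₂ + m ≤ lossIndex m d₁ d₂ := le_max_right _ _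
  have hq : 0 < D - m - d₂ := by linarith
  have hδ : 0 ≤ lossIndex m d₁ d₂ := by linarith
  have hsq : 2 * (D - m - d₂) ≤
      (√(lossIndex m d₁ d₂) + √(2 * (lossIndex m d₁ d₂ + (D - m - d₂)))) ^ 2 := by
    have e := Real.sq_sqrt (show 0 ≤ 2 * (lossIndex m d₁ d₂ + (D - m - d₂)) by linarith)
    have a := Real.sqrt_nonneg (lossIndex m d₁ d₂)
    have b := Real.sqrt_nonneg (2 * (lossIndex m d₁ d₂ + (D - m - d₂)))
    nlinarith [mul_nonneg a b, sq_nonneg (√(lossIndex m d₁ d₂))]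
  have h2 : D / (D - m - d₂) * (2 * (D - m - d₂)) ≤ D / (D - m - d₂) *
      (√(lossIndex m d₁ d₂) + √(2 * (lossIndex m d₁ d₂ + (D - m - d₂)))) ^ 2 :=
    mul_le_mul_of_nonneg_left hsq (div_nonneg (by linarith) hq.le)
  have h3 : D / (D - m - d₂) * (2 * (D - m - d₂)) = 2 * D := by
    field_simp
  unfold Pmin at hP
  linarith

theorem add_le_add_of_Pmin_lt {m d₁ d₂ D P : ℝ} (hm : 0 ≤ m) (hd₂ : 0 ≤ d₂)
    (hD : lossIndex m d₁ d₂ < D) (hP : Pmin m d₁ d₂ D < P) (s : ℝ) : s + D ≤ s + P :=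
  add_le_add_right (le_of_Pmin_lt hm hd₂ hD hP) s

namespace BanachScale

variable {X : ℝ → Type*} [∀ s, NormedAddCommGroup (X s)] [∀ s, NormedSpace ℝ (X s)]

/-- The maps `A s : X (s + m) → X s`, `s ≥ s₀`, are the restrictions of one map
`X (s₀ + m) → X s₀`. -/
def Coherent (B : BanachScale X) (s₀ m : ℝ) (A : ∀ s, X (s + m) → X s) : Prop :=
  ∀ (s s' : ℝ) (_ : s₀ ≤ s) (h : s ≤ s') (u : X (s' + m)),
    A s (B.incl (add_le_add_left h m) u) = B.incl h (A s' u)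

/-- `∂_t^k u` on `[0, T]`, as a function with values in `X (s - k m)`. -/
noncomputable def dt (B : BanachScale X) {m : ℝ} (hm : 0 ≤ m) (T : ℝ) (k : ℕ) {s : ℝ}
    (u : ℝ → X s) : ℝ → X (s - k * m) :=
  iteratedDerivWithin k (fun t => B.incl (sub_nat_mul_le hm k s) (u t)) (Icc 0 T)

/-- `u ∈ X^s_{(j)} = ⋂_{k ≤ j} C^k([0, T]; X (s - k m))`. -/
def MemX (B : BanachScale X) {m : ℝ} (hm : 0 ≤ m) (T : ℝ) (j : ℕ) {s : ℝ} (u : ℝ → X s) : Prop :=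
  ∀ k : ℕ, k ≤ j → ContDiffOn ℝ k (fun t => B.incl (sub_nat_mul_le hm k s) (u t)) (Icc 0 T)

/-- `|u|_{X^s_{(j)}} = ∑_{k ≤ j} sup_{[0, T]} |(ε ∂_t)^k u|_{s - k m}`. -/
noncomputable def normX (B : BanachScale X) {m : ℝ} (hm : 0 ≤ m) (T ε : ℝ) (j : ℕ) {s : ℝ}
    (u : ℝ → X s) : ℝ :=
  ∑ k ∈ Finset.range (j + 1), ε ^ k * supNorm T (B.dt hm T k u)

/-- `|(f, g)|_{F^s_{(p)}} = ∑_{i ≤ p} sup_{[0, T]} |(ε ∂_t)^i f|_{s - i m} + |g|_{s + m}`. -/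
noncomputable def normF (B : BanachScale X) {m : ℝ} (hm : 0 ≤ m) (T ε : ℝ) (p : ℕ) {s : ℝ}
    (f : ℝ → X s) (g : X (s + m)) : ℝ :=
  B.normX hm T ε p f + ‖g‖

/-- `I^s_{(p)}(t, f, g) = |g|_{s + m} + ∫_0^t ∑_{i ≤ p} sup_{[0, t']} |(ε ∂_t)^i f|_{s - i m} dt'`. -/
noncomputable def energyI (B : BanachScale X) {m : ℝ} (hm : 0 ≤ m) (T ε : ℝ) (p : ℕ) {s : ℝ}
    (t : ℝ) (f : ℝ → X s) (g : X (s + m)) : ℝ :=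
  ‖g‖ + ∫ t' in (0 : ℝ)..t, ∑ i ∈ Finset.range (p + 1), ε ^ i * supNorm t' (B.dt hm T i f)

/-- `u ∈ C([0, T]; X r)` solves `∂_t u + (1/ε) L(t) u + F[t, u] = h`, `u(0) = u₀` on `[0, T]`;
the equation is an identity in `X (r - m)`. -/
def IsSolution (B : BanachScale X) {m : ℝ} (hm : 0 ≤ m) (ε T : ℝ)
    (L : ℝ → ∀ s, X (s + m) →L[ℝ] X s) (F : ℝ → ∀ s, X (s + m) → X s)
    {r a b : ℝ} (hra : r ≤ a) (hrb : r ≤ b) (h : ℝ → X a) (u₀ : X b) (u : ℝ → X r) : Prop :=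
  ContinuousOn u (Icc 0 T) ∧ u 0 = B.incl hrb u₀ ∧
  ∀ t ∈ Icc 0 T, HasDerivWithinAt (fun τ => B.incl (sub_le_self r hm) (u τ))
    (B.incl ((sub_le_self r hm).trans hra) (h t)
      - (1 / ε) • L t (r - m) (B.incl (sub_add_cancel r m).le (u t))
      - F t (r - m) (B.incl (sub_add_cancel r m).le (u t)))
    (Icc 0 T) t

/-- `v ∈ C([0, T]; X s)` solves `∂_t v + (1/ε) L(t) v + F_u[t, u] v = f`, `v(0) = g` on `[0, T]`;
the equation is an identity in `X (s - m)`. -/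
def IsLinearizedSolution (B : BanachScale X) {m : ℝ} (hm : 0 ≤ m) (ε T : ℝ)
    (L : ℝ → ∀ s, X (s + m) →L[ℝ] X s) (F : ℝ → ∀ s, X (s + m) → X s)
    {s r a b : ℝ} (hsr : s ≤ r) (hsa : s ≤ a) (hsb : s ≤ b)
    (u : ℝ → X r) (f : ℝ → X a) (g : X b) (v : ℝ → X s) : Prop :=
  ContinuousOn v (Icc 0 T) ∧ v 0 = B.incl hsb g ∧
  ∀ t ∈ Icc 0 T, HasDerivWithinAt (fun τ => B.incl (sub_le_self s hm) (v τ))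
    (B.incl ((sub_le_self s hm).trans hsa) (f t)
      - (1 / ε) • L t (s - m) (B.incl (sub_add_cancel s m).le (v t))
      - fderiv ℝ (F t (s - m)) (B.incl ((sub_add_cancel s m).le.trans hsr) (u t))
          (B.incl (sub_add_cancel s m).le (v t)))
    (Icc 0 T) t

/-- The assumption on `L^ε`: `L^ε ∈ C^p(ℝ; 𝔏(X^{s+m}; X^s))` with `ε^i ∂_t^i L^ε` bounded on
`[0, T]` uniformly in `ε` for `i ≤ p`, and the evolution operator `U^ε` of
`∂_t u + (1/ε) L^ε(t) u = 0` is bounded on `X^s` uniformly in `ε` and `|t| ≤ T`, for `s ≥ s₀`.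
The time continuity of `U^ε` is that of its orbits `t ↦ U^ε(t) g`. -/
def AssumptionL (B : BanachScale X) (ε₀ T s₀ : ℝ) {m : ℝ} (hm : 0 ≤ m) (p : ℕ)
    (L : ℝ → ℝ → ∀ s, X (s + m) →L[ℝ] X s) : Prop :=
  (∀ ε ∈ Ioo 0 ε₀, ∀ t : ℝ, B.Coherent s₀ m (fun s u => L ε t s u)) ∧
  (∀ s, s₀ ≤ s →
    (∀ ε ∈ Ioo 0 ε₀, ContDiff ℝ p (fun t => L ε t s)) ∧
    (∀ i : ℕ, i ≤ p → ∃ K : ℝ, ∀ ε ∈ Ioo 0 ε₀, ∀ t ∈ Icc 0 T,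
      ‖ε ^ i • iteratedDeriv i (fun τ => L ε τ s) t‖ ≤ K)) ∧
  (∃ U : ℝ → ℝ → ∀ s, X s →L[ℝ] X s,
    (∀ ε ∈ Ioo 0 ε₀, ∀ (t s s' : ℝ) (_ : s₀ ≤ s) (h : s ≤ s') (g : X s'),
      U ε t s (B.incl h g) = B.incl h (U ε t s' g)) ∧
    (∀ s, s₀ ≤ s → ∀ ε ∈ Ioo 0 ε₀, ∀ g : X s,
      Continuous (fun t => U ε t s g) ∧ U ε 0 s g = g) ∧
    (∀ s, s₀ ≤ s → ∀ ε ∈ Ioo 0 ε₀, ∀ (g : X (s + m)) (t : ℝ),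
      HasDerivAt (fun τ => B.incl (le_add_of_nonneg_right hm) (U ε τ (s + m) g))
        (-((1 / ε) • L ε t s (U ε t (s + m) g))) t) ∧
    (∀ s, s₀ ≤ s → ∃ K : ℝ, ∀ ε ∈ Ioo 0 ε₀, ∀ t ∈ Icc (-T) T, ‖U ε t s‖ ≤ K))

/-- The assumption on `F^ε`: for `i ≤ p`, `i + j ≤ p + 2` and `s ≥ s₀ + i m`,
`F^ε ∈ C^i([0, T]; C^j(X^{s+m}; X^{s - i m}))`, with tame estimates on `ε^i ∂_t^i ∂_u^j F^ε`
that are uniform in `ε`. -/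
def AssumptionF (B : BanachScale X) (ε₀ T s₀ : ℝ) {m : ℝ} (hm : 0 ≤ m) (p : ℕ)
    (F : ℝ → ℝ → ∀ s, X (s + m) → X s) : Prop :=
  (∀ ε ∈ Ioo 0 ε₀, ∀ t ∈ Icc 0 T, B.Coherent s₀ m (F ε t)) ∧
  ∀ i j : ℕ, i ≤ p → i + j ≤ p + 2 → ∀ (s : ℝ) (hs : s₀ + i * m ≤ s),
    (∀ ε ∈ Ioo 0 ε₀, TimeSmooth T i j
      (fun t (u : X (s + m)) => B.incl (sub_nat_mul_le hm i s) (F ε t s u))) ∧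
    ∃ C : ℝ → ℝ, Monotone C ∧ ∀ ε ∈ Ioo 0 ε₀, ∀ t ∈ Icc 0 T,
      ∀ (u : X (s + m)) (v : Fin j → X (s + m)),
        ‖ε ^ i • iteratedFDeriv ℝ j (timeDeriv T i
          (fun τ (w : X (s + m)) => B.incl (sub_nat_mul_le hm i s) (F ε τ s w)) t) u v‖ ≤
        C ‖B.incl (add_succ_mul_le hs) u‖ *
          (∑ k, ‖v k‖ * ∏ l ∈ Finset.univ.erase k, ‖B.incl (add_succ_mul_le hs) (v l)‖
            + ‖u‖ * ∏ k, ‖B.incl (add_succ_mul_le hs) (v k)‖)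

/-- The assumption on the linearized problem: for `s ≥ s₀ + m`, `u ∈ X^{s + d₁}_{(p+1)}` and
`(f, g) ∈ F^{s + d₂}_{(p)}` it has a unique solution in `C([0, T]; X^s)`, with a tame energy
estimate that is uniform in `ε`. -/
def AssumptionLin (B : BanachScale X) (ε₀ T s₀ : ℝ) {m d₁ d₂ : ℝ} (hm : 0 ≤ m) (hd₁ : 0 ≤ d₁)
    (hd₂ : 0 ≤ d₂) (p : ℕ) (L : ℝ → ℝ → ∀ s, X (s + m) →L[ℝ] X s)
    (F : ℝ → ℝ → ∀ s, X (s + m) → X s) : Prop :=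
  ∀ (s : ℝ) (hs : s₀ + m ≤ s), ∃ C : ℝ → ℝ, Monotone C ∧
    ∀ ε ∈ Ioo 0 ε₀, ∀ u : ℝ → X (s + d₁), B.MemX hm T (p + 1) u →
    ∀ f : ℝ → X (s + d₂), B.MemX hm T p f → ∀ g : X (s + d₂ + m),
      ∃ v : ℝ → X s,
        B.IsLinearizedSolution hm ε T (L ε) (F ε) (le_add_of_nonneg_right hd₁)
          (le_add_of_nonneg_right hd₂)
          ((le_add_of_nonneg_right hd₂).trans (le_add_of_nonneg_right hm)) u f g v ∧
        (∀ w : ℝ → X s,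
          B.IsLinearizedSolution hm ε T (L ε) (F ε) (le_add_of_nonneg_right hd₁)
            (le_add_of_nonneg_right hd₂)
            ((le_add_of_nonneg_right hd₂).trans (le_add_of_nonneg_right hm)) u f g w →
          EqOn w v (Icc 0 T)) ∧
        ∀ t ∈ Icc 0 T, ‖v t‖ ≤
          C (B.normX hm T ε (p + 1) (fun τ => B.incl (add_le_add_left hs d₁) (u τ))) *
            (B.energyI hm T ε p t f g +
              B.normX hm T ε (p + 1) u *
                B.energyI hm T ε p t (fun τ => B.incl (add_le_add_left hs d₂) (f τ))
                  (B.incl (add_le_add_left (add_le_add_left hs d₂) m) g))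

/-- `(u^ε)_{0 < ε < ε₀}` is a family of solutions on `[0, T]` of the problems
`∂_t u + (1/ε) L^ε(t) u + F^ε[t, u] = h^ε`, `u(0) = u₀^ε`, bounded in `C([0, T]; X r)`. -/
def IsBoundedSolutionFamily (B : BanachScale X) {m : ℝ} (hm : 0 ≤ m) (ε₀ T : ℝ)
    (L : ℝ → ℝ → ∀ s, X (s + m) →L[ℝ] X s) (F : ℝ → ℝ → ∀ s, X (s + m) → X s)
    {r a b : ℝ} (hra : r ≤ a) (hrb : r ≤ b) (h : ℝ → ℝ → X a) (u₀ : ℝ → X b)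
    (u : ℝ → ℝ → X r) : Prop :=
  (∀ ε ∈ Ioo 0 ε₀, B.IsSolution hm ε T (L ε) (F ε) hra hrb (h ε) (u₀ ε) (u ε)) ∧
  ∃ K : ℝ, ∀ ε ∈ Ioo 0 ε₀, ∀ t ∈ Icc 0 T, ‖u ε t‖ ≤ K

end BanachScale

/-! The solution is built for each `ε` by a Nash–Moser iteration whose constants do not depend on
`ε`. Time derivatives occur only as `ε ∂_t`, because the equation, multiplied by `ε`, expresses `ε
∂_t u` through `L u`, `ε F[t, u]` and `ε h` without any factor `1/ε`; each such derivative costs `m`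
levels of the scale.

To avoid working in a different space for each level, everything is read inside `X s₀` (`Mem`,
`nrm`, `LC`), and a function of time is replaced by the curve of its jets, whose `k`-th component
`(ε ∂_t)^k u` is measured in `X (r - k m)` (`JLC`, `IsJet`, `pn`). On jets, `(ε ∂_t)^k F[t, u]` and
`(ε ∂_t)^k (L u)` are pointwise expressions defined by the recursion of the chain rule (`jet`,
`jetL`). The tame estimates of `F` pass to them by induction (`AssumptionF.jet_bound`), and the mean
value inequality along segments yields tame bounds for the quadratic remainder and for the variation
of `F_u`. The energy estimate controls only the zeroth component of a solution of the linearized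
equation; the equation then controls all `p + 1` derivatives (`AssumptionLin.pn_le`).

The iteration propagates two norms, a low one at the level `a` and a high one at `c = a + 5 ℓ`,
where `ℓ` slightly exceeds the loss `δ`. At the scale `Λ` the approximate solution is `O(1)` and
`O(Λ²)` in these norms, its residual `Λ⁻³` and `Λ`. A Newton step with data smoothed at the
frequency `Λ^(1/ℓ)` gives a correction `O(Λ⁻²)`, `O(Λ²)` and a residual `O(Λ⁻⁴)`, `O(Λ)`
(`exists_newton_step`). This is better than what is needed at the scale `μ Λ`, for a fixed large
`μ`, as soon as `Λ` is large. A geometric sequence of scales therefore suffices, and the corrections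
are summable (`exists_newton_sequence`).

The iteration must start with a small residual, and smallness comes from a short time. The
homogeneous evolution of the initial datum, corrected by `ε` times a lift of a suitable jet at time
`0`, has a bounded residual that vanishes at time `0` together with its derivatives up to the order
`p` (`exists_flat_residual`). One exact linearized correction is then `O(t)`, uniformly in `ε`, and
leaves a quadratic residual `O(t)` (`exists_small_residual`). This residual is small only on some
`[0, τ]`, whereas the linearized problem is posed on `[0, T]`. Sources are therefore extended from
`[0, τ]` to `[0, T]` by a dyadic lift of their jet at `τ`, at the price of an arbitrarily small loss
`η` (`extend`).

The limit solves the equation by `exists_solves_of_approx`. For uniqueness, the difference of two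
solutions solves the linearized equation with a quadratic source, which the difference itself
controls, and a Gronwall argument makes it vanish (`Solves.eqOn`). The condition on `P` enters only
through `2 D + 6 δ ≤ P`, which leaves room for all these losses. -/

open Filter Topology

/-! ### Mixed derivatives, symmetry of higher derivatives, integral form of differential equations.
-/

section Calculus

variable {E H : Type*} [NormedAddCommGroup E] [NormedSpace ℝ E] [NormedAddCommGroup H]
  [NormedSpace ℝ H]

/-- Derivatives in time and in space commute when the mixed derivative is continuous. -/
theorem hasDerivWithinAt_fderiv_of_continuousOn {I : Set ℝ} (hI : Convex ℝ I) {g g₁ : ℝ → E → H}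
    (hg : ∀ t ∈ I, ∀ x, HasDerivWithinAt (fun τ => g τ x) (g₁ t x) I t)
    (hd : ∀ t ∈ I, Differentiable ℝ (g t)) (hd₁ : ∀ t ∈ I, Differentiable ℝ (g₁ t))
    (hc : ContinuousOn (fun q : ℝ × E => fderiv ℝ (g₁ q.1) q.2) (I ×ˢ univ))
    {t₀ : ℝ} (ht₀ : t₀ ∈ I) (u : E) :
    HasDerivWithinAt (fun τ => fderiv ℝ (g τ) u) (fderiv ℝ (g₁ t₀) u) I t₀ := by
  rw [hasDerivWithinAt_iff_isLittleO, Asymptotics.isLittleO_iff]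
  intro e he
  have hcont := hc (t₀, u) ⟨ht₀, mem_univ _⟩
  rw [ContinuousWithinAt, Metric.tendsto_nhdsWithin_nhds] at hcont
  obtain ⟨d, hd0, hdd⟩ := hcont (e / 2) (by positivity)
  have key : ∀ τ ∈ I, |τ - t₀| < d → ∀ y ∈ Metric.ball u d, 
      ‖fderiv ℝ (fun x => g₁ τ x - g₁ t₀ x) y‖ ≤ e := by
    intro τ hτ hτd y hy
    have h1 := hdd (x := (τ, y)) ⟨hτ, mem_univ _⟩ (by
      rw [Prod.dist_eq]; exact max_lt (by simpa [Real.dist_eq] using hτd) hy)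
    have h2 := hdd (x := (t₀, y)) ⟨ht₀, mem_univ _⟩ (by
      rw [Prod.dist_eq]; exact max_lt (by simpa using hd0) hy)
    rw [fderiv_fun_sub (hd₁ τ hτ y) (hd₁ t₀ ht₀ y), ← dist_eq_norm]
    calc _ ≤ _ := dist_triangle_right _ _ (fderiv ℝ (g₁ t₀) u)
      _ ≤ e := by linarith
  have key2 : ∀ τ ∈ I, |τ - t₀| < d → ∀ y ∈ Metric.ball u d,
      ‖(g₁ τ y - g₁ t₀ y) - (g₁ τ u - g₁ t₀ u)‖ ≤ e * ‖y - u‖ := by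
    intro τ hτ hτd y hy
    exact (convex_ball u d).norm_image_sub_le_of_norm_fderiv_le (𝕜 := ℝ)
      (f := fun x => g₁ τ x - g₁ t₀ x)
      (fun x _ => (hd₁ τ hτ x).sub (hd₁ t₀ ht₀ x)) (fun x hx => key τ hτ hτd x hx)
      (Metric.mem_ball_self hd0) hy
  filter_upwards [inter_mem_nhdsWithin I (Metric.ball_mem_nhds t₀ hd0), self_mem_nhdsWithin]
    with t ht htI
  have htd : |t - t₀| < d := by simpa [Real.dist_eq] using ht.2
  -- `ψ` is the first-order Taylor remainder in time. The norm of its space derivative at `u` is at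
  -- most its Lipschitz constant at `u`, which the mean value inequality in time bounds by `e * |t -
  -- t₀|`, using `key2`.
  have hψ : HasFDerivAt (fun x => g t x - g t₀ x - (t - t₀) • g₁ t₀ x)
      (fderiv ℝ (g t) u - fderiv ℝ (g t₀) u - (t - t₀) • fderiv ℝ (g₁ t₀) u) u :=
    ((hd t htI u).hasFDerivAt.sub (hd t₀ ht₀ u).hasFDerivAt).sub
      ((hd₁ t₀ ht₀ u).hasFDerivAt.const_smul _)
  refine hψ.le_of_lip' (by positivity) ?_
  filter_upwards [Metric.ball_mem_nhds u hd0] with y hy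
  have hseg : segment ℝ t₀ t ⊆ I := hI.segment_subset ht₀ htI
  have := (convex_segment t₀ t).norm_image_sub_le_of_norm_hasDerivWithin_le
    (f := fun τ => g τ y - g τ u - τ • (g₁ t₀ y - g₁ t₀ u))
    (f' := fun τ => g₁ τ y - g₁ τ u - (1:ℝ) • (g₁ t₀ y - g₁ t₀ u)) (C := e * ‖y - u‖)
    (fun τ hτ => (((hg τ (hseg hτ) y).mono hseg).sub ((hg τ (hseg hτ) u).mono hseg)).sub
        ((hasDerivWithinAt_id τ _).smul_const _))
    (fun τ hτ => by
      have hle : |τ - t₀| < d := by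
        refine lt_of_le_of_lt ?_ htd
        rw [segment_eq_uIcc] at hτ
        exact abs_sub_left_of_mem_uIcc hτ
      have := key2 τ (hseg hτ) hle y hy
      convert this using 2
      simp only [one_smul]; abel)
    (left_mem_segment ℝ t₀ t) (right_mem_segment ℝ t₀ t)
  rw [Real.norm_eq_abs] at *
  calc _ = ‖g t y - g t u - t • (g₁ t₀ y - g₁ t₀ u) - (g t₀ y - g t₀ u - t₀ • (g₁ t₀ y - g₁ t₀ u))‖ := by
        congr 1
        simp only [sub_smul, smul_sub]; abel
    _ ≤ _ := this
    _ = _ := by ring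

theorem iteratedFDeriv_cons_apply {n : ℕ} {f : E → H} (hf : ContDiff ℝ (n + 1 : ℕ) f) (y a : E)
    (v : Fin n → E) :
    iteratedFDeriv ℝ (n + 1) f y (Fin.cons a v : Fin (n + 1) → E) =
      fderiv ℝ (fun z => iteratedFDeriv ℝ n f z v) y a := by
  rw [iteratedFDeriv_succ_apply_left]
  simp only [Fin.cons_zero, Fin.tail_cons]
  have hd : DifferentiableAt ℝ (iteratedFDeriv ℝ n f) y :=
    (hf.differentiable_iteratedFDeriv (m := n) (by norm_cast; omega)) y
  rw [fderiv_continuousMultilinear_apply_const hd]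
  rfl

/-- The first slot carries the outermost derivative. Hence exchanging the first two slots is the
symmetry of a second derivative, and every other adjacent exchange takes place under the outermost
derivative, where induction applies. Adjacent exchanges generate all permutations. -/
theorem iteratedFDeriv_comp_swap {n : ℕ} {f : E → H} (hf : ContDiff ℝ (n + 1 : ℕ) f) (i : Fin n)
    (y : E) (w : Fin (n + 1) → E) :
    iteratedFDeriv ℝ (n + 1) f y (w ∘ Equiv.swap i.castSucc i.succ) =
      iteratedFDeriv ℝ (n + 1) f y w := by
  induction n generalizing y with
  | zero => exact i.elim0
  | succ n ih =>
    obtain ⟨a, w, rfl⟩ : ∃ a v, w = (Fin.cons a v : Fin (n + 2) → E) :=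
      ⟨w 0, Fin.tail w, (Fin.cons_self_tail w).symm⟩
    refine Fin.cases ?_ (fun i => ?_) i
    · obtain ⟨c, v, rfl⟩ : ∃ a v, w = (Fin.cons a v : Fin (n + 1) → E) :=
        ⟨w 0, Fin.tail w, (Fin.cons_self_tail w).symm⟩
      have h0 : (Fin.cons a (Fin.cons c v : Fin (n + 1) → E) : Fin (n + 2) → E) ∘
          Equiv.swap (Fin.castSucc 0) (Fin.succ 0) =
          (Fin.cons c (Fin.cons a v : Fin (n + 1) → E) : Fin (n + 2) → E) := by
        funext k
        refine Fin.cases ?_ (fun k => Fin.cases ?_ (fun k => ?_) k) k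
        · simp
        · simp
        · rw [Function.comp_apply, Equiv.swap_apply_of_ne_of_ne (by simp [Fin.ext_iff])
            (by simp [Fin.ext_iff])]
          simp
      rw [h0, iteratedFDeriv_cons_apply hf, iteratedFDeriv_cons_apply hf]
      have h1 : ∀ x, (fun z => iteratedFDeriv ℝ (n + 1) f z (Fin.cons x v : Fin (n + 1) → E)) =
          fun z => fderiv ℝ (fun z => iteratedFDeriv ℝ n f z v) z x := fun x => by
        funext z
        rw [iteratedFDeriv_cons_apply (hf.of_le (by norm_cast; omega))]
      rw [h1, h1]
      have hφ : ContDiff ℝ 2 (fun z => iteratedFDeriv ℝ n f z v) := by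
        have h0 : ContDiff ℝ 2 (iteratedFDeriv ℝ n f) :=
          hf.iteratedFDeriv_right (by norm_cast; omega)
        exact (ContinuousMultilinearMap.apply ℝ (fun _ : Fin n => E) H v).contDiff.comp h0
      have hs := (hφ.contDiffAt (x := y)).isSymmSndFDerivAt (by simp)
      have hd' : DifferentiableAt ℝ (fderiv ℝ (fun z => iteratedFDeriv ℝ n f z v)) y :=
        (hφ.fderiv_right (m := 1) (by norm_num)).differentiable (by norm_num) y
      rw [fderiv_clm_apply hd' (differentiableAt_const _),
        fderiv_clm_apply hd' (differentiableAt_const _)]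
      simp [hs.eq a c]
    · have h0 : (Fin.cons a w : Fin (n + 2) → E) ∘ Equiv.swap i.succ.castSucc i.succ.succ =
          (Fin.cons a (w ∘ Equiv.swap i.castSucc i.succ) : Fin (n + 2) → E) := by
        funext k
        refine Fin.cases ?_ (fun k => ?_) k
        · rw [Function.comp_apply, Equiv.swap_apply_of_ne_of_ne (by simp [Fin.ext_iff])
            (by simp [Fin.ext_iff])]
          simp
        · simp only [Function.comp_apply, Fin.cons_succ, Equiv.swap_apply_def,
            ← Fin.succ_castSucc, Fin.succ_inj]
          split_ifs <;> simp
      rw [h0, iteratedFDeriv_cons_apply hf, iteratedFDeriv_cons_apply hf]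
      congr 2
      funext z
      exact ih (hf.of_le (by norm_cast; omega)) i z w

/-- The iterated derivative is symmetric. -/
theorem iteratedFDeriv_comp_perm {n : ℕ} {f : E → H} (hf : ContDiff ℝ n f) (y : E)
    (w : Fin n → E) (σ : Equiv.Perm (Fin n)) :
    iteratedFDeriv ℝ n f y (w ∘ σ) = iteratedFDeriv ℝ n f y w := by
  cases n with
  | zero => congr 1; ext i; exact i.elim0
  | succ n =>
    have hσ : σ ∈ Submonoid.closure (Set.range fun i : Fin n => Equiv.swap i.castSucc i.succ) := by
      rw [Equiv.Perm.mclosure_swap_castSucc_succ]; trivial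
    induction hσ using Submonoid.closure_induction generalizing w with
    | mem σ h => obtain ⟨i, rfl⟩ := h; exact iteratedFDeriv_comp_swap hf i y w
    | one => rfl
    | mul σ σ' _ _ h h' => 
      rw [Equiv.Perm.coe_mul, ← Function.comp_assoc, h', h]

theorem hasDerivWithinAt_of_eq_integral [CompleteSpace E] {τ : ℝ} {u g : ℝ → E}
    (hg : ContinuousOn g (Icc 0 τ)) (hu : ∀ t ∈ Icc 0 τ, u t = u 0 + ∫ r in (0 : ℝ)..t, g r) 
    {t : ℝ} (ht : t ∈ Icc 0 τ) : HasDerivWithinAt u (g t) (Icc 0 τ) t := by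
  have hint : IntervalIntegrable g MeasureTheory.volume 0 t :=
    (hg.mono (by rw [uIcc_of_le ht.1]; exact Icc_subset_Icc le_rfl ht.2)).intervalIntegrable
  have : Fact (t ∈ Icc 0 τ) := ⟨ht⟩
  have h1 := intervalIntegral.integral_hasDerivWithinAt_right (s := Icc 0 τ) (t := Icc 0 τ) hint
    (hg.stronglyMeasurableAtFilter_nhdsWithin measurableSet_Icc t) (hg t ht)
  exact (h1.const_add (u 0)).congr (fun x hx => hu x hx) (hu t ht)

theorem eq_integral_of_hasDerivWithinAt [CompleteSpace E] {τ : ℝ} {u g : ℝ → E}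
    (hg : ContinuousOn g (Icc 0 τ)) (hu : ∀ t ∈ Icc 0 τ, HasDerivWithinAt u (g t) (Icc 0 τ) t)
    {t : ℝ} (ht : t ∈ Icc 0 τ) : u t = u 0 + ∫ r in (0 : ℝ)..t, g r := by
  have hsub : Icc 0 t ⊆ Icc 0 τ := Icc_subset_Icc le_rfl ht.2
  have := intervalIntegral.integral_eq_sub_of_hasDerivAt_of_le ht.1
    (fun x hx => ((hu x (hsub hx)).mono hsub).continuousWithinAt)
    (fun x hx => (hu x (hsub ⟨hx.1.le, hx.2.le⟩)).hasDerivAt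
      (Icc_mem_nhds hx.1 (hx.2.trans_le ht.2)))
    ((hg.mono (by rw [uIcc_of_le ht.1]; exact hsub)).intervalIntegrable)
  rw [this]; abel

end Calculus

/-! ### Elements, norms and continuous curves of every level, read in one base space. -/

namespace BanachScale

variable {X : ℝ → Type*} [∀ s, NormedAddCommGroup (X s)] [∀ s, NormedSpace ℝ (X s)]

/-- A linear left inverse of the inclusion `X r ⊂ X b`. -/
noncomputable def up (B : BanachScale X) (b r : ℝ) : X b →ₗ[ℝ] X r := by
  classical
  -- Outside the image of `X r` the value is arbitrary, so that identities for `up` require `Mem`.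
  -- Linearity on all of `X b` makes `nrm r` a seminorm without any membership condition.
  exact if h : b ≤ r then Classical.choose
    (LinearMap.exists_leftInverse_of_injective (B.incl h : X r →ₗ[ℝ] X b)
      (LinearMap.ker_eq_bot.2 (B.incl_injective h))) else 0

/-- The element `x` of `X b` lies in `X r`. -/
def Mem (B : BanachScale X) {b : ℝ} (r : ℝ) (x : X b) : Prop :=
  ∃ h : b ≤ r, ∃ y : X r, B.incl h y = x

/-- The norm in `X r` of an element of `X b` that lies in `X r`. -/
noncomputable def nrm (B : BanachScale X) {b : ℝ} (r : ℝ) (x : X b) : ℝ := ‖B.up b r x‖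

variable {B : BanachScale X} {b : ℝ}

@[simp] theorem up_incl {r : ℝ} (h : b ≤ r) (y : X r) : B.up b r (B.incl h y) = y := by
  have := Classical.choose_spec
    (LinearMap.exists_leftInverse_of_injective (B.incl h : X r →ₗ[ℝ] X b)
      (LinearMap.ker_eq_bot.2 (B.incl_injective h)))
  unfold up
  rw [dif_pos h]
  exact LinearMap.congr_fun this y

theorem mem_incl {r : ℝ} (h : b ≤ r) (y : X r) : B.Mem r (B.incl h y) := ⟨h, y, rfl⟩

theorem incl_up {r : ℝ} (h : b ≤ r) {x : X b} (hx : B.Mem r x) : B.incl h (B.up b r x) = x := by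
  obtain ⟨_, y, rfl⟩ := hx
  rw [up_incl]

theorem Mem.le {r : ℝ} {x : X b} (hx : B.Mem r x) : b ≤ r := hx.1

theorem Mem.mono {r r' : ℝ} {x : X b} (hx : B.Mem r x) (h : b ≤ r') (h' : r' ≤ r) :
    B.Mem r' x := by
  obtain ⟨_, y, rfl⟩ := hx
  exact ⟨h, B.incl h' y, B.incl_incl _ _ _⟩

theorem incl_up_of_mem {r r' : ℝ} {x : X b} (hx : B.Mem r x) (h : b ≤ r') (h' : r' ≤ r) :
    B.incl h' (B.up b r x) = B.up b r' x := by
  obtain ⟨hr, y, rfl⟩ := hx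
  rw [up_incl, ← B.incl_incl h h', up_incl]

theorem mem_zero {r : ℝ} (h : b ≤ r) : B.Mem r (0 : X b) := ⟨h, 0, map_zero _⟩

theorem Mem.add {r : ℝ} {x y : X b} (hx : B.Mem r x) (hy : B.Mem r y) : B.Mem r (x + y) := by
  obtain ⟨h, x, rfl⟩ := hx
  obtain ⟨_, y, rfl⟩ := hy
  exact ⟨h, x + y, map_add _ _ _⟩

theorem Mem.smul {r : ℝ} {x : X b} (hx : B.Mem r x) (c : ℝ) : B.Mem r (c • x) := by
  obtain ⟨h, x, rfl⟩ := hx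
  exact ⟨h, c • x, map_smul _ _ _⟩

theorem Mem.neg {r : ℝ} {x : X b} (hx : B.Mem r x) : B.Mem r (-x) := by
  simpa using hx.smul (-1)

theorem Mem.sub {r : ℝ} {x y : X b} (hx : B.Mem r x) (hy : B.Mem r y) : B.Mem r (x - y) := by
  simpa [sub_eq_add_neg] using hx.add hy.neg

theorem mem_sum {ι : Type*} {r : ℝ} (h : b ≤ r) {s : Finset ι} {f : ι → X b}
    (hf : ∀ i ∈ s, B.Mem r (f i)) : B.Mem r (∑ i ∈ s, f i) := by
  classical
  induction s using Finset.induction_on with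
  | empty => simpa using mem_zero h
  | insert i s hi ih =>
    rw [Finset.sum_insert hi]
    exact (hf i (Finset.mem_insert_self _ _)).add
      (ih fun j hj => hf j (Finset.mem_insert_of_mem hj))

theorem nrm_nonneg (r : ℝ) (x : X b) : 0 ≤ B.nrm r x := norm_nonneg _

@[simp] theorem nrm_zero (r : ℝ) : B.nrm r (0 : X b) = 0 := by simp [nrm]

theorem nrm_incl {r : ℝ} (h : b ≤ r) (y : X r) : B.nrm r (B.incl h y) = ‖y‖ := by simp [nrm]

theorem nrm_add_le (r : ℝ) (x y : X b) : B.nrm r (x + y) ≤ B.nrm r x + B.nrm r y := by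
  simpa [nrm] using norm_add_le _ _

theorem nrm_sub_le (r : ℝ) (x y : X b) : B.nrm r (x - y) ≤ B.nrm r x + B.nrm r y := by
  simpa [nrm] using norm_sub_le _ _

theorem nrm_smul (r : ℝ) (c : ℝ) (x : X b) : B.nrm r (c • x) = |c| * B.nrm r x := by
  simp [nrm, norm_smul]

@[simp] theorem nrm_neg (r : ℝ) (x : X b) : B.nrm r (-x) = B.nrm r x := by simp [nrm]

theorem nrm_sum_le {ι : Type*} (r : ℝ) (s : Finset ι) (f : ι → X b) :
    B.nrm r (∑ i ∈ s, f i) ≤ ∑ i ∈ s, B.nrm r (f i) := by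
  simpa [nrm] using norm_sum_le _ _

theorem nrm_mono {r r' : ℝ} {x : X b} (hx : B.Mem r x) (h : b ≤ r') (h' : r' ≤ r) :
    B.nrm r' x ≤ B.nrm r x := by
  rw [nrm, ← incl_up_of_mem hx h h']
  exact B.norm_incl_le _ _

theorem norm_le_nrm {r : ℝ} {x : X b} (hx : B.Mem r x) : ‖x‖ ≤ B.nrm r x := by
  conv_lhs => rw [← incl_up hx.le hx]
  exact B.norm_incl_le _ _

theorem eq_zero_of_nrm_eq_zero {r : ℝ} {x : X b} (hx : B.Mem r x) (h : B.nrm r x = 0) : x = 0 := by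
  have := norm_le_nrm hx
  rw [h] at this
  exact norm_le_zero_iff.1 this

theorem up_self (x : X b) : B.up b b x = x := by
  conv_lhs => rw [← B.incl_refl b x]
  rw [up_incl]

/-- `f` is continuous on `[0, τ]` with values in `X r`. -/
def LC (B : BanachScale X) {b : ℝ} (r τ : ℝ) (f : ℝ → X b) : Prop :=
  (∀ t ∈ Icc 0 τ, B.Mem r (f t)) ∧ ContinuousOn (fun t => B.up b r (f t)) (Icc 0 τ)

variable {r r' τ τ' : ℝ} {f g : ℝ → X b}

theorem LC.mono (h : B.LC r τ f) (hb : b ≤ r') (h' : r' ≤ r) : B.LC r' τ f := by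
  refine ⟨fun t ht => (h.1 t ht).mono hb h', ?_⟩
  refine ((B.incl h').continuous.comp_continuousOn h.2).congr fun t ht => ?_
  exact (incl_up_of_mem (h.1 t ht) hb h').symm

theorem LC.mono_set (h : B.LC r τ f) (h' : τ' ≤ τ) : B.LC r τ' f :=
  ⟨fun t ht => h.1 t ⟨ht.1, ht.2.trans h'⟩, h.2.mono (Icc_subset_Icc le_rfl h')⟩

theorem LC.congr (h : B.LC r τ f) (hfg : EqOn g f (Icc 0 τ)) : B.LC r τ g :=
  ⟨fun t ht => by rw [hfg ht]; exact h.1 t ht, h.2.congr fun t ht => by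
    simp only [hfg ht]⟩

theorem LC.add (hf : B.LC r τ f) (hg : B.LC r τ g) : B.LC r τ (fun t => f t + g t) :=
  ⟨fun t ht => (hf.1 t ht).add (hg.1 t ht), by simp only [map_add]; exact hf.2.add hg.2⟩

theorem LC.sub (hf : B.LC r τ f) (hg : B.LC r τ g) : B.LC r τ (fun t => f t - g t) :=
  ⟨fun t ht => (hf.1 t ht).sub (hg.1 t ht), by simp only [map_sub]; exact hf.2.sub hg.2⟩

theorem LC.smul (hf : B.LC r τ f) (c : ℝ) : B.LC r τ (fun t => c • f t) :=
  ⟨fun t ht => (hf.1 t ht).smul c, by simp only [map_smul]; exact hf.2.const_smul c⟩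

theorem LC.neg (hf : B.LC r τ f) : B.LC r τ (fun t => -f t) := by
  simpa using hf.smul (-1)

theorem lc_const {x : X b} (hx : B.Mem r x) : B.LC r τ (fun _ => x) :=
  ⟨fun _ _ => hx, continuousOn_const⟩

theorem lc_sum {ι : Type*} (h : b ≤ r) {s : Finset ι} {f : ι → ℝ → X b}
    (hf : ∀ i ∈ s, B.LC r τ (f i)) : B.LC r τ (fun t => ∑ i ∈ s, f i t) :=
  ⟨fun t ht => mem_sum h fun i hi => (hf i hi).1 t ht, by
    simp only [map_sum]
    exact continuousOn_finsetSum _ fun i hi => (hf i hi).2⟩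

theorem LC.self (h : B.LC r τ f) (hb : b ≤ r) : ContinuousOn f (Icc 0 τ) := by
  have := (h.mono le_rfl hb).2
  simpa only [up_self] using this

theorem LC.exists_bound (h : B.LC r τ f) : ∃ K, 0 ≤ K ∧ ∀ t ∈ Icc 0 τ, B.nrm r (f t) ≤ K := by
  obtain ⟨K, hK⟩ := isCompact_Icc.exists_bound_of_continuousOn h.2
  exact ⟨max K 0, le_max_right _ _, fun t ht => (hK t ht).trans (le_max_left _ _)⟩

/-- A derivative in `X b` that is continuous with values in `X r` is a derivative in `X r`. -/
theorem LC.hasDerivWithinAt_up [∀ s, CompleteSpace (X s)] {f' : ℝ → X b} (hb : b ≤ r)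
    (hf : B.LC r τ f) (hf' : B.LC r τ f')
    (hd : ∀ t ∈ Icc 0 τ, HasDerivWithinAt f (f' t) (Icc 0 τ) t) {t : ℝ} (ht : t ∈ Icc 0 τ) :
    HasDerivWithinAt (fun t => B.up b r (f t)) (B.up b r (f' t)) (Icc 0 τ) t := by
  -- The integral form transfers between levels: the integral of a continuous curve commutes with
  -- the inclusion, which is injective.
  refine hasDerivWithinAt_of_eq_integral hf'.2 (fun t ht => ?_) ht
  have h0 : (0 : ℝ) ∈ Icc 0 τ := ⟨le_rfl, ht.1.trans ht.2⟩
  apply B.incl_injective hb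
  have hint : IntervalIntegrable (fun t => B.up b r (f' t)) MeasureTheory.volume 0 t :=
    (hf'.2.mono (by rw [uIcc_of_le ht.1]; exact Icc_subset_Icc le_rfl ht.2)).intervalIntegrable
  rw [map_add, incl_up hb (hf.1 t ht), incl_up hb (hf.1 0 h0),
    ← ContinuousLinearMap.intervalIntegral_comp_comm _ hint,
    eq_integral_of_hasDerivWithinAt (hf'.self hb) hd ht]
  congr 1
  refine intervalIntegral.integral_congr fun x hx => ?_
  rw [uIcc_of_le ht.1] at hx
  exact (incl_up hb (hf'.1 x ⟨hx.1, hx.2.trans ht.2⟩)).symm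

end BanachScale

/-! ### Time and space derivatives of the nonlinear maps. -/

section TimeSmooth

variable {E E' H H' W : Type*} [NormedAddCommGroup E] [NormedSpace ℝ E]
  [NormedAddCommGroup E'] [NormedSpace ℝ E'] [NormedAddCommGroup H] [NormedSpace ℝ H]
  [NormedAddCommGroup H'] [NormedSpace ℝ H'] [NormedAddCommGroup W] [NormedSpace ℝ W]
  {T : ℝ} {i j : ℕ}

theorem TimeSmooth.hasDerivWithinAt_timeDeriv {Φ : ℝ → E → H} (hT : 0 < T)
    (hΦ : TimeSmooth T i j Φ) {l : ℕ} (hl : l < i) {t : ℝ} (ht : t ∈ Icc 0 T) (u : E) :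
    HasDerivWithinAt (fun τ => timeDeriv T l Φ τ u) (timeDeriv T (l + 1) Φ t u) (Icc 0 T) t := by
  have hd : DifferentiableWithinAt ℝ (iteratedDerivWithin l (fun τ => Φ τ u) (Icc 0 T))
      (Icc 0 T) t := (hΦ.1 u).differentiableOn_iteratedDerivWithin (by exact_mod_cast hl)
        (uniqueDiffOn_Icc hT) t ht
  have := hd.hasDerivWithinAt
  rwa [← iteratedDerivWithin_succ] at this

/-- Induction on the number of space derivatives: each new one is exchanged with the time derivative
by `hasDerivWithinAt_fderiv_of_continuousOn`, whose continuity requirement is the joint continuity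
contained in `TimeSmooth`. -/
theorem TimeSmooth.hasDerivWithinAt_iteratedFDeriv {Φ : ℝ → E → H} (hT : 0 < T)
    (hΦ : TimeSmooth T i j Φ) {l : ℕ} (hl : l < i) (k : ℕ) (hk : k ≤ j) {t : ℝ}
    (ht : t ∈ Icc 0 T) (u : E) :
    HasDerivWithinAt (fun τ => iteratedFDeriv ℝ k (timeDeriv T l Φ τ) u)
      (iteratedFDeriv ℝ k (timeDeriv T (l + 1) Φ t) u) (Icc 0 T) t := by
  induction k generalizing t u with
  | zero =>
    simp only [iteratedFDeriv_zero_eq_comp, Function.comp_def]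
    exact (continuousMultilinearCurryFin0 ℝ E
      H).symm.toContinuousLinearEquiv.toContinuousLinearMap.hasFDerivAt.comp_hasDerivWithinAt t (hΦ.hasDerivWithinAt_timeDeriv hT hl ht u)
  | succ k ih =>
    simp only [iteratedFDeriv_succ_eq_comp_left, Function.comp_def]
    have hdiff : ∀ l', l' ≤ i → ∀ t ∈ Icc 0 T,
        Differentiable ℝ (iteratedFDeriv ℝ k (timeDeriv T l' Φ t)) := fun l' hl' t ht =>
      ((hΦ.2 l' hl').1 t ht).differentiable_iteratedFDeriv (by exact_mod_cast hk)
    have := hasDerivWithinAt_fderiv_of_continuousOn (convex_Icc (0 : ℝ) T)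
      (g := fun τ => iteratedFDeriv ℝ k (timeDeriv T l Φ τ))
      (g₁ := fun τ => iteratedFDeriv ℝ k (timeDeriv T (l + 1) Φ τ))
      (fun t ht x => ih (by omega) ht x) (hdiff l hl.le) (hdiff (l + 1) hl)
      (by
        have h1 := (hΦ.2 (l + 1) hl).2 (k + 1) hk
        simp only [iteratedFDeriv_succ_eq_comp_left, Function.comp_def] at h1
        exact (((continuousMultilinearCurryLeftEquiv ℝ
          (fun _ : Fin (k + 1) => E) H).symm).comp_continuousOn_iff).1 h1) ht u
    exact (continuousMultilinearCurryLeftEquiv ℝ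
      (fun _ : Fin (k + 1) => E) H).symm.toContinuousLinearEquiv.toContinuousLinearMap.hasFDerivAt.comp_hasDerivWithinAt t this

theorem ContinuousLinearMap.iteratedDerivWithin_comp (hT : 0 < T) (κ : H →L[ℝ] W) {f : ℝ → H}
    {l : ℕ} (hf : ContDiffOn ℝ l f (Icc 0 T)) {t : ℝ} (ht : t ∈ Icc 0 T) :
    iteratedDerivWithin l (fun τ => κ (f τ)) (Icc 0 T) t =
      κ (iteratedDerivWithin l f (Icc 0 T) t) := by
  simp only [iteratedDerivWithin]
  have := κ.iteratedFDerivWithin_comp_left (hf t ht) (uniqueDiffOn_Icc hT) ht le_rfl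
  simp only [Function.comp_def] at this
  rw [this]
  rfl

/-- Derivatives of intertwined maps are intertwined. -/
theorem TimeSmooth.intertwine {Φ : ℝ → E → H} {Φ' : ℝ → E' → H'} {i' j' : ℕ} (hT : 0 < T)
    (hΦ : TimeSmooth T i j Φ) (hΦ' : TimeSmooth T i' j' Φ') (ι : E' →L[ℝ] E) (κ : H →L[ℝ] W)
    (κ' : H' →L[ℝ] W) (h : ∀ t ∈ Icc 0 T, ∀ y, κ (Φ t (ι y)) = κ' (Φ' t y)) {l k : ℕ}
    (hl : l ≤ i) (hl' : l ≤ i') (hk : k ≤ j) (hk' : k ≤ j') {t : ℝ} (ht : t ∈ Icc 0 T) (y : E')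
    (w : Fin k → E') :
    κ (iteratedFDeriv ℝ k (timeDeriv T l Φ t) (ι y) (fun q => ι (w q))) =
      κ' (iteratedFDeriv ℝ k (timeDeriv T l Φ' t) y w) := by
  have h1 : (fun y => κ (timeDeriv T l Φ t (ι y))) = fun y => κ' (timeDeriv T l Φ' t y) := by
    funext y
    simp only [timeDeriv]
    rw [← κ.iteratedDerivWithin_comp hT ((hΦ.1 (ι y)).of_le (by exact_mod_cast hl)) ht,
      ← κ'.iteratedDerivWithin_comp hT ((hΦ'.1 y).of_le (by exact_mod_cast hl')) ht]
    exact iteratedDerivWithin_congr (fun τ hτ => h τ hτ y) ht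
  have hc := ((hΦ.2 l hl).1 t ht).of_le (m := k) (by exact_mod_cast hk)
  have hc' := ((hΦ'.2 l hl').1 t ht).of_le (m := k) (by exact_mod_cast hk')
  have e1 := κ.iteratedFDeriv_comp_left (hc.comp ι.contDiff).contDiffAt (x := y) (i := k) le_rfl
  have e2 := κ'.iteratedFDeriv_comp_left hc'.contDiffAt (x := y) (i := k) le_rfl
  have e3 := ι.iteratedFDeriv_comp_right hc y (i := k) le_rfl
  have e4 := congrArg (fun f => iteratedFDeriv ℝ k f y w) h1
  simp only [Function.comp_def] at e1 e2 e3
  simp only [e1, e2, e3] at e4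
  simpa using e4

end TimeSmooth

/-! ### Tame sums and differentiation along the diagonal. -/

/-- The tame bound `∑ₖ yₖ ∏_{l ≠ k} xₗ + z ∏ₖ xₖ`. -/
noncomputable def tameSum {n : ℕ} (z : ℝ) (x y : Fin n → ℝ) : ℝ :=
  ∑ k, y k * ∏ l ∈ Finset.univ.erase k, x l + z * ∏ k, x k

theorem tameSum_nonneg {n : ℕ} {z : ℝ} {x y : Fin n → ℝ} (hz : 0 ≤ z) (hx : ∀ i, 0 ≤ x i)
    (hy : ∀ i, 0 ≤ y i) : 0 ≤ tameSum z x y :=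
  add_nonneg (Finset.sum_nonneg fun k _ => mul_nonneg (hy k) (Finset.prod_nonneg fun l _ => hx l))
    (mul_nonneg hz (Finset.prod_nonneg fun l _ => hx l))

theorem tameSum_mono {n : ℕ} {z z' : ℝ} {x y x' y' : Fin n → ℝ} (hz : 0 ≤ z) (hx : ∀ i, 0 ≤ x i)
    (hy : ∀ i, 0 ≤ y i) (hz' : z ≤ z') (hx' : ∀ i, x i ≤ x' i) (hy' : ∀ i, y i ≤ y' i) :
    tameSum z x y ≤ tameSum z' x' y' := by
  have hp : ∀ s : Finset (Fin n), 0 ≤ ∏ l ∈ s, x l := fun s => Finset.prod_nonneg fun l _ => hx l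
  have hpp : ∀ s : Finset (Fin n), ∏ l ∈ s, x l ≤ ∏ l ∈ s, x' l := fun s =>
    Finset.prod_le_prod (fun l _ => hx l) fun l _ => hx' l
  exact add_le_add (Finset.sum_le_sum fun k _ => mul_le_mul (hy' k) (hpp _) (hp _)
    ((hy k).trans (hy' k))) (mul_le_mul hz' (hpp _) (hp _) (hz.trans hz'))

/-- Differentiating along the curve appends one direction, of low norm `a` and high norm `c`. When
these are the norms of the jet of `u` itself, the last term is already part of the tame sum of order
`n`, so the tame form of the bound is preserved. -/
theorem tameSum_snoc {n : ℕ} (z a c : ℝ) (x y : Fin n → ℝ) :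
    tameSum z (Fin.snoc x a : Fin (n + 1) → ℝ) (Fin.snoc y c : Fin (n + 1) → ℝ) =
      a * tameSum z x y + c * ∏ k, x k := by
  have h1 : ∀ k : Fin n, ∏ l ∈ Finset.univ.erase k.castSucc, (Fin.snoc x a : Fin (n + 1) → ℝ) l =
      (∏ l ∈ Finset.univ.erase k, x l) * a := by
    intro k
    have : (Finset.univ.erase k.castSucc : Finset (Fin (n + 1))) =
        insert (Fin.last n) ((Finset.univ.erase k).map Fin.castSuccEmb) := by
      ext q
      refine Fin.lastCases ?_ (fun q => ?_) q
      · simp [Fin.ext_iff]; omega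
      · simp [Fin.ext_iff]; omega
    rw [this, Finset.prod_insert (by simp [Fin.ext_iff]; omega), Finset.prod_map]
    simp [mul_comm]
  have h2 : ∏ l ∈ Finset.univ.erase (Fin.last n), (Fin.snoc x a : Fin (n + 1) → ℝ) l =
      ∏ l, x l := by
    have : (Finset.univ.erase (Fin.last n) : Finset (Fin (n + 1))) =
        Finset.univ.map Fin.castSuccEmb := by
      ext q
      refine Fin.lastCases ?_ (fun q => ?_) q
      · simp [Fin.ext_iff]; omega
      · simp [Fin.ext_iff]; omega
    rw [this, Finset.prod_map]
    simp
  unfold tameSum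
  rw [Fin.sum_univ_castSucc, Fin.prod_univ_castSucc]
  simp only [h1, h2, Fin.snoc_castSucc, Fin.snoc_last]
  rw [mul_add, Finset.mul_sum]
  have : ∀ k, y k * ((∏ l ∈ Finset.univ.erase k, x l) * a) =
      a * (y k * ∏ l ∈ Finset.univ.erase k, x l) := fun k => by ring
  simp only [this]
  ring

/-- The derivative along the diagonal. -/
theorem hasDerivWithinAt_diag {E : Type*} [NormedAddCommGroup E] [NormedSpace ℝ E] {τ T : ℝ}
    (hτ : τ ≤ T) {f f₁ : ℝ → ℝ → E} {d : E} {t : ℝ} (ht : t ∈ Icc 0 τ)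
    (hder : ∀ z ∈ Icc 0 τ, ∀ t ∈ Icc 0 T, HasDerivWithinAt (f z) (f₁ z t) (Icc 0 T) t)
    (hcont : ContinuousOn (fun q : ℝ × ℝ => f₁ q.1 q.2) (Icc 0 τ ×ˢ Icc 0 T))
    (hd : HasDerivWithinAt (fun z => f z t) d (Icc 0 τ) t) :
    HasDerivWithinAt (fun t => f t t) (f₁ t t + d) (Icc 0 τ) t := by
  have htT : t ∈ Icc 0 T := ⟨ht.1, ht.2.trans hτ⟩
  -- The increment in the second variable is taken with the first one frozen at the moving point
  -- `z`; joint continuity of `f₁` makes the mean value estimate uniform in `z` near `t`.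
  have htime : HasDerivWithinAt (fun t' => f t' t' - f t' t) (f₁ t t) (Icc 0 τ) t := by
    rw [hasDerivWithinAt_iff_isLittleO, Asymptotics.isLittleO_iff]
    intro e he
    have h1 := hcont (t, t) ⟨ht, htT⟩
    rw [ContinuousWithinAt, Metric.tendsto_nhdsWithin_nhds] at h1
    obtain ⟨d, hd0, hdd⟩ := h1 e he
    filter_upwards [inter_mem_nhdsWithin _ (Metric.ball_mem_nhds t hd0)] with z hz
    have hzd : |z - t| < d := by simpa [Real.dist_eq] using hz.2
    have hzT : z ∈ Icc 0 T := ⟨hz.1.1, hz.1.2.trans hτ⟩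
    have hseg : segment ℝ t z ⊆ Icc 0 T := (convex_Icc 0 T).segment_subset htT hzT
    have := (convex_segment t z).norm_image_sub_le_of_norm_hasDerivWithin_le
      (f := fun r => f z r - r • f₁ t t) (f' := fun r => f₁ z r - (1 : ℝ) • f₁ t t) (C := e)
      (fun r hr => ((hder z hz.1 r (hseg hr)).mono hseg).sub
        ((hasDerivWithinAt_id r _).smul_const _))
      (fun r hr => by
        have hle : |r - t| < d := by
          refine lt_of_le_of_lt ?_ hzd
          rw [segment_eq_uIcc] at hr
          exact abs_sub_left_of_mem_uIcc hr
        have := hdd (x := (z, r)) ⟨hz.1, hseg hr⟩ (by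
          rw [Prod.dist_eq]; exact max_lt (by simpa [Real.dist_eq] using hzd)
            (by simpa [Real.dist_eq] using hle))
        rw [dist_eq_norm] at this
        simpa using this.le)
      (left_mem_segment ℝ t z) (right_mem_segment ℝ t z)
    convert this using 2
    simp only [sub_smul, sub_self, sub_zero]; abel
  exact (htime.add hd).congr_of_mem (fun z hz => by simp) ht

/-! ### Partial derivatives of the nonlinear term as multilinear maps on the base space. -/

namespace BanachScale

variable {X : ℝ → Type*} [∀ s, NormedAddCommGroup (X s)] [∀ s, NormedSpace ℝ (X s)]

/-- `F[t, ·]` as a map from `X (ρ + m)` to `X σ`, `σ ≤ ρ`. -/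
noncomputable def lower (B : BanachScale X) {m : ℝ} (F : ℝ → ∀ s, X (s + m) → X s) {ρ σ : ℝ}
    (h : σ ≤ ρ) : ℝ → X (ρ + m) → X σ := fun t y => B.incl h (F t ρ y)

theorem le_add_mul_sub (s₀ : ℝ) (a : ℕ) (m : ℝ) : s₀ ≤ s₀ + a * m - a * m := by simp

/-- `ε^a ∂_t^a ∂_u^j F[t, x]`, as a multilinear map on `X s₀`. -/
noncomputable def jetF (B : BanachScale X) {m : ℝ} (hm : 0 ≤ m) (T s₀ ε : ℝ)
    (F : ℝ → ∀ s, X (s + m) → X s) (a j : ℕ) (t : ℝ) (x : X s₀) :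
    MultilinearMap ℝ (fun _ : Fin j => X s₀) (X s₀) :=
  ε ^ a • (B.incl (le_add_mul_sub s₀ a m) : _ →ₗ[ℝ] X s₀).compMultilinearMap
    ((iteratedFDeriv ℝ j (timeDeriv T a (B.lower F (sub_nat_mul_le hm a (s₀ + a * m))) t)
      (B.up s₀ (s₀ + a * m + m) x)).toMultilinearMap.compLinearMap
        (fun _ => B.up s₀ (s₀ + a * m + m)))

variable {B : BanachScale X} {ε₀ T s₀ m : ℝ} {hm : 0 ≤ m} {p : ℕ}
  {F : ℝ → ℝ → ∀ s, X (s + m) → X s}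

theorem AssumptionF.timeSmooth (hF : B.AssumptionF ε₀ T s₀ hm p F) {a j : ℕ} (ha : a ≤ p)
    (haj : a + j ≤ p + 2) {ρ : ℝ} (hρ : s₀ + a * m ≤ ρ) {ε : ℝ} (hε : ε ∈ Ioo 0 ε₀) :
    TimeSmooth T a j (B.lower (F ε) (sub_nat_mul_le hm a ρ)) :=
  (hF.2 a j ha haj ρ hρ).1 ε hε

theorem jetF_apply (ε : ℝ) (a j : ℕ) (t : ℝ) (x : X s₀) (w : Fin j → X s₀) :
    B.jetF hm T s₀ ε (F ε) a j t x w = ε ^ a • B.incl (le_add_mul_sub s₀ a m)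
      (iteratedFDeriv ℝ j (timeDeriv T a (B.lower (F ε) (sub_nat_mul_le hm a (s₀ + a * m))) t)
        (B.up s₀ (s₀ + a * m + m) x) (fun l => B.up s₀ (s₀ + a * m + m) (w l))) := rfl

/-- The derivatives of `F` may be computed at any level. -/
theorem AssumptionF.jetF_eq (hF : B.AssumptionF ε₀ T s₀ hm p F) (hT : 0 < T) {a c j : ℕ}
    (hac : a ≤ c) (hc : c ≤ p) (hcj : c + j ≤ p + 2) {ρ : ℝ} (hρ : s₀ + c * m ≤ ρ) {ε : ℝ}
    (hε : ε ∈ Ioo 0 ε₀) {t : ℝ} (ht : t ∈ Icc 0 T) {x : X s₀} {w : Fin j → X s₀}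
    (hx : B.Mem (ρ + m) x) (hw : ∀ l, B.Mem (ρ + m) (w l)) :
    B.jetF hm T s₀ ε (F ε) a j t x w = ε ^ a • B.incl (le_sub_iff_add_le.2 hρ)
      (iteratedFDeriv ℝ j (timeDeriv T a (B.lower (F ε) (sub_nat_mul_le hm c ρ)) t)
        (B.up s₀ (ρ + m) x) (fun l => B.up s₀ (ρ + m) (w l))) := by
  have hacm : (a : ℝ) * m ≤ c * m := by gcongr
  have h0 : s₀ ≤ s₀ + a * m + m := by
    have : 0 ≤ (a : ℝ) * m := by positivity
    linarith
  have h1 : s₀ + a * m ≤ ρ := by linarith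
  have h2 : s₀ + a * m + m ≤ ρ + m := by linarith
  -- By coherence of `F`, the maps at the levels `s₀ + a m` and `ρ` are intertwined by inclusions;
  -- hence so are all their derivatives.
  have key := (hF.timeSmooth (hac.trans hc) (by omega) le_rfl hε).intertwine (j := j) (j' := j) hT
    (hF.timeSmooth hc hcj hρ hε)
    (B.incl h2) (B.incl (le_add_mul_sub s₀ a m)) (B.incl (le_sub_iff_add_le.2 hρ))
    (fun t ht y => by
      have := hF.1 ε hε t ht (s₀ + a * m) ρ (by have : 0 ≤ (a : ℝ) * m := by positivity
                                                linarith) h1 y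
      simp only [lower, B.incl_incl]
      rw [this, B.incl_incl]) le_rfl hac le_rfl le_rfl ht (B.up s₀ (ρ + m) x)
      (fun l => B.up s₀ (ρ + m) (w l))
  rw [jetF_apply, ← key, incl_up_of_mem hx h0 h2]
  congr 4
  funext l
  rw [incl_up_of_mem (hw l) h0 h2]

theorem AssumptionF.jetF_bound (hF : B.AssumptionF ε₀ T s₀ hm p F) (hT : 0 < T) {a j : ℕ}
    (ha : a ≤ p) (haj : a + j ≤ p + 2) {ρ : ℝ} (hρ : s₀ + a * m ≤ ρ) :
    ∃ K : ℝ → ℝ, Monotone K ∧ (∀ z, 0 ≤ K z) ∧ ∀ ε ∈ Ioo 0 ε₀, ∀ t ∈ Icc 0 T,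
      ∀ (x : X s₀) (w : Fin j → X s₀), B.Mem (ρ + m) x → (∀ l, B.Mem (ρ + m) (w l)) →
      B.Mem (ρ - a * m) (B.jetF hm T s₀ ε (F ε) a j t x w) ∧
      B.nrm (ρ - a * m) (B.jetF hm T s₀ ε (F ε) a j t x w) ≤ K (B.nrm (s₀ + (a + 1) * m) x) *
        tameSum (B.nrm (ρ + m) x) (fun l => B.nrm (s₀ + (a + 1) * m) (w l))
          (fun l => B.nrm (ρ + m) (w l)) := by
  obtain ⟨C, hC, hb⟩ := (hF.2 a j ha haj ρ hρ).2
  -- The given `C` may take negative values; truncation keeps it monotone.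
  refine ⟨fun z => max (C z) 0, fun x y h => max_le_max (hC h) le_rfl, fun z => le_max_right _ _,
    fun ε hε t ht x w hx hw => ?_⟩
  have h0 : s₀ ≤ s₀ + (a + 1) * m := by
    have : 0 ≤ ((a : ℝ) + 1) * m := by positivity
    linarith
  rw [hF.jetF_eq hT le_rfl ha haj hρ hε ht hx hw]
  refine ⟨(mem_incl _ _).smul _, ?_⟩
  rw [← map_smul, nrm_incl]
  have h1 : ∀ {y}, B.Mem (ρ + m) y → ‖B.incl (add_succ_mul_le hρ) (B.up s₀ (ρ + m) y)‖ =
      B.nrm (s₀ + (a + 1) * m) y := fun hy => by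
    rw [incl_up_of_mem hy h0 (add_succ_mul_le hρ), nrm]
  refine (hb ε hε t ht (B.up s₀ (ρ + m) x) (fun l => B.up s₀ (ρ + m) (w l))).trans ?_
  rw [h1 hx]
  simp only [fun l => h1 (hw l)]
  exact mul_le_mul_of_nonneg_right (le_max_left _ _) (tameSum_nonneg (nrm_nonneg _ _)
    (fun _ => nrm_nonneg _ _) (fun _ => nrm_nonneg _ _))

theorem AssumptionF.jetF_comp_perm (hF : B.AssumptionF ε₀ T s₀ hm p F) {a j : ℕ} (ha : a ≤ p)
    (haj : a + j ≤ p + 2) {ε : ℝ} (hε : ε ∈ Ioo 0 ε₀) {t : ℝ} (ht : t ∈ Icc 0 T) (x : X s₀)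
    (w : Fin j → X s₀) (σ : Equiv.Perm (Fin j)) :
    B.jetF hm T s₀ ε (F ε) a j t x (w ∘ σ) = B.jetF hm T s₀ ε (F ε) a j t x w := by
  have h := ((hF.timeSmooth (j := j) ha (by omega) le_rfl hε).2 a le_rfl).1 t ht
  rw [jetF_apply, jetF_apply]
  exact congrArg (fun y => ε ^ a • B.incl (le_add_mul_sub s₀ a m) y)
    (iteratedFDeriv_comp_perm h _ (fun l => B.up s₀ (s₀ + a * m + m) (w l)) σ)

/-- The chain rule creates the new direction in the first slot, while the recursion defining `jet`
appends it in the last one. -/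
theorem AssumptionF.jetF_cons_eq_snoc (hF : B.AssumptionF ε₀ T s₀ hm p F) {a j : ℕ} (ha : a ≤ p)
    (haj : a + j + 1 ≤ p + 2) {ε : ℝ} (hε : ε ∈ Ioo 0 ε₀) {t : ℝ} (ht : t ∈ Icc 0 T) (x v : X s₀)
    (w : Fin j → X s₀) :
    B.jetF hm T s₀ ε (F ε) a (j + 1) t x (Fin.cons v w : Fin (j + 1) → X s₀) =
      B.jetF hm T s₀ ε (F ε) a (j + 1) t x (Fin.snoc w v : Fin (j + 1) → X s₀) := by
  rw [Fin.snoc_eq_cons_rotate]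
  exact (hF.jetF_comp_perm ha (by omega) hε ht x _ (finRotate _)).symm

theorem continuousOn_iteratedFDeriv_apply {E H : Type*} [NormedAddCommGroup E] [NormedSpace ℝ E]
    [NormedAddCommGroup H] [NormedSpace ℝ H] {α : Type*} [TopologicalSpace α] {S : Set α} {j : ℕ}
    {M : α → ContinuousMultilinearMap ℝ (fun _ : Fin j => E) H} {w : Fin j → α → E}
    (hM : ContinuousOn M S) (hw : ∀ l, ContinuousOn (w l) S) :
    ContinuousOn (fun z => M z (fun l => w l z)) S := by
  have h1 := ContinuousMultilinearMap.hasStrictFDerivAt_uncurry (𝕜 := ℝ) (E := fun _ : Fin j => E)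
    (F := H)
  intro z hz
  exact (h1 (M z, fun l => w l z)).continuousAt.comp_continuousWithinAt
    (f := fun z => (M z, fun l => w l z)) ((hM z hz).prodMk (continuousWithinAt_pi.2 fun l => hw l z hz))

theorem AssumptionF.continuousOn_up_jetF (hF : B.AssumptionF ε₀ T s₀ hm p F) (hT : 0 < T)
    {a j : ℕ} (ha : a ≤ p) (haj : a + j ≤ p + 2) {ρ : ℝ} (hρ : s₀ + a * m ≤ ρ) {ε : ℝ}
    (hε : ε ∈ Ioo 0 ε₀) {α : Type*} [TopologicalSpace α] {S : Set α} {θ : α → ℝ}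
    (hθ : ContinuousOn θ S) (hθT : MapsTo θ S (Icc 0 T)) {x : α → X s₀} {w : Fin j → α → X s₀}
    (hx : ∀ z ∈ S, B.Mem (ρ + m) (x z)) (hw : ∀ l, ∀ z ∈ S, B.Mem (ρ + m) (w l z))
    (hxc : ContinuousOn (fun z => B.up s₀ (ρ + m) (x z)) S)
    (hwc : ∀ l, ContinuousOn (fun z => B.up s₀ (ρ + m) (w l z)) S) :
    ContinuousOn (fun z => B.up s₀ (ρ - a * m)
      (B.jetF hm T s₀ ε (F ε) a j (θ z) (x z) (fun l => w l z))) S := by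
  have : EqOn (fun z => B.up s₀ (ρ - a * m)
      (B.jetF hm T s₀ ε (F ε) a j (θ z) (x z) (fun l => w l z)))
      (fun z => ε ^ a • iteratedFDeriv ℝ j
        (timeDeriv T a (B.lower (F ε) (sub_nat_mul_le hm a ρ)) (θ z))
      (B.up s₀ (ρ + m) (x z)) (fun l => B.up s₀ (ρ + m) (w l z))) S := fun z hz => by
    simp only [hF.jetF_eq hT le_rfl ha haj hρ hε (hθT hz) (hx z hz) (fun l => hw l z hz),
      map_smul, up_incl]
  refine ContinuousOn.congr ?_ this
  refine ContinuousOn.const_smul (continuousOn_iteratedFDeriv_apply ?_ hwc) _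
  exact (((hF.timeSmooth ha haj hρ hε).2 a le_rfl).2 j le_rfl).comp (hθ.prodMk hxc)
    fun z hz => ⟨hθT hz, mem_univ _⟩

theorem AssumptionF.mem_jetF (hF : B.AssumptionF ε₀ T s₀ hm p F) (hT : 0 < T)
    {a j : ℕ} (ha : a ≤ p) (haj : a + j ≤ p + 2) {ρ : ℝ} (hρ : s₀ + a * m ≤ ρ) {ε : ℝ}
    (hε : ε ∈ Ioo 0 ε₀) {t : ℝ} (ht : t ∈ Icc 0 T) {x : X s₀} {w : Fin j → X s₀}
    (hx : B.Mem (ρ + m) x) (hw : ∀ l, B.Mem (ρ + m) (w l)) :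
    B.Mem (ρ - a * m) (B.jetF hm T s₀ ε (F ε) a j t x w) := by
  rw [hF.jetF_eq hT le_rfl ha haj hρ hε ht hx hw]
  exact (mem_incl _ _).smul _

theorem AssumptionF.lc_jetF (hF : B.AssumptionF ε₀ T s₀ hm p F) (hT : 0 < T) {a j : ℕ}
    (ha : a ≤ p) (haj : a + j ≤ p + 2) {ρ : ℝ} (hρ : s₀ + a * m ≤ ρ) {ε : ℝ}
    (hε : ε ∈ Ioo 0 ε₀) {τ : ℝ} {θ : ℝ → ℝ} (hθ : ContinuousOn θ (Icc 0 τ))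
    (hθT : MapsTo θ (Icc 0 τ) (Icc 0 T)) {x : ℝ → X s₀} {w : Fin j → ℝ → X s₀}
    (hx : B.LC (ρ + m) τ x) (hw : ∀ l, B.LC (ρ + m) τ (w l)) :
    B.LC (ρ - a * m) τ (fun z => B.jetF hm T s₀ ε (F ε) a j (θ z) (x z) (fun l => w l z)) :=
  ⟨fun z hz => hF.mem_jetF hT ha haj hρ hε (hθT hz) (hx.1 z hz) fun l => (hw l).1 z hz,
    hF.continuousOn_up_jetF hT ha haj hρ hε hθ hθT hx.1 (fun l => (hw l).1) hx.2 fun l => (hw l).2⟩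

/-- The chain rule in the space variables. -/
theorem AssumptionF.hasDerivWithinAt_jetF (hF : B.AssumptionF ε₀ T s₀ hm p F) {a j : ℕ}
    (ha : a ≤ p) (haj : a + j + 1 ≤ p + 2) {ε : ℝ} (hε : ε ∈ Ioo 0 ε₀) {t : ℝ} (ht : t ∈ Icc 0 T)
    {S : Set ℝ} {z : ℝ} {x : ℝ → X s₀} {w : Fin j → ℝ → X s₀} {x' : X s₀} {w' : Fin j → X s₀}
    (hx : HasDerivWithinAt (fun z => B.up s₀ (s₀ + a * m + m) (x z))
      (B.up s₀ (s₀ + a * m + m) x') S z)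
    (hw : ∀ l, HasDerivWithinAt (fun z => B.up s₀ (s₀ + a * m + m) (w l z))
      (B.up s₀ (s₀ + a * m + m) (w' l)) S z) :
    HasDerivWithinAt (fun z => B.jetF hm T s₀ ε (F ε) a j t (x z) (fun l => w l z))
      (B.jetF hm T s₀ ε (F ε) a (j + 1) t (x z)
        (Fin.cons x' (fun l => w l z) : Fin (j + 1) → X s₀) +
        ∑ l, B.jetF hm T s₀ ε (F ε) a j t (x z) (Function.update (fun l => w l z) l (w' l))) S z := by
  have hcd := ((hF.timeSmooth (j := j + 1) ha (by omega) le_rfl hε).2 a le_rfl).1 t ht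
  have hD := (hcd.differentiable_iteratedFDeriv (m := j) (by norm_cast; omega)
    (B.up s₀ (s₀ + a * m + m) (x z))).hasFDerivAt.comp_hasDerivWithinAt z hx
  have h1 := (hD.hasFDerivWithinAt.continuousMultilinearMap_apply
    (fun l => (hw l).hasFDerivWithinAt)).hasDerivWithinAt
  have h2 := ((B.incl (le_add_mul_sub s₀ a m)).hasFDerivAt.comp_hasDerivWithinAt z h1).const_smul
    (ε ^ a)
  refine h2.congr_deriv ?_
  rw [jetF_apply]
  simp only [jetF_apply]
  rw [← Finset.smul_sum, ← smul_add, ← map_sum, ← map_add, iteratedFDeriv_succ_apply_left]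
  congr 2
  simp only [Function.comp_apply, add_apply, ContinuousLinearMap.comp_apply,
    ContinuousLinearMap.toSpanSingleton_apply, one_smul, ContinuousMultilinearMap.apply_apply,
    FunLike.coe_sum, Finset.sum_apply, Fin.cons_zero, Fin.tail_def, Fin.cons_succ,
    ContinuousMultilinearMap.toContinuousLinearMap_apply]
  congr 1
  refine Finset.sum_congr rfl fun i _ => ?_
  congr 1
  funext l
  by_cases hl : l = i
  · subst hl; simp
  · simp [hl]

/-- The chain rule in time and space. -/
theorem AssumptionF.hasDerivWithinAt_jetF_time [∀ s, CompleteSpace (X s)]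
    (hF : B.AssumptionF ε₀ T s₀ hm p F) (hT : 0 < T) {a j : ℕ}
    (ha : a + 1 ≤ p) (haj : a + 1 + j ≤ p + 2) {ε : ℝ} (hε : ε ∈ Ioo 0 ε₀) {τ : ℝ} (hτ : τ ≤ T)
    {x x₁ : ℝ → X s₀} {w w₁ : Fin j → ℝ → X s₀} {r : ℝ} (hr : s₀ + (a + 1) * m + m ≤ r)
    (hx : B.LC r τ x) (hw : ∀ l, B.LC r τ (w l))
    (hx₁ : B.LC (r - m) τ x₁) (hw₁ : ∀ l, B.LC (r - m) τ (w₁ l))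
    (hdx : ∀ t ∈ Icc 0 τ, HasDerivWithinAt x (ε⁻¹ • x₁ t) (Icc 0 τ) t)
    (hdw : ∀ l, ∀ t ∈ Icc 0 τ, HasDerivWithinAt (w l) (ε⁻¹ • w₁ l t) (Icc 0 τ) t)
    {t : ℝ} (ht : t ∈ Icc 0 τ) :
    HasDerivWithinAt (fun t => B.jetF hm T s₀ ε (F ε) a j t (x t) (fun l => w l t))
      (ε⁻¹ • (B.jetF hm T s₀ ε (F ε) (a + 1) j t (x t) (fun l => w l t) +
        B.jetF hm T s₀ ε (F ε) a (j + 1) t (x t)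
          (Fin.snoc (fun l => w l t) (x₁ t) : Fin (j + 1) → X s₀) +
        ∑ l, B.jetF hm T s₀ ε (F ε) a j t (x t) (Function.update (fun l => w l t) l (w₁ l t))))
      (Icc 0 τ) t := by
  have hε0 : ε ≠ 0 := hε.1.ne'
  have htT : t ∈ Icc 0 T := ⟨ht.1, ht.2.trans hτ⟩
  have ham : 0 ≤ ((a : ℝ) + 1) * m := by positivity
  have hs0 : s₀ ≤ s₀ + (a + 1) * m + m := by linarith
  have hcast : (((a + 1 : ℕ) : ℝ)) = a + 1 := by push_cast; ring
  have hlev : s₀ ≤ s₀ + a * m + m := by nlinarith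
  have hup : ∀ {y y₁ : ℝ → X s₀}, B.LC r τ y → B.LC (r - m) τ y₁ →
      (∀ t ∈ Icc 0 τ, HasDerivWithinAt y (ε⁻¹ • y₁ t) (Icc 0 τ) t) →
      HasDerivWithinAt (fun z => B.up s₀ (s₀ + a * m + m) (y z))
        (B.up s₀ (s₀ + a * m + m) (ε⁻¹ • y₁ t)) (Icc 0 τ) t := fun hy hy₁ hd =>
    (hy.mono hlev (by linarith)).hasDerivWithinAt_up hlev
      ((hy₁.mono hlev (by linarith)).smul _) hd ht
  have hspace := hF.hasDerivWithinAt_jetF (a := a) (j := j) (by omega) (by omega) hε htT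
    (hup hx hx₁ hdx) (fun l => hup (hw l) (hw₁ l) (hdw l))
  -- This is the lowest level at which one regularity statement covers both the time derivatives of
  -- order `a` and `a + 1`.
  obtain ⟨ρ, hρ⟩ : ∃ ρ, ρ = s₀ + (a + 1) * m := ⟨_, rfl⟩
  have hc1 : s₀ + ((a + 1 : ℕ) : ℝ) * m ≤ ρ := by rw [hcast, hρ]
  have hs0 : s₀ ≤ ρ + m := by linarith
  have hrρ : ρ + m ≤ r := by linarith
  have hTS := hF.timeSmooth (a := a + 1) ha haj hc1 hε
  have heq := fun (c : ℕ) (hac : c ≤ a + 1) (t : ℝ) (ht : t ∈ Icc 0 T) (z : ℝ)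
    (hz : z ∈ Icc 0 τ) => hF.jetF_eq (j := j) hT hac ha haj hc1 hε ht
      (x := x z) (w := fun l => w l z) ((hx.mono hs0 hrρ).1 z hz)
      (fun l => ((hw l).mono hs0 hrρ).1 z hz)
  have hder : ∀ z ∈ Icc 0 τ, ∀ t ∈ Icc 0 T,
      HasDerivWithinAt (fun t => B.jetF hm T s₀ ε (F ε) a j t (x z) (fun l => w l z))
        (ε⁻¹ • B.jetF hm T s₀ ε (F ε) (a + 1) j t (x z) (fun l => w l z)) (Icc 0 T) t := by
    intro z hz t ht
    have h1 := hTS.hasDerivWithinAt_iteratedFDeriv hT (l := a) (by omega) j le_rfl ht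
      (B.up s₀ (ρ + m) (x z))
    have h2 := (ContinuousMultilinearMap.apply ℝ _ _
      (fun l => B.up s₀ (ρ + m) (w l z))).hasFDerivAt.comp_hasDerivWithinAt t h1
    have h3 := ((B.incl (le_sub_iff_add_le.2 hc1)).hasFDerivAt.comp_hasDerivWithinAt t
      h2).const_smul (ε ^ a)
    refine (h3.congr (fun t ht => heq a (by omega) t ht z hz)
      (heq a (by omega) t ht z hz)).congr_deriv ?_
    rw [heq (a + 1) le_rfl t ht z hz, smul_smul]
    have : ε⁻¹ * ε ^ (a + 1) = ε ^ a := by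
      rw [pow_succ]; field_simp
    rw [this]
    rfl
  have hcont : ContinuousOn (fun q : ℝ × ℝ => ε⁻¹ • B.jetF hm T s₀ ε (F ε) (a + 1) j q.2 (x q.1)
      (fun l => w l q.1)) (Icc 0 τ ×ˢ Icc 0 T) := by
    have hle : s₀ ≤ ρ - ((a + 1 : ℕ) : ℝ) * m := le_sub_iff_add_le.2 hc1
    have h1 := hF.continuousOn_up_jetF hT ha haj hc1 hε (S := Icc 0 τ ×ˢ Icc 0 T)
      (θ := fun q : ℝ × ℝ => q.2) continuousOn_snd (fun q hq => hq.2) (x := fun q => x q.1)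
      (w := fun l q => w l q.1) (fun q hq => (hx.mono hs0 hrρ).1 q.1 hq.1)
      (fun l q hq => ((hw l).mono hs0 hrρ).1 q.1 hq.1)
      ((hx.mono hs0 hrρ).2.comp continuousOn_fst fun q hq => hq.1)
      (fun l => ((hw l).mono hs0 hrρ).2.comp continuousOn_fst fun q hq => hq.1)
    refine (((B.incl hle).continuous.comp_continuousOn h1).congr fun q hq => ?_).const_smul _
    exact (incl_up hle (hF.mem_jetF hT ha haj hc1 hε hq.2 ((hx.mono hs0 hrρ).1 q.1 hq.1)
      (fun l => ((hw l).mono hs0 hrρ).1 q.1 hq.1))).symm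
  -- The first variable moves the arguments `x` and `w` at a frozen time, the second one the
  -- explicit time.
  have := hasDerivWithinAt_diag hτ ht hder hcont hspace
  refine this.congr_deriv ?_
  have h1 : (Fin.cons (ε⁻¹ • x₁ t) (fun l => w l t) : Fin (j + 1) → X s₀) =
    Function.update (Fin.cons (x₁ t) (fun l => w l t) : Fin (j + 1) → X s₀) 0 (ε⁻¹ • x₁ t) := by
    simp
  rw [h1, MultilinearMap.map_update_smul]
  simp only [MultilinearMap.map_update_smul, Fin.update_cons_zero]
  rw [hF.jetF_cons_eq_snoc (by omega) (by omega) hε htT, smul_add, smul_add, Finset.smul_sum]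
  abel

end BanachScale

/-! ### Jets, and the total time derivatives of the nonlinear term. -/

namespace BanachScale

variable {X : ℝ → Type*} [∀ s, NormedAddCommGroup (X s)] [∀ s, NormedSpace ℝ (X s)]

/-- The jet of the derivative. -/
def shift {V : Type*} (x : ℕ → V) : ℕ → V := fun k => x (k + 1)

/-- The jet `x` of order `j` lies in `∏ₖ X (r - k m)`. -/
def JMem (B : BanachScale X) {b : ℝ} (m r : ℝ) (j : ℕ) (x : ℕ → X b) : Prop :=
  ∀ k ≤ j, B.Mem (r - k * m) (x k)

/-- The norm of the jet `x` of order `j` in `∏ₖ X (r - k m)`. -/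
noncomputable def pn (B : BanachScale X) {b : ℝ} (m r : ℝ) (j : ℕ) (x : ℕ → X b) : ℝ :=
  ∑ k ∈ Finset.range (j + 1), B.nrm (r - k * m) (x k)

section Jets

variable {B : BanachScale X} {b m r r' : ℝ} {i j : ℕ} {x y : ℕ → X b}

theorem JMem.mono (h : B.JMem m r j x) (hij : i ≤ j) (hr : r' ≤ r) (hb : b ≤ r' - i * m)
    (hm : 0 ≤ m) : B.JMem m r' i x := fun k hk =>
  (h k (hk.trans hij)).mono
    (hb.trans (by have : (k : ℝ) * m ≤ i * m := by gcongr
                  linarith)) (by linarith)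

theorem JMem.shift (h : B.JMem m r (j + 1) x) : B.JMem m (r - m) j (shift x) := fun k hk => by
  rw [show r - m - k * m = r - ((k + 1 : ℕ) : ℝ) * m by push_cast; ring]
  exact h (k + 1) (by omega)

theorem JMem.add (hx : B.JMem m r j x) (hy : B.JMem m r j y) : B.JMem m r j (x + y) :=
  fun k hk => (hx k hk).add (hy k hk)

theorem JMem.sub (hx : B.JMem m r j x) (hy : B.JMem m r j y) : B.JMem m r j (x - y) :=
  fun k hk => (hx k hk).sub (hy k hk)

theorem JMem.smul (hx : B.JMem m r j x) (c : ℝ) : B.JMem m r j (c • x) :=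
  fun k hk => (hx k hk).smul c

theorem pn_nonneg (m r : ℝ) (j : ℕ) (x : ℕ → X b) : 0 ≤ B.pn m r j x :=
  Finset.sum_nonneg fun _ _ => nrm_nonneg _ _

theorem pn_mono (h : B.JMem m r j x) (hij : i ≤ j) (hr : r' ≤ r) (hb : b ≤ r' - i * m)
    (hm : 0 ≤ m) : B.pn m r' i x ≤ B.pn m r j x := by
  refine (Finset.sum_le_sum fun k hk => ?_).trans (Finset.sum_le_sum_of_subset_of_nonneg
    (Finset.range_subset_range.2 (by omega)) fun _ _ _ => nrm_nonneg _ _)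
  have hk' : k ≤ i := by simpa [Nat.lt_succ_iff] using hk
  refine nrm_mono (h k (hk'.trans hij)) (hb.trans ?_) (by linarith)
  have : (k : ℝ) * m ≤ i * m := by gcongr
  linarith

theorem pn_shift_le : B.pn m (r - m) j (shift x) ≤ B.pn m r (j + 1) x := by
  unfold pn
  rw [Finset.sum_range_succ' _ (j + 1)]
  refine (le_of_eq ?_).trans (le_add_of_nonneg_right (nrm_nonneg _ _))
  refine Finset.sum_congr rfl fun k _ => ?_
  simp only [shift]
  congr 1
  push_cast; ring

theorem nrm_le_pn {k : ℕ} (hk : k ≤ j) : B.nrm (r - k * m) (x k) ≤ B.pn m r j x :=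
  Finset.single_le_sum (f := fun k : ℕ => B.nrm (r - k * m) (x k)) (fun _ _ => nrm_nonneg _ _)
    (Finset.mem_range.2 (by omega))

theorem pn_succ : B.pn m r (j + 1) x =
    B.pn m r j x + B.nrm (r - ((j + 1 : ℕ) : ℝ) * m) (x (j + 1)) := Finset.sum_range_succ _ _

theorem pn_zero_order : B.pn m r 0 x = B.nrm r (x 0) := by simp [pn]

theorem pn_add_le : B.pn m r j (x + y) ≤ B.pn m r j x + B.pn m r j y := by
  unfold pn
  rw [← Finset.sum_add_distrib]
  exact Finset.sum_le_sum fun k _ => nrm_add_le _ _ _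

theorem pn_sub_le : B.pn m r j (x - y) ≤ B.pn m r j x + B.pn m r j y := by
  unfold pn
  rw [← Finset.sum_add_distrib]
  exact Finset.sum_le_sum fun k _ => nrm_sub_le _ _ _

theorem pn_smul (c : ℝ) : B.pn m r j (c • x) = |c| * B.pn m r j x := by
  simp only [pn, Finset.mul_sum, Pi.smul_apply, nrm_smul]

theorem pn_le_of_forall {K : ℝ} (h : ∀ k ≤ j, B.nrm (r - k * m) (x k) ≤ K) :
    B.pn m r j x ≤ (j + 1) * K := by
  refine (Finset.sum_le_card_nsmul _ _ K fun k hk => h k ?_).trans ?_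
  · simpa [Nat.lt_succ_iff] using hk
  · simp

end Jets

/-- The `i`-th derivative `(ε ∂_t)^i` of `ε^a ∂_t^a ∂_u^j F[t, u(t)](w(t))` in terms of the jets of
`u` and `w` at time `t`. -/
noncomputable def jet (B : BanachScale X) {m : ℝ} (hm : 0 ≤ m) (T s₀ ε : ℝ)
    (F : ℝ → ∀ s, X (s + m) → X s) :
    ℕ → ∀ (_ j : ℕ), ℝ → (ℕ → X s₀) → (Fin j → ℕ → X s₀) → X s₀
  | 0, a, j, t, u, w => B.jetF hm T s₀ ε F a j t (u 0) (fun l => w l 0)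
  | i + 1, a, j, t, u, w => jet B hm T s₀ ε F i (a + 1) j t u w +
      jet B hm T s₀ ε F i a (j + 1) t u (Fin.snoc w (shift u) : Fin (j + 1) → ℕ → X s₀) +
      ∑ l, jet B hm T s₀ ε F i a j t u (Function.update w l (shift (w l)))

variable {B : BanachScale X} {ε₀ T s₀ m : ℝ} {hm : 0 ≤ m} {p : ℕ}
  {F : ℝ → ℝ → ∀ s, X (s + m) → X s}

theorem jet_zero (ε : ℝ) (a j : ℕ) (t : ℝ) (u : ℕ → X s₀) (w : Fin j → ℕ → X s₀) :
    B.jet hm T s₀ ε (F ε) 0 a j t u w =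
      B.jetF hm T s₀ ε (F ε) a j t (u 0) (fun l => w l 0) := rfl

/-- The three terms differentiate the explicit time dependence, the point `u`, which adds the
direction `shift u` representing `ε ∂_t u`, and each of the directions `w l`. -/
theorem jet_succ (ε : ℝ) (i a j : ℕ) (t : ℝ) (u : ℕ → X s₀) (w : Fin j → ℕ → X s₀) :
    B.jet hm T s₀ ε (F ε) (i + 1) a j t u w = B.jet hm T s₀ ε (F ε) i (a + 1) j t u w +
      B.jet hm T s₀ ε (F ε) i a (j + 1) t u (Fin.snoc w (shift u) : Fin (j + 1) → ℕ → X s₀) +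
      ∑ l, B.jet hm T s₀ ε (F ε) i a j t u (Function.update w l (shift (w l))) := rfl

/-- Locality in the order: since each differentiation calls for only one more component, the higher
components of the jet of a solution can be defined recursively from the equation. -/
theorem jet_congr (ε : ℝ) {i a j : ℕ} {t : ℝ} {u u' : ℕ → X s₀} {w w' : Fin j → ℕ → X s₀}
    (hu : ∀ k ≤ i, u k = u' k) (hw : ∀ l, ∀ k ≤ i, w l k = w' l k) :
    B.jet hm T s₀ ε (F ε) i a j t u w = B.jet hm T s₀ ε (F ε) i a j t u' w' := by
  induction i generalizing a j w w' with
  | zero =>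
    simp only [jet_zero, hu 0 le_rfl, fun l => hw l 0 le_rfl]
  | succ i ih =>
    have hu' : ∀ k ≤ i, u k = u' k := fun k hk => hu k (by omega)
    have hw' : ∀ l, ∀ k ≤ i, w l k = w' l k := fun l k hk => hw l k (by omega)
    rw [jet_succ, jet_succ]
    congr 1
    · congr 1
      · exact ih hu' hw'
      · refine ih hu' fun l => ?_
        refine Fin.lastCases ?_ (fun l => ?_) l
        · intro k hk
          simpa [shift] using hu (k + 1) (by omega)
        · intro k hk
          simpa using hw' l k hk
    · refine Finset.sum_congr rfl fun l _ => ih hu' fun l' k hk => ?_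
      by_cases h : l' = l
      · subst h; simpa [shift] using hw l' (k + 1) (by omega)
      · simpa [h] using hw' l' k hk

/-- Multilinearity survives the recursion because `shift` is linear and modifications of different
slots commute; the slot `l` has to be isolated, since it is the only one where `shift` acts on the
varying argument. -/
theorem jet_update_linear (ε : ℝ) {i a j : ℕ} {t : ℝ} {u : ℕ → X s₀} (w : Fin j → ℕ → X s₀)
    (l : Fin j) (c d : ℝ) (x y : ℕ → X s₀) :
    B.jet hm T s₀ ε (F ε) i a j t u (Function.update w l (c • x + d • y)) =
      c • B.jet hm T s₀ ε (F ε) i a j t u (Function.update w l x) +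
      d • B.jet hm T s₀ ε (F ε) i a j t u (Function.update w l y) := by
  induction i generalizing a j w x y with
  | zero =>
    simp only [jet_zero]
    have h : ∀ z : ℕ → X s₀, (fun q => Function.update w l z q 0) =
        Function.update (fun q => w q 0) l (z 0) := fun z => by
      funext q
      by_cases hq : q = l
      · subst hq; simp
      · simp [hq]
    simp only [h, Pi.add_apply, Pi.smul_apply, MultilinearMap.map_update_add,
      MultilinearMap.map_update_smul]
  | succ i ih =>
    have h1 : ∀ z : ℕ → X s₀, (Fin.snoc (Function.update w l z) (shift u) :
        Fin (j + 1) → ℕ → X s₀) = Function.update (Fin.snoc w (shift u) : Fin (j + 1) → ℕ → X s₀)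
          l.castSucc z := fun z => Fin.snoc_update _ _ _ _
    have h2 : ∀ (z : ℕ → X s₀) (q : Fin j), q ≠ l → Function.update (Function.update w l z) q
        (shift (Function.update w l z q)) =
        Function.update (Function.update w q (shift (w q))) l z := fun z q hq => by
      rw [Function.update_of_ne hq, Function.update_comm hq.symm]
    have h3 : ∀ z : ℕ → X s₀, Function.update (Function.update w l z) l
        (shift (Function.update w l z l)) = Function.update w l (shift z) := fun z => by
      simp
    have h4 : ∀ z : ℕ → X s₀, ∑ q, B.jet hm T s₀ ε (F ε) i a j t u
        (Function.update (Function.update w l z) q (shift (Function.update w l z q))) =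
        B.jet hm T s₀ ε (F ε) i a j t u (Function.update w l (shift z)) +
        ∑ q ∈ Finset.univ.erase l, B.jet hm T s₀ ε (F ε) i a j t u
          (Function.update (Function.update w q (shift (w q))) l z) := fun z => by
      rw [← Finset.add_sum_erase _ _ (Finset.mem_univ l), h3]
      congr 1
      exact Finset.sum_congr rfl fun q hq => by rw [h2 z q (Finset.ne_of_mem_erase hq)]
    have h5 : shift (c • x + d • y) = c • shift x + d • shift y := rfl
    simp only [jet_succ, h4, h1, h5]
    rw [ih, ih, ih]
    simp only [ih, Finset.sum_add_distrib, ← Finset.smul_sum, smul_add]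
    abel

theorem exists_perm_snoc {j : ℕ} (σ : Equiv.Perm (Fin j)) : ∃ σ' : Equiv.Perm (Fin (j + 1)),
    ∀ {V : Type _} (w : Fin j → V) (x : V), (Fin.snoc (w ∘ σ) x : Fin (j + 1) → V) =
      (Fin.snoc w x : Fin (j + 1) → V) ∘ σ' := by
  refine ⟨finSuccEquivLast.trans ((Equiv.optionCongr σ).trans finSuccEquivLast.symm),
    fun w x => ?_⟩
  funext k
  refine Fin.lastCases ?_ (fun k => ?_) k <;> simp

theorem AssumptionF.jet_comp_perm (hF : B.AssumptionF ε₀ T s₀ hm p F) {i a j : ℕ} (ha : a + i ≤ p)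
    (haj : a + i + j ≤ p + 2) {ε : ℝ} (hε : ε ∈ Ioo 0 ε₀) {t : ℝ} (ht : t ∈ Icc 0 T) (u : ℕ → X s₀)
    (w : Fin j → ℕ → X s₀) (σ : Equiv.Perm (Fin j)) :
    B.jet hm T s₀ ε (F ε) i a j t u (w ∘ σ) = B.jet hm T s₀ ε (F ε) i a j t u w := by
  induction i generalizing a j w σ with
  | zero =>
    exact hF.jetF_comp_perm (by omega) (by omega) hε ht (u 0) (fun l => w l 0) σ
  | succ i ih =>
    rw [jet_succ, jet_succ, ih (by omega) (by omega)]
    congr 1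
    · obtain ⟨σ', hσ'⟩ := exists_perm_snoc σ
      rw [hσ', ih (by omega) (by omega)]
    · refine Fintype.sum_equiv σ _ _ fun l => ?_
      rw [← ih (by omega) (by omega) (Function.update w (σ l) (shift (w (σ l)))) σ]
      congr 1
      funext q
      by_cases hq : q = l
      · subst hq; simp
      · simp [hq]

/-- The pointwise tame estimate of the jets. -/
theorem AssumptionF.jet_bound (hF : B.AssumptionF ε₀ T s₀ hm p F) (hT : 0 < T) (i : ℕ) :
    ∀ {a j : ℕ}, a + i ≤ p → a + i + j ≤ p + 2 → ∀ {ρ : ℝ}, s₀ + (a + i) * m ≤ ρ →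
    ∃ K : ℝ → ℝ, Monotone K ∧ (∀ z, 0 ≤ K z) ∧ ∀ ε ∈ Ioo 0 ε₀, ∀ t ∈ Icc 0 T,
      ∀ (u : ℕ → X s₀) (w : Fin j → ℕ → X s₀), B.JMem m (ρ + m) i u →
      (∀ l, B.JMem m (ρ + m) i (w l)) →
      B.Mem (ρ - (a + i) * m) (B.jet hm T s₀ ε (F ε) i a j t u w) ∧
      B.nrm (ρ - (a + i) * m) (B.jet hm T s₀ ε (F ε) i a j t u w) ≤
        K (B.pn m (s₀ + (a + i + 1) * m) i u) * tameSum (B.pn m (ρ + m) i u)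
          (fun l => B.pn m (s₀ + (a + i + 1) * m) i (w l)) (fun l => B.pn m (ρ + m) i (w l)) := by
  induction i with
  | zero =>
    intro a j ha haj ρ hρ
    simp only [Nat.cast_zero, add_zero] at hρ ⊢
    obtain ⟨K, hK, hK0, h⟩ := hF.jetF_bound hT (by omega) (by omega) hρ
    refine ⟨K, hK, hK0, fun ε hε t ht u w hu hw => ?_⟩
    simp only [pn_zero_order]
    exact h ε hε t ht (u 0) (fun l => w l 0) (by simpa using hu 0 le_rfl)
      (fun l => by simpa using hw l 0 le_rfl)
  | succ i ih =>
    intro a j ha haj ρ hρ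
    have hc : (((i + 1 : ℕ)) : ℝ) = i + 1 := by push_cast; ring
    have hca : (((a + 1 : ℕ)) : ℝ) = a + 1 := by push_cast; ring
    rw [hc] at hρ ⊢
    have e0 : ρ - m + m = ρ := by ring
    have e1 : (a : ℝ) + 1 + i = a + (i + 1) := by ring
    have e2 : ρ - m - (a + i) * m = ρ - (a + (i + 1)) * m := by ring
    -- The term with one more explicit time derivative is taken at the level `ρ`, the other two at
    -- `ρ - m` because a shifted jet has lost `m`; all three land in the same space.
    obtain ⟨K₁, hK₁, hK₁0, h₁⟩ := ih (a := a + 1) (j := j) (by omega) (by omega) (ρ := ρ)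
      (by rw [hca]; linarith)
    obtain ⟨K₂, hK₂, hK₂0, h₂⟩ := ih (a := a) (j := j + 1) (by omega) (by omega) (ρ := ρ - m)
      (by linarith)
    obtain ⟨K₃, hK₃, hK₃0, h₃⟩ := ih (a := a) (j := j) (by omega) (by omega) (ρ := ρ - m)
      (by linarith)
    rw [hca, e1] at h₁
    rw [e0, e2] at h₂ h₃
    -- The factor `max z 0 + 1` comes from `tameSum_snoc`: the low norm of `u` multiplies the old
    -- tame sum, and the remaining product is bounded by that sum. There are `j` terms of the third
    -- kind.
    refine ⟨fun z => K₁ z + K₂ z * (max z 0 + 1) + j * K₃ z, ?_, ?_, ?_⟩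
    · intro x y hxy
      have a1 := hK₁ hxy
      have a2 := hK₂ hxy
      have a3 := hK₃ hxy
      have a4 : max x 0 ≤ max y 0 := max_le_max hxy le_rfl
      have a5 : 0 ≤ max x 0 := le_max_right _ _
      have := hK₂0 y
      beta_reduce
      gcongr
    · intro z
      have a1 := hK₁0 z
      have a2 := hK₂0 z
      have a3 := hK₃0 z
      have a5 : 0 ≤ max z 0 := le_max_right _ _
      positivity
    intro ε hε t ht u w hu hw
    have hsρ : s₀ + (a + i + 2) * m ≤ ρ + m := by linarith
    have him : 0 ≤ (i : ℝ) * m := by positivity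
    have ham : 0 ≤ (a : ℝ) * m := by positivity
    have hlow : s₀ ≤ s₀ + (a + (i + 1) + 1) * m - ((i + 1 : ℕ) : ℝ) * m := by
      rw [hc]; nlinarith
    have hloi : s₀ ≤ s₀ + (a + (i + 1) + 1) * m - i * m := by nlinarith
    have hloi' : s₀ ≤ s₀ + (a + i + 1) * m - i * m := by nlinarith
    have hiρ : s₀ ≤ ρ - i * m := by linarith
    have hiρ' : s₀ ≤ ρ + m - i * m := by linarith
    have hlohi : s₀ + (a + (i + 1) + 1) * m ≤ ρ + m := by linarith
    -- comparison of the norms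
    set lo := B.pn (b := s₀) m (s₀ + (a + (i + 1) + 1) * m) (i + 1) with hlo
    set hi := B.pn (b := s₀) m (ρ + m) (i + 1) with hhi
    have c1 : ∀ {x : ℕ → X s₀}, B.JMem m (ρ + m) (i + 1) x →
        B.pn m (s₀ + (a + (i + 1) + 1) * m) i x ≤ lo x := fun hx =>
      pn_mono (hx.mono le_rfl hlohi hlow hm) (by omega) le_rfl hloi hm
    have c2 : ∀ {x : ℕ → X s₀}, B.JMem m (ρ + m) (i + 1) x → B.pn m (ρ + m) i x ≤ hi x :=
      fun hx => pn_mono hx (by omega) le_rfl hiρ' hm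
    have c3 : ∀ {x : ℕ → X s₀}, B.JMem m (ρ + m) (i + 1) x →
        B.pn m (s₀ + (a + i + 1) * m) i x ≤ lo x := fun hx =>
      pn_mono (hx.mono le_rfl hlohi hlow hm) (by omega) (by linarith) hloi' hm
    have c4 : ∀ {x : ℕ → X s₀}, B.JMem m (ρ + m) (i + 1) x → B.pn m ρ i x ≤ hi x :=
      fun hx => pn_mono hx (by omega) (by linarith) hiρ hm
    have c5 : ∀ {x : ℕ → X s₀}, B.pn m (s₀ + (a + i + 1) * m) i (shift x) ≤ lo x := by
      intro x
      have := pn_shift_le (B := B) (m := m) (r := s₀ + (a + (i + 1) + 1) * m) (j := i) (x := x)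
      convert this using 2
      ring
    have c6 : ∀ {x : ℕ → X s₀}, B.pn m ρ i (shift x) ≤ hi x := by
      intro x
      have := pn_shift_le (B := B) (m := m) (r := ρ + m) (j := i) (x := x)
      convert this using 2
      ring
    have d1 : ∀ {x : ℕ → X s₀}, B.JMem m (ρ + m) (i + 1) x → B.JMem m (ρ + m) i x :=
      fun hx => hx.mono (by omega) le_rfl hiρ' hm
    have d2 : ∀ {x : ℕ → X s₀}, B.JMem m (ρ + m) (i + 1) x → B.JMem m ρ i x :=
      fun hx => hx.mono (by omega) (by linarith) hiρ hm
    have d3 : ∀ {x : ℕ → X s₀}, B.JMem m (ρ + m) (i + 1) x → B.JMem m ρ i (shift x) :=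
      fun hx => by have := hx.shift; rwa [show ρ + m - m = ρ by ring] at this
    have nn : ∀ r i (x : ℕ → X s₀), 0 ≤ B.pn m r i x := fun r i x => pn_nonneg m r i x
    obtain ⟨m₁, b₁⟩ := h₁ ε hε t ht u w (d1 hu) (fun l => d1 (hw l))
    obtain ⟨m₂, b₂⟩ := h₂ ε hε t ht u (Fin.snoc w (shift u)) (d2 hu) (fun l => by
      refine Fin.lastCases ?_ (fun l => ?_) l
      · simpa using d3 hu
      · simpa using d2 (hw l))
    have h₃' := fun l => h₃ ε hε t ht u (Function.update w l (shift (w l))) (d2 hu) (fun q => by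
      by_cases hq : q = l
      · subst hq; simpa using d3 (hw q)
      · simpa [hq] using d2 (hw q))
    rw [jet_succ]
    refine ⟨(m₁.add m₂).add (mem_sum (by linarith) fun l _ => (h₃' l).1), ?_⟩
    set tm := tameSum (hi u) (fun l => lo (w l)) (fun l => hi (w l)) with htm
    have htm0 : 0 ≤ tm := tameSum_nonneg (nn _ _ _) (fun l => nn _ _ _) (fun l => nn _ _ _)
    have hprod : hi u * ∏ l, lo (w l) ≤ tm := by
      rw [htm, tameSum]
      exact le_add_of_nonneg_left (Finset.sum_nonneg fun k _ =>
        mul_nonneg (nn _ _ _) (Finset.prod_nonneg fun l _ => nn _ _ _))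
    have B₁ : B.nrm (ρ - (a + (i + 1)) * m) (B.jet hm T s₀ ε (F ε) i (a + 1) j t u w) ≤
        K₁ (lo u) * tm := b₁.trans (mul_le_mul (hK₁ (c1 hu)) (tameSum_mono (nn _ _ _)
          (fun _ => nn _ _ _) (fun _ => nn _ _ _) (c2 hu) (fun l => c1 (hw l))
          (fun l => c2 (hw l))) (tameSum_nonneg (nn _ _ _) (fun l => nn _ _ _)
          (fun l => nn _ _ _)) (hK₁0 _))
    have B₂ : B.nrm (ρ - (a + (i + 1)) * m) (B.jet hm T s₀ ε (F ε) i a (j + 1) t u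
        (Fin.snoc w (shift u))) ≤ K₂ (lo u) * (max (lo u) 0 + 1) * tm := by
      refine b₂.trans ?_
      have : tameSum (B.pn m ρ i u) (fun l => B.pn m (s₀ + (a + i + 1) * m) i
          ((Fin.snoc w (shift u) : Fin (j + 1) → ℕ → X s₀) l)) (fun l => B.pn m ρ i
          ((Fin.snoc w (shift u) : Fin (j + 1) → ℕ → X s₀) l)) ≤
          tameSum (hi u) (Fin.snoc (fun l => lo (w l)) (lo u) : Fin (j + 1) → ℝ)
            (Fin.snoc (fun l => hi (w l)) (hi u) : Fin (j + 1) → ℝ) := by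
        refine tameSum_mono (nn _ _ _) (fun _ => nn _ _ _) (fun _ => nn _ _ _) (c4 hu)
          (fun l => ?_) (fun l => ?_)
        · refine Fin.lastCases ?_ (fun l => ?_) l
          · simpa using c5
          · simpa using c3 (hw l)
        · refine Fin.lastCases ?_ (fun l => ?_) l
          · simpa using c6
          · simpa using c4 (hw l)
      rw [tameSum_snoc] at this
      rw [mul_assoc]
      refine mul_le_mul (hK₂ (c3 hu)) (this.trans ?_) (tameSum_nonneg (nn _ _ _)
        (fun l => nn _ _ _) (fun l => nn _ _ _)) (hK₂0 _)
      rw [max_eq_left (nn _ _ _)]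
      linarith
    have B₃ : ∀ l, B.nrm (ρ - (a + (i + 1)) * m) (B.jet hm T s₀ ε (F ε) i a j t u
        (Function.update w l (shift (w l)))) ≤ K₃ (lo u) * tm := fun l => by
      refine (h₃' l).2.trans (mul_le_mul (hK₃ (c3 hu)) (tameSum_mono (nn _ _ _)
          (fun _ => nn _ _ _) (fun _ => nn _ _ _) (c4 hu) (fun q => ?_)
          (fun q => ?_)) (tameSum_nonneg (nn _ _ _) (fun l => nn _ _ _)
          (fun l => nn _ _ _)) (hK₃0 _))
      · by_cases hq : q = l
        · subst hq; simpa using c5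
        · simpa [hq] using c3 (hw q)
      · by_cases hq : q = l
        · subst hq; simpa using c6
        · simpa [hq] using c4 (hw q)
    have B₄ := (nrm_sum_le (B := B) (ρ - (a + (i + 1)) * m) Finset.univ (fun l =>
      B.jet hm T s₀ ε (F ε) i a j t u (Function.update w l (shift (w l))))).trans
      (Finset.sum_le_card_nsmul _ _ _ fun l _ => B₃ l)
    simp only [Finset.card_univ, Fintype.card_fin, nsmul_eq_mul] at B₄
    refine (nrm_add_le _ _ _).trans ((add_le_add ((nrm_add_le _ _ _).trans
      (add_le_add B₁ B₂)) B₄).trans (le_of_eq (by ring)))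

end BanachScale

/-! ### Curves of jets: continuity and derivatives of the jet expressions. -/

namespace BanachScale

variable {X : ℝ → Type*} [∀ s, NormedAddCommGroup (X s)] [∀ s, NormedSpace ℝ (X s)]

/-- The curve of jets `u` of order `j` is continuous with values in `∏ₖ X (r - k m)`. -/
def JLC (B : BanachScale X) {b : ℝ} (m r τ : ℝ) (j : ℕ) (u : ℝ → ℕ → X b) : Prop :=
  ∀ k ≤ j, B.LC (r - k * m) τ (fun t => u t k)

/-- The components of the curve of jets `u` of order `j` are the derivatives `(ε ∂_t)^k` of the
first one. -/
def IsJet {b : ℝ} (τ ε : ℝ) (j : ℕ) (u : ℝ → ℕ → X b) : Prop :=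
  ∀ k < j, ∀ t ∈ Icc 0 τ, HasDerivWithinAt (fun t => u t k) (ε⁻¹ • u t (k + 1)) (Icc 0 τ) t

section JLC

variable {B : BanachScale X} {b m r r' τ τ' ε : ℝ} {i j : ℕ} {u v : ℝ → ℕ → X b}

theorem JLC.jmem (h : B.JLC m r τ j u) {t : ℝ} (ht : t ∈ Icc 0 τ) : B.JMem m r j (u t) :=
  fun k hk => (h k hk).1 t ht

theorem JLC.mono (h : B.JLC m r τ j u) (hij : i ≤ j) (hr : r' ≤ r) (hb : b ≤ r' - i * m)
    (hm : 0 ≤ m) : B.JLC m r' τ i u := fun k hk =>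
  (h k (hk.trans hij)).mono
    (hb.trans (by have : (k : ℝ) * m ≤ i * m := by gcongr
                  linarith)) (by linarith)

theorem JLC.mono_set (h : B.JLC m r τ j u) (h' : τ' ≤ τ) : B.JLC m r τ' j u :=
  fun k hk => (h k hk).mono_set h'

theorem JLC.shift (h : B.JLC m r τ (j + 1) u) : B.JLC m (r - m) τ j (fun t => shift (u t)) :=
  fun k hk => by
    rw [show r - m - k * m = r - ((k + 1 : ℕ) : ℝ) * m by push_cast; ring]
    exact h (k + 1) (by omega)

theorem JLC.add (hu : B.JLC m r τ j u) (hv : B.JLC m r τ j v) : B.JLC m r τ j (u + v) :=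
  fun k hk => (hu k hk).add (hv k hk)

theorem JLC.sub (hu : B.JLC m r τ j u) (hv : B.JLC m r τ j v) : B.JLC m r τ j (u - v) :=
  fun k hk => (hu k hk).sub (hv k hk)

theorem JLC.smul (hu : B.JLC m r τ j u) (c : ℝ) : B.JLC m r τ j (c • u) :=
  fun k hk => (hu k hk).smul c

theorem IsJet.mono (h : IsJet τ ε j u) (hij : i ≤ j) : IsJet τ ε i u :=
  fun k hk => h k (by omega)

theorem IsJet.mono_set (h : IsJet τ ε j u) (h' : τ' ≤ τ) : IsJet τ' ε j u :=
  fun k hk t ht => (h k hk t ⟨ht.1, ht.2.trans h'⟩).mono (Icc_subset_Icc le_rfl h')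

theorem IsJet.shift (h : IsJet τ ε (j + 1) u) : IsJet τ ε j (fun t => shift (u t)) :=
  fun k hk => h (k + 1) (by omega)

theorem IsJet.add (hu : IsJet τ ε j u) (hv : IsJet τ ε j v) : IsJet τ ε j (u + v) :=
  fun k hk t ht =>
    ((hu k hk t ht).fun_add (hv k hk t ht)).congr_deriv (smul_add _ _ _).symm

theorem IsJet.sub (hu : IsJet τ ε j u) (hv : IsJet τ ε j v) : IsJet τ ε j (u - v) :=
  fun k hk t ht =>
    ((hu k hk t ht).fun_sub (hv k hk t ht)).congr_deriv (smul_sub _ _ _).symm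

theorem IsJet.smul (hu : IsJet τ ε j u) (c : ℝ) : IsJet τ ε j (c • u) :=
  fun k hk t ht =>
    ((hu k hk t ht).fun_const_smul c).congr_deriv (smul_comm _ _ _)

end JLC

variable {B : BanachScale X} {ε₀ T s₀ m : ℝ} {hm : 0 ≤ m} {p : ℕ}
  {F : ℝ → ℝ → ∀ s, X (s + m) → X s}

theorem AssumptionF.lc_jet (hF : B.AssumptionF ε₀ T s₀ hm p F) (hT : 0 < T) (i : ℕ) {ε : ℝ}
    (hε : ε ∈ Ioo 0 ε₀) {τ : ℝ} {θ : ℝ → ℝ} (hθ : ContinuousOn θ (Icc 0 τ))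
    (hθT : MapsTo θ (Icc 0 τ) (Icc 0 T)) {u : ℝ → ℕ → X s₀} :
    ∀ {a j : ℕ}, a + i ≤ p → a + i + j ≤ p + 2 → ∀ {ρ : ℝ}, s₀ + (a + i) * m ≤ ρ →
    ∀ {w : Fin j → ℝ → ℕ → X s₀}, B.JLC m (ρ + m) τ i u → (∀ l, B.JLC m (ρ + m) τ i (w l)) →
    B.LC (ρ - (a + i) * m) τ
      (fun z => B.jet hm T s₀ ε (F ε) i a j (θ z) (u z) (fun l => w l z)) := by
  induction i with
  | zero =>
    intro a j ha haj ρ hρ w hu hw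
    simp only [Nat.cast_zero, add_zero] at hρ ⊢
    exact hF.lc_jetF hT (by omega) (by omega) hρ hε hθ hθT (x := fun z => u z 0)
      (w := fun l z => w l z 0) (by simpa using hu 0 le_rfl)
      (fun l => by simpa using hw l 0 le_rfl)
  | succ i ih =>
    intro a j ha haj ρ hρ w hu hw
    have hc : (((i + 1 : ℕ)) : ℝ) = i + 1 := by push_cast; ring
    have hca : (((a + 1 : ℕ)) : ℝ) = a + 1 := by push_cast; ring
    rw [hc] at hρ ⊢
    have e0 : ρ - m + m = ρ := by ring
    have e1 : (a : ℝ) + 1 + i = a + (i + 1) := by ring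
    have e2 : ρ - m - (a + i) * m = ρ - (a + (i + 1)) * m := by ring
    have him : 0 ≤ (i : ℝ) * m := by positivity
    have ham : 0 ≤ (a : ℝ) * m := by positivity
    have hiρ : s₀ ≤ ρ - i * m := by linarith
    have hiρ' : s₀ ≤ ρ + m - i * m := by linarith
    have h₁ := @ih (a + 1) j (by omega) (by omega) ρ (by rw [hca]; linarith) w
      (hu.mono (by omega) le_rfl hiρ' hm) (fun l => (hw l).mono (by omega) le_rfl hiρ' hm)
    have d3 : ∀ {x : ℝ → ℕ → X s₀}, B.JLC m (ρ + m) τ (i + 1) x →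
        B.JLC m ρ τ i (fun z => BanachScale.shift (x z)) := fun hx => by
      have := hx.shift; rwa [show ρ + m - m = ρ by ring] at this
    have d2 : ∀ {x : ℝ → ℕ → X s₀}, B.JLC m (ρ + m) τ (i + 1) x → B.JLC m ρ τ i x :=
      fun hx => hx.mono (by omega) (by linarith) hiρ hm
    have h₂ := @ih a (j + 1) (by omega) (by omega) (ρ - m) (by linarith)
      (Fin.snoc w (fun z => BanachScale.shift (u z))) (by rw [e0]; exact d2 hu) (fun l => by
        rw [e0]
        refine Fin.lastCases ?_ (fun l => ?_) l
        · simpa using d3 hu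
        · simpa using d2 (hw l))
    have h₃ := fun l => @ih a j (by omega) (by omega) (ρ - m) (by linarith)
      (Function.update w l (fun z => BanachScale.shift (w l z))) (by rw [e0]; exact d2 hu)
      (fun q => by
        rw [e0]
        by_cases hq : q = l
        · subst hq; simpa using d3 (hw q)
        · simpa [hq] using d2 (hw q))
    rw [hca, e1] at h₁
    rw [e2] at h₂
    simp only [e2] at h₃
    refine ((h₁.add h₂).add (lc_sum (by linarith) fun l (_ : l ∈ Finset.univ) => h₃ l)).congr
      fun z hz => ?_
    rw [jet_succ]
    congr 1
    · congr 2
      funext l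
      refine Fin.lastCases ?_ (fun l => ?_) l <;> simp
    · refine Finset.sum_congr rfl fun l _ => ?_
      congr 1
      funext q
      by_cases hq : q = l
      · subst hq; simp
      · simp [hq]

/-- Needed because time differentiation appends `shift u` and differentiation with respect to `u`
appends the increment `v`: the two operations fill the last two slots in opposite orders. -/
theorem AssumptionF.jet_snoc_snoc_comm (hF : B.AssumptionF ε₀ T s₀ hm p F) {i a j : ℕ}
    (ha : a + i ≤ p) (haj : a + i + j + 2 ≤ p + 2) {ε : ℝ} (hε : ε ∈ Ioo 0 ε₀) {t : ℝ}
    (ht : t ∈ Icc 0 T) (u x y : ℕ → X s₀) (w : Fin j → ℕ → X s₀) :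
    B.jet hm T s₀ ε (F ε) i a (j + 2) t u
      (Fin.snoc (Fin.snoc w x : Fin (j + 1) → ℕ → X s₀) y : Fin (j + 2) → ℕ → X s₀) =
    B.jet hm T s₀ ε (F ε) i a (j + 2) t u
      (Fin.snoc (Fin.snoc w y : Fin (j + 1) → ℕ → X s₀) x : Fin (j + 2) → ℕ → X s₀) := by
  rw [← hF.jet_comp_perm ha (by omega) hε ht u _
    (Equiv.swap (Fin.last (j + 1)) (Fin.castSucc (Fin.last j)))]
  congr 1
  funext k
  refine Fin.lastCases ?_ (fun k => Fin.lastCases ?_ (fun k => ?_) k) k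
  · simp
  · simp
  · rw [Function.comp_apply, Equiv.swap_apply_of_ne_of_ne (by simp [Fin.ext_iff]; omega)
      (by simp [Fin.ext_iff]; omega)]
    simp

/-- The derivative of the jets with respect to the jet of `u`. -/
theorem AssumptionF.hasDerivAt_jet (hF : B.AssumptionF ε₀ T s₀ hm p F) (i : ℕ) {ε : ℝ}
    (hε : ε ∈ Ioo 0 ε₀) {t : ℝ} (ht : t ∈ Icc 0 T) (u v : ℕ → X s₀) :
    ∀ {a j : ℕ}, a + i ≤ p → a + i + j + 1 ≤ p + 2 → ∀ (w : Fin j → ℕ → X s₀) (z : ℝ),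
    HasDerivAt (fun z : ℝ => B.jet hm T s₀ ε (F ε) i a j t (u + z • v) w)
      (B.jet hm T s₀ ε (F ε) i a (j + 1) t (u + z • v)
        (Fin.snoc w v : Fin (j + 1) → ℕ → X s₀)) z := by
  induction i with
  | zero =>
    intro a j ha haj w z
    have hx : HasDerivWithinAt (fun z : ℝ => B.up s₀ (s₀ + a * m + m) (u 0 + z • v 0))
        (B.up s₀ (s₀ + a * m + m) (v 0)) univ z := by
      simp only [map_add, map_smul]
      simpa using ((hasDerivWithinAt_id z univ).smul_const
        (B.up s₀ (s₀ + a * m + m) (v 0))).const_add (B.up s₀ (s₀ + a * m + m) (u 0))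
    have := hF.hasDerivWithinAt_jetF (a := a) (j := j) (by omega) (by omega) hε ht
      (w := fun l _ => w l 0) (w' := 0) hx (fun l => by
        simpa using hasDerivWithinAt_const (𝕜 := ℝ) z univ (B.up s₀ (s₀ + a * m + m) (w l 0)))
    rw [hasDerivWithinAt_univ] at this
    refine this.congr_deriv ?_
    rw [hF.jetF_cons_eq_snoc (by omega) (by omega) hε ht]
    simp only [Pi.zero_apply, MultilinearMap.map_update_zero, Finset.sum_const_zero, add_zero,
      jet_zero]
    congr 1
    funext l
    refine Fin.lastCases ?_ (fun l => ?_) l <;> simp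
  | succ i ih =>
    intro a j ha haj w z
    simp only [jet_succ]
    -- The appended direction depends on `z` too. It is affine in `z`, so the product rule applies
    -- once this dependence is pulled out by linearity.
    have hlin : ∀ (z : ℝ) (U : ℕ → X s₀), B.jet hm T s₀ ε (F ε) i a (j + 1) t U
        (Fin.snoc w (shift (u + z • v)) : Fin (j + 1) → ℕ → X s₀) =
        B.jet hm T s₀ ε (F ε) i a (j + 1) t U (Fin.snoc w (shift u)) +
          z • B.jet hm T s₀ ε (F ε) i a (j + 1) t U (Fin.snoc w (shift v)) := by
      intro z U
      have := jet_update_linear (B := B) (hm := hm) (T := T) (F := F) ε (i := i) (a := a) (t := t)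
        (u := U) (Fin.snoc w (shift u) : Fin (j + 1) → ℕ → X s₀) (Fin.last j) 1 z (shift u)
        (shift v)
      simp only [Fin.update_snoc_last, one_smul] at this
      exact this
    have h₁ := @ih (a + 1) j (by omega) (by omega) w z
    have h₂ := (@ih a (j + 1) (by omega) (by omega) (Fin.snoc w (shift u)) z).add
      ((hasDerivAt_id z).smul (@ih a (j + 1) (by omega) (by omega) (Fin.snoc w (shift v)) z))
    have h₃ := HasDerivAt.fun_sum (u := Finset.univ) fun l _ => @ih a j (by omega) (by omega)
      (Function.update w l (shift (w l))) z
    simp only [hlin]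
    refine ((h₁.add h₂).add h₃).congr_deriv ?_
    rw [Fin.sum_univ_castSucc]
    simp only [Fin.snoc_castSucc, Fin.snoc_last, Fin.update_snoc_last, ← Fin.snoc_update, id]
    have e1 := hF.jet_snoc_snoc_comm (i := i) (a := a) (by omega) (by omega) hε ht (u + z • v) v
      (shift u + z • shift v) w
    have := jet_update_linear (B := B) (hm := hm) (T := T) (F := F) ε (i := i) (a := a) (t := t)
        (u := u + z • v) (Fin.snoc (Fin.snoc w (shift u) : Fin (j + 1) → ℕ → X s₀) v :
          Fin (j + 2) → ℕ → X s₀) (Fin.castSucc (Fin.last j)) 1 z (shift u) (shift v)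
    simp only [← Fin.snoc_update, Fin.update_snoc_last, one_smul] at this
    have e2 : shift (u + z • v) = shift u + z • shift v := rfl
    rw [e2, e1, this, one_smul]
    abel

/-- The derivative of the jets in time. -/
theorem AssumptionF.hasDerivWithinAt_jet [∀ s, CompleteSpace (X s)]
    (hF : B.AssumptionF ε₀ T s₀ hm p F) (hT : 0 < T) (i : ℕ) {ε : ℝ}
    (hε : ε ∈ Ioo 0 ε₀) {τ : ℝ} (hτ : τ ≤ T) :
    ∀ {a j : ℕ}, a + i + 1 ≤ p → a + i + 1 + j ≤ p + 2 → ∀ {r : ℝ}, s₀ + (a + i + 1) * m + m ≤ r →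
    ∀ {u : ℝ → ℕ → X s₀} {w : Fin j → ℝ → ℕ → X s₀}, B.JLC m r τ (i + 1) u →
    (∀ l, B.JLC m r τ (i + 1) (w l)) → IsJet τ ε (i + 1) u → (∀ l, IsJet τ ε (i + 1) (w l)) →
    ∀ {t : ℝ}, t ∈ Icc 0 τ →
    HasDerivWithinAt (fun t => B.jet hm T s₀ ε (F ε) i a j t (u t) (fun l => w l t))
      (ε⁻¹ • B.jet hm T s₀ ε (F ε) (i + 1) a j t (u t) (fun l => w l t)) (Icc 0 τ) t := by
  induction i with
  | zero =>
    intro a j ha haj r hr u w hu hw hdu hdw t ht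
    simp only [Nat.cast_zero, add_zero, zero_add] at *
    have hs : ∀ {x : ℝ → ℕ → X s₀}, B.JLC m r τ 1 x → B.LC r τ (fun t => x t 0) := fun hx => by
      simpa using hx 0 (by omega)
    have hs1 : ∀ {x : ℝ → ℕ → X s₀}, B.JLC m r τ 1 x → B.LC (r - m) τ (fun t => x t 1) :=
      fun hx => by simpa using hx 1 (by omega)
    have := hF.hasDerivWithinAt_jetF_time hT ha haj hε hτ hr (hs hu) (fun l => hs (hw l)) (hs1 hu)
      (fun l => hs1 (hw l)) (hdu 0 (by omega)) (fun l => hdw l 0 (by omega)) ht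
    refine this.congr_deriv ?_
    rw [jet_succ]
    congr 2
    · congr 1
      rw [jet_zero]
      congr 1
      funext l
      refine Fin.lastCases ?_ (fun l => ?_) l <;> simp [shift]
    · refine Finset.sum_congr rfl fun l _ => ?_
      rw [jet_zero]
      congr 1
      funext q
      by_cases hq : q = l
      · subst hq; simp [shift]
      · simp [hq]
  | succ i ih =>
    intro a j ha haj r hr u w hu hw hdu hdw t ht
    have hc : (((i + 1 : ℕ)) : ℝ) = i + 1 := by push_cast; ring
    have hca : (((a + 1 : ℕ)) : ℝ) = a + 1 := by push_cast; ring
    rw [hc] at hr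
    have him : 0 ≤ (i : ℝ) * m := by positivity
    have ham : 0 ≤ (a : ℝ) * m := by positivity
    have hir : s₀ ≤ r - ((i + 1 : ℕ) : ℝ) * m := by rw [hc]; nlinarith
    have hir' : s₀ ≤ r - m - ((i + 1 : ℕ) : ℝ) * m := by rw [hc]; nlinarith
    have d1 : ∀ {x : ℝ → ℕ → X s₀}, B.JLC m r τ (i + 2) x → B.JLC m r τ (i + 1) x :=
      fun hx => hx.mono (by omega) le_rfl hir hm
    have d2 : ∀ {x : ℝ → ℕ → X s₀}, B.JLC m r τ (i + 2) x → B.JLC m (r - m) τ (i + 1) x :=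
      fun hx => hx.mono (by omega) (by linarith) hir' hm
    have h₁ := @ih (a + 1) j (by omega) (by omega) r (by rw [hca]; linarith) u w (d1 hu)
      (fun l => d1 (hw l)) (hdu.mono (by omega)) (fun l => (hdw l).mono (by omega)) t ht
    have h₂ := @ih a (j + 1) (by omega) (by omega) (r - m) (by linarith) u
      (Fin.snoc w (fun z => BanachScale.shift (u z))) (d2 hu) (fun l => by
        refine Fin.lastCases ?_ (fun l => ?_) l
        · simpa using hu.shift
        · simpa using d2 (hw l)) (hdu.mono (by omega)) (fun l => by
        refine Fin.lastCases ?_ (fun l => ?_) l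
        · simpa using hdu.shift
        · simpa using (hdw l).mono (by omega)) t ht
    have h₃ := HasDerivWithinAt.fun_sum (u := Finset.univ) fun l _ =>
      @ih a j (by omega) (by omega) (r - m) (by linarith) u
      (Function.update w l (fun z => BanachScale.shift (w l z))) (d2 hu)
      (fun q => by
        by_cases hq : q = l
        · subst hq; simpa using (hw q).shift
        · simpa [hq] using d2 (hw q)) (hdu.mono (by omega))
      (fun q => by
        by_cases hq : q = l
        · subst hq; simpa using (hdw q).shift
        · simpa [hq] using (hdw q).mono (by omega)) t ht
    have e1 : ∀ t, (fun l => (Fin.snoc w (fun z => BanachScale.shift (u z)) :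
        Fin (j + 1) → ℝ → ℕ → X s₀) l t) =
        (Fin.snoc (fun l => w l t) (BanachScale.shift (u t)) : Fin (j + 1) → ℕ → X s₀) := by
      intro t
      funext l
      refine Fin.lastCases ?_ (fun l => ?_) l <;> simp
    have e2 : ∀ t l, (fun q => Function.update w l (fun z => BanachScale.shift (w l z)) q t) =
        Function.update (fun l => w l t) l (BanachScale.shift (w l t)) := by
      intro t l
      funext q
      by_cases hq : q = l
      · subst hq; simp
      · simp [hq]
    simp only [e1] at h₂
    simp only [e2] at h₃
    refine ((h₁.add h₂).add h₃).congr_deriv ?_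
    rw [jet_succ ε (i + 1), smul_add, smul_add, Finset.smul_sum]

end BanachScale

/-! ### Tame estimates of `F`, of `F_u` and of their Taylor remainders, order by order. -/

namespace BanachScale

variable {X : ℝ → Type*} [∀ s, NormedAddCommGroup (X s)] [∀ s, NormedSpace ℝ (X s)]
variable {B : BanachScale X} {ε₀ T s₀ m : ℝ} {hm : 0 ≤ m} {p : ℕ}
  {F : ℝ → ℝ → ∀ s, X (s + m) → X s}

/-- The derivative is known only in `X b`; the continuity of `g'` in `X r` makes it a derivative in
`X r`, where the mean value inequality is applied. -/
theorem nrm_sub_le_of_hasDerivAt [∀ s, CompleteSpace (X s)] {b r C : ℝ} (hb : b ≤ r)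
    {g g' : ℝ → X b} (hg : B.LC r 1 g) (hg' : B.LC r 1 g') (hd : ∀ z, HasDerivAt g (g' z) z)
    (hC : ∀ z ∈ Icc (0 : ℝ) 1, B.nrm r (g' z) ≤ C) : B.nrm r (g 1 - g 0) ≤ C := by
  have h1 := norm_image_sub_le_of_norm_deriv_le_segment_01'
    (fun z hz => LC.hasDerivWithinAt_up hb hg hg' (fun t _ => (hd t).hasDerivWithinAt) hz)
    (fun z hz => hC z ⟨hz.1, hz.2.le⟩)
  rwa [← map_sub] at h1

theorem jlc_line {b r τ : ℝ} {k : ℕ} {u v : ℕ → X b} (hu : B.JMem m r k u)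
    (hv : B.JMem m r k v) : B.JLC m r τ k (fun z : ℝ => u + z • v) := fun i hi =>
  ⟨fun z _ => (hu i hi).add ((hv i hi).smul z), by
    simp only [Pi.add_apply, Pi.smul_apply, map_add, map_smul]
    fun_prop⟩

theorem pn_line_le {b r z : ℝ} {k : ℕ} {u v : ℕ → X b} (hz : z ∈ Icc (0 : ℝ) 1) :
    B.pn m r k (u + z • v) ≤ B.pn m r k u + B.pn m r k v := by
  refine pn_add_le.trans (add_le_add le_rfl ?_)
  rw [pn_smul, abs_of_nonneg hz.1]
  exact mul_le_of_le_one_left (pn_nonneg _ _ _ _) hz.2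

/-- `(ε ∂_t)^k F[t, u]` in terms of the jet of `u`. -/
noncomputable def jetN (B : BanachScale X) {m : ℝ} (hm : 0 ≤ m) (T s₀ ε : ℝ)
    (F : ℝ → ∀ s, X (s + m) → X s) (k : ℕ) (t : ℝ) (u : ℕ → X s₀) : X s₀ :=
  B.jet hm T s₀ ε F k 0 0 t u Fin.elim0

/-- `(ε ∂_t)^k F_u[t, u] v` in terms of the jets of `u` and `v`. -/
noncomputable def jetD (B : BanachScale X) {m : ℝ} (hm : 0 ≤ m) (T s₀ ε : ℝ)
    (F : ℝ → ∀ s, X (s + m) → X s) (k : ℕ) (t : ℝ) (u v : ℕ → X s₀) : X s₀ :=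
  B.jet hm T s₀ ε F k 0 1 t u (fun _ => v)

theorem snoc_elim0 {V : Type*} (v : V) :
    (Fin.snoc (Fin.elim0 : Fin 0 → V) v : Fin 1 → V) = fun _ => v := by
  funext l
  refine Fin.lastCases ?_ (fun l => ?_) l
  · rw [Fin.snoc_last]
  · exact l.elim0

section Bounds

variable {s r : ℝ} {k : ℕ}

/-- The case `a = j = 0` of `AssumptionF.jet_bound`, where the tame sum reduces to the high norm of
`u`. Bounding the low norm by `M` turns the monotone function into a constant. -/
theorem AssumptionF.jetN_bound (hF : B.AssumptionF ε₀ T s₀ hm p F) (hT : 0 < T) (hk : k ≤ p)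
    (hs : s₀ + (k + 1) * m ≤ s) (hsr : s ≤ r) (M : ℝ) :
    ∃ K, 0 ≤ K ∧ ∀ ε ∈ Ioo 0 ε₀, ∀ t ∈ Icc 0 T, ∀ u : ℕ → X s₀, B.JMem m r k u →
      B.pn m s k u ≤ M → B.Mem (r - (k + 1) * m) (B.jetN hm T s₀ ε (F ε) k t u) ∧
      B.nrm (r - (k + 1) * m) (B.jetN hm T s₀ ε (F ε) k t u) ≤ K * B.pn m r k u := by
  obtain ⟨K, hK, hK0, h⟩ := hF.jet_bound hT k (a := 0) (j := 0) (by omega) (by omega)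
    (ρ := r - m) (by push_cast; linarith)
  refine ⟨K M, hK0 _, fun ε hε t ht u hu huM => ?_⟩
  have := h ε hε t ht u Fin.elim0 (by simpa using hu) (fun l => l.elim0)
  rw [show r - m - ((0 : ℕ) + k) * m = r - (k + 1) * m by push_cast; ring, sub_add_cancel] at this
  refine ⟨this.1, this.2.trans ?_⟩
  have hus : B.pn m (s₀ + ((0 : ℕ) + k + 1) * m) k u ≤ M :=
    (pn_mono (hu.mono le_rfl hsr (by linarith) hm) le_rfl (by push_cast; linarith)
      (by push_cast; linarith) hm).trans huM
  simp only [tameSum, Finset.univ_eq_empty, Finset.sum_empty, Finset.prod_empty, mul_one, zero_add]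
  exact mul_le_mul_of_nonneg_right (hK hus) (pn_nonneg _ _ _ _)

theorem AssumptionF.jetD_bound (hF : B.AssumptionF ε₀ T s₀ hm p F) (hT : 0 < T) (hk : k ≤ p)
    (hs : s₀ + (k + 1) * m ≤ s) (hsr : s ≤ r) (M : ℝ) :
    ∃ K, 0 ≤ K ∧ ∀ ε ∈ Ioo 0 ε₀, ∀ t ∈ Icc 0 T, ∀ u v : ℕ → X s₀, B.JMem m r k u →
      B.JMem m r k v → B.pn m s k u ≤ M →
      B.Mem (r - (k + 1) * m) (B.jetD hm T s₀ ε (F ε) k t u v) ∧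
      B.nrm (r - (k + 1) * m) (B.jetD hm T s₀ ε (F ε) k t u v) ≤
        K * (B.pn m r k v + B.pn m r k u * B.pn m s k v) := by
  obtain ⟨K, hK, hK0, h⟩ := hF.jet_bound hT k (a := 0) (j := 1) (by omega) (by omega)
    (ρ := r - m) (by push_cast; linarith)
  refine ⟨K M, hK0 _, fun ε hε t ht u v hu hv huM => ?_⟩
  have := h ε hε t ht u (fun _ => v) (by simpa using hu) (fun l => by simpa using hv)
  rw [show r - m - ((0 : ℕ) + k) * m = r - (k + 1) * m by push_cast; ring, sub_add_cancel] at this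
  refine ⟨this.1, this.2.trans ?_⟩
  have hlo : ∀ {x : ℕ → X s₀}, B.JMem m r k x →
      B.pn m (s₀ + ((0 : ℕ) + k + 1) * m) k x ≤ B.pn m s k x := fun hx =>
    pn_mono (hx.mono le_rfl hsr (by linarith) hm) le_rfl (by push_cast; linarith)
      (by push_cast; linarith) hm
  refine mul_le_mul (hK ((hlo hu).trans huM)) ?_ (tameSum_nonneg (pn_nonneg _ _ _ _)
    (fun _ => pn_nonneg _ _ _ _) (fun _ => pn_nonneg _ _ _ _)) (hK0 _)
  refine (tameSum_mono (pn_nonneg _ _ _ _) (fun _ => pn_nonneg _ _ _ _)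
    (fun _ => pn_nonneg _ _ _ _) le_rfl (fun _ => hlo hv) (fun _ => le_rfl)).trans (le_of_eq ?_)
  simp [tameSum]

/-- The estimate of the variation of `F_u`. -/
theorem AssumptionF.jetD_sub_bound [∀ s, CompleteSpace (X s)]
    (hF : B.AssumptionF ε₀ T s₀ hm p F) (hT : 0 < T) (hk : k ≤ p)
    (hs : s₀ + (k + 1) * m ≤ s) (hsr : s ≤ r) (M : ℝ) :
    ∃ K, 0 ≤ K ∧ ∀ ε ∈ Ioo 0 ε₀, ∀ t ∈ Icc 0 T, ∀ u w v : ℕ → X s₀, B.JMem m r k u →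
      B.JMem m r k w → B.JMem m r k v → B.pn m s k u ≤ M → B.pn m s k w ≤ M →
      B.nrm (r - (k + 1) * m)
        (B.jetD hm T s₀ ε (F ε) k t (u + w) v - B.jetD hm T s₀ ε (F ε) k t u v) ≤
        K * (B.pn m r k v * B.pn m s k w + B.pn m r k w * B.pn m s k v +
          (B.pn m r k u + B.pn m r k w) * (B.pn m s k v * B.pn m s k w)) := by
  obtain ⟨K, hK, hK0, h⟩ := hF.jet_bound hT k (a := 0) (j := 2) (by omega) (by omega)
    (ρ := r - m) (by push_cast; linarith)
  refine ⟨K (M + M), hK0 _, fun ε hε t ht u w v hu hw hv huM hwM => ?_⟩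
  have e : r - m - ((0 : ℕ) + k) * m = r - (k + 1) * m := by push_cast; ring
  simp only [e, sub_add_cancel] at h
  have hlo : ∀ {x : ℕ → X s₀}, B.JMem m r k x →
      B.pn m (s₀ + ((0 : ℕ) + k + 1) * m) k x ≤ B.pn m s k x := fun hx =>
    pn_mono (hx.mono le_rfl hsr (by linarith) hm) le_rfl (by push_cast; linarith)
      (by push_cast; linarith) hm
  have hline := jlc_line (B := B) (τ := 1) hu hw
  have hconst : ∀ {x : ℕ → X s₀}, B.JMem m r k x → B.JLC m r 1 k (fun _ => x) :=
    fun hx i hi => lc_const (hx i hi)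
  have hmaps : MapsTo (fun _ : ℝ => t) (Icc (0 : ℝ) 1) (Icc 0 T) := fun _ _ => ht
  -- Along the segment from `u` to `u + w`, the derivative of `F_u v` is the second derivative in
  -- the directions `v` and `w`.
  have h1 := nrm_sub_le_of_hasDerivAt (B := B) (b := s₀) (r := r - (k + 1) * m)
    (C := K (M + M) * (B.pn m r k v * B.pn m s k w + B.pn m r k w * B.pn m s k v +
      (B.pn m r k u + B.pn m r k w) * (B.pn m s k v * B.pn m s k w))) (by linarith)
    (g := fun z => B.jetD hm T s₀ ε (F ε) k t (u + z • w) v)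
    (g' := fun z => B.jet hm T s₀ ε (F ε) k 0 2 t (u + z • w)
        (Fin.snoc (fun _ => v) w : Fin 2 → ℕ → X s₀))
    (by
      have := hF.lc_jet hT k hε (a := 0) (j := 1) (continuousOn_const (c := t)) hmaps (by omega)
        (by omega) (ρ := r - m) (by push_cast; linarith) (w := fun _ _ => v)
        (by simpa using hline) (fun _ => by simpa using hconst hv)
      rwa [e] at this)
    (by
      have := hF.lc_jet hT k hε (a := 0) (j := 2) (continuousOn_const (c := t)) hmaps (by omega)
        (by omega) (ρ := r - m) (by push_cast; linarith)
        (w := fun l _ => (Fin.snoc (fun _ => v) w : Fin 2 → ℕ → X s₀) l)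
        (by simpa using hline) (fun l => by
          rw [sub_add_cancel]
          refine Fin.lastCases ?_ (fun l => ?_) l
          · simpa only [Fin.snoc_last] using hconst hw
          · simpa only [Fin.snoc_castSucc] using hconst hv)
      rwa [e] at this)
    (fun z => hF.hasDerivAt_jet k hε ht u w (by omega) (by omega) _ z)
    (fun z hz => ?_)
  · simpa using h1
  · have hz' := hline.jmem hz
    refine (h ε hε t ht _ _ hz' (fun l => ?_)).2.trans ?_
    · refine Fin.lastCases ?_ (fun l => ?_) l
      · simpa only [Fin.snoc_last] using hw
      · simpa only [Fin.snoc_castSucc] using hv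
    refine mul_le_mul (hK ((hlo hz').trans ((pn_line_le hz).trans (add_le_add huM hwM)))) ?_
      (tameSum_nonneg (pn_nonneg _ _ _ _)
        (fun _ => pn_nonneg _ _ _ _) (fun _ => pn_nonneg _ _ _ _)) (hK0 _)
    refine (tameSum_mono (pn_nonneg _ _ _ _) (fun _ => pn_nonneg _ _ _ _)
      (fun _ => pn_nonneg _ _ _ _) (pn_line_le hz)
      (x' := (Fin.snoc (fun _ => B.pn m s k v) (B.pn m s k w) : Fin 2 → ℝ))
      (y' := (Fin.snoc (fun _ => B.pn m r k v) (B.pn m r k w) : Fin 2 → ℝ))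
      (fun l => ?_) (fun l => ?_)).trans (le_of_eq ?_)
    · refine Fin.lastCases ?_ (fun l => ?_) l
      · simpa only [Fin.snoc_last] using hlo hw
      · simpa only [Fin.snoc_castSucc] using hlo hv
    · refine Fin.lastCases ?_ (fun l => ?_) l
      · simp only [Fin.snoc_last, le_refl]
      · simp only [Fin.snoc_castSucc, le_refl]
    · rw [tameSum_snoc]
      simp [tameSum]
      ring

/-- The estimate of the quadratic remainder of `F`. -/
theorem AssumptionF.jetN_sub_bound [∀ s, CompleteSpace (X s)]
    (hF : B.AssumptionF ε₀ T s₀ hm p F) (hT : 0 < T) (hk : k ≤ p)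
    (hs : s₀ + (k + 1) * m ≤ s) (hsr : s ≤ r) (M : ℝ) :
    ∃ K, 0 ≤ K ∧ ∀ ε ∈ Ioo 0 ε₀, ∀ t ∈ Icc 0 T, ∀ u v : ℕ → X s₀, B.JMem m r k u →
      B.JMem m r k v → B.pn m s k u ≤ M → B.pn m s k v ≤ M →
      B.nrm (r - (k + 1) * m)
        (B.jetN hm T s₀ ε (F ε) k t (u + v) - B.jetN hm T s₀ ε (F ε) k t u -
          B.jetD hm T s₀ ε (F ε) k t u v) ≤
        K * (2 * B.pn m r k v * B.pn m s k v +
          (B.pn m r k u + B.pn m r k v) * B.pn m s k v ^ 2) := by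
  obtain ⟨K, hK0, h⟩ := hF.jetD_sub_bound hT hk hs hsr M
  refine ⟨K, hK0, fun ε hε t ht u v hu hv huM hvM => ?_⟩
  have e : r - m - ((0 : ℕ) + k) * m = r - (k + 1) * m := by push_cast; ring
  have hline := jlc_line (B := B) (τ := 1) hu hv
  have hconst : ∀ {x : ℕ → X s₀}, B.JMem m r k x → B.JLC m r 1 k (fun _ => x) :=
    fun hx i hi => lc_const (hx i hi)
  have hmaps : MapsTo (fun _ : ℝ => t) (Icc (0 : ℝ) 1) (Icc 0 T) := fun _ _ => ht
  have hD : ∀ {x : ℝ → ℕ → X s₀}, B.JLC m r 1 k x →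
      B.LC (r - (k + 1) * m) 1 (fun z => B.jetD hm T s₀ ε (F ε) k t (x z) v) := fun hx => by
    have := hF.lc_jet hT k hε (a := 0) (j := 1) (continuousOn_const (c := t)) hmaps (by omega)
      (by omega) (ρ := r - m) (by push_cast; linarith) (w := fun _ _ => v)
      (by simpa using hx) (fun _ => by simpa using hconst hv)
    rwa [e] at this
  have hN : B.LC (r - (k + 1) * m) 1 (fun z => B.jetN hm T s₀ ε (F ε) k t (u + z • v)) := by
    have := hF.lc_jet hT k hε (a := 0) (j := 0) (continuousOn_const (c := t)) hmaps (by omega)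
      (by omega) (ρ := r - m) (by push_cast; linarith) (w := Fin.elim0)
      (by simpa using hline) (fun l => l.elim0)
    rw [e] at this
    refine this.congr fun z _ => ?_
    simp only [jetN]
    congr 1
    funext l
    exact l.elim0
  -- Subtracting the linear term `z • F_u[t, u] v` makes the derivative in `z` a variation of `F_u`
  -- with increment `z • v`, to which `jetD_sub_bound` applies.
  have h1 := nrm_sub_le_of_hasDerivAt (B := B) (b := s₀) (r := r - (k + 1) * m)
    (C := K * (2 * B.pn m r k v * B.pn m s k v +
          (B.pn m r k u + B.pn m r k v) * B.pn m s k v ^ 2)) (by linarith)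
    (g := fun z => B.jetN hm T s₀ ε (F ε) k t (u + z • v) - z • B.jetD hm T s₀ ε (F ε) k t u v)
    (g' := fun z => B.jetD hm T s₀ ε (F ε) k t (u + z • v) v - B.jetD hm T s₀ ε (F ε) k t u v)
    (hN.sub ⟨fun z hz => ((hD (hconst hu)).1 z hz).smul z, by
      simp only [map_smul]; fun_prop⟩)
    ((hD hline).sub (hD (hconst hu)))
    (fun z => by
      have := hF.hasDerivAt_jet k hε ht u v (a := 0) (j := 0) (by omega) (by omega) Fin.elim0 z
      rw [snoc_elim0] at this
      exact (this.fun_sub ((hasDerivAt_id z).smul_const (B.jetD hm T s₀ ε (F ε) k t u v))).congr_deriv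
        (by rw [one_smul, jetD, jetD]))
    (fun z hz => ?_)
  · simpa [sub_right_comm] using h1
  · have hzle : ∀ ρ, B.pn m ρ k (z • v) ≤ B.pn m ρ k v := fun ρ => by
      rw [pn_smul, abs_of_nonneg hz.1]
      exact mul_le_of_le_one_left (pn_nonneg _ _ _ _) hz.2
    refine (h ε hε t ht u (z • v) v hu (hv.smul z) hv huM ((hzle s).trans hvM)).trans ?_
    refine mul_le_mul_of_nonneg_left ?_ hK0
    have a1 := hzle s
    have a2 := hzle r
    have b1 := pn_nonneg (B := B) m s k v
    have b2 := pn_nonneg (B := B) m r k v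
    have b3 := pn_nonneg (B := B) m r k u
    have b4 := pn_nonneg (B := B) m s k (z • v)
    have b5 := pn_nonneg (B := B) m r k (z • v)
    calc _ ≤ B.pn m r k v * B.pn m s k v + B.pn m r k v * B.pn m s k v +
          (B.pn m r k u + B.pn m r k v) * (B.pn m s k v * B.pn m s k v) := by gcongr
      _ = _ := by ring

end Bounds

end BanachScale

/-! ### Jets of the linear term. -/

theorem ContinuousLinearMap.iteratedDeriv_comp {H W : Type*} [NormedAddCommGroup H]
    [NormedSpace ℝ H] [NormedAddCommGroup W] [NormedSpace ℝ W] (κ : H →L[ℝ] W) {f : ℝ → H}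
    {l : ℕ} (hf : ContDiff ℝ l f) (t : ℝ) :
    iteratedDeriv l (fun τ => κ (f τ)) t = κ (iteratedDeriv l f t) := by
  simp only [iteratedDeriv]
  have := κ.iteratedFDeriv_comp_left (hf.contDiffAt (x := t)) le_rfl
  simp only [Function.comp_def] at this
  rw [this]
  rfl

namespace BanachScale

variable {X : ℝ → Type*} [∀ s, NormedAddCommGroup (X s)] [∀ s, NormedSpace ℝ (X s)]
variable {B : BanachScale X} {ε₀ T s₀ m : ℝ} {hm : 0 ≤ m} {p : ℕ}
  {L : ℝ → ℝ → ∀ s, X (s + m) →L[ℝ] X s}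

/-- `ε^a ∂_t^a L(t)` as a linear map on `X s₀`. -/
noncomputable def opL (B : BanachScale X) {m : ℝ} (s₀ ε : ℝ) (L : ℝ → ∀ s, X (s + m) →L[ℝ] X s)
    (a : ℕ) (t : ℝ) : X s₀ →ₗ[ℝ] X s₀ :=
  (ε ^ a • iteratedDeriv a (fun τ => L τ s₀) t : X (s₀ + m) →L[ℝ] X s₀).toLinearMap ∘ₗ
    B.up s₀ (s₀ + m)

theorem opL_apply (ε : ℝ) (a : ℕ) (t : ℝ) (x : X s₀) : B.opL s₀ ε (L ε) a t x =
    ε ^ a • iteratedDeriv a (fun τ => L ε τ s₀) t (B.up s₀ (s₀ + m) x) := rfl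

/-- The derivatives of `L` may be computed at any level. -/
theorem AssumptionL.opL_eq (hL : B.AssumptionL ε₀ T s₀ hm p L) {a : ℕ} (ha : a ≤ p) {ρ : ℝ}
    (hρ : s₀ ≤ ρ) {ε : ℝ} (hε : ε ∈ Ioo 0 ε₀) (t : ℝ) {x : X s₀} (hx : B.Mem (ρ + m) x) :
    B.opL s₀ ε (L ε) a t x =
      B.incl hρ ((ε ^ a • iteratedDeriv a (fun τ => L ε τ ρ) t) (B.up s₀ (ρ + m) x)) := by
  have h0 := ((hL.2.1 s₀ le_rfl).1 ε hε).of_le (m := a) (by exact_mod_cast ha)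
  have h1 := ((hL.2.1 ρ hρ).1 ε hε).of_le (m := a) (by exact_mod_cast ha)
  have e1 := ((ContinuousLinearMap.compL ℝ (X (ρ + m)) (X (s₀ + m)) (X s₀)).flip
    (B.incl (add_le_add_left hρ m))).iteratedDeriv_comp h0 t
  have e2 := (ContinuousLinearMap.compL ℝ (X (ρ + m)) (X ρ) (X s₀)
    (B.incl hρ)).iteratedDeriv_comp h1 t
  have e3 : (fun τ => (ContinuousLinearMap.compL ℝ (X (ρ + m)) (X (s₀ + m)) (X s₀)).flip
    (B.incl (add_le_add_left hρ m)) (L ε τ s₀)) = fun τ =>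
      ContinuousLinearMap.compL ℝ (X (ρ + m)) (X ρ) (X s₀) (B.incl hρ) (L ε τ ρ) := by
    funext τ
    ext y
    exact hL.1 ε hε τ s₀ ρ le_rfl hρ y
  rw [e3, e2] at e1
  have e4 := congrArg (fun κ => κ (B.up s₀ (ρ + m) x)) e1
  simp only [ContinuousLinearMap.compL_apply, ContinuousLinearMap.flip_apply,
    ContinuousLinearMap.comp_apply] at e4
  rw [incl_up_of_mem hx (le_add_of_nonneg_right hm)] at e4
  rw [opL_apply, ← e4]
  simp

theorem AssumptionL.opL_bound (hL : B.AssumptionL ε₀ T s₀ hm p L) {a : ℕ} (ha : a ≤ p) {ρ : ℝ}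
    (hρ : s₀ ≤ ρ) : ∃ K, 0 ≤ K ∧ ∀ ε ∈ Ioo 0 ε₀, ∀ t ∈ Icc 0 T, ∀ x : X s₀, B.Mem (ρ + m) x →
      B.Mem ρ (B.opL s₀ ε (L ε) a t x) ∧
      B.nrm ρ (B.opL s₀ ε (L ε) a t x) ≤ K * B.nrm (ρ + m) x := by
  obtain ⟨K, hK⟩ := (hL.2.1 ρ hρ).2 a ha
  refine ⟨max K 0, le_max_right _ _, fun ε hε t ht x hx => ?_⟩
  rw [hL.opL_eq ha hρ hε t hx, nrm_incl]
  exact ⟨mem_incl _ _, (ContinuousLinearMap.le_opNorm _ _).trans (mul_le_mul_of_nonneg_right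
    ((hK ε hε t ht).trans (le_max_left _ _)) (norm_nonneg _))⟩

theorem AssumptionL.lc_opL (hL : B.AssumptionL ε₀ T s₀ hm p L) {a : ℕ} (ha : a ≤ p) {ρ : ℝ}
    (hρ : s₀ ≤ ρ) {ε : ℝ} (hε : ε ∈ Ioo 0 ε₀) {τ : ℝ} {x : ℝ → X s₀} (hx : B.LC (ρ + m) τ x) :
    B.LC ρ τ (fun t => B.opL s₀ ε (L ε) a t (x t)) := by
  have hc := ((hL.2.1 ρ hρ).1 ε hε).continuous_iteratedDeriv a (by exact_mod_cast ha)
  refine ⟨fun t ht => ?_, ?_⟩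
  · simp only [hL.opL_eq ha hρ hε t (hx.1 t ht)]
    exact mem_incl _ _
  · refine ((hc.continuousOn.const_smul (ε ^ a)).clm_apply hx.2).congr fun t ht => ?_
    simp only [hL.opL_eq ha hρ hε t (hx.1 t ht), up_incl]
    rfl

theorem AssumptionL.hasDerivWithinAt_opL [∀ s, CompleteSpace (X s)]
    (hL : B.AssumptionL ε₀ T s₀ hm p L) {a : ℕ} (ha : a + 1 ≤ p) {ε : ℝ} (hε : ε ∈ Ioo 0 ε₀)
    {τ r : ℝ} (hr : s₀ + m + m ≤ r) {x x₁ : ℝ → X s₀} (hx : B.LC r τ x) (hx₁ : B.LC (r - m) τ x₁)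
    (hd : ∀ t ∈ Icc 0 τ, HasDerivWithinAt x (ε⁻¹ • x₁ t) (Icc 0 τ) t) {t : ℝ}
    (ht : t ∈ Icc 0 τ) : HasDerivWithinAt (fun t => B.opL s₀ ε (L ε) a t (x t))
      (ε⁻¹ • (B.opL s₀ ε (L ε) (a + 1) t (x t) + B.opL s₀ ε (L ε) a t (x₁ t))) (Icc 0 τ) t := by
  have h0 : ε ≠ 0 := hε.1.ne'
  have hup := LC.hasDerivWithinAt_up (B := B) (r := s₀ + m) (by linarith)
    (hx.mono (by linarith) (by linarith)) ((hx₁.mono (by linarith) (by linarith)).smul ε⁻¹) hd ht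
  have hop : HasDerivAt (iteratedDeriv a (fun τ => L ε τ s₀))
      (iteratedDeriv (a + 1) (fun τ => L ε τ s₀) t) t := by
    rw [iteratedDeriv_succ]
    exact (((hL.2.1 s₀ le_rfl).1 ε hε).differentiable_iteratedDeriv a
      (by exact_mod_cast ha) t).hasDerivAt
  refine ((hop.hasDerivWithinAt.clm_apply hup).const_smul (ε ^ a)).congr_deriv ?_
  simp only [opL_apply, map_smul, smul_add, smul_smul]
  congr 2
  · rw [pow_succ, mul_comm (ε ^ a), inv_mul_cancel_left₀ h0]
  · exact mul_comm _ _

/-- `(ε ∂_t)^i (ε^a ∂_t^a L(t) u(t))` in terms of the jet of `u`. -/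
noncomputable def jetL (B : BanachScale X) {m : ℝ} (s₀ ε : ℝ) (L : ℝ → ∀ s, X (s + m) →L[ℝ] X s) :
    ℕ → ℕ → ℝ → (ℕ → X s₀) → X s₀
  | 0, a, t, u => B.opL s₀ ε L a t (u 0)
  | i + 1, a, t, u => jetL B s₀ ε L i (a + 1) t u + jetL B s₀ ε L i a t (shift u)

theorem jetL_zero (ε : ℝ) (a : ℕ) (t : ℝ) (u : ℕ → X s₀) :
    B.jetL s₀ ε (L ε) 0 a t u = B.opL s₀ ε (L ε) a t (u 0) := rfl

theorem jetL_succ (ε : ℝ) (i a : ℕ) (t : ℝ) (u : ℕ → X s₀) : B.jetL s₀ ε (L ε) (i + 1) a t u =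
    B.jetL s₀ ε (L ε) i (a + 1) t u + B.jetL s₀ ε (L ε) i a t (shift u) := rfl

theorem jetL_congr (ε : ℝ) {i a : ℕ} {t : ℝ} {u v : ℕ → X s₀} (h : ∀ k ≤ i, u k = v k) :
    B.jetL s₀ ε (L ε) i a t u = B.jetL s₀ ε (L ε) i a t v := by
  induction i generalizing a u v with
  | zero => rw [jetL_zero, jetL_zero, h 0 le_rfl]
  | succ i ih =>
    rw [jetL_succ, jetL_succ, ih fun k hk => h k (by omega),
      ih (u := shift u) (v := shift v) fun k hk => h (k + 1) (by omega)]

theorem jetL_add (ε : ℝ) (i a : ℕ) (t : ℝ) (u v : ℕ → X s₀) : B.jetL s₀ ε (L ε) i a t (u + v) =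
    B.jetL s₀ ε (L ε) i a t u + B.jetL s₀ ε (L ε) i a t v := by
  induction i generalizing a u v with
  | zero => simp [jetL_zero]
  | succ i ih =>
    rw [jetL_succ, jetL_succ, jetL_succ, ih, show shift (u + v) = shift u + shift v from rfl, ih]
    abel

theorem jetL_smul (ε : ℝ) (i a : ℕ) (t c : ℝ) (u : ℕ → X s₀) : B.jetL s₀ ε (L ε) i a t (c • u) =
    c • B.jetL s₀ ε (L ε) i a t u := by
  induction i generalizing a u with
  | zero => simp [jetL_zero]
  | succ i ih =>
    rw [jetL_succ, jetL_succ, ih, show shift (c • u) = c • shift u from rfl, ih, smul_add]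

theorem jetL_sub (ε : ℝ) (i a : ℕ) (t : ℝ) (u v : ℕ → X s₀) : B.jetL s₀ ε (L ε) i a t (u - v) =
    B.jetL s₀ ε (L ε) i a t u - B.jetL s₀ ε (L ε) i a t v := by
  have := jetL_add (B := B) (L := L) ε i a t u ((-1 : ℝ) • v)
  rw [jetL_smul] at this
  simpa [sub_eq_add_neg] using this

theorem AssumptionL.jetL_bound (hL : B.AssumptionL ε₀ T s₀ hm p L) (i : ℕ) : ∀ {a : ℕ}, a + i ≤ p →
    ∀ {r : ℝ}, s₀ + (i + 1) * m ≤ r → ∃ K, 0 ≤ K ∧ ∀ ε ∈ Ioo 0 ε₀, ∀ t ∈ Icc 0 T, ∀ u : ℕ → X s₀,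
      B.JMem m r i u → B.Mem (r - (i + 1) * m) (B.jetL s₀ ε (L ε) i a t u) ∧
      B.nrm (r - (i + 1) * m) (B.jetL s₀ ε (L ε) i a t u) ≤ K * B.pn m r i u := by
  induction i with
  | zero =>
    intro a ha r hr
    simp only [Nat.cast_zero, zero_add, one_mul] at hr ⊢
    obtain ⟨K, hK, h⟩ := hL.opL_bound (a := a) (by omega) (ρ := r - m) (by linarith)
    refine ⟨K, hK, fun ε hε t ht u hu => ?_⟩
    have := h ε hε t ht (u 0) (by simpa using hu 0 le_rfl)
    rwa [sub_add_cancel, ← pn_zero_order (m := m)] at this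
  | succ i ih =>
    intro a ha r hr
    push_cast at hr
    have him : 0 ≤ (i : ℝ) * m := by positivity
    obtain ⟨K₁, hK₁, h₁⟩ := @ih (a + 1) (by omega) r (by linarith)
    obtain ⟨K₂, hK₂, h₂⟩ := @ih a (by omega) (r - m) (by linarith)
    refine ⟨K₁ + K₂, by positivity, fun ε hε t ht u hu => ?_⟩
    obtain ⟨a₁, b₁⟩ := h₁ ε hε t ht u (hu.mono (by omega) le_rfl (by linarith) hm)
    obtain ⟨a₂, b₂⟩ := h₂ ε hε t ht (shift u) hu.shift
    have e : r - m - (i + 1) * m = r - (((i + 1 : ℕ) : ℝ) + 1) * m := by push_cast; ring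
    rw [e] at a₂ b₂
    have hb : s₀ ≤ r - (((i + 1 : ℕ) : ℝ) + 1) * m := by push_cast; linarith
    have hb' : r - (((i + 1 : ℕ) : ℝ) + 1) * m ≤ r - (i + 1) * m := by push_cast; linarith
    rw [jetL_succ]
    refine ⟨(a₁.mono hb hb').add a₂, (nrm_add_le _ _ _).trans ?_⟩
    rw [add_mul K₁]
    refine add_le_add ((nrm_mono a₁ hb hb').trans (b₁.trans ?_)) (b₂.trans ?_)
    · exact mul_le_mul_of_nonneg_left (pn_mono hu (by omega) le_rfl (by linarith) hm) hK₁
    · exact mul_le_mul_of_nonneg_left pn_shift_le hK₂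

theorem AssumptionL.lc_jetL (hL : B.AssumptionL ε₀ T s₀ hm p L) (i : ℕ) {ε : ℝ}
    (hε : ε ∈ Ioo 0 ε₀) {τ : ℝ} : ∀ {a : ℕ}, a + i ≤ p →
    ∀ {r : ℝ}, s₀ + (i + 1) * m ≤ r → ∀ {u : ℝ → ℕ → X s₀}, B.JLC m r τ i u →
      B.LC (r - (i + 1) * m) τ (fun t => B.jetL s₀ ε (L ε) i a t (u t)) := by
  induction i with
  | zero =>
    intro a ha r hr u hu
    simp only [Nat.cast_zero, zero_add, one_mul] at hr ⊢
    exact hL.lc_opL (by omega) (by linarith) hε (x := fun t => u t 0)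
      (by simpa using hu 0 le_rfl)
  | succ i ih =>
    intro a ha r hr u hu
    push_cast at hr
    have him : 0 ≤ (i : ℝ) * m := by positivity
    have h₁ := @ih (a + 1) (by omega) r (by linarith) u (hu.mono (by omega) le_rfl (by linarith) hm)
    have h₂ := @ih a (by omega) (r - m) (by linarith) _ hu.shift
    rw [show r - m - (i + 1) * m = r - (((i + 1 : ℕ) : ℝ) + 1) * m by push_cast; ring] at h₂
    exact (h₁.mono (by push_cast; linarith) (by push_cast; linarith)).add h₂

theorem AssumptionL.hasDerivWithinAt_jetL [∀ s, CompleteSpace (X s)]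
    (hL : B.AssumptionL ε₀ T s₀ hm p L) (i : ℕ) {ε : ℝ} (hε : ε ∈ Ioo 0 ε₀) {τ : ℝ} :
    ∀ {a : ℕ}, a + i + 1 ≤ p → ∀ {r : ℝ}, s₀ + (i + 1) * m + m ≤ r → ∀ {u : ℝ → ℕ → X s₀},
    B.JLC m r τ (i + 1) u → IsJet τ ε (i + 1) u → ∀ {t : ℝ}, t ∈ Icc 0 τ →
    HasDerivWithinAt (fun t => B.jetL s₀ ε (L ε) i a t (u t))
      (ε⁻¹ • B.jetL s₀ ε (L ε) (i + 1) a t (u t)) (Icc 0 τ) t := by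
  induction i with
  | zero =>
    intro a ha r hr u hu hdu t ht
    simp only [Nat.cast_zero, zero_add, one_mul] at hr
    exact hL.hasDerivWithinAt_opL (by omega) hε hr (by simpa using hu 0 (by omega))
      (by simpa using hu 1 (by omega)) (hdu 0 (by omega)) ht
  | succ i ih =>
    intro a ha r hr u hu hdu t ht
    push_cast at hr
    have him : 0 ≤ (i : ℝ) * m := by positivity
    have h₁ := @ih (a + 1) (by omega) r (by linarith) u
      (hu.mono (by omega) le_rfl (by push_cast; linarith) hm) (hdu.mono (by omega)) t ht
    have h₂ := @ih a (by omega) (r - m) (by linarith) _ hu.shift hdu.shift t ht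
    refine (h₁.add h₂).congr_deriv ?_
    rw [jetL_succ ε (i + 1), smul_add]

/-! ### Reconstruction of the jets of a solution from its equation. -/

/-- A sequence is determined by its first term and by its terms of positive order in terms of the
lower ones. -/
theorem exists_seq_of_recursion {V : Type*} (x : V) (G : ℕ → (ℕ → V) → V)
    (hG : ∀ k u v, (∀ i ≤ k, u i = v i) → G k u = G k v) :
    ∃ u : ℕ → V, u 0 = x ∧ ∀ k, u (k + 1) = G k u := by
  -- The entries of `c n` up to the index `n` are final, since each step rewrites only the next one;
  -- the diagonal is therefore the required sequence.
  let c : ℕ → ℕ → V := fun n => Nat.rec (fun _ => x) (fun k v => Function.update v (k + 1) (G k v)) n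
  have hc : ∀ n, c (n + 1) = Function.update (c n) (n + 1) (G n (c n)) := fun n => rfl
  have hst : ∀ k n, k ≤ n → c n k = c k k := by
    intro k n hkn
    induction n, hkn using Nat.le_induction with
    | base => rfl
    | succ n hkn ih => rw [hc, Function.update_of_ne (by omega), ih]
  refine ⟨fun k => c k k, rfl, fun k => ?_⟩
  simp only [hc k, Function.update_self]
  exact hG k _ _ fun i hi => hst i k hi

/-- A solution `x` of `ε ∂_t x = G 0 x` is the first component of a curve of jets, if `G (k + 1)` is
`(ε ∂_t) (G k)`. -/
theorem exists_jet_of_eq {b ε τ r : ℝ} {j : ℕ} {x : ℝ → X b} (hx : B.LC r τ x)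
    (G : ℕ → ℝ → (ℕ → X b) → X b)
    (hG : ∀ k t u v, (∀ i ≤ k, u i = v i) → G k t u = G k t v)
    (hlc : ∀ k ≤ j, ∀ u, B.JLC m r τ k u → IsJet τ ε k u →
      B.LC (r - (k + 1) * m) τ (fun t => G k t (u t)))
    (hd : ∀ k < j, ∀ u, B.JLC m r τ (k + 1) u → IsJet τ ε (k + 1) u → ∀ t ∈ Icc 0 τ,
      HasDerivWithinAt (fun t => G k t (u t)) (ε⁻¹ • G (k + 1) t (u t)) (Icc 0 τ) t)
    (heq : ∀ u : ℕ → X b, ∀ t ∈ Icc 0 τ, u 0 = x t →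
      HasDerivWithinAt x (ε⁻¹ • G 0 t u) (Icc 0 τ) t) :
    ∃ u : ℝ → ℕ → X b, (∀ t, u t 0 = x t) ∧ B.JLC m r τ (j + 1) u ∧ IsJet τ ε (j + 1) u ∧
      ∀ k t, u t (k + 1) = G k t (u t) := by
  choose u hu0 hu using fun t => exists_seq_of_recursion (x t) (fun k => G k t) (hG · t)
  -- The components are defined pointwise in time by the algebraic recursion; their regularity and
  -- the jet relations are obtained afterwards, order by order.
  have key : ∀ k ≤ j + 1, B.JLC m r τ k u ∧ IsJet τ ε k u := by
    intro k hk
    induction k with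
    | zero =>
      refine ⟨fun k hk => ?_, fun k hk => absurd hk (by omega)⟩
      obtain rfl : k = 0 := by omega
      simpa [hu0] using hx
    | succ k ih =>
      obtain ⟨h1, h2⟩ := ih (by omega)
      refine ⟨fun i hi => ?_, fun i hi t ht => ?_⟩
      · rcases Nat.lt_or_ge i (k + 1) with h | h
        · exact h1 i (by omega)
        · obtain rfl : i = k + 1 := by omega
          have := hlc k (by omega) u h1 h2
          simpa [hu] using this
      · rcases Nat.lt_or_ge i k with h | h
        · exact h2 i h t ht
        · obtain rfl : i = k := by omega
          cases i with
          | zero =>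
            simp only [hu0, hu]
            exact heq _ t ht (hu0 t)
          | succ i =>
            simp only [hu]
            have := hd i (by omega) u h1 h2 t ht
            simpa [hu] using this
  exact ⟨u, hu0, (key _ le_rfl).1, (key _ le_rfl).2, fun k t => hu t k⟩

end BanachScale

/-! ### Passage between curves of jets and the spaces and norms of the hypotheses. -/

theorem contDiffOn_Icc_of_hasDerivWithinAt {E : Type*} [NormedAddCommGroup E] [NormedSpace ℝ E]
    {T : ℝ} (hT : 0 < T) {k : ℕ} {g : ℕ → ℝ → E} (hc : ∀ i ≤ k, ContinuousOn (g i) (Icc 0 T))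
    (hd : ∀ i < k, ∀ t ∈ Icc 0 T, HasDerivWithinAt (g i) (g (i + 1) t) (Icc 0 T) t) :
    ContDiffOn ℝ k (g 0) (Icc 0 T) ∧
      ∀ i ≤ k, ∀ t ∈ Icc 0 T, iteratedDerivWithin i (g 0) (Icc 0 T) t = g i t := by
  have h2 : ∀ i ≤ k, ∀ t ∈ Icc 0 T, iteratedDerivWithin i (g 0) (Icc 0 T) t = g i t := by
    intro i
    induction i with
    | zero => intro _ t _; simp
    | succ i ih =>
      intro hi t ht
      rw [iteratedDerivWithin_succ, derivWithin_congr (fun t ht => ih (by omega) t ht)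
        (ih (by omega) t ht)]
      exact (hd i (by omega) t ht).derivWithin (uniqueDiffOn_Icc hT t ht)
  refine ⟨?_, h2⟩
  rw [contDiffOn_nat_iff_continuousOn_differentiableOn_deriv (uniqueDiffOn_Icc hT)]
  exact ⟨fun i hi => (hc i hi).congr (h2 i hi), fun i hi t ht =>
    ((hd i hi t ht).congr (fun t ht => h2 i hi.le t ht) (h2 i hi.le t ht)).differentiableWithinAt⟩

theorem supNorm_nonneg {E : Type*} [NormedAddCommGroup E] (t : ℝ) (f : ℝ → E) :
    0 ≤ supNorm t f :=
  Real.sSup_nonneg (by rintro _ ⟨t, _, rfl⟩; exact norm_nonneg _)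

theorem supNorm_le {E : Type*} [NormedAddCommGroup E] {t M : ℝ} {f : ℝ → E} (hM : 0 ≤ M)
    (h : ∀ t' ∈ Icc 0 t, ‖f t'‖ ≤ M) : supNorm t f ≤ M :=
  Real.sSup_le (by rintro _ ⟨t, ht, rfl⟩; exact h t ht) hM

theorem norm_le_supNorm {E : Type*} [NormedAddCommGroup E] {T t : ℝ} {f : ℝ → E}
    (hf : ContinuousOn f (Icc 0 T)) (ht : t ∈ Icc 0 T) : ‖f t‖ ≤ supNorm T f :=
  le_csSup (isCompact_Icc.image_of_continuousOn hf.norm).bddAbove (mem_image_of_mem _ ht)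

namespace BanachScale

variable {X : ℝ → Type*} [∀ s, NormedAddCommGroup (X s)] [∀ s, NormedSpace ℝ (X s)]
variable {B : BanachScale X} {m : ℝ} {hm : 0 ≤ m}

section Conversion

variable {b r T ε : ℝ} {j : ℕ}

/-- A jet stores `(ε ∂_t)^k`, whence the factor `ε⁻¹ ^ k`. The derivatives are first known in `X b`;
up to the order `k` they hold in `X (r - k m)`, where all the components involved are continuous. -/
theorem JLC.memX_and_dt [∀ s, CompleteSpace (X s)] (hT : 0 < T) {u : ℝ → ℕ → X b}
    (hu : B.JLC m r T j u) (hdu : IsJet T ε j u) (hb : b ≤ r - j * m) {ũ : ℝ → X r}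
    (hũ : ∀ t ∈ Icc 0 T, ũ t = B.up b r (u t 0)) :
    B.MemX hm T j ũ ∧ ∀ k ≤ j, ∀ t ∈ Icc 0 T,
      B.dt hm T k ũ t = ε⁻¹ ^ k • B.up b (r - k * m) (u t k) := by
  have key : ∀ k ≤ j, ContDiffOn ℝ k (fun t => B.incl (sub_nat_mul_le hm k r) (ũ t)) (Icc 0 T) ∧ ∀ t ∈ Icc 0 T, B.dt hm T k ũ t =
        ε⁻¹ ^ k • B.up b (r - k * m) (u t k) := by
    intro k hk
    have hkj : (k : ℝ) * m ≤ j * m := by gcongr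
    have hbk : b ≤ r - k * m := by linarith
    have hlc : ∀ i ≤ k, B.LC (r - k * m) T (fun t => u t i) := fun i hi =>
      (hu i (hi.trans hk)).mono hbk (by have : (i : ℝ) * m ≤ k * m := by gcongr
                                        linarith)
    obtain ⟨h1, h2⟩ := contDiffOn_Icc_of_hasDerivWithinAt hT (k := k)
      (g := fun i t => ε⁻¹ ^ i • B.up b (r - k * m) (u t i))
      (fun i hi => (hlc i hi).2.const_smul _) (fun i hi t ht => by
        have := LC.hasDerivWithinAt_up hbk (hlc i hi.le) ((hlc (i + 1) hi).smul ε⁻¹)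
          (hdu i (by omega)) ht
        refine (this.const_smul (ε⁻¹ ^ i)).congr_deriv ?_
        rw [map_smul, smul_smul, pow_succ])
    have e : EqOn (fun t => B.incl (sub_nat_mul_le hm k r) (ũ t))
        (fun t => ε⁻¹ ^ 0 • B.up b (r - k * m) (u t 0)) (Icc 0 T) := fun t ht => by
      have := (hu 0 (by omega)).1 t ht
      simp only [pow_zero, one_smul, hũ t ht]
      exact incl_up_of_mem (by simpa using this) hbk _
    refine ⟨h1.congr e, fun t ht => ?_⟩
    rw [dt, iteratedDerivWithin_congr e ht]
    exact h2 k le_rfl t ht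
  exact ⟨fun k hk => (key k hk).1, fun k hk => (key k hk).2⟩

theorem MemX.dt_incl (hT : 0 < T) {σ : ℝ} (hσ : σ ≤ r) {u : ℝ → X r} (hu : B.MemX hm T j u) {k : ℕ}
    (hk : k ≤ j) {t : ℝ} (ht : t ∈ Icc 0 T) : B.dt hm T k (fun t => B.incl hσ (u t)) t =
      B.incl (sub_le_sub_right hσ (k * m)) (B.dt hm T k u t) := by
  rw [dt, dt, ← ContinuousLinearMap.iteratedDerivWithin_comp hT _ (hu k hk) ht]
  simp only [B.incl_incl]

theorem pow_mul_supNorm_dt_le [∀ s, CompleteSpace (X s)] (hT : 0 < T) (hε : 0 < ε)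
    {u : ℝ → ℕ → X b}
    (hu : B.JLC m r T j u) (hdu : IsJet T ε j u) (hb : b ≤ r - j * m) {ũ : ℝ → X r}
    (hũ : ∀ t ∈ Icc 0 T, ũ t = B.up b r (u t 0)) {σ t M : ℝ} (hσ : σ ≤ r) (ht : t ∈ Icc 0 T)
    (hM : ∀ t' ∈ Icc 0 t, B.pn m r j (u t') ≤ M) {k : ℕ} (hk : k ≤ j) :
    ε ^ k * supNorm t (B.dt hm T k (fun t => B.incl hσ (ũ t))) ≤ M := by
  have hM0 : 0 ≤ M := (pn_nonneg _ _ _ _).trans (hM 0 ⟨le_rfl, ht.1⟩)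
  have : supNorm t (B.dt hm T k (fun t => B.incl hσ (ũ t))) ≤ (ε ^ k)⁻¹ * M := by
    refine supNorm_le (by positivity) fun t' ht' => ?_
    have hX := hu.memX_and_dt (hm := hm) hT hdu hb hũ
    rw [hX.1.dt_incl hT hσ hk ⟨ht'.1, ht'.2.trans ht.2⟩]
    refine (B.norm_incl_le _ _).trans ?_
    rw [hX.2 k hk t' ⟨ht'.1, ht'.2.trans ht.2⟩, norm_smul,
      norm_pow, norm_inv, Real.norm_of_nonneg hε.le, inv_pow]
    exact mul_le_mul_of_nonneg_left ((nrm_le_pn hk).trans (hM t' ht')) (by positivity)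
  calc _ ≤ ε ^ k * ((ε ^ k)⁻¹ * M) := by gcongr
    _ = M := by rw [mul_inv_cancel_left₀ (by positivity)]

theorem normX_le [∀ s, CompleteSpace (X s)] (hT : 0 < T) (hε : 0 < ε) {u : ℝ → ℕ → X b}
    (hu : B.JLC m r T j u) (hdu : IsJet T ε j u) (hb : b ≤ r - j * m) {ũ : ℝ → X r}
    (hũ : ∀ t ∈ Icc 0 T, ũ t = B.up b r (u t 0)) {σ M : ℝ} (hσ : σ ≤ r)
    (hM : ∀ t ∈ Icc 0 T, B.pn m r j (u t) ≤ M) :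
    B.normX hm T ε j (fun t => B.incl hσ (ũ t)) ≤ (j + 1) * M := by
  refine (Finset.sum_le_card_nsmul _ _ M fun k hk => pow_mul_supNorm_dt_le hT hε hu hdu hb hũ
    hσ ⟨hT.le, le_rfl⟩ hM (by simpa [Nat.lt_succ_iff] using hk)).trans ?_
  simp

theorem normX_nonneg (hε : 0 < ε) {s : ℝ} (u : ℝ → X s) : 0 ≤ B.normX hm T ε j u :=
  Finset.sum_nonneg fun _ _ => mul_nonneg (by positivity) (supNorm_nonneg _ _)

/-- The integrand contains suprema over `[0, t']`. A monotone `φ` that bounds the norms pointwise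
also bounds these suprema at `t'`, and its continuity provides an integrable majorant. -/
theorem energyI_le [∀ s, CompleteSpace (X s)] (hT : 0 < T) (hε : 0 < ε) {f : ℝ → ℕ → X b}
    (hf : B.JLC m r T j f) (hdf : IsJet T ε j f) (hb : b ≤ r - j * m) {ũ : ℝ → X r}
    (hũ : ∀ t ∈ Icc 0 T, ũ t = B.up b r (f t 0)) {σ t : ℝ} (hσ : σ ≤ r) (ht : t ∈ Icc 0 T)
    {φ : ℝ → ℝ} (hφ : ContinuousOn φ (Icc 0 t)) (hφ' : MonotoneOn φ (Icc 0 t))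
    (h : ∀ t' ∈ Icc 0 t, B.pn m r j (f t') ≤ φ t') :
    B.energyI hm T ε j t (fun t => B.incl hσ (ũ t)) 0 ≤ (j + 1) * ∫ t' in (0 : ℝ)..t, φ t' := by
  rw [energyI, norm_zero, zero_add, ← intervalIntegral.integral_const_mul]
  refine (Real.le_norm_self _).trans (intervalIntegral.norm_integral_le_of_norm_le ht.1 ?_ ?_)
  · refine Eventually.of_forall fun t' ht' => ?_
    have ht1 : t' ∈ Icc 0 t := ⟨ht'.1.le, ht'.2⟩
    rw [Real.norm_of_nonneg (Finset.sum_nonneg fun _ _ =>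
      mul_nonneg (by positivity) (supNorm_nonneg _ _))]
    refine (Finset.sum_le_card_nsmul _ _ (φ t') fun k hk => pow_mul_supNorm_dt_le hT hε hf hdf hb hũ
      hσ ⟨ht1.1, ht1.2.trans ht.2⟩ (fun t'' ht'' => ?_) (by simpa [Nat.lt_succ_iff] using hk)).trans ?_
    · exact (h t'' ⟨ht''.1, ht''.2.trans ht1.2⟩).trans
        (hφ' ⟨ht''.1, ht''.2.trans ht1.2⟩ ht1 ht''.2)
    · simp
  · exact ((continuousOn_const.mul hφ).mono (by rw [uIcc_of_le ht.1])).intervalIntegrable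

theorem energyI_nonneg (hε : 0 < ε) {s t : ℝ} (ht : 0 ≤ t) (f : ℝ → X s) (g : X (s + m)) :
    0 ≤ B.energyI hm T ε j t f g :=
  add_nonneg (norm_nonneg _) (intervalIntegral.integral_nonneg ht fun _ _ =>
    Finset.sum_nonneg fun _ _ => mul_nonneg (by positivity) (supNorm_nonneg _ _))

theorem dt_congr {u v : ℝ → X r} (h : EqOn u v (Icc 0 T)) (k : ℕ) :
    EqOn (B.dt hm T k u) (B.dt hm T k v) (Icc 0 T) := fun t ht =>
  iteratedDerivWithin_congr (fun t ht => by simp only [h ht]) ht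

theorem supNorm_dt_congr {u v : ℝ → X r} (h : EqOn u v (Icc 0 T)) (k : ℕ) {t : ℝ} (ht : t ≤ T) :
    supNorm t (B.dt hm T k u) = supNorm t (B.dt hm T k v) := by
  unfold supNorm
  congr 1
  exact image_congr fun t' ht' => by rw [dt_congr h k ⟨ht'.1, ht'.2.trans ht⟩]

theorem normX_congr {u v : ℝ → X r} (h : EqOn u v (Icc 0 T)) :
    B.normX hm T ε j u = B.normX hm T ε j v :=
  Finset.sum_congr rfl fun k _ => by rw [supNorm_dt_congr h k le_rfl]

theorem energyI_congr {f g : ℝ → X r} {t : ℝ} (ht : t ∈ Icc 0 T) (h : EqOn f g (Icc 0 T))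
    {x : X (r + m)} : B.energyI hm T ε j t f x = B.energyI hm T ε j t g x := by
  unfold energyI
  congr 1
  refine intervalIntegral.integral_congr fun t' ht' => Finset.sum_congr rfl fun k _ => ?_
  rw [uIcc_of_le ht.1] at ht'
  rw [supNorm_dt_congr h k (ht'.2.trans ht.2)]

/-- The curve of the jets of `h ∈ X^r_{(j)}`. -/
theorem MemX.exists_jet (hT : 0 < T) (hε : 0 < ε) {h : ℝ → X r} (hh : B.MemX hm T j h)
    (hb : b ≤ r - j * m) : ∃ u : ℝ → ℕ → X b, B.JLC m r T j u ∧ IsJet T ε j u ∧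
      (∀ t, u t 0 = B.incl (hb.trans (sub_nat_mul_le hm j r)) (h t)) ∧
      ∀ t ∈ Icc 0 T, B.pn m r j (u t) ≤ B.normX hm T ε j h := by
  have hbk : ∀ k ≤ j, b ≤ r - k * m := fun k hk => by
    have : (k : ℝ) * m ≤ j * m := by gcongr
    linarith
  have hcont : ∀ k ≤ j, ContinuousOn (B.dt hm T k h) (Icc 0 T) := fun k hk =>
    (hh k hk).continuousOn_iteratedDerivWithin le_rfl (uniqueDiffOn_Icc hT)
  let u : ℝ → ℕ → X b := fun t k => if hk : b ≤ r - k * m then ε ^ k • B.incl hk (B.dt hm T k h t)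
    else 0
  have hu : ∀ k (hk : k ≤ j), ∀ t, u t k = B.incl (hbk k hk) (ε ^ k • B.dt hm T k h t) := fun k hk t => by
    simp only [u, dif_pos (hbk k hk), map_smul]
  have hdt : ∀ k (hk : k ≤ j), ∀ l (hl : l ≤ j), ∀ t ∈ Icc 0 T, B.incl (hbk l hl) (B.dt hm T l h t) =
      iteratedDerivWithin l (fun t => B.incl ((hbk k hk).trans (sub_nat_mul_le hm k r)) (h t))
        (Icc 0 T) t := fun k hk l hl t ht => by
    rw [dt, ← ContinuousLinearMap.iteratedDerivWithin_comp hT _ (hh l hl) ht]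
    simp only [B.incl_incl]
  refine ⟨u, fun k hk => ⟨fun t _ => ?_, ?_⟩, fun k hk t ht => ?_, fun t => ?_, fun t ht => ?_⟩
  · simp only [hu k hk]; exact mem_incl _ _
  · simp only [hu k hk, up_incl]
    exact (hcont k hk).const_smul _
  · simp only [hu k hk.le, hu (k + 1) hk, map_smul]
    have hC : ContDiffOn ℝ (k + 1 : ℕ)
        (fun t => B.incl ((hbk (k + 1) hk).trans (sub_nat_mul_le hm (k + 1) r)) (h t))
        (Icc 0 T) := by
      have := (B.incl (hbk (k + 1) hk)).contDiff.comp_contDiffOn (n := (k + 1 : ℕ)) (hh (k + 1) hk)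
      simpa only [Function.comp_def, B.incl_incl] using this
    have hd := (hC.differentiableOn_iteratedDerivWithin (m := k) (by exact_mod_cast Nat.lt_succ_self k)
      (uniqueDiffOn_Icc hT) t ht).hasDerivWithinAt
    rw [← iteratedDerivWithin_succ] at hd
    refine ((hd.congr (fun t ht => hdt (k + 1) hk k hk.le t ht)
      (hdt (k + 1) hk k hk.le t ht)).const_smul (ε ^ k)).congr_deriv ?_
    rw [← hdt (k + 1) hk (k + 1) hk t ht, smul_smul, pow_succ, mul_comm (ε ^ k),
      inv_mul_cancel_left₀ hε.ne']
  · rw [hu 0 (by omega)]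
    simp only [pow_zero, one_smul, dt, iteratedDerivWithin_zero, B.incl_incl]
  · refine Finset.sum_le_sum fun k hk => ?_
    have hk : k ≤ j := by simpa [Nat.lt_succ_iff] using hk
    rw [hu k hk, nrm_incl, norm_smul, norm_pow, Real.norm_of_nonneg hε.le]
    exact mul_le_mul_of_nonneg_left (norm_le_supNorm (hcont k hk) ht) (by positivity)

end Conversion

variable {ε₀ T s₀ : ℝ} {p : ℕ} {F : ℝ → ℝ → ∀ s, X (s + m) → X s}
  {L : ℝ → ℝ → ∀ s, X (s + m) →L[ℝ] X s}

/-- At order zero the target is `X (ρ - 0 * m)`, whose index equals `ρ` only propositionally; the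
inclusion is then the identity. -/
theorem contDiff_of_incl_of_eq {E : Type*} [NormedAddCommGroup E] [NormedSpace ℝ E] {n : ℕ}
    {σ ρ : ℝ} (h : σ ≤ ρ) (e : σ = ρ) {G : E → X ρ} (hG : ContDiff ℝ n (fun x => B.incl h (G x))) :
    ContDiff ℝ n G := by
  subst e
  simpa only [B.incl_refl] using hG

theorem AssumptionF.contDiff (hF : B.AssumptionF ε₀ T s₀ hm p F) (n : ℕ) (hn : n ≤ p + 2) {ρ : ℝ}
    (hρ : s₀ ≤ ρ) {ε : ℝ} (hε : ε ∈ Ioo 0 ε₀) {t : ℝ} (ht : t ∈ Icc 0 T) :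
    ContDiff ℝ n (F ε t ρ) := by
  have := ((hF.timeSmooth (a := 0) (j := n) (by omega) (by omega) (ρ := ρ) (by simpa using hρ)
    hε).2 0 le_rfl).1 t ht
  have e : timeDeriv T 0 (B.lower (F ε) (sub_nat_mul_le hm 0 ρ)) t =
      fun x => B.incl (sub_nat_mul_le hm 0 ρ) (F ε t ρ x) := by
    funext x
    simp [timeDeriv, lower]
  rw [e] at this
  exact contDiff_of_incl_of_eq (sub_nat_mul_le hm 0 ρ) (by simp) this

theorem AssumptionF.jetN_zero (hF : B.AssumptionF ε₀ T s₀ hm p F) (hT : 0 < T) {ρ : ℝ}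
    (hρ : s₀ ≤ ρ) {ε : ℝ} (hε : ε ∈ Ioo 0 ε₀) {t : ℝ} (ht : t ∈ Icc 0 T) {u : ℕ → X s₀}
    (hu : B.Mem (ρ + m) (u 0)) :
    B.jetN hm T s₀ ε (F ε) 0 t u = B.incl hρ (F ε t ρ (B.up s₀ (ρ + m) (u 0))) := by
  rw [jetN, jet_zero, hF.jetF_eq hT le_rfl (by omega) (by omega) (ρ := ρ) (by simpa using hρ) hε ht
    hu (fun l => l.elim0)]
  simp [timeDeriv, lower, B.incl_incl]

theorem AssumptionF.jetD_zero (hF : B.AssumptionF ε₀ T s₀ hm p F) (hT : 0 < T) {ρ : ℝ}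
    (hρ : s₀ ≤ ρ) {ε : ℝ} (hε : ε ∈ Ioo 0 ε₀) {t : ℝ} (ht : t ∈ Icc 0 T) {u v : ℕ → X s₀}
    (hu : B.Mem (ρ + m) (u 0)) (hv : B.Mem (ρ + m) (v 0)) :
    B.jetD hm T s₀ ε (F ε) 0 t u v =
      B.incl hρ (fderiv ℝ (F ε t ρ) (B.up s₀ (ρ + m) (u 0)) (B.up s₀ (ρ + m) (v 0))) := by
  rw [jetD, jet_zero, hF.jetF_eq hT le_rfl (by omega) (by omega) (ρ := ρ) (by simpa using hρ) hε ht
    hu (fun _ => hv)]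
  have hd : DifferentiableAt ℝ (F ε t ρ) (B.up s₀ (ρ + m) (u 0)) :=
    ((hF.contDiff 1 (by omega) hρ hε ht).differentiable (by norm_num)) _
  have e : timeDeriv T 0 (B.lower (F ε) (sub_nat_mul_le hm 0 ρ)) t =
      fun x => B.incl (sub_nat_mul_le hm 0 ρ) (F ε t ρ x) := by
    funext x
    simp [timeDeriv, lower]
  have h1 := ((B.incl (sub_nat_mul_le hm 0 ρ)).hasFDerivAt.comp _ hd.hasFDerivAt).fderiv
  simp only [Function.comp_def] at h1
  rw [e, iteratedFDeriv_one_apply, h1]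
  simp [B.incl_incl]

theorem AssumptionL.opL_zero (hL : B.AssumptionL ε₀ T s₀ hm p L) {ρ : ℝ}
    (hρ : s₀ ≤ ρ) {ε : ℝ} (hε : ε ∈ Ioo 0 ε₀) (t : ℝ) {x : X s₀} (hx : B.Mem (ρ + m) x) :
    B.opL s₀ ε (L ε) 0 t x = B.incl hρ (L ε t ρ (B.up s₀ (ρ + m) x)) := by
  rw [hL.opL_eq (by omega) hρ hε t hx]
  simp

end BanachScale

/-! ### The linearized problem in terms of jets. -/

namespace BanachScale

variable {X : ℝ → Type*} [∀ s, NormedAddCommGroup (X s)] [∀ s, NormedSpace ℝ (X s)]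
variable {B : BanachScale X} {m : ℝ} {hm : 0 ≤ m} {ε₀ T s₀ d₁ d₂ : ℝ} {hd₁ : 0 ≤ d₁}
  {hd₂ : 0 ≤ d₂} {p : ℕ} {F : ℝ → ℝ → ∀ s, X (s + m) → X s}
  {L : ℝ → ℝ → ∀ s, X (s + m) →L[ℝ] X s}

theorem AssumptionF.lc_jetN (hF : B.AssumptionF ε₀ T s₀ hm p F) (hT : 0 < T) {k : ℕ} (hk : k ≤ p)
    {ε : ℝ} (hε : ε ∈ Ioo 0 ε₀) {τ r : ℝ} (hτ : τ ≤ T) (hr : s₀ + (k + 1) * m ≤ r)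
    {u : ℝ → ℕ → X s₀} (hu : B.JLC m r τ k u) :
    B.LC (r - (k + 1) * m) τ (fun t => B.jetN hm T s₀ ε (F ε) k t (u t)) := by
  have := hF.lc_jet hT k hε (a := 0) (j := 0) (continuousOn_id (s := Icc 0 τ))
    (fun t ht => ⟨ht.1, ht.2.trans hτ⟩) (by omega) (by omega) (ρ := r - m)
    (by push_cast; linarith) (w := Fin.elim0) (by simpa using hu) (fun l => l.elim0)
  rw [show r - m - ((0 : ℕ) + k) * m = r - (k + 1) * m by push_cast; ring] at this
  refine this.congr fun z _ => ?_
  simp only [jetN]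
  congr 1
  funext l
  exact l.elim0

theorem AssumptionF.lc_jetD (hF : B.AssumptionF ε₀ T s₀ hm p F) (hT : 0 < T) {k : ℕ} (hk : k ≤ p)
    {ε : ℝ} (hε : ε ∈ Ioo 0 ε₀) {τ r : ℝ} (hτ : τ ≤ T) (hr : s₀ + (k + 1) * m ≤ r)
    {u v : ℝ → ℕ → X s₀} (hu : B.JLC m r τ k u) (hv : B.JLC m r τ k v) :
    B.LC (r - (k + 1) * m) τ (fun t => B.jetD hm T s₀ ε (F ε) k t (u t) (v t)) := by
  have := hF.lc_jet hT k hε (a := 0) (j := 1) (continuousOn_id (s := Icc 0 τ))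
    (fun t ht => ⟨ht.1, ht.2.trans hτ⟩) (by omega) (by omega) (ρ := r - m)
    (by push_cast; linarith) (w := fun _ => v) (by simpa using hu) (fun l => by simpa using hv)
  rwa [show r - m - ((0 : ℕ) + k) * m = r - (k + 1) * m by push_cast; ring] at this

theorem AssumptionF.hasDerivWithinAt_jetN [∀ s, CompleteSpace (X s)]
    (hF : B.AssumptionF ε₀ T s₀ hm p F) (hT : 0 < T) {k : ℕ} (hk : k < p)
    {ε : ℝ} (hε : ε ∈ Ioo 0 ε₀) {τ r : ℝ} (hτ : τ ≤ T) (hr : s₀ + (k + 1) * m + m ≤ r)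
    {u : ℝ → ℕ → X s₀} (hu : B.JLC m r τ (k + 1) u) (hdu : IsJet τ ε (k + 1) u) {t : ℝ}
    (ht : t ∈ Icc 0 τ) : HasDerivWithinAt (fun t => B.jetN hm T s₀ ε (F ε) k t (u t))
      (ε⁻¹ • B.jetN hm T s₀ ε (F ε) (k + 1) t (u t)) (Icc 0 τ) t := by
  have := hF.hasDerivWithinAt_jet hT k hε hτ (a := 0) (j := 0) (by omega) (by omega) (r := r)
    (by push_cast; linarith) (w := Fin.elim0) hu (fun l => l.elim0) hdu (fun l => l.elim0) ht
  have e : ∀ t, (fun l => (Fin.elim0 : Fin 0 → ℝ → ℕ → X s₀) l t) = Fin.elim0 := fun t =>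
    funext fun l => l.elim0
  simp only [e] at this
  exact this

theorem AssumptionF.hasDerivWithinAt_jetD [∀ s, CompleteSpace (X s)]
    (hF : B.AssumptionF ε₀ T s₀ hm p F) (hT : 0 < T) {k : ℕ} (hk : k < p)
    {ε : ℝ} (hε : ε ∈ Ioo 0 ε₀) {τ r : ℝ} (hτ : τ ≤ T) (hr : s₀ + (k + 1) * m + m ≤ r)
    {u v : ℝ → ℕ → X s₀} (hu : B.JLC m r τ (k + 1) u) (hdu : IsJet τ ε (k + 1) u)
    (hv : B.JLC m r τ (k + 1) v) (hdv : IsJet τ ε (k + 1) v) {t : ℝ}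
    (ht : t ∈ Icc 0 τ) : HasDerivWithinAt (fun t => B.jetD hm T s₀ ε (F ε) k t (u t) (v t))
      (ε⁻¹ • B.jetD hm T s₀ ε (F ε) (k + 1) t (u t) (v t)) (Icc 0 τ) t :=
  hF.hasDerivWithinAt_jet hT k hε hτ (a := 0) (j := 1) (by omega) (by omega) (r := r)
    (by push_cast; linarith) (w := fun _ => v) hu (fun _ => hv) hdu (fun _ => hdv) ht

theorem jetN_congr (ε : ℝ) {k : ℕ} {t : ℝ} {u u' : ℕ → X s₀} (hu : ∀ i ≤ k, u i = u' i) :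
    B.jetN hm T s₀ ε (F ε) k t u = B.jetN hm T s₀ ε (F ε) k t u' :=
  jet_congr ε hu (fun l => l.elim0)

theorem jetD_congr (ε : ℝ) {k : ℕ} {t : ℝ} {u u' v v' : ℕ → X s₀} (hu : ∀ i ≤ k, u i = u' i)
    (hv : ∀ i ≤ k, v i = v' i) :
    B.jetD hm T s₀ ε (F ε) k t u v = B.jetD hm T s₀ ε (F ε) k t u' v' :=
  jet_congr ε hu (fun _ => hv)

/-- The right-hand side of the linearized equation in terms of jets. -/
theorem incl_linearized_rhs (hL : B.AssumptionL ε₀ T s₀ hm p L)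
    (hF : B.AssumptionF ε₀ T s₀ hm p F) (hT : 0 < T) {r r₁ r₂ : ℝ} (hr : s₀ ≤ r - m)
    (h₁ : r ≤ r₁) (h₂ : r ≤ r₂) {ε : ℝ} (hε : ε ∈ Ioo 0 ε₀) {t : ℝ} (ht : t ∈ Icc 0 T)
    {f u w : ℕ → X s₀} (hf : B.Mem r₂ (f 0)) (hu : B.Mem r₁ (u 0)) (hw : B.Mem r (w 0)) :
    B.incl hr (B.incl ((sub_le_self r hm).trans h₂) (B.up s₀ r₂ (f 0))
      - (1 / ε) • L ε t (r - m) (B.incl (sub_add_cancel r m).le (B.up s₀ r (w 0)))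
      - fderiv ℝ (F ε t (r - m)) (B.incl ((sub_add_cancel r m).le.trans h₁) (B.up s₀ r₁ (u 0)))
          (B.incl (sub_add_cancel r m).le (B.up s₀ r (w 0)))) =
    ε⁻¹ • (ε • f 0 - B.jetL s₀ ε (L ε) 0 0 t w - ε • B.jetD hm T s₀ ε (F ε) 0 t u w) := by
  have e : r - m + m ≤ r := (sub_add_cancel r m).le
  have hb : s₀ ≤ r - m + m := by linarith
  have hw' : B.Mem (r - m + m) (w 0) := hw.mono hb e
  have hu' : B.Mem (r - m + m) (u 0) := hu.mono hb (e.trans h₁)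
  rw [jetL_zero, hF.jetD_zero hT hr hε ht hu' hw', hL.opL_zero hr hε t hw',
    incl_up_of_mem hw hb e, incl_up_of_mem hu hb (e.trans h₁), map_sub, map_sub, map_smul,
    incl_up_of_mem hf hr, incl_up hr (hf.mono hr ((sub_le_self r hm).trans h₂)), one_div, smul_sub,
    smul_sub, smul_smul, smul_smul, inv_mul_cancel₀ hε.1.ne', one_smul, one_smul]

/-- The jets of order `≤ p + 1` of `v` are those of a solution of the linearized equation. -/
def LinEq (B : BanachScale X) {m : ℝ} (hm : 0 ≤ m) (T s₀ ε : ℝ)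
    (L : ℝ → ∀ s, X (s + m) →L[ℝ] X s) (F : ℝ → ∀ s, X (s + m) → X s) (p : ℕ) (t : ℝ)
    (u f v : ℕ → X s₀) : Prop :=
  -- This is the linearized equation multiplied by `ε` and differentiated `k` times by `ε ∂_t`: no
  -- negative power of `ε` is left.
  ∀ k ≤ p, v (k + 1) = ε • f k - B.jetL s₀ ε L k 0 t v - ε • B.jetD hm T s₀ ε F k t u v

/-- The hypothesis yields a solution that is merely continuous in time. As the equation expresses `ε
∂_t v` through `v`, `exists_jet_of_eq` provides `p + 1` derivatives, each at the cost `m`.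
Corrections start from the zero datum. -/
theorem AssumptionLin.exists_jet [∀ s, CompleteSpace (X s)]
    (hLin : B.AssumptionLin ε₀ T s₀ hm hd₁ hd₂ p L F)
    (hL : B.AssumptionL ε₀ T s₀ hm p L) (hF : B.AssumptionF ε₀ T s₀ hm p F) (hT : 0 < T) {r : ℝ}
    (hr : s₀ + (p + 1) * m ≤ r) {ε : ℝ} (hε : ε ∈ Ioo 0 ε₀) {u f : ℝ → ℕ → X s₀}
    (hu : B.JLC m (r + d₁) T (p + 1) u) (hdu : IsJet T ε (p + 1) u)
    (hf : B.JLC m (r + d₂) T p f) (hdf : IsJet T ε p f) :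
    ∃ v : ℝ → ℕ → X s₀, B.JLC m r T (p + 1) v ∧ IsJet T ε (p + 1) v ∧ v 0 0 = 0 ∧
      ∀ t ∈ Icc 0 T, B.LinEq hm T s₀ ε (L ε) (F ε) p t (u t) (f t) (v t) := by
  have hpm : 0 ≤ (p : ℝ) * m := by positivity
  have hrm : s₀ ≤ r - m := by linarith
  have hr0 : s₀ ≤ r := by linarith
  obtain ⟨C, -, h⟩ := hLin r (by linarith)
  obtain ⟨v, ⟨hvc, hv0, hvd⟩, -, -⟩ := h ε hε _ (hu.memX_and_dt (hm := hm) hT hdu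
    (by push_cast; linarith) (fun t _ => rfl)).1 _ (hf.memX_and_dt (hm := hm) hT hdf
    (by linarith) (fun t _ => rfl)).1 0
  have hkp : ∀ k ≤ p, (k : ℝ) * m ≤ p * m := fun k hk => by gcongr
  have hu' : ∀ k ≤ p + 1, B.JLC m r T k u := fun k hk => hu.mono hk (by linarith) (by
    have : (k : ℝ) * m ≤ (p + 1 : ℕ) * m := by gcongr
    push_cast at this; linarith) hm
  obtain ⟨w, hw0, hw1, hw2, hw3⟩ := exists_jet_of_eq (B := B) (m := m) (ε := ε) (τ := T) (r := r)
    (j := p) (x := fun t => B.incl hr0 (v t))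
    ⟨fun t _ => mem_incl _ _, by simpa using hvc⟩
    (fun k t w => ε • f t k - B.jetL s₀ ε (L ε) k 0 t w - ε • B.jetD hm T s₀ ε (F ε) k t (u t) w)
    (fun k t u v h => by rw [jetL_congr ε h, jetD_congr ε (fun _ _ => rfl) h])
    (fun k hk w hw hdw => by
      have := hkp k hk
      exact ((((hf k hk).mono (by linarith) (by linarith)).smul ε).sub
        (hL.lc_jetL k hε (by omega) (by linarith) hw)).sub
        ((hF.lc_jetD hT hk hε le_rfl (by linarith) (hu' k (by omega)) hw).smul ε))
    (fun k hk w hw hdw t ht => by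
      have := hkp (k + 1) hk
      push_cast at this
      refine ((((hdf k hk t ht).fun_const_smul ε).fun_sub
        (hL.hasDerivWithinAt_jetL k hε (by omega) (by linarith) hw hdw ht)).fun_sub
        ((hF.hasDerivWithinAt_jetD hT hk hε le_rfl (by linarith) (hu' (k + 1) (by omega))
          (hdu.mono (by omega)) hw hdw ht).fun_const_smul ε)).congr_deriv ?_
      simp only [smul_sub, smul_comm ε ε⁻¹])
    (fun w t ht hw => by
      have h1 := (B.incl hrm).hasFDerivAt.comp_hasDerivWithinAt t (hvd t ht)
      simp only [Function.comp_def, B.incl_incl] at h1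
      have hwm : B.Mem r (w 0) := by rw [hw]; exact mem_incl _ _
      have h2 := incl_linearized_rhs hL hF hT hrm (le_add_of_nonneg_right hd₁)
        (le_add_of_nonneg_right hd₂) hε ht (f := f t) (u := u t) (w := w)
        (by simpa using (hf 0 (by omega)).1 t ht) (by simpa using (hu 0 (by omega)).1 t ht) hwm
      rw [← h2]
      rw [hw, up_incl]
      exact h1)
  exact ⟨w, hw1, hw2, by rw [hw0, hv0, map_zero, map_zero], fun t ht k hk => hw3 k t⟩

/-- The energy estimate for the jets of a solution of the linearized equation. -/
theorem AssumptionLin.nrm_le [∀ s, CompleteSpace (X s)]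
    (hLin : B.AssumptionLin ε₀ T s₀ hm hd₁ hd₂ p L F)
    (hL : B.AssumptionL ε₀ T s₀ hm p L) (hF : B.AssumptionF ε₀ T s₀ hm p F) (hT : 0 < T) {s r : ℝ}
    (hs : s₀ + (p + 1) * m ≤ s) (hr : s ≤ r) (M : ℝ) : ∃ K, 0 ≤ K ∧ ∀ ε ∈ Ioo 0 ε₀,
    ∀ u f v : ℝ → ℕ → X s₀,
    B.JLC m (r + d₁) T (p + 1) u → IsJet T ε (p + 1) u → B.JLC m (r + d₂) T p f → IsJet T ε p f →
    B.JLC m r T 1 v → IsJet T ε 1 v → v 0 0 = 0 →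
    (∀ t ∈ Icc 0 T, B.LinEq hm T s₀ ε (L ε) (F ε) p t (u t) (f t) (v t)) → ∀ H,
    (∀ t ∈ Icc 0 T, B.pn m (s + d₁) (p + 1) (u t) ≤ M) →
    (∀ t ∈ Icc 0 T, B.pn m (r + d₁) (p + 1) (u t) ≤ H) → ∀ t ∈ Icc 0 T, ∀ φ ψ : ℝ → ℝ,
    ContinuousOn φ (Icc 0 t) → MonotoneOn φ (Icc 0 t) → ContinuousOn ψ (Icc 0 t) →
    MonotoneOn ψ (Icc 0 t) →
    (∀ t' ∈ Icc 0 t, B.pn m (r + d₂) p (f t') ≤ φ t') →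
    (∀ t' ∈ Icc 0 t, B.pn m (s + d₂) p (f t') ≤ ψ t') →
    B.nrm r (v t 0) ≤ K * ((∫ t' in (0 : ℝ)..t, φ t') + H * ∫ t' in (0 : ℝ)..t, ψ t') := by
  have hpm : 0 ≤ (p : ℝ) * m := by positivity
  have hrm : s₀ ≤ r - m := by linarith
  have hr0 : s₀ ≤ r := by linarith
  have hsr : s₀ + m ≤ r := by linarith
  obtain ⟨C, hC, h⟩ := hLin r hsr
  -- The argument of `C` is `(p + 2) M`, since `normX` of order `p + 1` is a sum of `p + 2` terms,
  -- each at most `M`.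
  have hK0 : 0 ≤ max (C (((p + 1 : ℕ) + 1) * M)) 0 := le_max_right _ _
  refine ⟨max (C (((p + 1 : ℕ) + 1) * M)) 0 * ((p + 1) * ((p + 1 : ℕ) + 1)),
    mul_nonneg hK0 (by positivity), fun ε hε u f v hu hdu hf hdf hv hdv hv0 hveq H huM huH t ht φ ψ
      hφc hφm hψc hψm hφ hψ => ?_⟩
  set ũ : ℝ → X (r + d₁) := fun t => B.up s₀ (r + d₁) (u t 0) with hũ
  set f' : ℝ → X (r + d₂) := fun t => B.up s₀ (r + d₂) (f t 0) with hf'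
  obtain ⟨w, -, huniq, hest⟩ := h ε hε ũ (hu.memX_and_dt (hm := hm) hT hdu
    (by push_cast; linarith) (fun t _ => rfl)).1 f' (hf.memX_and_dt (hm := hm) hT hdf
    (by linarith) (fun t _ => rfl)).1 0
  have hf0 : ∀ t ∈ Icc 0 T, B.Mem (r + d₂) (f t 0) := fun t ht => by
    simpa using (hf 0 (by omega)).1 t ht
  have hu0 : ∀ t ∈ Icc 0 T, B.Mem (r + d₁) (u t 0) := fun t ht => by
    simpa using (hu 0 (by omega)).1 t ht
  have hv0' : B.LC r T (fun t => v t 0) := by simpa using hv 0 (by omega)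
  have hv1 : B.LC (r - m) T (fun t => v t 1) := by simpa using hv 1 (by omega)
  -- The curve `v`, read at the level `r`, solves the linearized problem; uniqueness identifies it
  -- with the solution that carries the energy estimate.
  have hsol : B.IsLinearizedSolution hm ε T (L ε) (F ε) (le_add_of_nonneg_right hd₁)
      (le_add_of_nonneg_right hd₂)
      ((le_add_of_nonneg_right hd₂).trans (le_add_of_nonneg_right hm)) ũ f' 0
      (fun t => B.up s₀ r (v t 0)) := by
    refine ⟨hv0'.2, by simp [hv0], fun t ht => ?_⟩
    have h1 := LC.hasDerivWithinAt_up hrm (hv0'.mono hrm (by linarith)) (hv1.smul ε⁻¹)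
      (fun t ht => hdv 0 (by omega) t ht) ht
    refine (h1.congr (fun t ht => incl_up_of_mem (hv0'.1 t ht) hrm _)
      (incl_up_of_mem (hv0'.1 t ht) hrm _)).congr_deriv ?_
    apply B.incl_injective hrm
    rw [incl_linearized_rhs hL hF hT hrm (le_add_of_nonneg_right hd₁) (le_add_of_nonneg_right hd₂) hε ht (hf0 t ht) (hu0 t ht) (hv0'.1 t ht),
      incl_up hrm ((hv1.1 t ht).smul _)]
    exact congrArg _ (hveq t ht 0 (by omega))
  have hvt : B.nrm r (v t 0) = ‖w t‖ := by rw [← huniq _ hsol ht]; rfl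
  have hlo : B.normX hm T ε (p + 1) (fun τ => B.incl (add_le_add_left hsr d₁) (ũ τ)) ≤
      ((p + 1 : ℕ) + 1) * M := by
    have := normX_le (hm := hm) hT hε.1 (hu.mono le_rfl (add_le_add_left hr d₁)
      (by push_cast; linarith) hm) hdu (by push_cast; linarith) (fun _ _ => rfl)
      (add_le_add_left (show s₀ + m ≤ s by linarith) d₁) huM
    refine le_of_eq_of_le (normX_congr fun t ht => ?_) this
    simp only [hũ]
    rw [← incl_up_of_mem (hu0 t ht) (by linarith) (add_le_add_left hr d₁), B.incl_incl]
  have hhi : B.normX hm T ε (p + 1) ũ ≤ ((p + 1 : ℕ) + 1) * H := by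
    simpa only [B.incl_refl] using normX_le (hm := hm) hT hε.1 hu hdu (by push_cast; linarith)
      (fun _ _ => rfl) le_rfl huH
  have hEhi : B.energyI hm T ε p t f' 0 ≤ (p + 1) * ∫ t' in (0 : ℝ)..t, φ t' := by
    simpa only [B.incl_refl] using energyI_le (hm := hm) hT hε.1 hf hdf (by linarith)
      (fun _ _ => rfl) le_rfl ht hφc hφm hφ
  have hElo : B.energyI hm T ε p t (fun τ => B.incl (add_le_add_left hsr d₂) (f' τ))
      (B.incl (add_le_add_left (add_le_add_left hsr d₂) m) 0) ≤
      (p + 1) * ∫ t' in (0 : ℝ)..t, ψ t' := by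
    have := energyI_le (hm := hm) hT hε.1 (hf.mono le_rfl (add_le_add_left hr d₂)
      (by linarith) hm) hdf (by linarith) (fun _ _ => rfl)
      (add_le_add_left (show s₀ + m ≤ s by linarith) d₂) ht hψc hψm hψ
    rw [map_zero]
    refine le_of_eq_of_le (energyI_congr ht fun t ht => ?_) this
    simp only [hf']
    rw [← incl_up_of_mem (hf0 t ht) (by linarith) (add_le_add_left hr d₂), B.incl_incl]
  have hE1 : 0 ≤ B.energyI hm T ε p t f' 0 := energyI_nonneg hε.1 ht.1 _ _
  have hE2 : 0 ≤ B.energyI hm T ε p t (fun τ => B.incl (add_le_add_left hsr d₂) (f' τ))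
      (B.incl (add_le_add_left (add_le_add_left hsr d₂) m) 0) := energyI_nonneg hε.1 ht.1 _ _
  have hX0 : 0 ≤ B.normX hm T ε (p + 1) ũ := normX_nonneg hε.1 _
  have hH : 0 ≤ H := (pn_nonneg _ _ _ _).trans (huH t ht)
  have hφ0 : 0 ≤ ∫ t' in (0 : ℝ)..t, φ t' := intervalIntegral.integral_nonneg ht.1 fun t' ht' =>
    (pn_nonneg _ _ _ _).trans (hφ t' ht')
  have hψ0 : 0 ≤ ∫ t' in (0 : ℝ)..t, ψ t' := intervalIntegral.integral_nonneg ht.1 fun t' ht' =>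
    (pn_nonneg _ _ _ _).trans (hψ t' ht')
  rw [hvt]
  refine (hest t ht).trans ?_
  calc _ ≤ max (C (((p + 1 : ℕ) + 1) * M)) 0 * ((p + 1) * (∫ t' in (0 : ℝ)..t, φ t') +
        (((p + 1 : ℕ) + 1) * H) * ((p + 1) * ∫ t' in (0 : ℝ)..t, ψ t')) := by
        refine mul_le_mul ((hC hlo).trans (le_max_left _ _)) (add_le_add hEhi
          (mul_le_mul hhi hElo hE2 (hX0.trans hhi))) (add_nonneg hE1 (mul_nonneg hX0 hE2)) hK0
    _ ≤ max (C (((p + 1 : ℕ) + 1) * M)) 0 * ((p + 1) * ((p + 1 : ℕ) + 1) *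
        (∫ t' in (0 : ℝ)..t, φ t') +
        (((p + 1 : ℕ) + 1) * H) * ((p + 1) * ∫ t' in (0 : ℝ)..t, ψ t')) := by
        gcongr
        have h1 : (1 : ℝ) ≤ (p + 1 : ℕ) + 1 := le_add_of_nonneg_left (by positivity)
        exact le_mul_of_one_le_right (by positivity) h1
    _ = _ := by ring

/-- Each component of the jet of a solution of the linearized equation in terms of the lower ones. -/
theorem LinEq.nrm_succ_le (hL : B.AssumptionL ε₀ T s₀ hm p L)
    (hF : B.AssumptionF ε₀ T s₀ hm p F) (hT : 0 < T) {k : ℕ} (hk : k ≤ p) {s r : ℝ}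
    (hs : s₀ + (k + 1) * m ≤ s) (hr : s ≤ r) (M : ℝ) : ∃ K, 0 ≤ K ∧ ∀ ε ∈ Ioo 0 ε₀,
    ∀ t ∈ Icc 0 T, ∀ u f v : ℕ → X s₀, B.LinEq hm T s₀ ε (L ε) (F ε) p t u f v →
    B.JMem m r k u → B.JMem m r k v → B.pn m s k u ≤ M →
    B.nrm (r - (k + 1) * m) (v (k + 1)) ≤ ε * B.nrm (r - (k + 1) * m) (f k) +
      K * (B.pn m r k v + B.pn m r k u * B.pn m s k v) := by
  obtain ⟨K₁, hK₁, h₁⟩ := hL.jetL_bound k (a := 0) (by omega) (r := r) (by linarith)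
  obtain ⟨K₂, hK₂, h₂⟩ := hF.jetD_bound hT hk hs hr M
  refine ⟨K₁ + |ε₀| * K₂, by positivity, fun ε hε t ht u f v h hu hv huM => ?_⟩
  rw [h k hk]
  refine (nrm_sub_le _ _ _).trans ((add_le_add (nrm_sub_le _ _ _) le_rfl).trans ?_)
  rw [nrm_smul, nrm_smul, abs_of_pos hε.1]
  have b₁ := (h₁ ε hε t ht v hv).2
  have b₂ := (h₂ ε hε t ht u v hu hv huM).2
  have c1 := pn_nonneg (B := B) m r k v
  have c2 := pn_nonneg (B := B) m r k u
  have c3 := pn_nonneg (B := B) m s k v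
  have c4 : ε ≤ |ε₀| := hε.2.le.trans (le_abs_self _)
  have c5 : ε * B.nrm (r - (k + 1) * m) (B.jetD hm T s₀ ε (F ε) k t u v) ≤
      |ε₀| * (K₂ * (B.pn m r k v + B.pn m r k u * B.pn m s k v)) :=
    mul_le_mul c4 b₂ (nrm_nonneg _ _) (abs_nonneg _)
  have c6 : K₁ * B.pn m r k v ≤ K₁ * (B.pn m r k v + B.pn m r k u * B.pn m s k v) :=
    mul_le_mul_of_nonneg_left (le_add_of_nonneg_right (mul_nonneg c2 c3)) hK₁
  linarith

/-- The norm of the jet of a solution of the linearized equation. -/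
theorem LinEq.pn_le (hL : B.AssumptionL ε₀ T s₀ hm p L)
    (hF : B.AssumptionF ε₀ T s₀ hm p F) (hT : 0 < T) {s r : ℝ}
    (hs : s₀ + (p + 1) * m ≤ s) (hr : s ≤ r) (M : ℝ) (j : ℕ) (hj : j ≤ p + 1) : ∃ K, 0 ≤ K ∧
    ∀ ε ∈ Ioo 0 ε₀, ∀ t ∈ Icc 0 T, ∀ u f v : ℕ → X s₀,
    B.LinEq hm T s₀ ε (L ε) (F ε) p t u f v → B.JMem m r p u → B.JMem m r (p + 1) v →
    B.pn m s p u ≤ M → ∀ a c, 0 ≤ a → 0 ≤ c →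
    (∀ k < j, ε * B.nrm (r - (k + 1) * m) (f k) ≤ a) →
    (∀ k < j, ε * B.nrm (s - (k + 1) * m) (f k) ≤ c) →
    B.pn m s j v ≤ K * (B.nrm s (v 0) + c) ∧
    B.pn m r j v ≤ K * (B.nrm r (v 0) + a + B.pn m r p u * (B.nrm s (v 0) + c)) := by
  have hkp : ∀ k ≤ p, (k : ℝ) * m ≤ p * m := fun k hk => by gcongr
  induction j with
  | zero =>
    refine ⟨1, zero_le_one, fun ε hε t ht u f v h hu hv huM a c ha hc _ _ => ?_⟩
    have c1 := mul_nonneg (pn_nonneg (B := B) m r p u) (add_nonneg (nrm_nonneg (B := B) s (v 0)) hc)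
    rw [pn_zero_order, pn_zero_order]
    constructor <;> linarith
  | succ j ih =>
    obtain ⟨K, hK, h⟩ := ih (by omega)
    have hjp := hkp j (by omega)
    have hj1 : ((j + 1 : ℕ) : ℝ) * m = (j + 1) * m := by push_cast; ring
    have hsj : s₀ + (j + 1) * m ≤ s := by linarith
    obtain ⟨K₁, hK₁, h₁⟩ := LinEq.nrm_succ_le hL hF hT (k := j) (by omega) hsj hr M
    obtain ⟨K₂, hK₂, h₂⟩ := LinEq.nrm_succ_le hL hF hT (k := j) (by omega) hsj le_rfl M
    refine ⟨(K + K₁ * K + K₁ * K + 1) + (K + K₂ * (K + |M| * K) + 1), by positivity,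
      fun ε hε t ht u f v hv hum hvm huM a c ha hc hfa hfc => ?_⟩
    obtain ⟨i1, i2⟩ := h ε hε t ht u f v hv hum hvm huM a c ha hc (fun k hk => hfa k (by omega))
      (fun k hk => hfc k (by omega))
    have humj : B.JMem m r j u := hum.mono (by omega) le_rfl (by linarith) hm
    have hvmj : B.JMem m r j v := hvm.mono (by omega) le_rfl (by linarith) hm
    have huj : B.pn m r j u ≤ B.pn m r p u := pn_mono hum (by omega) le_rfl (by linarith) hm
    have husj : B.pn m s j u ≤ M :=
      (pn_mono (hum.mono le_rfl hr (by linarith) hm) (by omega) le_rfl (by linarith) hm).trans huM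
    have s1 := h₁ ε hε t ht u f v hv humj hvmj husj
    have s2 := h₂ ε hε t ht u f v hv (humj.mono le_rfl hr (by linarith) hm)
      (hvmj.mono le_rfl hr (by linarith) hm) husj
    have f1 := hfa j (by omega)
    have f2 := hfc j (by omega)
    rw [pn_succ, pn_succ, hj1]
    set S := B.nrm s (v 0) + c with hS
    set R := B.nrm r (v 0) + a with hR
    have hS0 : 0 ≤ S := add_nonneg (nrm_nonneg _ _) hc
    have hR0 : 0 ≤ R := add_nonneg (nrm_nonneg _ _) ha
    have hcS : c ≤ S := le_add_of_nonneg_left (nrm_nonneg _ _)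
    have haR : a ≤ R := le_add_of_nonneg_left (nrm_nonneg _ _)
    have hU := pn_nonneg (B := B) m r p u
    have hus0 := pn_nonneg (B := B) m s j u
    have hvs0 := pn_nonneg (B := B) m s j v
    have hur0 := pn_nonneg (B := B) m r j u
    set U := B.pn m r p u with hUdef
    -- The low estimate closes by itself because the low norm of `u` is at most `M`; the high one
    -- uses it, multiplied by the high norm of `u`.
    have q2 : B.pn m s j v + B.nrm (s - (j + 1) * m) (v (j + 1)) ≤
        (K + K₂ * (K + |M| * K) + 1) * S := by
      have : K₂ * (B.pn m s j v + B.pn m s j u * B.pn m s j v) ≤ K₂ * (K * S + |M| * (K * S)) := by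
        have := husj.trans (le_abs_self M)
        gcongr
      nlinarith
    have q1 : B.pn m r j v + B.nrm (r - (j + 1) * m) (v (j + 1)) ≤
        (K + K₁ * K + K₁ * K + 1) * (R + U * S) := by
      have e1 : K₁ * (B.pn m r j v + B.pn m r j u * B.pn m s j v) ≤
          K₁ * (K * (R + U * S) + U * (K * S)) := by gcongr
      have e2 : K₁ * (K * (R + U * S) + U * (K * S)) ≤ K₁ * (K * (R + U * S) + K * (R + U * S)) := by
        have : U * (K * S) ≤ K * (R + U * S) := by nlinarith [mul_nonneg hK hR0]
        gcongr
      have : 0 ≤ U * S := mul_nonneg hU hS0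
      nlinarith
    have z1 : 0 ≤ K + K₁ * K + K₁ * K + 1 := by positivity
    have z2 : 0 ≤ K + K₂ * (K + |M| * K) + 1 := by positivity
    have z3 : 0 ≤ R + U * S := by positivity
    refine ⟨q2.trans (mul_le_mul_of_nonneg_right (le_add_of_nonneg_left z1) hS0),
      q1.trans (mul_le_mul_of_nonneg_right (le_add_of_nonneg_right z2) z3)⟩

end BanachScale

/-! ### Smoothing operators acting on elements and on jets. -/

namespace BanachScale

variable {X : ℝ → Type*} [∀ s, NormedAddCommGroup (X s)] [∀ s, NormedSpace ℝ (X s)]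
variable {B : BanachScale X} {b r r' m : ℝ}

section Smoothing

variable {θ : ℝ} {x : X b}

theorem mem_smooth (hθ : 1 ≤ θ) (hb : b ≤ r) (x : X b) : B.Mem r (B.smooth θ b b x) :=
  ⟨hb, B.smooth θ b r x, B.incl_smooth θ hθ b hb x⟩

theorem up_smooth (hθ : 1 ≤ θ) (hb : b ≤ r) (x : X b) :
    B.up b r (B.smooth θ b b x) = B.smooth θ b r x := by
  rw [← B.incl_smooth θ hθ b hb x, up_incl]

theorem Mem.smooth_eq (hθ : 1 ≤ θ) (hx : B.Mem r x) (r' : ℝ) :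
    B.smooth θ b r' x = B.smooth θ r r' (B.up b r x) := by
  rw [← B.smooth_incl θ hθ hx.le, incl_up hx.le hx]

theorem continuous_smooth (hθ : 1 ≤ θ) (hb : b ≤ r) : Continuous (B.smooth θ b r) := by
  obtain ⟨C, hC⟩ := B.norm_smooth_le hb
  exact AddMonoidHomClass.continuous_of_bound (B.smooth θ b r) _ (hC θ hθ)

theorem nrm_smooth_le (B : BanachScale X) (hb : b ≤ r) (h : r ≤ r') :
    ∃ C, 0 ≤ C ∧ ∀ θ : ℝ, 1 ≤ θ → ∀ x : X b, B.Mem r x →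
      B.nrm r' (B.smooth θ b b x) ≤ C * θ ^ (r' - r) * B.nrm r x := by
  obtain ⟨C, hC⟩ := B.norm_smooth_le h
  refine ⟨max C 0, le_max_right _ _, fun θ hθ x hx => ?_⟩
  rw [nrm, up_smooth hθ (hb.trans h), hx.smooth_eq hθ]
  refine (hC θ hθ _).trans ?_
  have : 0 < θ := by linarith
  exact mul_le_mul_of_nonneg_right (mul_le_mul_of_nonneg_right (le_max_left _ _)
    (by positivity)) (norm_nonneg _)

theorem nrm_sub_smooth_le (B : BanachScale X) (hb : b ≤ r') (h : r' ≤ r) :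
    ∃ C, 0 ≤ C ∧ ∀ θ : ℝ, 1 ≤ θ → ∀ x : X b, B.Mem r x →
      B.nrm r' (x - B.smooth θ b b x) ≤ C * θ ^ (r' - r) * B.nrm r x := by
  -- The smoothing estimate of the scale concerns distinct indices; for equal ones the triangle
  -- inequality and the boundedness of `S_θ` replace it.
  rcases h.eq_or_lt with rfl | h
  · obtain ⟨C, hC0, hC⟩ := B.nrm_smooth_le hb (le_refl r')
    refine ⟨1 + C, by positivity, fun θ hθ x hx => (nrm_sub_le _ _ _).trans ?_⟩
    have := hC θ hθ x hx
    rw [sub_self, Real.rpow_zero, mul_one] at this ⊢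
    rw [add_mul, one_mul]
    exact add_le_add le_rfl this
  · obtain ⟨C, hC⟩ := B.norm_sub_smooth_le h
    refine ⟨max C 0, le_max_right _ _, fun θ hθ x hx => ?_⟩
    rw [nrm, map_sub, up_smooth hθ hb, hx.smooth_eq hθ, ← incl_up_of_mem hx hb h.le]
    refine (hC θ hθ _).trans ?_
    have : 0 < θ := by linarith
    exact mul_le_mul_of_nonneg_right (mul_le_mul_of_nonneg_right (le_max_left _ _)
      (by positivity)) (norm_nonneg _)

variable {τ ε : ℝ} {j : ℕ}

/-- The action of the smoothing operators on jets. -/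
noncomputable def smoothJet (B : BanachScale X) {b : ℝ} (θ : ℝ) (u : ℕ → X b) : ℕ → X b :=
  fun k => B.smooth θ b b (u k)

theorem LC.smooth {f : ℝ → X b} (hf : B.LC r τ f) (hθ : 1 ≤ θ) (hb : b ≤ r) (hb' : b ≤ r') :
    B.LC r' τ (fun t => B.smooth θ b b (f t)) :=
  ⟨fun _ _ => mem_smooth hθ hb' _, by
    simp only [up_smooth hθ hb']
    exact (continuous_smooth hθ hb').comp_continuousOn (hf.self hb)⟩

theorem JLC.smooth {u : ℝ → ℕ → X b} (hu : B.JLC m r τ j u) (hm : 0 ≤ m) (hθ : 1 ≤ θ)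
    (hb : b ≤ r - j * m) (hb' : b ≤ r' - j * m) :
    B.JLC m r' τ j (fun t => B.smoothJet θ (u t)) := fun k hk => by
  have : (k : ℝ) * m ≤ j * m := by gcongr
  exact (hu k hk).smooth hθ (by linarith) (by linarith)

theorem IsJet.smooth {u : ℝ → ℕ → X b} (hu : IsJet τ ε j u) (hθ : 1 ≤ θ) :
    IsJet τ ε j (fun t => B.smoothJet θ (u t)) := fun k hk t ht => by
  have := (⟨B.smooth θ b b, continuous_smooth hθ le_rfl⟩ : X b →L[ℝ] X b).hasFDerivAt
    |>.comp_hasDerivWithinAt t (hu k hk t ht)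
  rw [map_smul] at this
  exact this

theorem exists_uniform_bound (j : ℕ) (P : ℕ → ℝ → Prop) (hP : ∀ k C C', P k C → C ≤ C' → P k C')
    (h : ∀ k ≤ j, ∃ C, 0 ≤ C ∧ P k C) : ∃ C, 0 ≤ C ∧ ∀ k ≤ j, P k C := by
  choose! C hC hPC using h
  refine ⟨∑ k ∈ Finset.range (j + 1), C k, Finset.sum_nonneg fun k hk => hC k (by
    simpa [Nat.lt_succ_iff] using hk), fun k hk => hP k _ _ (hPC k hk) ?_⟩
  exact Finset.single_le_sum (fun i hi => hC i (by simpa [Nat.lt_succ_iff] using hi))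
    (Finset.mem_range.2 (by omega))

theorem pn_smooth_le (B : BanachScale X) (hm : 0 ≤ m) (j : ℕ) (hb : b ≤ r - j * m) (h : r ≤ r') :
    ∃ C, 0 ≤ C ∧ ∀ θ : ℝ, 1 ≤ θ → ∀ x : ℕ → X b, B.JMem m r j x →
      B.pn m r' j (B.smoothJet θ x) ≤ C * θ ^ (r' - r) * B.pn m r j x := by
  obtain ⟨C, hC0, hC⟩ := exists_uniform_bound j (fun k C => ∀ θ : ℝ, 1 ≤ θ → ∀ x : X b,
    B.Mem (r - k * m) x → B.nrm (r' - k * m) (B.smooth θ b b x) ≤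
      C * θ ^ (r' - r) * B.nrm (r - k * m) x)
    (fun k C C' h hCC θ hθ x hx => (h θ hθ x hx).trans (by
      have : 0 ≤ θ := by linarith
      have := nrm_nonneg (B := B) (r - k * m) x
      gcongr))
    (fun k hk => by
      have : (k : ℝ) * m ≤ j * m := by gcongr
      have := B.nrm_smooth_le (b := b) (r := r - k * m) (r' := r' - k * m) (by linarith)
        (by linarith)
      simpa using this)
  refine ⟨C, hC0, fun θ hθ x hx => ?_⟩
  rw [pn, pn, Finset.mul_sum]
  exact Finset.sum_le_sum fun k hk => hC k (by simpa [Nat.lt_succ_iff] using hk) θ hθ _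
    (hx k (by simpa [Nat.lt_succ_iff] using hk))

theorem pn_sub_smooth_le (B : BanachScale X) (hm : 0 ≤ m) (j : ℕ) (hb : b ≤ r' - j * m)
    (h : r' ≤ r) :
    ∃ C, 0 ≤ C ∧ ∀ θ : ℝ, 1 ≤ θ → ∀ x : ℕ → X b, B.JMem m r j x →
      B.pn m r' j (x - B.smoothJet θ x) ≤ C * θ ^ (r' - r) * B.pn m r j x := by
  obtain ⟨C, hC0, hC⟩ := exists_uniform_bound j (fun k C => ∀ θ : ℝ, 1 ≤ θ → ∀ x : X b,
    B.Mem (r - k * m) x → B.nrm (r' - k * m) (x - B.smooth θ b b x) ≤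
      C * θ ^ (r' - r) * B.nrm (r - k * m) x)
    (fun k C C' h hCC θ hθ x hx => (h θ hθ x hx).trans (by
      have : 0 ≤ θ := by linarith
      have := nrm_nonneg (B := B) (r - k * m) x
      gcongr))
    (fun k hk => by
      have : (k : ℝ) * m ≤ j * m := by gcongr
      have := B.nrm_sub_smooth_le (b := b) (r := r - k * m) (r' := r' - k * m) (by linarith)
        (by linarith)
      simpa using this)
  refine ⟨C, hC0, fun θ hθ x hx => ?_⟩
  rw [pn, pn, Finset.mul_sum]
  exact Finset.sum_le_sum fun k hk => hC k (by simpa [Nat.lt_succ_iff] using hk) θ hθ _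
    (hx k (by simpa [Nat.lt_succ_iff] using hk))

end Smoothing

/-! ### Dyadic decomposition. -/

section Dyadic

/-- The dyadic decomposition of the identity. -/
noncomputable def dyadic (B : BanachScale X) {b : ℝ} : ℕ → X b → X b
  | 0, x => B.smooth 1 b b x
  | n + 1, x => B.smooth (2 ^ (n + 1)) b b x - B.smooth (2 ^ n) b b x

theorem mem_dyadic (hb : b ≤ r) (n : ℕ) (x : X b) : B.Mem r (B.dyadic n x) := by
  cases n with
  | zero => exact mem_smooth le_rfl hb x
  | succ n =>
    exact (mem_smooth (one_le_pow₀ one_le_two) hb x).sub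
      (mem_smooth (one_le_pow₀ one_le_two) hb x)

/-- A block localises at the frequency `2 ^ n`, so it may be measured in any space. To go up, each
of its two smoothings is bounded separately; to go down, the block is rewritten as a difference of
two remainders `1 - S_θ`. -/
theorem nrm_dyadic_le (B : BanachScale X) (hb : b ≤ r) (hb' : b ≤ r') :
    ∃ C, 0 ≤ C ∧ ∀ (n : ℕ) (x : X b), B.Mem r x →
      B.nrm r' (B.dyadic n x) ≤ C * ((2 : ℝ) ^ n) ^ (r' - r) * B.nrm r x := by
  have h1 : ∀ n : ℕ, (1 : ℝ) ≤ 2 ^ n := fun n => one_le_pow₀ one_le_two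
  rcases le_total r r' with h | h
  · obtain ⟨C, hC0, hC⟩ := B.nrm_smooth_le hb h
    refine ⟨2 * C, by positivity, fun n x hx => ?_⟩
    have hx0 := nrm_nonneg (B := B) r x
    cases n with
    | zero =>
      have := hC 1 le_rfl x hx
      simp only [dyadic, pow_zero]
      rw [Real.one_rpow] at this ⊢
      nlinarith [mul_nonneg hC0 hx0]
    | succ n =>
      refine (nrm_sub_le _ _ _).trans ((add_le_add (hC _ (h1 _) x hx) (hC _ (h1 _) x hx)).trans ?_)
      have : ((2 : ℝ) ^ n) ^ (r' - r) ≤ ((2 : ℝ) ^ (n + 1)) ^ (r' - r) :=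
        Real.rpow_le_rpow (by positivity) (pow_le_pow_right₀ one_le_two (by omega)) (by linarith)
      calc _ ≤ C * ((2 : ℝ) ^ (n + 1)) ^ (r' - r) * B.nrm r x +
            C * ((2 : ℝ) ^ (n + 1)) ^ (r' - r) * B.nrm r x := by gcongr
        _ = _ := by ring
  · obtain ⟨C, hC0, hC⟩ := B.nrm_sub_smooth_le hb' h
    have hb2 : (0 : ℝ) < 2 ^ (r - r') := by positivity
    refine ⟨1 + C + C * 2 ^ (r - r'), by positivity, fun n x hx => ?_⟩
    have hx0 := nrm_nonneg (B := B) r x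
    cases n with
    | zero =>
      have h2 := hC 1 le_rfl x hx
      have h3 := nrm_mono hx hb' h
      have h4 : B.smooth 1 b b x = x - (x - B.smooth 1 b b x) := by abel
      simp only [dyadic, pow_zero]
      rw [h4]
      refine (nrm_sub_le _ _ _).trans ((add_le_add h3 h2).trans ?_)
      rw [Real.one_rpow]
      nlinarith [mul_nonneg (mul_nonneg hC0 hb2.le) hx0]
    | succ n =>
      have h4 : B.dyadic (n + 1) x = (x - B.smooth (2 ^ n) b b x) -
        (x - B.smooth (2 ^ (n + 1)) b b x) := by simp only [dyadic]; abel
      rw [h4]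
      refine (nrm_sub_le _ _ _).trans ((add_le_add (hC _ (h1 _) x hx) (hC _ (h1 _) x hx)).trans ?_)
      have h5 : ((2 : ℝ) ^ n) ^ (r' - r) = 2 ^ (r - r') * ((2 : ℝ) ^ (n + 1)) ^ (r' - r) := by
        rw [pow_succ, Real.mul_rpow (by positivity) (by positivity), mul_comm (((2 : ℝ) ^ n) ^ _),
          ← mul_assoc, ← Real.rpow_add two_pos]
        simp
      rw [h5]
      have h6 : 0 ≤ ((2 : ℝ) ^ (n + 1)) ^ (r' - r) * B.nrm r x := by positivity
      nlinarith

theorem summable_two_pow_rpow {η : ℝ} (hη : 0 < η) :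
    Summable (fun n : ℕ => ((2 : ℝ) ^ n) ^ (-η)) := by
  have h : ∀ n : ℕ, ((2 : ℝ) ^ n) ^ (-η) = ((2 : ℝ) ^ (-η)) ^ n := fun n => by
    rw [← Real.rpow_natCast, ← Real.rpow_natCast, ← Real.rpow_mul two_pos.le,
      ← Real.rpow_mul two_pos.le, mul_comm]
  simp only [h]
  exact summable_geometric_of_lt_one (by positivity)
    (Real.rpow_lt_one_of_one_lt_of_neg one_lt_two (by linarith))

/-- The partial sums telescope to `S_θ x` with `θ = 2 ^ n`, and these tend to `x` in `X b` because
`x` belongs to a strictly smaller space. -/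
theorem hasSum_dyadic [CompleteSpace (X b)] (hb : b < r) {x : X b} (hx : B.Mem r x) :
    HasSum (fun n => B.dyadic n x) x := by
  have h1 : ∀ n : ℕ, (1 : ℝ) ≤ 2 ^ n := fun n => one_le_pow₀ one_le_two
  obtain ⟨C, hC0, hC⟩ := B.nrm_dyadic_le hb.le (le_refl b)
  have hs : Summable (fun n : ℕ => ((2 : ℝ) ^ n) ^ (b - r)) := by
    simpa using summable_two_pow_rpow (sub_pos.2 hb)
  have hsum : Summable (fun n => B.dyadic n x) := by
    refine Summable.of_norm_bounded ((hs.mul_left C).mul_right (B.nrm r x)) fun n => ?_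
    have := hC n x hx
    rwa [nrm, up_self] at this
  rw [hsum.hasSum_iff_tendsto_nat, ← tendsto_add_atTop_iff_nat 1]
  have hpart : ∀ n : ℕ, ∑ i ∈ Finset.range (n + 1), B.dyadic i x = B.smooth (2 ^ n) b b x := by
    intro n
    induction n with
    | zero => simp [dyadic]
    | succ n ih => rw [Finset.sum_range_succ, ih]; simp [dyadic]
  simp only [hpart]
  obtain ⟨C', hC0', hC'⟩ := B.nrm_sub_smooth_le (le_refl b) hb.le
  rw [tendsto_iff_norm_sub_tendsto_zero]
  have hlim := (hs.tendsto_atTop_zero.const_mul C').mul_const (B.nrm r x)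
  rw [mul_zero, zero_mul] at hlim
  refine squeeze_zero (fun n => norm_nonneg _) (fun n => ?_) hlim
  have := hC' _ (h1 n) x hx
  rwa [nrm, up_self, norm_sub_rev] at this

end Dyadic

end BanachScale

/-! ### Curves with a prescribed jet at the time `0`. -/

open scoped ContDiff in
theorem exists_contDiff_iteratedDeriv_eq_ite (i : ℕ) : ∃ φ : ℝ → ℝ, ContDiff ℝ ∞ φ ∧
    (∀ k, ∃ C, ∀ x, |iteratedDeriv k φ x| ≤ C) ∧
      ∀ k, iteratedDeriv k φ 0 = if k = i then 1 else 0 := by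
  -- A cutoff equal to one near the origin, times `x ^ i / i!`: the jet at the origin is unaffected
  -- and compact support bounds all the derivatives.
  let χ : ContDiffBump (0 : ℝ) := ⟨1, 2, one_pos, one_lt_two⟩
  have hφ : ContDiff ℝ ∞ (fun x => χ x * ((i.factorial : ℝ)⁻¹ * x ^ i)) :=
    χ.contDiff.mul (by fun_prop)
  have hsupp : ∀ k, HasCompactSupport
      (iteratedDeriv k (fun x => χ x * ((i.factorial : ℝ)⁻¹ * x ^ i))) := by
    intro k
    induction k with
    | zero => rw [iteratedDeriv_zero]; exact χ.hasCompactSupport.mul_right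
    | succ k ih => rw [iteratedDeriv_succ]; exact ih.deriv
  refine ⟨_, hφ, fun k => ?_, fun k => ?_⟩
  · obtain ⟨C, hC⟩ := (hφ.continuous_iteratedDeriv k
      (by exact_mod_cast le_top)).bounded_above_of_compact_support (hsupp k)
    exact ⟨C, hC⟩
  · have h : (fun x => χ x * ((i.factorial : ℝ)⁻¹ * x ^ i)) =ᶠ[𝓝 0]
        fun x => (i.factorial : ℝ)⁻¹ * x ^ i := by
      filter_upwards [χ.eventuallyEq_one] with x hx
      rw [hx]; simp
    rw [h.iteratedDeriv_eq, iteratedDeriv_const_mul_field, iteratedDeriv_fun_pow_zero]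
    split_ifs with h1
    · subst h1
      simp [Nat.factorial_ne_zero]
    all_goals simp_all

namespace BanachScale

variable {X : ℝ → Type*} [∀ s, NormedAddCommGroup (X s)] [∀ s, NormedSpace ℝ (X s)]
variable {B : BanachScale X} {b r m : ℝ}

/-- The series converges already in `X ρ`, uniformly in `t`, and the inclusion into `X b` commutes
with the sum. -/
theorem tsum_mem_level [∀ s, CompleteSpace (X s)] {ρ : ℝ} (hb : b ≤ ρ) {g : ℕ → ℝ → X b}
    {u : ℕ → ℝ} (hu : Summable u) (hg : ∀ n t, B.Mem ρ (g n t))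
    (hc : ∀ n, Continuous fun t => B.up b ρ (g n t)) (hgu : ∀ n t, B.nrm ρ (g n t) ≤ u n) :
    (∀ t, B.Mem ρ (∑' n, g n t)) ∧ (Continuous fun t => B.up b ρ (∑' n, g n t)) ∧
      (∀ t, B.nrm ρ (∑' n, g n t) ≤ ∑' n, u n) ∧ ∀ t, Summable fun n => g n t := by
  have hs : ∀ t, Summable fun n => B.up b ρ (g n t) := fun t =>
    Summable.of_norm_bounded hu fun n => hgu n t
  have e : ∀ t, ∑' n, g n t = B.incl hb (∑' n, B.up b ρ (g n t)) := fun t => by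
    rw [ContinuousLinearMap.map_tsum _ (hs t)]
    exact tsum_congr fun n => (incl_up hb (hg n t)).symm
  refine ⟨fun t => ?_, ?_, fun t => ?_, fun t => ?_⟩
  · rw [e]; exact mem_incl _ _
  · simp only [e, up_incl]
    exact continuous_tsum hc hu fun n t => hgu n t
  · rw [e, nrm_incl]
    exact tsum_of_norm_bounded hu.hasSum fun n => hgu n t
  · refine ((B.incl hb).summable (hs t)).congr fun n => ?_
    exact incl_up hb (hg n t)

/-- A smooth function with bounded derivatives whose jet at the origin is that of `x ^ i / i!`. -/
noncomputable def monoBump (i : ℕ) : ℝ → ℝ := (exists_contDiff_iteratedDeriv_eq_ite i).choose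

theorem exists_monoBump_bound (i k : ℕ) : ∃ C, ∀ x, |iteratedDeriv k (monoBump i) x| ≤ C :=
  (exists_contDiff_iteratedDeriv_eq_ite i).choose_spec.2.1 k

theorem iteratedDeriv_monoBump_zero (i k : ℕ) :
    iteratedDeriv k (monoBump i) 0 = if k = i then 1 else 0 :=
  (exists_contDiff_iteratedDeriv_eq_ite i).choose_spec.2.2 k

theorem hasDerivAt_monoBump (i k : ℕ) (x : ℝ) : HasDerivAt (iteratedDeriv k (monoBump i))
    (iteratedDeriv (k + 1) (monoBump i) x) x := by
  rw [iteratedDeriv_succ]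
  exact ((exists_contDiff_iteratedDeriv_eq_ite i).choose_spec.1.differentiable_iteratedDeriv k
    (by exact_mod_cast WithTop.coe_lt_top _) x).hasDerivAt

/-- The terms of the series that defines `liftOne`. -/
noncomputable def liftTerm (B : BanachScale X) {b : ℝ} (m ε : ℝ) (i : ℕ) (a : X b) (k n : ℕ)
    (t : ℝ) : X b :=
  ((((2 : ℝ) ^ n) ^ m) ^ k / (((2 : ℝ) ^ n) ^ m) ^ i *
    iteratedDeriv k (monoBump i) (((2 : ℝ) ^ n) ^ m * t / ε)) • B.dyadic n a

/-- The jets of a curve whose jet at the time `0` is `a`, at the order `i`. -/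
noncomputable def liftOne (B : BanachScale X) {b : ℝ} (m ε : ℝ) (i : ℕ) (a : X b) (t : ℝ) (k : ℕ) :
    X b := ∑' n, B.liftTerm m ε i a k n t

/-- The jets of order `≤ j` of a curve with a given jet `a` at the time `0`. -/
noncomputable def lift (B : BanachScale X) {b : ℝ} (m ε : ℝ) (j : ℕ) (a : ℕ → X b) (t : ℝ) (k : ℕ) :
    X b := ∑ i ∈ Finset.range (j + 1), B.liftOne m ε i (a i) t k

/-- The `k`-th derivative of the rescaled profile contributes `2 ^ (n m (k - i))`, while moving a
block from `X (r - i m)` to `X (r - η - k m)` contributes `2 ^ (n ((i - k) m - η))`. Only `2 ^ (-n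
η)` remains, which is summable: this is the reason for the loss `η`. The time scale `t / ε` makes
the bound independent of `ε`. -/
theorem nrm_liftTerm_le (B : BanachScale X) {η : ℝ} (i k : ℕ) (hb : b ≤ r - i * m)
    (hb' : b ≤ r - η - k * m) : ∃ C, 0 ≤ C ∧ ∀ (ε : ℝ) (a : X b) (n : ℕ) (t : ℝ),
      B.Mem (r - i * m) a → B.nrm (r - η - k * m) (B.liftTerm m ε i a k n t) ≤
        C * B.nrm (r - i * m) a * ((2 : ℝ) ^ n) ^ (-η) := by
  obtain ⟨C₁, hC₁⟩ := exists_monoBump_bound i k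
  have hC₁0 : 0 ≤ C₁ := (abs_nonneg _).trans (hC₁ 0)
  obtain ⟨C₂, hC₂0, hC₂⟩ := B.nrm_dyadic_le hb hb'
  refine ⟨C₁ * C₂, by positivity, fun ε a n t ha => ?_⟩
  have h2 : (0 : ℝ) < 2 ^ n := by positivity
  have e : (((2 : ℝ) ^ n) ^ m) ^ k / (((2 : ℝ) ^ n) ^ m) ^ i *
      ((2 : ℝ) ^ n) ^ (r - η - k * m - (r - i * m)) = ((2 : ℝ) ^ n) ^ (-η) := by
    rw [← Real.rpow_mul_natCast h2.le, ← Real.rpow_mul_natCast h2.le, ← Real.rpow_sub h2,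
      ← Real.rpow_add h2]
    congr 1
    ring
  rw [liftTerm, nrm_smul, abs_mul, abs_of_nonneg (by positivity)]
  calc _ ≤ (((2 : ℝ) ^ n) ^ m) ^ k / (((2 : ℝ) ^ n) ^ m) ^ i * C₁ *
        (C₂ * ((2 : ℝ) ^ n) ^ (r - η - k * m - (r - i * m)) * B.nrm (r - i * m) a) := by
        gcongr
        · exact nrm_nonneg _ _
        · exact hC₁ _
        · exact hC₂ n a ha
    _ = C₁ * C₂ * B.nrm (r - i * m) a * ((((2 : ℝ) ^ n) ^ m) ^ k / (((2 : ℝ) ^ n) ^ m) ^ i *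
        ((2 : ℝ) ^ n) ^ (r - η - k * m - (r - i * m))) := by ring
    _ = _ := by rw [e]

theorem continuous_up_liftTerm (ρ ε : ℝ) (i : ℕ) (a : X b) (k n : ℕ) :
    Continuous fun t => B.up b ρ (B.liftTerm m ε i a k n t) := by
  simp only [liftTerm, map_smul]
  have : Continuous (iteratedDeriv k (monoBump i)) :=
    continuous_iff_continuousAt.2 fun x => (hasDerivAt_monoBump i k x).continuousAt
  fun_prop

theorem hasDerivAt_liftTerm (ε : ℝ) (i : ℕ) (a : X b) (k n : ℕ) (t : ℝ) :
    HasDerivAt (B.liftTerm m ε i a k n) (ε⁻¹ • B.liftTerm m ε i a (k + 1) n t) t := by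
  have h := (hasDerivAt_monoBump i k (((2 : ℝ) ^ n) ^ m * t / ε)).comp t
    (((hasDerivAt_id t).const_mul (((2 : ℝ) ^ n) ^ m)).div_const ε)
  refine ((h.const_mul ((((2 : ℝ) ^ n) ^ m) ^ k / (((2 : ℝ) ^ n) ^ m) ^ i)).smul_const
    (B.dyadic n a)).congr_deriv ?_
  rw [liftTerm, smul_smul]
  congr 1
  rw [pow_succ]
  ring

theorem liftOne_spec [∀ s, CompleteSpace (X s)] (B : BanachScale X) {η : ℝ} (hη : 0 < η) (i k : ℕ)
    (hb : b ≤ r - i * m) (hb' : b ≤ r - η - k * m) : ∃ C, 0 ≤ C ∧ ∀ (ε : ℝ) (a : X b),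
      B.Mem (r - i * m) a → (∀ t, B.Mem (r - η - k * m) (B.liftOne m ε i a t k)) ∧
      (Continuous fun t => B.up b (r - η - k * m) (B.liftOne m ε i a t k)) ∧
      ∀ t, B.nrm (r - η - k * m) (B.liftOne m ε i a t k) ≤ C * B.nrm (r - i * m) a := by
  obtain ⟨C, hC0, hC⟩ := B.nrm_liftTerm_le i k hb hb'
  have hs := summable_two_pow_rpow hη
  refine ⟨C * ∑' n : ℕ, ((2 : ℝ) ^ n) ^ (-η), mul_nonneg hC0 (tsum_nonneg fun n => by positivity),
    fun ε a ha => ?_⟩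
  obtain ⟨h1, h2, h3, -⟩ := tsum_mem_level (B := B) hb' (hs.mul_left (C * B.nrm (r - i * m) a))
    (fun n t => (mem_dyadic hb' n a).smul _) (continuous_up_liftTerm _ ε i a k)
    (fun n t => hC ε a n t ha)
  refine ⟨h1, h2, fun t => (h3 t).trans (le_of_eq ?_)⟩
  rw [tsum_mul_left]
  ring

theorem hasDerivAt_liftOne [∀ s, CompleteSpace (X s)] {η : ℝ} (hη : 0 < η) (hm : 0 ≤ m) (i k : ℕ)
    (hb : b ≤ r - i * m) (hb' : b ≤ r - η - (k + 1) * m) (ε : ℝ) {a : X b}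
    (ha : B.Mem (r - i * m) a) (t : ℝ) :
    HasDerivAt (fun t => B.liftOne m ε i a t k) (ε⁻¹ • B.liftOne m ε i a t (k + 1)) t := by
  have hb'' : b ≤ r - η - ((k + 1 : ℕ) : ℝ) * m := by push_cast; exact hb'
  have hb0 : b ≤ r - η - k * m := by linarith
  obtain ⟨C, hC0, hC⟩ := B.nrm_liftTerm_le i (k + 1) hb hb''
  obtain ⟨C', hC0', hC'⟩ := B.nrm_liftTerm_le i k hb hb0
  have hs := summable_two_pow_rpow hη
  obtain ⟨-, -, -, h4⟩ := tsum_mem_level (B := B) hb0 (hs.mul_left (C' * B.nrm (r - i * m) a))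
    (fun n t => (mem_dyadic hb0 n a).smul _) (continuous_up_liftTerm _ ε i a k)
    (fun n t => hC' ε a n t ha)
  have := hasDerivAt_tsum (g := fun n t => B.liftTerm m ε i a k n t)
    (g' := fun n t => ε⁻¹ • B.liftTerm m ε i a (k + 1) n t)
    ((hs.mul_left (C * B.nrm (r - i * m) a)).mul_left |ε⁻¹|)
    (fun n t => hasDerivAt_liftTerm ε i a k n t) (fun n t => by
      rw [norm_smul, Real.norm_eq_abs]
      exact mul_le_mul_of_nonneg_left ((norm_le_nrm ((mem_dyadic hb'' n a).smul _)).trans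
        (hC ε a n t ha)) (abs_nonneg _)) (h4 0) t
  rwa [tsum_const_smul''] at this

/-- At the origin the profile has only its `i`-th derivative, equal to one; the factors `2 ^ (n m)`
then cancel and the blocks of `a` add up to `a`. -/
theorem liftOne_zero [∀ s, CompleteSpace (X s)] (i k : ℕ) (hb : b < r - i * m) (ε : ℝ) {a : X b}
    (ha : B.Mem (r - i * m) a) : B.liftOne m ε i a 0 k = if k = i then a else 0 := by
  rw [liftOne]
  have h2 : ∀ n : ℕ, (0 : ℝ) < ((2 : ℝ) ^ n) ^ m := fun n => by positivity
  split_ifs with h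
  · subst h
    refine Eq.trans (tsum_congr fun n => ?_) (hasSum_dyadic hb ha).tsum_eq
    rw [liftTerm, mul_zero, zero_div, iteratedDeriv_monoBump_zero, if_pos rfl,
      div_self (pow_ne_zero _ (h2 n).ne'), one_mul, one_smul]
  · refine Eq.trans (tsum_congr fun n => ?_) tsum_zero
    rw [liftTerm, mul_zero, zero_div, iteratedDeriv_monoBump_zero, if_neg h, mul_zero, zero_smul]

section Lift

variable {η : ℝ} {j : ℕ}

theorem lift_zero [∀ s, CompleteSpace (X s)] (hm : 0 ≤ m) (hb : b < r - j * m) (ε : ℝ)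
    {a : ℕ → X b} (ha : B.JMem m r j a) {k : ℕ} (hk : k ≤ j) : B.lift m ε j a 0 k = a k := by
  rw [lift, Finset.sum_congr rfl fun i hi => ?_, Finset.sum_ite_eq (Finset.range (j + 1)) k a,
    if_pos (Finset.mem_range.2 (by omega))]
  have hi : i ≤ j := by simpa [Nat.lt_succ_iff] using hi
  have : (i : ℝ) * m ≤ j * m := by gcongr
  rw [liftOne_zero i k (by linarith) ε (ha i hi)]

theorem hasDerivAt_lift [∀ s, CompleteSpace (X s)] (hη : 0 < η) (hm : 0 ≤ m)
    (hb : b ≤ r - η - j * m) (ε : ℝ) {a : ℕ → X b} (ha : B.JMem m r j a) {k : ℕ} (hk : k < j)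
    (t : ℝ) : HasDerivAt (fun t => B.lift m ε j a t k) (ε⁻¹ • B.lift m ε j a t (k + 1)) t := by
  have hjk : ((k + 1 : ℕ) : ℝ) * m ≤ j * m := by gcongr; omega
  push_cast at hjk
  refine (HasDerivAt.fun_sum fun i hi => hasDerivAt_liftOne hη hm i k ?_ (by linarith) ε
    (ha i ?_) t).congr_deriv (by rw [← Finset.smul_sum]; rfl)
  all_goals
    have hi : i ≤ j := by simpa [Nat.lt_succ_iff] using hi
    have : (i : ℝ) * m ≤ j * m := by gcongr
  · linarith
  · exact hi

theorem lift_spec [∀ s, CompleteSpace (X s)] (B : BanachScale X) (hη : 0 < η) (hm : 0 ≤ m)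
    (hb : b ≤ r - η - j * m) : ∃ C, 0 ≤ C ∧ ∀ (ε : ℝ) (a : ℕ → X b), B.JMem m r j a →
      (∀ k ≤ j, (∀ t, B.Mem (r - η - k * m) (B.lift m ε j a t k)) ∧
      (Continuous fun t => B.up b (r - η - k * m) (B.lift m ε j a t k))) ∧
      ∀ t, B.pn m (r - η) j (B.lift m ε j a t) ≤ C * B.pn m r j a := by
  have hle : ∀ i ≤ j, (i : ℝ) * m ≤ j * m := fun i hi => by gcongr
  obtain ⟨C, hC0, hC⟩ := exists_uniform_bound j (fun k C => ∀ i ≤ j, ∀ (ε : ℝ) (a : X b),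
      B.Mem (r - i * m) a → (∀ t, B.Mem (r - η - k * m) (B.liftOne m ε i a t k)) ∧
      (Continuous fun t => B.up b (r - η - k * m) (B.liftOne m ε i a t k)) ∧
      ∀ t, B.nrm (r - η - k * m) (B.liftOne m ε i a t k) ≤ C * B.nrm (r - i * m) a)
    (fun k C C' h hCC i hi ε a ha => ⟨(h i hi ε a ha).1, (h i hi ε a ha).2.1, fun t =>
      ((h i hi ε a ha).2.2 t).trans (mul_le_mul_of_nonneg_right hCC (nrm_nonneg _ _))⟩)
    (fun k hk => exists_uniform_bound j (fun i C => ∀ (ε : ℝ) (a : X b),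
      B.Mem (r - i * m) a → (∀ t, B.Mem (r - η - k * m) (B.liftOne m ε i a t k)) ∧
      (Continuous fun t => B.up b (r - η - k * m) (B.liftOne m ε i a t k)) ∧
      ∀ t, B.nrm (r - η - k * m) (B.liftOne m ε i a t k) ≤ C * B.nrm (r - i * m) a)
      (fun i C C' h hCC ε a ha => ⟨(h ε a ha).1, (h ε a ha).2.1, fun t =>
        ((h ε a ha).2.2 t).trans (mul_le_mul_of_nonneg_right hCC (nrm_nonneg _ _))⟩)
      (fun i hi => B.liftOne_spec hη i k (by have := hle i hi; linarith)
        (by have := hle k hk; linarith)))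
  refine ⟨(j + 1) * C, by positivity, fun ε a ha => ⟨fun k hk => ⟨fun t => ?_, ?_⟩, fun t => ?_⟩⟩
  · exact mem_sum (by have := hle k hk; linarith) fun i hi => by
      have hi : i ≤ j := by simpa [Nat.lt_succ_iff] using hi
      exact (hC k hk i hi ε _ (ha i hi)).1 t
  · simp only [lift, map_sum]
    exact continuous_finsetSum _ fun i hi => by
      have hi : i ≤ j := by simpa [Nat.lt_succ_iff] using hi
      exact (hC k hk i hi ε _ (ha i hi)).2.1
  · rw [mul_assoc]
    refine pn_le_of_forall fun k hk => (nrm_sum_le _ _ _).trans ?_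
    rw [pn, Finset.mul_sum]
    exact Finset.sum_le_sum fun i hi => by
      have hi : i ≤ j := by simpa [Nat.lt_succ_iff] using hi
      exact (hC k hk i hi ε _ (ha i hi)).2.2 t

/-! ### Extension in time of curves of jets. -/

/-- The extension to larger times of a curve of jets given on `[0, τ]`. -/
noncomputable def extend (B : BanachScale X) {b : ℝ} (m ε : ℝ) (j : ℕ) (τ : ℝ) (u : ℝ → ℕ → X b)
    (t : ℝ) : ℕ → X b := if t ≤ τ then u t else B.lift m ε j (u τ) (t - τ)

theorem extend_of_le {ε τ t : ℝ} {u : ℝ → ℕ → X b} (ht : t ≤ τ) :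
    B.extend m ε j τ u t = u t := if_pos ht

variable {τ T : ℝ}

theorem JLC.extend [∀ s, CompleteSpace (X s)] (hη : 0 < η) (hm : 0 ≤ m)
    (hb : b ≤ r - η - j * m) (hτ : 0 ≤ τ) {ε : ℝ} {u : ℝ → ℕ → X b} (hu : B.JLC m r τ j u) :
    B.JLC m (r - η) T j (B.extend m ε j τ u) := fun k hk => by
  obtain ⟨C, -, hC⟩ := B.lift_spec (r := r) (j := j) hη hm hb
  have hτm : τ ∈ Icc 0 τ := ⟨hτ, le_rfl⟩
  have hkj : (k : ℝ) * m ≤ j * m := by gcongr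
  obtain ⟨h1, h2⟩ := (hC ε (u τ) (hu.jmem hτm)).1 k hk
  have hu' := (hu k hk).mono (r' := r - η - k * m) (by linarith) (by linarith)
  refine ⟨fun t ht => ?_, ?_⟩
  · simp only [BanachScale.extend]
    split_ifs with h
    · exact hu'.1 t ⟨ht.1, h⟩
    · exact h1 _
  · have e : (fun t => B.up b (r - η - k * m) (B.extend m ε j τ u t k)) = fun t =>
        if t ≤ τ then B.up b (r - η - k * m) (u t k)
        else B.up b (r - η - k * m) (B.lift m ε j (u τ) (t - τ) k) := by
      funext t
      simp only [BanachScale.extend]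
      split_ifs <;> rfl
    rw [e]
    refine ContinuousOn.if (fun t ht => ?_) ?_ ?_
    · have : t = τ := by
        have := frontier_le_subset_eq (continuous_id (X := ℝ)) continuous_const ht.2
        exact this
      subst this
      rw [sub_self, lift_zero (r := r) hm (by linarith) ε (hu.jmem hτm) hk]
    · refine hu'.2.mono fun t ht => ⟨ht.1.1, ?_⟩
      have := ht.2
      rwa [show {a : ℝ | a ≤ τ} = Iic τ from rfl, closure_Iic] at this
    · exact (h2.comp (continuous_id.sub continuous_const)).continuousOn

/-- Away from `τ` the relation is inherited from one of the two pieces. At `τ` the lift has the jet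
of `u`, so that the two one-sided derivatives agree and are glued. -/
theorem IsJet.extend [∀ s, CompleteSpace (X s)] (hη : 0 < η) (hm : 0 ≤ m)
    (hb : b ≤ r - η - j * m) (hτ : 0 ≤ τ) {ε : ℝ} {u : ℝ → ℕ → X b} (hu : B.JLC m r τ j u)
    (hdu : IsJet τ ε j u) : IsJet T ε j (B.extend m ε j τ u) := fun k hk t ht => by
  have hτm : τ ∈ Icc 0 τ := ⟨hτ, le_rfl⟩
  have hz : ∀ i ≤ j, B.lift m ε j (u τ) 0 i = u τ i := fun i hi =>
    lift_zero (r := r) hm (by linarith) ε (hu.jmem hτm) hi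
  have hl : ∀ t, HasDerivAt (fun t => B.lift m ε j (u τ) (t - τ) k)
      (ε⁻¹ • B.lift m ε j (u τ) (t - τ) (k + 1)) t := fun t =>
    (hasDerivAt_lift hη hm hb ε (hu.jmem hτm) hk (t - τ)).comp_sub_const t τ
  rcases lt_trichotomy t τ with h | h | h
  · have h1 := hdu k hk t ⟨ht.1, h.le⟩
    rw [extend_of_le h.le]
    refine ((h1.congr (fun s hs => ?_) ?_).mono_of_mem_nhdsWithin ?_)
    · rw [extend_of_le hs.2]
    · rw [extend_of_le h.le]
    · filter_upwards [self_mem_nhdsWithin, mem_nhdsWithin_of_mem_nhds (Iio_mem_nhds h)] with s hs hs'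
      exact ⟨hs.1, le_of_lt hs'⟩
  · subst h
    have h1 := hdu k hk t ⟨ht.1, le_rfl⟩
    have h2 := (hl t).hasDerivWithinAt (s := Ici t)
    rw [extend_of_le le_rfl]
    rw [sub_self, hz (k + 1) hk] at h2
    have h3 := (h1.congr (f₁ := fun s => B.extend m ε j t u s k)
      (fun s hs => by rw [extend_of_le hs.2]) (by rw [extend_of_le le_rfl])).union
      (h2.congr (f₁ := fun s => B.extend m ε j t u s k) (fun s hs => ?_) ?_)
    · exact h3.mono fun s hs => (le_total s t).imp (fun h => ⟨hs.1, h⟩) id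
    · rcases (mem_Ici.1 hs).eq_or_lt with h | h
      · rw [← h, extend_of_le le_rfl, sub_self, hz k hk.le]
      · rw [BanachScale.extend, if_neg (not_le.2 h)]
    · rw [extend_of_le le_rfl, sub_self, hz k hk.le]
  · have h2 : HasDerivAt (fun s => B.extend m ε j τ u s k)
        (ε⁻¹ • B.lift m ε j (u τ) (t - τ) (k + 1)) t := by
      refine (hl t).congr_of_eventuallyEq ?_
      filter_upwards [Ioi_mem_nhds h] with s hs
      rw [BanachScale.extend, if_neg (not_le.2 hs)]
    rw [BanachScale.extend, if_neg (not_le.2 h)]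
    exact h2.hasDerivWithinAt

theorem pn_extend_le [∀ s, CompleteSpace (X s)] (B : BanachScale X) (hη : 0 < η) (hm : 0 ≤ m)
    (hb : b ≤ r - η - j * m) : ∃ C, 1 ≤ C ∧ ∀ (ε τ T M : ℝ) (u : ℝ → ℕ → X b), 0 ≤ τ →
      B.JLC m r τ j u → (∀ t ∈ Icc 0 τ, B.pn m r j (u t) ≤ M) →
      ∀ t ∈ Icc 0 T, B.pn m (r - η) j (B.extend m ε j τ u t) ≤ C * M := by
  obtain ⟨C, hC0, hC⟩ := B.lift_spec (r := r) (j := j) hη hm hb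
  refine ⟨C + 1, by linarith, fun ε τ T M u hτ hu hM t ht => ?_⟩
  have hM0 : 0 ≤ M := (pn_nonneg _ _ _ _).trans (hM 0 ⟨le_rfl, hτ⟩)
  have hτm : τ ∈ Icc 0 τ := ⟨hτ, le_rfl⟩
  simp only [BanachScale.extend]
  split_ifs with h
  · refine (pn_mono (hu.jmem ⟨ht.1, h⟩) le_rfl (by linarith) hb hm).trans ((hM t ⟨ht.1, h⟩).trans ?_)
    nlinarith
  · refine ((hC ε (u τ) (hu.jmem hτm)).2 _).trans ?_
    have := mul_le_mul_of_nonneg_left (hM τ hτm) hC0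
    linarith

end Lift

end BanachScale

/-! ### Estimates for full jets: the nonlinear term and the linearized problem. -/

namespace BanachScale

variable {X : ℝ → Type*} [∀ s, NormedAddCommGroup (X s)] [∀ s, NormedSpace ℝ (X s)]
variable {B : BanachScale X} {m : ℝ} {hm : 0 ≤ m} {ε₀ T s₀ d₁ d₂ : ℝ} {hd₁ : 0 ≤ d₁}
  {hd₂ : 0 ≤ d₂} {p : ℕ} {F : ℝ → ℝ → ∀ s, X (s + m) → X s}
  {L : ℝ → ℝ → ∀ s, X (s + m) →L[ℝ] X s}

section NonlinearTerm

variable {r s τ : ℝ}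

theorem AssumptionF.jlc_jetN (hF : B.AssumptionF ε₀ T s₀ hm p F) (hT : 0 < T) {ε : ℝ}
    (hε : ε ∈ Ioo 0 ε₀) (hτ : τ ≤ T) (hr : s₀ + (p + 1) * m ≤ r) {u : ℝ → ℕ → X s₀}
    (hu : B.JLC m r τ p u) :
    B.JLC m (r - m) τ p (fun t k => B.jetN hm T s₀ ε (F ε) k t (u t)) := fun k hk => by
  have hkp : (k : ℝ) * m ≤ p * m := by gcongr
  have := hF.lc_jetN hT hk hε hτ (r := r) (by linarith) (hu.mono hk le_rfl (by linarith) hm)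
  rwa [show r - m - k * m = r - (k + 1) * m by ring]

theorem AssumptionF.jlc_jetD (hF : B.AssumptionF ε₀ T s₀ hm p F) (hT : 0 < T) {ε : ℝ}
    (hε : ε ∈ Ioo 0 ε₀) (hτ : τ ≤ T) (hr : s₀ + (p + 1) * m ≤ r) {u v : ℝ → ℕ → X s₀}
    (hu : B.JLC m r τ p u) (hv : B.JLC m r τ p v) :
    B.JLC m (r - m) τ p (fun t k => B.jetD hm T s₀ ε (F ε) k t (u t) (v t)) := fun k hk => by
  have hkp : (k : ℝ) * m ≤ p * m := by gcongr
  have := hF.lc_jetD hT hk hε hτ (r := r) (by linarith) (hu.mono hk le_rfl (by linarith) hm)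
    (hv.mono hk le_rfl (by linarith) hm)
  rwa [show r - m - k * m = r - (k + 1) * m by ring]

theorem AssumptionF.isJet_jetN [∀ s, CompleteSpace (X s)] (hF : B.AssumptionF ε₀ T s₀ hm p F)
    (hT : 0 < T) {ε : ℝ} (hε : ε ∈ Ioo 0 ε₀) (hτ : τ ≤ T) (hr : s₀ + (p + 1) * m ≤ r)
    {u : ℝ → ℕ → X s₀} (hu : B.JLC m r τ p u) (hdu : IsJet τ ε p u) :
    IsJet τ ε p (fun t k => B.jetN hm T s₀ ε (F ε) k t (u t)) := fun k hk t ht => by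
  have hkp : ((k + 1 : ℕ) : ℝ) * m ≤ p * m := by gcongr; omega
  push_cast at hkp
  exact hF.hasDerivWithinAt_jetN hT hk hε hτ (r := r) (by linarith)
    (hu.mono hk le_rfl (by push_cast; linarith) hm) (hdu.mono hk) ht

theorem AssumptionF.isJet_jetD [∀ s, CompleteSpace (X s)] (hF : B.AssumptionF ε₀ T s₀ hm p F)
    (hT : 0 < T) {ε : ℝ} (hε : ε ∈ Ioo 0 ε₀) (hτ : τ ≤ T) (hr : s₀ + (p + 1) * m ≤ r)
    {u v : ℝ → ℕ → X s₀} (hu : B.JLC m r τ p u) (hdu : IsJet τ ε p u) (hv : B.JLC m r τ p v)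
    (hdv : IsJet τ ε p v) :
    IsJet τ ε p (fun t k => B.jetD hm T s₀ ε (F ε) k t (u t) (v t)) := fun k hk t ht => by
  have hkp : ((k + 1 : ℕ) : ℝ) * m ≤ p * m := by gcongr; omega
  push_cast at hkp
  exact hF.hasDerivWithinAt_jetD hT hk hε hτ (r := r) (by linarith)
    (hu.mono hk le_rfl (by push_cast; linarith) hm) (hdu.mono hk)
    (hv.mono hk le_rfl (by push_cast; linarith) hm) (hdv.mono hk) ht

/-- The order `k` of a nonlinear or linear term lands in `X (r - (k + 1) m)`; all orders together
thus form a jet at the level `r - m`. -/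
theorem pn_le_of_level {b C : ℝ} {j : ℕ} {x : ℕ → X b}
    (h : ∀ k ≤ j, B.nrm (r - (k + 1) * m) (x k) ≤ C) : B.pn m (r - m) j x ≤ (j + 1) * C :=
  pn_le_of_forall fun k hk => by
    rw [show r - m - k * m = r - (k + 1) * m by ring]
    exact h k hk

theorem AssumptionF.pn_jetN_le (hF : B.AssumptionF ε₀ T s₀ hm p F) (hT : 0 < T)
    (hs : s₀ + (p + 1) * m ≤ s) (hsr : s ≤ r) (M : ℝ) :
    ∃ K, 0 ≤ K ∧ ∀ ε ∈ Ioo 0 ε₀, ∀ t ∈ Icc 0 T, ∀ u : ℕ → X s₀, B.JMem m r p u →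
      B.pn m s p u ≤ M →
      B.pn m (r - m) p (fun k => B.jetN hm T s₀ ε (F ε) k t u) ≤ K * B.pn m r p u := by
  have hkp : ∀ k ≤ p, (k : ℝ) * m ≤ p * m := fun k hk => by gcongr
  obtain ⟨K, hK0, hK⟩ := exists_uniform_bound p (fun k K => ∀ ε ∈ Ioo 0 ε₀, ∀ t ∈ Icc 0 T,
      ∀ u : ℕ → X s₀, B.JMem m r p u → B.pn m s p u ≤ M →
      B.nrm (r - (k + 1) * m) (B.jetN hm T s₀ ε (F ε) k t u) ≤ K * B.pn m r p u)
    (fun k C C' h hCC ε hε t ht u hu hM => (h ε hε t ht u hu hM).trans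
      (mul_le_mul_of_nonneg_right hCC (pn_nonneg _ _ _ _)))
    (fun k hk => by
      have := hkp k hk
      obtain ⟨K, hK0, hK⟩ := hF.jetN_bound hT hk (s := s) (r := r) (by linarith) hsr M
      refine ⟨K, hK0, fun ε hε t ht u hu hM => ?_⟩
      have h1 : ∀ {x : ℕ → X s₀}, B.JMem m r p x → B.pn m r k x ≤ B.pn m r p x := fun hx =>
        pn_mono hx hk le_rfl (by linarith) hm
      have h2 : ∀ {x : ℕ → X s₀}, B.JMem m r p x → B.pn m s k x ≤ B.pn m s p x := fun hx =>
        pn_mono (hx.mono le_rfl hsr (by linarith) hm) hk le_rfl (by linarith) hm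
      exact (hK ε hε t ht u (hu.mono hk le_rfl (by linarith) hm) ((h2 hu).trans hM)).2.trans
        (mul_le_mul_of_nonneg_left (h1 hu) hK0))
  refine ⟨(p + 1) * K, by positivity, fun ε hε t ht u hu hM => ?_⟩
  rw [mul_assoc]
  exact pn_le_of_level fun k hk => hK k hk ε hε t ht u hu hM

theorem AssumptionF.pn_jetD_sub_le [∀ s, CompleteSpace (X s)] (hF : B.AssumptionF ε₀ T s₀ hm p F)
    (hT : 0 < T) (hs : s₀ + (p + 1) * m ≤ s) (hsr : s ≤ r) (M : ℝ) :
    ∃ K, 0 ≤ K ∧ ∀ ε ∈ Ioo 0 ε₀, ∀ t ∈ Icc 0 T, ∀ u w v : ℕ → X s₀, B.JMem m r p u →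
      B.JMem m r p w → B.JMem m r p v → B.pn m s p u ≤ M → B.pn m s p w ≤ M →
      B.pn m (r - m) p (fun k =>
        B.jetD hm T s₀ ε (F ε) k t (u + w) v - B.jetD hm T s₀ ε (F ε) k t u v) ≤
        K * (B.pn m r p v * B.pn m s p w + B.pn m r p w * B.pn m s p v +
          (B.pn m r p u + B.pn m r p w) * (B.pn m s p v * B.pn m s p w)) := by
  have hkp : ∀ k ≤ p, (k : ℝ) * m ≤ p * m := fun k hk => by gcongr
  obtain ⟨K, hK0, hK⟩ := exists_uniform_bound p (fun k K => ∀ ε ∈ Ioo 0 ε₀, ∀ t ∈ Icc 0 T,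
      ∀ u w v : ℕ → X s₀, B.JMem m r p u → B.JMem m r p w → B.JMem m r p v →
      B.pn m s p u ≤ M → B.pn m s p w ≤ M →
      B.nrm (r - (k + 1) * m)
        (B.jetD hm T s₀ ε (F ε) k t (u + w) v - B.jetD hm T s₀ ε (F ε) k t u v) ≤
        K * (B.pn m r p v * B.pn m s p w + B.pn m r p w * B.pn m s p v +
          (B.pn m r p u + B.pn m r p w) * (B.pn m s p v * B.pn m s p w)))
    (fun k C C' h hCC ε hε t ht u w v hu hw hv hM hM' => (h ε hε t ht u w v hu hw hv hM hM').trans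
      (mul_le_mul_of_nonneg_right hCC (by
        have := pn_nonneg (B := B) m r p v
        have := pn_nonneg (B := B) m r p w
        have := pn_nonneg (B := B) m r p u
        have := pn_nonneg (B := B) m s p v
        have := pn_nonneg (B := B) m s p w
        positivity)))
    (fun k hk => by
      have := hkp k hk
      obtain ⟨K, hK0, hK⟩ := hF.jetD_sub_bound hT hk (s := s) (r := r) (by linarith) hsr M
      refine ⟨K, hK0, fun ε hε t ht u w v hu hw hv hM hM' => ?_⟩
      have h1 : ∀ {x : ℕ → X s₀}, B.JMem m r p x → B.pn m r k x ≤ B.pn m r p x := fun hx =>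
        pn_mono hx hk le_rfl (by linarith) hm
      have h2 : ∀ {x : ℕ → X s₀}, B.JMem m r p x → B.pn m s k x ≤ B.pn m s p x := fun hx =>
        pn_mono (hx.mono le_rfl hsr (by linarith) hm) hk le_rfl (by linarith) hm
      have h3 : ∀ {x : ℕ → X s₀}, B.JMem m r p x → B.JMem m r k x := fun hx =>
        hx.mono hk le_rfl (by linarith) hm
      refine (hK ε hε t ht u w v (h3 hu) (h3 hw) (h3 hv) ((h2 hu).trans hM)
        ((h2 hw).trans hM')).trans (mul_le_mul_of_nonneg_left ?_ hK0)
      have a1 := pn_nonneg (B := B) m r k v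
      have a2 := pn_nonneg (B := B) m r k w
      have a3 := pn_nonneg (B := B) m r k u
      have a4 := pn_nonneg (B := B) m s k v
      have a5 := pn_nonneg (B := B) m s k w
      have b1 := h1 hv
      have b2 := h1 hw
      have b3 := h1 hu
      have b4 := h2 hv
      have b5 := h2 hw
      have c1 := a1.trans b1
      have c2 := a2.trans b2
      have c3 := a3.trans b3
      have c4 := a4.trans b4
      gcongr)
  refine ⟨(p + 1) * K, by positivity, fun ε hε t ht u w v hu hw hv hM hM' => ?_⟩
  rw [mul_assoc]
  exact pn_le_of_level fun k hk => hK k hk ε hε t ht u w v hu hw hv hM hM'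

theorem AssumptionF.pn_jetN_sub_le [∀ s, CompleteSpace (X s)] (hF : B.AssumptionF ε₀ T s₀ hm p F)
    (hT : 0 < T) (hs : s₀ + (p + 1) * m ≤ s) (hsr : s ≤ r) (M : ℝ) :
    ∃ K, 0 ≤ K ∧ ∀ ε ∈ Ioo 0 ε₀, ∀ t ∈ Icc 0 T, ∀ u v : ℕ → X s₀, B.JMem m r p u →
      B.JMem m r p v → B.pn m s p u ≤ M → B.pn m s p v ≤ M →
      B.pn m (r - m) p (fun k => B.jetN hm T s₀ ε (F ε) k t (u + v) -
        B.jetN hm T s₀ ε (F ε) k t u - B.jetD hm T s₀ ε (F ε) k t u v) ≤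
        K * (2 * B.pn m r p v * B.pn m s p v +
          (B.pn m r p u + B.pn m r p v) * B.pn m s p v ^ 2) := by
  have hkp : ∀ k ≤ p, (k : ℝ) * m ≤ p * m := fun k hk => by gcongr
  obtain ⟨K, hK0, hK⟩ := exists_uniform_bound p (fun k K => ∀ ε ∈ Ioo 0 ε₀, ∀ t ∈ Icc 0 T,
      ∀ u v : ℕ → X s₀, B.JMem m r p u → B.JMem m r p v →
      B.pn m s p u ≤ M → B.pn m s p v ≤ M →
      B.nrm (r - (k + 1) * m) (B.jetN hm T s₀ ε (F ε) k t (u + v) -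
        B.jetN hm T s₀ ε (F ε) k t u - B.jetD hm T s₀ ε (F ε) k t u v) ≤
        K * (2 * B.pn m r p v * B.pn m s p v +
          (B.pn m r p u + B.pn m r p v) * B.pn m s p v ^ 2))
    (fun k C C' h hCC ε hε t ht u v hu hv hM hM' => (h ε hε t ht u v hu hv hM hM').trans
      (mul_le_mul_of_nonneg_right hCC (by
        have := pn_nonneg (B := B) m r p v
        have := pn_nonneg (B := B) m r p u
        have := pn_nonneg (B := B) m s p v
        positivity)))
    (fun k hk => by
      have := hkp k hk
      obtain ⟨K, hK0, hK⟩ := hF.jetN_sub_bound hT hk (s := s) (r := r) (by linarith) hsr M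
      refine ⟨K, hK0, fun ε hε t ht u v hu hv hM hM' => ?_⟩
      have h1 : ∀ {x : ℕ → X s₀}, B.JMem m r p x → B.pn m r k x ≤ B.pn m r p x := fun hx =>
        pn_mono hx hk le_rfl (by linarith) hm
      have h2 : ∀ {x : ℕ → X s₀}, B.JMem m r p x → B.pn m s k x ≤ B.pn m s p x := fun hx =>
        pn_mono (hx.mono le_rfl hsr (by linarith) hm) hk le_rfl (by linarith) hm
      have h3 : ∀ {x : ℕ → X s₀}, B.JMem m r p x → B.JMem m r k x := fun hx =>
        hx.mono hk le_rfl (by linarith) hm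
      refine (hK ε hε t ht u v (h3 hu) (h3 hv) ((h2 hu).trans hM)
        ((h2 hv).trans hM')).trans (mul_le_mul_of_nonneg_left ?_ hK0)
      have a1 := pn_nonneg (B := B) m r k v
      have a3 := pn_nonneg (B := B) m r k u
      have a4 := pn_nonneg (B := B) m s k v
      have b1 := h1 hv
      have b3 := h1 hu
      have b4 := h2 hv
      have c1 := a1.trans b1
      have c3 := a3.trans b3
      have c4 := a4.trans b4
      gcongr)
  refine ⟨(p + 1) * K, by positivity, fun ε hε t ht u v hu hv hM hM' => ?_⟩
  rw [mul_assoc]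
  exact pn_le_of_level fun k hk => hK k hk ε hε t ht u v hu hv hM hM'

end NonlinearTerm

/-- The estimate of all the derivatives of the solution of the linearized equation. -/
theorem AssumptionLin.pn_le [∀ s, CompleteSpace (X s)] (hε₀ : 0 < ε₀)
    (hLin : B.AssumptionLin ε₀ T s₀ hm hd₁ hd₂ p L F)
    (hL : B.AssumptionL ε₀ T s₀ hm p L) (hF : B.AssumptionF ε₀ T s₀ hm p F) (hT : 0 < T) {s r : ℝ}
    (hs : s₀ + (p + 1) * m ≤ s) (hr : s ≤ r) (M : ℝ) : ∃ K, 0 ≤ K ∧ ∀ ε ∈ Ioo 0 ε₀,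
    ∀ u f v : ℝ → ℕ → X s₀,
    B.JLC m (r + d₁) T (p + 1) u → IsJet T ε (p + 1) u → B.JLC m (r + d₂) T p f → IsJet T ε p f →
    B.JLC m r T (p + 1) v → IsJet T ε (p + 1) v → v 0 0 = 0 →
    (∀ t ∈ Icc 0 T, B.LinEq hm T s₀ ε (L ε) (F ε) p t (u t) (f t) (v t)) → ∀ H φ ψ : ℝ,
    (∀ t ∈ Icc 0 T, B.pn m (s + d₁) (p + 1) (u t) ≤ M) →
    (∀ t ∈ Icc 0 T, B.pn m (r + d₁) (p + 1) (u t) ≤ H) →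
    (∀ t ∈ Icc 0 T, B.pn m (r + d₂) p (f t) ≤ φ) →
    (∀ t ∈ Icc 0 T, B.pn m (s + d₂) p (f t) ≤ ψ) →
    ∀ t ∈ Icc 0 T, B.pn m r (p + 1) (v t) ≤ K * (φ + H * ψ) := by
  have hpm : 0 ≤ (p : ℝ) * m := by positivity
  obtain ⟨K₁, hK₁, h₁⟩ := hLin.nrm_le hL hF hT hs hr M
  obtain ⟨K₂, hK₂, h₂⟩ := hLin.nrm_le hL hF hT hs le_rfl M
  obtain ⟨K₃, hK₃, h₃⟩ := LinEq.pn_le hL hF hT hs hr M (p + 1) le_rfl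
  refine ⟨K₃ * (K₁ * T + ε₀ + (K₂ * (T + |M| * T) + ε₀)), by positivity,
    fun ε hε u f v hu hdu hf hdf hv hdv hv0 heq H φ ψ huM huH hfφ hfψ t ht => ?_⟩
  have hφ0 : 0 ≤ φ := (pn_nonneg _ _ _ _).trans (hfφ t ht)
  have hψ0 : 0 ≤ ψ := (pn_nonneg _ _ _ _).trans (hfψ t ht)
  have hH0 : 0 ≤ H := (pn_nonneg _ _ _ _).trans (huH t ht)
  have hM0 : 0 ≤ M := (pn_nonneg _ _ _ _).trans (huM t ht)
  have hsub : ∀ t' ∈ Icc 0 t, t' ∈ Icc 0 T := fun t' ht' => ⟨ht'.1, ht'.2.trans ht.2⟩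
  have hint : ∀ c : ℝ, ∫ _ in (0 : ℝ)..t, c = t * c := fun c => by simp
  have n1 := h₁ ε hε u f v hu hdu hf hdf (hv.mono (by omega) le_rfl (by push_cast; linarith) hm)
    (hdv.mono (by omega)) hv0 heq H huM huH t ht (fun _ => φ) (fun _ => ψ) continuousOn_const
    monotoneOn_const continuousOn_const monotoneOn_const (fun t' ht' => hfφ t' (hsub t' ht'))
    (fun t' ht' => hfψ t' (hsub t' ht'))
  -- The energy estimate is used a second time at the level `s`, where the high norm of `u` is also
  -- at most `M`: it bounds the low norm of `v`, which the high estimate multiplies by `H`.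
  have n2 := h₂ ε hε u f v (hu.mono le_rfl (by linarith) (by push_cast; linarith) hm) hdu
    (hf.mono le_rfl (by linarith) (by linarith) hm) hdf
    (hv.mono (by omega) hr (by push_cast; linarith) hm)
    (hdv.mono (by omega)) hv0 heq M huM huM t ht (fun _ => ψ) (fun _ => ψ) continuousOn_const
    monotoneOn_const continuousOn_const monotoneOn_const (fun t' ht' => hfψ t' (hsub t' ht'))
    (fun t' ht' => hfψ t' (hsub t' ht'))
  rw [hint, hint] at n1
  rw [hint] at n2
  have hut := hu.jmem ht
  have hft := hf.jmem ht
  have hlev : ∀ σ, s ≤ σ → σ ≤ r → ∀ k < p + 1, B.nrm (σ - (k + 1) * m) (f t k) ≤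
      B.pn m (σ + d₂) p (f t) := fun σ hσ hσr k hk => by
    have hkp : (k : ℝ) * m ≤ p * m := by gcongr; omega
    refine le_trans ?_ (nrm_le_pn (show k ≤ p by omega))
    exact nrm_mono ((hft k (by omega)).mono (by linarith) (by linarith)) (by linarith) (by linarith)
  have hup : B.pn m r p (u t) ≤ H := (pn_mono hut (by omega) (by linarith) (by linarith) hm).trans
    (huH t ht)
  have hus : B.pn m s p (u t) ≤ M :=
    (pn_mono (hut.mono le_rfl (by linarith) (by push_cast; linarith) hm) (by omega) (by linarith)
      (by linarith) hm).trans (huM t ht)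
  have hεle := hε.2.le
  have n3 := (h₃ ε hε t ht (u t) (f t) (v t) (heq t ht)
    (hut.mono (by omega) (by linarith) (by linarith) hm) (hv.jmem ht) hus (ε₀ * φ) (ε₀ * ψ)
    (by positivity) (by positivity)
    (fun k hk => mul_le_mul hεle ((hlev r hr le_rfl k hk).trans (hfφ t ht)) (nrm_nonneg _ _) hε₀.le)
    (fun k hk => mul_le_mul hεle ((hlev s le_rfl hr k hk).trans (hfψ t ht)) (nrm_nonneg _ _)
      hε₀.le)).2
  refine n3.trans ?_
  rw [mul_assoc]
  refine mul_le_mul_of_nonneg_left ?_ hK₃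
  have t1 : t * φ ≤ T * φ := mul_le_mul_of_nonneg_right ht.2 hφ0
  have t2 : t * ψ ≤ T * ψ := mul_le_mul_of_nonneg_right ht.2 hψ0
  have m1 : B.nrm r (v t 0) ≤ K₁ * (T * φ + H * (T * ψ)) := n1.trans (by gcongr)
  have m2 : B.nrm s (v t 0) ≤ K₂ * (T * ψ + |M| * (T * ψ)) := n2.trans (by
    rw [abs_of_nonneg hM0]
    gcongr)
  have m3 : B.pn m r p (u t) * (B.nrm s (v t 0) + ε₀ * ψ) ≤
      H * (K₂ * (T * ψ + |M| * (T * ψ)) + ε₀ * ψ) := by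
    have := nrm_nonneg (B := B) s (v t 0)
    gcongr
  have m4 : 0 ≤ K₁ * T + ε₀ := by positivity
  have m5 : 0 ≤ K₂ * (T + |M| * T) + ε₀ := by positivity
  nlinarith [mul_nonneg m5 hφ0, mul_nonneg hε₀.le (mul_nonneg hH0 hψ0)]

/-! ### The equation with a residual, and the residual left by a Newton step. -/

/-- The jets of order `≤ p + 1` of `u` are those of a solution of the equation with the source
`h + f`. -/
def ResEq (B : BanachScale X) {m : ℝ} (hm : 0 ≤ m) (T s₀ ε : ℝ)
    (L : ℝ → ∀ s, X (s + m) →L[ℝ] X s) (F : ℝ → ∀ s, X (s + m) → X s) (p : ℕ) (t : ℝ)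
    (h u f : ℕ → X s₀) : Prop :=
  ∀ k ≤ p, u (k + 1) + B.jetL s₀ ε L k 0 t u + ε • B.jetN hm T s₀ ε F k t u = ε • (h k + f k)

/-- The residual after one step of the Newton iteration. -/
noncomputable def newResidual (B : BanachScale X) {m : ℝ} (hm : 0 ≤ m) (T s₀ ε : ℝ)
    (F : ℝ → ∀ s, X (s + m) → X s) (t : ℝ) (u ū v f g : ℕ → X s₀) : ℕ → X s₀ := fun k =>
  (f k - g k) + (B.jetN hm T s₀ ε F k t (u + v) - B.jetN hm T s₀ ε F k t u -
    B.jetD hm T s₀ ε F k t u v) +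
    (B.jetD hm T s₀ ε F k t u v - B.jetD hm T s₀ ε F k t ū v)

/-- The correction cancels `g` by means of the linearization at `ū` instead of `u`. Hence three
errors remain: the smoothing error `f - g`, the quadratic Taylor remainder at `u`, and `(F_u[t, u] -
F_u[t, ū]) v`. -/
theorem ResEq.add {ε t : ℝ} {h u ū v f g : ℕ → X s₀}
    (hu : B.ResEq hm T s₀ ε (L ε) (F ε) p t h u f)
    (hv : B.LinEq hm T s₀ ε (L ε) (F ε) p t ū (-g) v) :
    B.ResEq hm T s₀ ε (L ε) (F ε) p t h (u + v)
      (B.newResidual hm T s₀ ε (F ε) t u ū v f g) := fun k hk => by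
  have h1 := hu k hk
  have h2 := hv k hk
  simp only [Pi.neg_apply] at h2
  rw [Pi.add_apply, jetL_add, h2, newResidual]
  have h3 : u (k + 1) = ε • (h k + f k) - B.jetL s₀ ε (L ε) k 0 t u -
      ε • B.jetN hm T s₀ ε (F ε) k t u := by rw [← h1]; abel
  rw [h3]
  simp only [smul_add, smul_sub, smul_neg]
  abel

end BanachScale

namespace BanachScale

variable {X : ℝ → Type*} [∀ s, NormedAddCommGroup (X s)] [∀ s, NormedSpace ℝ (X s)]
variable {B : BanachScale X} {m : ℝ} {hm : 0 ≤ m} {ε₀ T s₀ d₁ d₂ : ℝ} {hd₁ : 0 ≤ d₁}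
  {hd₂ : 0 ≤ d₂} {p : ℕ} {F : ℝ → ℝ → ∀ s, X (s + m) → X s}
  {L : ℝ → ℝ → ∀ s, X (s + m) →L[ℝ] X s}

theorem pn_neg {b r : ℝ} {j : ℕ} (x : ℕ → X b) : B.pn m r j (-x) = B.pn m r j x := by
  simpa using pn_smul (B := B) (m := m) (r := r) (j := j) (x := x) (-1)

theorem JLC.neg {b r τ : ℝ} {j : ℕ} {u : ℝ → ℕ → X b} (hu : B.JLC m r τ j u) :
    B.JLC m r τ j (-u) := by
  simpa using hu.smul (-1)

theorem IsJet.neg {b τ ε : ℝ} {j : ℕ} {u : ℝ → ℕ → X b} (hu : IsJet τ ε j u) :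
    IsJet τ ε j (-u) := by
  simpa using hu.smul (-1)

section NewResidual

variable {r s τ : ℝ}

theorem AssumptionF.pn_newResidual_le [∀ s, CompleteSpace (X s)]
    (hF : B.AssumptionF ε₀ T s₀ hm p F) (hT : 0 < T) (hs : s₀ + (p + 1) * m ≤ s) (hsr : s ≤ r)
    (M : ℝ) : ∃ K, 0 ≤ K ∧ ∀ ε ∈ Ioo 0 ε₀, ∀ t ∈ Icc 0 T, ∀ u ū v f g : ℕ → X s₀,
      B.JMem m r p u → B.JMem m r p ū → B.JMem m r p v →
      B.pn m s p u ≤ M → B.pn m s p ū ≤ M → B.pn m s p v ≤ M → B.pn m s p (u - ū) ≤ M →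
      B.pn m (r - m) p (B.newResidual hm T s₀ ε (F ε) t u ū v f g) ≤
        B.pn m (r - m) p (f - g) + K * ((2 * B.pn m r p v * B.pn m s p v +
          (B.pn m r p u + B.pn m r p v) * B.pn m s p v ^ 2) +
          (B.pn m r p v * B.pn m s p (u - ū) + B.pn m r p (u - ū) * B.pn m s p v +
          (B.pn m r p ū + B.pn m r p (u - ū)) * (B.pn m s p v * B.pn m s p (u - ū)))) := by
  obtain ⟨K₁, hK₁, h₁⟩ := hF.pn_jetN_sub_le hT hs hsr M
  obtain ⟨K₂, hK₂, h₂⟩ := hF.pn_jetD_sub_le hT hs hsr M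
  refine ⟨K₁ + K₂, by positivity, fun ε hε t ht u ū v f g hu hū hv mu mū mv mw => ?_⟩
  have e₁ := h₁ ε hε t ht u v hu hv mu mv
  have e₂ := h₂ ε hε t ht ū (u - ū) v hū (hu.sub hū) hv mū mw
  rw [add_sub_cancel] at e₂
  refine (pn_add_le (x := fun k => (f k - g k) + (B.jetN hm T s₀ ε (F ε) k t (u + v) -
    B.jetN hm T s₀ ε (F ε) k t u - B.jetD hm T s₀ ε (F ε) k t u v))
    (y := fun k => B.jetD hm T s₀ ε (F ε) k t u v - B.jetD hm T s₀ ε (F ε) k t ū v)).trans ?_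
  have e₃ := pn_add_le (B := B) (m := m) (r := r - m) (j := p) (x := f - g)
    (y := fun k => B.jetN hm T s₀ ε (F ε) k t (u + v) -
      B.jetN hm T s₀ ε (F ε) k t u - B.jetD hm T s₀ ε (F ε) k t u v)
  have a1 := pn_nonneg (B := B) m r p v
  have a2 := pn_nonneg (B := B) m r p u
  have a3 := pn_nonneg (B := B) m r p ū
  have a4 := pn_nonneg (B := B) m r p (u - ū)
  have a5 := pn_nonneg (B := B) m s p v
  have a6 := pn_nonneg (B := B) m s p (u - ū)
  have p₁ : 0 ≤ 2 * B.pn m r p v * B.pn m s p v +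
    (B.pn m r p u + B.pn m r p v) * B.pn m s p v ^ 2 := by positivity
  have p₂ : 0 ≤ B.pn m r p v * B.pn m s p (u - ū) + B.pn m r p (u - ū) * B.pn m s p v +
    (B.pn m r p ū + B.pn m r p (u - ū)) * (B.pn m s p v * B.pn m s p (u - ū)) := by positivity
  refine (add_le_add (e₃.trans (add_le_add le_rfl e₁)) e₂).trans ?_
  nlinarith [mul_nonneg hK₁ p₂, mul_nonneg hK₂ p₁]

theorem AssumptionF.jlc_newResidual (hF : B.AssumptionF ε₀ T s₀ hm p F) (hT : 0 < T) {ε : ℝ}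
    (hε : ε ∈ Ioo 0 ε₀) (hτ : τ ≤ T) (hr : s₀ + (p + 1) * m ≤ r) {u ū v f g : ℝ → ℕ → X s₀}
    (hu : B.JLC m r τ p u) (hū : B.JLC m r τ p ū) (hv : B.JLC m r τ p v)
    (hf : B.JLC m (r - m) τ p f) (hg : B.JLC m (r - m) τ p g) :
    B.JLC m (r - m) τ p
      (fun t => B.newResidual hm T s₀ ε (F ε) t (u t) (ū t) (v t) (f t) (g t)) :=
  ((hf.sub hg).add (((hF.jlc_jetN hT hε hτ hr (hu.add hv)).sub
    (hF.jlc_jetN hT hε hτ hr hu)).sub (hF.jlc_jetD hT hε hτ hr hu hv))).add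
    ((hF.jlc_jetD hT hε hτ hr hu hv).sub (hF.jlc_jetD hT hε hτ hr hū hv))

theorem AssumptionF.isJet_newResidual [∀ s, CompleteSpace (X s)]
    (hF : B.AssumptionF ε₀ T s₀ hm p F) (hT : 0 < T) {ε : ℝ}
    (hε : ε ∈ Ioo 0 ε₀) (hτ : τ ≤ T) (hr : s₀ + (p + 1) * m ≤ r) {u ū v f g : ℝ → ℕ → X s₀}
    (hu : B.JLC m r τ p u) (hū : B.JLC m r τ p ū) (hv : B.JLC m r τ p v)
    (hdu : IsJet τ ε p u) (hdū : IsJet τ ε p ū) (hdv : IsJet τ ε p v)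
    (hf : IsJet τ ε p f) (hg : IsJet τ ε p g) :
    IsJet τ ε p
      (fun t => B.newResidual hm T s₀ ε (F ε) t (u t) (ū t) (v t) (f t) (g t)) :=
  ((hf.sub hg).add (((hF.isJet_jetN hT hε hτ hr (hu.add hv) (hdu.add hdv)).sub
    (hF.isJet_jetN hT hε hτ hr hu hdu)).sub (hF.isJet_jetD hT hε hτ hr hu hdu hv hdv))).add
    ((hF.isJet_jetD hT hε hτ hr hu hdu hv hdv).sub (hF.isJet_jetD hT hε hτ hr hū hdū hv hdv))

end NewResidual

/-! ### The Newton step with smoothing. -/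

/-- An approximate solution `u` on `[0, T]` whose residual on `[0, τ]` is `f`, with the bounds of
the Newton iteration at the scale `Λ`. -/
structure Approx (B : BanachScale X) {m : ℝ} (hm : 0 ≤ m) (T s₀ ε : ℝ)
    (L : ℝ → ∀ s, X (s + m) →L[ℝ] X s) (F : ℝ → ∀ s, X (s + m) → X s) (p : ℕ) (a c τ M Λ : ℝ)
    (h u f : ℝ → ℕ → X s₀) : Prop where
  jlc : B.JLC m c T (p + 1) u
  jet : IsJet T ε (p + 1) u
  -- The exponents of `Λ`, in the low and the high norm, are `0` and `2` for `u`, `-3` and `1` for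
  -- the residual; with `c - a = 5 ℓ` this pattern reproduces itself from one scale to the next.
  low : ∀ t ∈ Icc 0 T, B.pn m a (p + 1) (u t) ≤ M
  high : ∀ t ∈ Icc 0 T, B.pn m c (p + 1) (u t) ≤ M * Λ ^ 2
  res_jlc : B.JLC m (c - m) τ p f
  res_jet : IsJet τ ε p f
  res_low : ∀ t ∈ Icc 0 τ, B.pn m (a - m) p (f t) ≤ Λ⁻¹ ^ 3
  res_high : ∀ t ∈ Icc 0 τ, B.pn m (c - m) p (f t) ≤ Λ
  eq : ∀ t ∈ Icc 0 τ, B.ResEq hm T s₀ ε L F p t (h t) (u t) (f t)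


-- Smoothing is at `θ = Λ^(1/ℓ)`: climbing `ℓ` levels costs `Λ`, and descending from `c` to `a`
-- gains `Λ⁻⁵`. In the low norm, the smoothed residual at the level required by the linear estimate
-- is `Λ · Λ⁻³`, and so is the product of the high norm of `ū` with the low norm of the residual,
-- whence `v = O(Λ⁻²)`. The three errors are `Λ⁻⁵ · Λ` from smoothing, `(Λ⁻²)²` from the Taylor
-- remainder, and `Λ⁻² · Λ⁻³` from replacing `u` by `ū`: all are `O(Λ⁻⁴)`. In the high norm, `v` is
-- `O(Λ² + Λ³ · Λ⁻³)`. The nonlinear errors are bounded, and the smoothing error is `O(Λ)`.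
set_option maxHeartbeats 2000000 in
theorem exists_newton_step [∀ s, CompleteSpace (X s)] (hε₀ : 0 < ε₀)
    (hLin : B.AssumptionLin ε₀ T s₀ hm hd₁ hd₂ p L F)
    (hL : B.AssumptionL ε₀ T s₀ hm p L) (hF : B.AssumptionF ε₀ T s₀ hm p F) (hT : 0 < T)
    {s a c ℓ η : ℝ} (hs : s₀ + (p + 1) * m ≤ s) (hη : 0 < η) (hℓ₁ : d₁ ≤ ℓ)
    (hℓ₂ : d₂ + m + η ≤ ℓ) (ha : s + ℓ ≤ a) (hc : c = a + 5 * ℓ) {M : ℝ} (hM : 0 ≤ M) :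
    ∃ C, 1 ≤ C ∧ ∀ ε ∈ Ioo 0 ε₀, ∀ τ, 0 < τ → τ ≤ T → ∀ h u f : ℝ → ℕ → X s₀, ∀ Λ, 1 ≤ Λ →
      B.Approx hm T s₀ ε (L ε) (F ε) p a c τ M Λ h u f → ∃ v f' : ℝ → ℕ → X s₀,
      B.JLC m c T (p + 1) v ∧ IsJet T ε (p + 1) v ∧ v 0 0 = 0 ∧
      (∀ t ∈ Icc 0 T, B.pn m a (p + 1) (v t) ≤ C * Λ⁻¹ ^ 2) ∧
      (∀ t ∈ Icc 0 T, B.pn m c (p + 1) (v t) ≤ C * Λ ^ 2) ∧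
      B.JLC m (c - m) τ p f' ∧ IsJet τ ε p f' ∧
      (∀ t ∈ Icc 0 τ, B.pn m (a - m) p (f' t) ≤ C * Λ⁻¹ ^ 4) ∧
      (∀ t ∈ Icc 0 τ, B.pn m (c - m) p (f' t) ≤ C * Λ) ∧
      ∀ t ∈ Icc 0 τ, B.ResEq hm T s₀ ε (L ε) (F ε) p t (h t) (u t + v t) (f' t) := by
  have hpm : 0 ≤ (p : ℝ) * m := by positivity
  have hcast : ((p + 1 : ℕ) : ℝ) * m = p * m + m := by push_cast; ring
  have hs' : s₀ + p * m + m ≤ s := by linarith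
  have hℓ : 0 < ℓ := by linarith
  -- the constants of the smoothing, extension, linear and nonlinear estimates
  obtain ⟨C₁, hC₁, k₁⟩ := pn_smooth_le B hm (p + 1) (b := s₀) (r := a) (r' := a + ℓ)
    (by rw [hcast]; linarith) (by linarith)
  obtain ⟨C₂, hC₂, k₂⟩ := pn_smooth_le B hm (p + 1) (b := s₀) (r := c) (r' := c + ℓ)
    (by rw [hcast]; linarith) (by linarith)
  obtain ⟨C₃, hC₃, k₃⟩ := pn_smooth_le B hm (p + 1) (b := s₀) (r := a) (r' := a)
    (by rw [hcast]; linarith) le_rfl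
  obtain ⟨C₄, hC₄, k₄⟩ := pn_sub_smooth_le B hm (p + 1) (b := s₀) (r := c) (r' := a)
    (by rw [hcast]; linarith) (by linarith)
  obtain ⟨C₅, hC₅, k₅⟩ := pn_sub_smooth_le B hm (p + 1) (b := s₀) (r := c) (r' := c)
    (by rw [hcast]; linarith) le_rfl
  obtain ⟨E₁, hE₁, e₁⟩ := pn_smooth_le B hm p (b := s₀) (r := a - m) (r' := a - m + ℓ)
    (by linarith) (by linarith)
  obtain ⟨E₂, hE₂, e₂⟩ := pn_smooth_le B hm p (b := s₀) (r := c - m) (r' := c - m + ℓ)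
    (by linarith) (by linarith)
  obtain ⟨E₃, hE₃, e₃⟩ := pn_smooth_le B hm p (b := s₀) (r := a - m) (r' := a - m)
    (by linarith) le_rfl
  obtain ⟨E₄, hE₄, e₄⟩ := pn_sub_smooth_le B hm p (b := s₀) (r := c - m) (r' := a - m)
    (by linarith) (by linarith)
  obtain ⟨E₅, hE₅, e₅⟩ := pn_sub_smooth_le B hm p (b := s₀) (r := c - m) (r' := c - m)
    (by linarith) le_rfl
  -- Each extension is made from `η` levels above its target, which compensates its loss.
  obtain ⟨G₁, hG₁, g₁⟩ := pn_extend_le B (b := s₀) (r := a + d₂ + η) (j := p) hη hm (by linarith)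
  obtain ⟨G₂, hG₂, g₂⟩ := pn_extend_le B (b := s₀) (r := c + d₂ + η) (j := p) hη hm (by linarith)
  obtain ⟨G₃, hG₃, g₃⟩ := pn_extend_le B (b := s₀) (r := s + d₂ + η) (j := p) hη hm (by linarith)
  obtain ⟨K₁, hK₁, l₁⟩ := hLin.pn_le hε₀ hL hF hT hs (r := a) (by linarith) (C₃ * M)
  obtain ⟨K₂, hK₂, l₂⟩ := hLin.pn_le hε₀ hL hF hT hs (r := c) (by linarith) (C₃ * M)
  set Va := K₁ * (G₁ * E₁ + C₁ * M * (G₃ * E₃)) with hVa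
  set Vc := K₂ * (G₂ * E₂ + C₂ * M * (G₃ * E₃)) with hVc
  have hVa0 : 0 ≤ Va := by positivity
  have hVc0 : 0 ≤ Vc := by positivity
  -- A common bound for the low norms of `u`, `ū`, `v` and `u - ū`, as required by the estimate of
  -- the new residual.
  set W := M + C₃ * M + Va + C₄ * M with hW
  obtain ⟨N₁, hN₁, n₁⟩ := hF.pn_newResidual_le hT hs (r := a) (by linarith) W
  obtain ⟨N₂, hN₂, n₂⟩ := hF.pn_newResidual_le hT hs (r := c) (by linarith) W
  set Ra := E₄ + N₁ * ((2 * Va * Va + (M + Va) * Va ^ 2) +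
    (Va * (C₄ * M) + (C₄ * M) * Va + (C₃ * M + C₄ * M) * (Va * (C₄ * M)))) with hRa
  set Rc := E₅ + N₂ * ((2 * Vc * Va + (M + Vc) * Va ^ 2) +
    (Vc * (C₄ * M) + (C₅ * M) * Va + (C₂ * M + C₅ * M) * (Va * (C₄ * M)))) with hRc
  have hRa0 : 0 ≤ Ra := by positivity
  have hRc0 : 0 ≤ Rc := by positivity
  refine ⟨1 + Va + Vc + Ra + Rc, by linarith, fun ε hε τ hτ0 hτ h u f Λ hΛ hA => ?_⟩
  have hΛ0 : 0 < Λ := by linarith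
  set θ := Λ ^ (1 / ℓ) with hθdef
  have hθ : 1 ≤ θ := Real.one_le_rpow hΛ (by positivity)
  have hθℓ : θ ^ ℓ = Λ := by
    rw [hθdef, ← Real.rpow_mul hΛ0.le, one_div_mul_cancel hℓ.ne', Real.rpow_one]
  set z := Λ⁻¹ with hz
  have hz0 : 0 < z := by positivity
  have hz1 : z ≤ 1 := inv_le_one_of_one_le₀ hΛ
  have hΛz : Λ * z = 1 := mul_inv_cancel₀ hΛ0.ne'
  have hθ5 : θ ^ (-(5 * ℓ)) = z ^ 5 := by
    rw [Real.rpow_neg (by linarith), mul_comm, Real.rpow_mul (by linarith), hθℓ, hz, inv_pow]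
    norm_num
  have hsub : ∀ t ∈ Icc 0 τ, t ∈ Icc 0 T := fun t ht => ⟨ht.1, ht.2.trans hτ⟩
  -- the smoothed data
  have hū : ∀ r', s ≤ r' → B.JLC m r' T (p + 1) (fun t => B.smoothJet θ (u t)) := fun r' hr' =>
    hA.jlc.smooth hm hθ (by rw [hcast]; linarith) (by rw [hcast]; linarith)
  have hdū : IsJet T ε (p + 1) (fun t => B.smoothJet θ (u t)) := hA.jet.smooth hθ
  have hg : ∀ r', s - m ≤ r' → B.JLC m r' τ p (fun t => B.smoothJet θ (f t)) := fun r' hr' =>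
    hA.res_jlc.smooth hm hθ (by linarith) (by linarith)
  have hdg : IsJet τ ε p (fun t => B.smoothJet θ (f t)) := hA.res_jet.smooth hθ
  -- The residual lives on `[0, τ]` only, the linearized problem on `[0, T]`. Smoothing comes before
  -- the extension, so the loss `η` is taken from the smoothed levels.
  set g := B.extend m ε p τ (fun t => B.smoothJet θ (f t)) with hgdef
  have hgE : ∀ r', s ≤ r' → B.JLC m r' T p g := fun r' hr' => by
    have := (hg (r' + η) (by linarith)).extend (T := T) (ε := ε) hη hm (by linarith) hτ0.le
    rwa [add_sub_cancel_right] at this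
  have hgdE : IsJet T ε p g := hdg.extend hη hm (by linarith) hτ0.le (hg (s + η) (by linarith))
  obtain ⟨v, hv, hdv, hv0, hveq⟩ := hLin.exists_jet hL hF hT (r := c) (by linarith) hε
    (hū (c + d₁) (by linarith)) hdū (f := -g) (hgE (c + d₂) (by linarith)).neg hgdE.neg
  have huc := fun {t} (ht : t ∈ Icc 0 T) => hA.jlc.jmem ht
  have hua := fun {t} (ht : t ∈ Icc 0 T) => (huc ht).mono le_rfl (show a ≤ c by linarith)
    (by rw [hcast]; linarith) hm
  have hfc := fun {t} (ht : t ∈ Icc 0 τ) => hA.res_jlc.jmem ht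
  have hfa := fun {t} (ht : t ∈ Icc 0 τ) => (hfc ht).mono le_rfl (show a - m ≤ c - m by linarith)
    (by linarith) hm
  have hūm := fun {t} (ht : t ∈ Icc 0 T) r' hr' => (hū r' hr').jmem ht
  -- the bounds of the smoothed data
  have b₁ : ∀ t ∈ Icc 0 T, B.pn m (a + ℓ) (p + 1) (B.smoothJet θ (u t)) ≤ C₁ * M * Λ :=
    fun t ht => by
      have := k₁ θ hθ (u t) (hua ht)
      rw [add_sub_cancel_left, hθℓ] at this
      refine this.trans ?_
      rw [mul_right_comm]
      have := hA.low t ht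
      gcongr
  have b₂ : ∀ t ∈ Icc 0 T, B.pn m (c + ℓ) (p + 1) (B.smoothJet θ (u t)) ≤ C₂ * M * Λ ^ 3 :=
    fun t ht => by
      have := k₂ θ hθ (u t) (huc ht)
      rw [add_sub_cancel_left, hθℓ] at this
      refine this.trans ?_
      rw [show C₂ * M * Λ ^ 3 = C₂ * Λ * (M * Λ ^ 2) by ring]
      have := hA.high t ht
      gcongr
  have b₃ : ∀ t ∈ Icc 0 T, B.pn m a (p + 1) (B.smoothJet θ (u t)) ≤ C₃ * M := fun t ht => by
    have := k₃ θ hθ (u t) (hua ht)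
    rw [sub_self, Real.rpow_zero, mul_one] at this
    exact this.trans (mul_le_mul_of_nonneg_left (hA.low t ht) hC₃)
  have b₄ : ∀ t ∈ Icc 0 T, B.pn m a (p + 1) (u t - B.smoothJet θ (u t)) ≤ C₄ * M * z ^ 3 :=
    fun t ht => by
      have := k₄ θ hθ (u t) (huc ht)
      rw [show a - c = -(5 * ℓ) by linarith, hθ5] at this
      refine this.trans ((mul_le_mul_of_nonneg_left (hA.high t ht) (by positivity)).trans
        (le_of_eq ?_))
      linear_combination (C₄ * M * z ^ 3) * (Λ * z + 1) * hΛz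
  have b₅ : ∀ t ∈ Icc 0 T, B.pn m c (p + 1) (u t - B.smoothJet θ (u t)) ≤ C₅ * M * Λ ^ 2 :=
    fun t ht => by
      have := k₅ θ hθ (u t) (huc ht)
      rw [sub_self, Real.rpow_zero, mul_one] at this
      exact this.trans ((mul_le_mul_of_nonneg_left (hA.high t ht) hC₅).trans_eq (by ring))
  have f₁ : ∀ t ∈ Icc 0 τ, B.pn m (a - m + ℓ) p (B.smoothJet θ (f t)) ≤ E₁ * z ^ 2 :=
    fun t ht => by
      have := e₁ θ hθ (f t) (hfa ht)
      rw [add_sub_cancel_left, hθℓ] at this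
      refine this.trans ((mul_le_mul_of_nonneg_left (hA.res_low t ht) (by positivity)).trans_eq ?_)
      linear_combination (E₁ * z ^ 2) * hΛz
  have f₂ : ∀ t ∈ Icc 0 τ, B.pn m (c - m + ℓ) p (B.smoothJet θ (f t)) ≤ E₂ * Λ ^ 2 :=
    fun t ht => by
      have := e₂ θ hθ (f t) (hfc ht)
      rw [add_sub_cancel_left, hθℓ] at this
      exact this.trans ((mul_le_mul_of_nonneg_left (hA.res_high t ht) (by positivity)).trans_eq
        (by ring))
  have f₃ : ∀ t ∈ Icc 0 τ, B.pn m (a - m) p (B.smoothJet θ (f t)) ≤ E₃ * z ^ 3 :=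
    fun t ht => by
      have := e₃ θ hθ (f t) (hfa ht)
      rw [sub_self, Real.rpow_zero, mul_one] at this
      exact this.trans (mul_le_mul_of_nonneg_left (hA.res_low t ht) hE₃)
  have f₄ : ∀ t ∈ Icc 0 τ, B.pn m (a - m) p (f t - B.smoothJet θ (f t)) ≤ E₄ * z ^ 4 :=
    fun t ht => by
      have := e₄ θ hθ (f t) (hfc ht)
      rw [show a - m - (c - m) = -(5 * ℓ) by linarith, hθ5] at this
      refine this.trans ((mul_le_mul_of_nonneg_left (hA.res_high t ht) (by positivity)).trans_eq ?_)
      linear_combination (E₄ * z ^ 4) * hΛz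
  have f₅ : ∀ t ∈ Icc 0 τ, B.pn m (c - m) p (f t - B.smoothJet θ (f t)) ≤ E₅ * Λ :=
    fun t ht => by
      have := e₅ θ hθ (f t) (hfc ht)
      rw [sub_self, Real.rpow_zero, mul_one] at this
      exact this.trans (mul_le_mul_of_nonneg_left (hA.res_high t ht) hE₅)
  have hgm := fun {t} (ht : t ∈ Icc 0 τ) r' hr' => (hg r' hr').jmem ht
  -- Here `d₂ + m + η ≤ ℓ` is used: the climb of `ℓ` levels from `a - m` covers the loss `d₂` of the
  -- linear estimate, the loss `m` of the residual and the loss `η` of the extension.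
  have x₁ : ∀ t ∈ Icc 0 T, B.pn m (a + d₂) p ((-g) t) ≤ G₁ * (E₁ * z ^ 2) := fun t ht => by
    have := g₁ ε τ T (E₁ * z ^ 2) _ hτ0.le (hg _ (by linarith)) (fun t ht => (pn_mono
      (hgm ht (a - m + ℓ) (by linarith)) le_rfl (by linarith) (by linarith) hm).trans (f₁ t ht)) t ht
    rw [add_sub_cancel_right] at this
    exact (pn_neg _).trans_le this
  have x₂ : ∀ t ∈ Icc 0 T, B.pn m (c + d₂) p ((-g) t) ≤ G₂ * (E₂ * Λ ^ 2) := fun t ht => by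
    have := g₂ ε τ T (E₂ * Λ ^ 2) _ hτ0.le (hg _ (by linarith)) (fun t ht => (pn_mono
      (hgm ht (c - m + ℓ) (by linarith)) le_rfl (by linarith) (by linarith) hm).trans (f₂ t ht)) t ht
    rw [add_sub_cancel_right] at this
    exact (pn_neg _).trans_le this
  have x₃ : ∀ t ∈ Icc 0 T, B.pn m (s + d₂) p ((-g) t) ≤ G₃ * (E₃ * z ^ 3) := fun t ht => by
    have := g₃ ε τ T (E₃ * z ^ 3) _ hτ0.le (hg _ (by linarith)) (fun t ht => (pn_mono
      (hgm ht (a - m) (by linarith)) le_rfl (by linarith) (by linarith) hm).trans (f₃ t ht)) t ht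
    rw [add_sub_cancel_right] at this
    exact (pn_neg _).trans_le this
  have y₃ : ∀ t ∈ Icc 0 T, B.pn m (s + d₁) (p + 1) (B.smoothJet θ (u t)) ≤ C₃ * M := fun t ht =>
    (pn_mono (hūm ht a (by linarith)) le_rfl (by linarith) (by rw [hcast]; linarith) hm).trans
      (b₃ t ht)
  -- the bounds of the correction
  have va : ∀ t ∈ Icc 0 T, B.pn m a (p + 1) (v t) ≤ Va * z ^ 2 := fun t ht => by
    refine (l₁ ε hε _ (-g) v (hū _ (by linarith)) hdū
      (hgE (a + d₂) (by linarith)).neg hgdE.neg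
      (hv.mono le_rfl (by linarith) (by rw [hcast]; linarith) hm) hdv hv0 hveq (C₁ * M * Λ)
      (G₁ * (E₁ * z ^ 2)) (G₃ * (E₃ * z ^ 3)) y₃ (fun t ht => (pn_mono
        (hūm ht (a + ℓ) (by linarith)) le_rfl (by linarith) (by rw [hcast]; linarith) hm).trans
        (b₁ t ht)) x₁ x₃ t ht).trans_eq ?_
    rw [hVa]
    linear_combination (K₁ * C₁ * M * G₃ * E₃ * z ^ 2) * hΛz
  have vc : ∀ t ∈ Icc 0 T, B.pn m c (p + 1) (v t) ≤ Vc * Λ ^ 2 := fun t ht => by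
    refine (l₂ ε hε _ (-g) v (hū _ (by linarith)) hdū
      (hgE (c + d₂) (by linarith)).neg hgdE.neg
      hv hdv hv0 hveq (C₂ * M * Λ ^ 3)
      (G₂ * (E₂ * Λ ^ 2)) (G₃ * (E₃ * z ^ 3)) y₃ (fun t ht => (pn_mono
        (hūm ht (c + ℓ) (by linarith)) le_rfl (by linarith) (by rw [hcast]; linarith) hm).trans
        (b₂ t ht)) x₂ x₃ t ht).trans ?_
    -- The growth `Λ³` of the high norm of `ū` is exactly balanced by the low norm `Λ⁻³` of the
    -- residual; this fixes the exponent `3`.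
    have e : C₂ * M * Λ ^ 3 * (G₃ * (E₃ * z ^ 3)) = C₂ * M * (G₃ * E₃) * 1 := by
      have : Λ ^ 3 * z ^ 3 = 1 := by rw [← mul_pow, hΛz, one_pow]
      linear_combination (C₂ * M * G₃ * E₃) * this
    rw [e, hVc, mul_assoc K₂ _ (Λ ^ 2)]
    refine mul_le_mul_of_nonneg_left ?_ hK₂
    have : C₂ * M * (G₃ * E₃) * 1 ≤ C₂ * M * (G₃ * E₃) * Λ ^ 2 :=
      mul_le_mul_of_nonneg_left (one_le_pow₀ hΛ) (by positivity)
    linarith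
  have low : ∀ {r r' C : ℝ} {x : ℕ → X s₀}, B.JMem m r (p + 1) x → r' ≤ r → s ≤ r' →
      B.pn m r (p + 1) x ≤ C → B.pn m r' p x ≤ C := fun hx hr hr' h =>
    (pn_mono hx (by omega) hr (by linarith) hm).trans h
  have hJ : ∀ {r' : ℝ} {x : ℕ → X s₀}, B.JMem m c (p + 1) x → r' ≤ c → s ≤ r' →
      B.JMem m r' (p + 1) x := fun hx hr hr' =>
    hx.mono le_rfl hr (by rw [hcast]; linarith) hm
  have hJ' : ∀ {r' : ℝ} {x : ℕ → X s₀}, B.JMem m c (p + 1) x → r' ≤ c → s ≤ r' →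
      B.JMem m r' p x := fun hx hr hr' => hx.mono (by omega) hr (by linarith) hm
  have hz2 : z ^ 2 ≤ 1 := pow_le_one₀ hz0.le hz1
  have hz3 : z ^ 3 ≤ 1 := pow_le_one₀ hz0.le hz1
  have hres : ∀ t ∈ Icc 0 τ,
      B.pn m (a - m) p (B.newResidual hm T s₀ ε (F ε) t (u t) (B.smoothJet θ (u t)) (v t) (f t)
        (B.smoothJet θ (f t))) ≤ Ra * z ^ 4 ∧
      B.pn m (c - m) p (B.newResidual hm T s₀ ε (F ε) t (u t) (B.smoothJet θ (u t)) (v t) (f t)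
        (B.smoothJet θ (f t))) ≤ Rc * Λ := fun t ht => by
    have ht' := hsub t ht
    have ju := huc ht'
    have jū := hūm ht' c (by linarith)
    have jv := hv.jmem ht'
    have jw := ju.sub jū
    have hac : a ≤ c := by linarith
    have hsa : s ≤ a := by linarith
    have us := low (hJ ju hac hsa) hsa le_rfl (hA.low t ht')
    have ūs := low (hJ jū hac hsa) hsa le_rfl (b₃ t ht')
    have vs := low (hJ jv hac hsa) hsa le_rfl (va t ht')
    have ws := low (hJ jw hac hsa) hsa le_rfl (b₄ t ht')
    have ua := low (hJ ju hac hsa) le_rfl hsa (hA.low t ht')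
    have ūa := low (hJ jū hac hsa) le_rfl hsa (b₃ t ht')
    have va' := low (hJ jv hac hsa) le_rfl hsa (va t ht')
    have wa := low (hJ jw hac hsa) le_rfl hsa (b₄ t ht')
    have uc := low ju le_rfl (hsa.trans hac) (hA.high t ht')
    have ūc := low (hūm ht' (c + ℓ) (by linarith)) (show c ≤ c + ℓ by linarith) (hsa.trans hac)
      (b₂ t ht')
    have vc' := low jv le_rfl (hsa.trans hac) (vc t ht')
    have wc := low jw le_rfl (hsa.trans hac) (b₅ t ht')
    have h1 : Va * z ^ 2 ≤ Va := mul_le_of_le_one_right hVa0 hz2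
    have h2 : C₄ * M * z ^ 3 ≤ C₄ * M := mul_le_of_le_one_right (by positivity) hz3
    have h3 : 0 ≤ C₃ * M := by positivity
    have h4 : 0 ≤ C₄ * M := by positivity
    have nn := fun r (x : ℕ → X s₀) => pn_nonneg (B := B) m r p x
    constructor
    · refine (n₁ ε hε t ht' _ _ _ (f t) (B.smoothJet θ (f t)) (hJ' ju hac hsa) (hJ' jū hac hsa)
        (hJ' jv hac hsa) (by linarith) (by linarith) (by linarith) (by linarith)).trans ?_
      rw [hRa, add_mul E₄, mul_assoc N₁]
      refine add_le_add (f₄ t ht) (mul_le_mul_of_nonneg_left ?_ hN₁)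
      rw [add_mul (2 * Va * Va + (M + Va) * Va ^ 2)]
      refine add_le_add ?_ ?_
      · calc _ ≤ 2 * (Va * z ^ 2) * (Va * z ^ 2) + (M + Va) * (Va * z ^ 2) ^ 2 := by
              have := nn a (v t)
              have := nn s (v t)
              have := nn a (u t)
              gcongr
              exact va'.trans h1
          _ = _ := by ring
      · calc _ ≤ (Va * z ^ 2) * (C₄ * M * z ^ 3) + (C₄ * M * z ^ 3) * (Va * z ^ 2) +
              (C₃ * M + C₄ * M) * ((Va * z ^ 2) * (C₄ * M * z ^ 3)) := by
              have := nn a (v t)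
              have := nn s (v t)
              have := nn a (u t - B.smoothJet θ (u t))
              have := nn s (u t - B.smoothJet θ (u t))
              have := nn a (B.smoothJet θ (u t))
              gcongr
              exact wa.trans h2
          _ = (Va * (C₄ * M) + (C₄ * M) * Va + (C₃ * M + C₄ * M) * (Va * (C₄ * M))) * z ^ 4 * z := by
              ring
          _ ≤ _ := mul_le_of_le_one_right (by positivity) hz1
    · refine (n₂ ε hε t ht' _ _ _ (f t) (B.smoothJet θ (f t)) (hJ' ju le_rfl (by linarith))
        (hJ' jū le_rfl (by linarith)) (hJ' jv le_rfl (by linarith)) (by linarith) (by linarith)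
        (by linarith) (by linarith)).trans ?_
      rw [hRc, add_mul E₅, mul_assoc N₂]
      refine add_le_add (f₅ t ht) (mul_le_mul_of_nonneg_left ?_ hN₂)
      -- Each product pairs a growing high norm with low norms that compensate it, so the nonlinear
      -- errors are bounded by a constant and there is a spare factor `Λ`.
      refine le_trans ?_ (le_mul_of_one_le_right (by positivity) hΛ)
      have q : Λ ^ 2 * z ^ 2 = 1 := by rw [← mul_pow, hΛz, one_pow]
      have q3 : Λ ^ 3 * z ^ 3 = 1 := by rw [← mul_pow, hΛz, one_pow]
      refine add_le_add ?_ ?_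
      · calc _ ≤ 2 * (Vc * Λ ^ 2) * (Va * z ^ 2) + (M * Λ ^ 2 + Vc * Λ ^ 2) * (Va * z ^ 2) ^ 2 := by
              have := nn c (v t)
              have := nn s (v t)
              have := nn c (u t)
              gcongr
          _ = 2 * Vc * Va + (M + Vc) * Va ^ 2 * z ^ 2 := by
              linear_combination (2 * Vc * Va + (M + Vc) * Va ^ 2 * z ^ 2) * q
          _ ≤ _ := by
              have := mul_le_of_le_one_right (show 0 ≤ (M + Vc) * Va ^ 2 by positivity) hz2
              linarith
      · calc _ ≤ (Vc * Λ ^ 2) * (C₄ * M * z ^ 3) + (C₅ * M * Λ ^ 2) * (Va * z ^ 2) +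
              (C₂ * M * Λ ^ 3 + C₅ * M * Λ ^ 3) * ((Va * z ^ 2) * (C₄ * M * z ^ 3)) := by
              have := nn c (v t)
              have := nn s (v t)
              have := nn c (u t - B.smoothJet θ (u t))
              have := nn s (u t - B.smoothJet θ (u t))
              have := nn c (B.smoothJet θ (u t))
              gcongr
              refine wc.trans ?_
              gcongr
              norm_num
          _ = Vc * (C₄ * M) * z + (C₅ * M) * Va + (C₂ * M + C₅ * M) * (Va * (C₄ * M)) * z ^ 2 := by
              linear_combination (Vc * (C₄ * M) * z + (C₅ * M) * Va) * q +
                ((C₂ * M + C₅ * M) * (Va * (C₄ * M)) * z ^ 2) * q3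
          _ ≤ _ := by
              have i1 := mul_le_of_le_one_right (show 0 ≤ Vc * (C₄ * M) by positivity) hz1
              have i2 := mul_le_of_le_one_right
                (show 0 ≤ (C₂ * M + C₅ * M) * (Va * (C₄ * M)) by positivity) hz2
              linarith
  refine ⟨v, fun t => B.newResidual hm T s₀ ε (F ε) t (u t) (B.smoothJet θ (u t)) (v t) (f t)
    (B.smoothJet θ (f t)), hv, hdv, hv0, fun t ht => (va t ht).trans ?_,
    fun t ht => (vc t ht).trans ?_, ?_, ?_, fun t ht => (hres t ht).1.trans ?_,
    fun t ht => (hres t ht).2.trans ?_, fun t ht => ?_⟩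
  · gcongr; linarith
  · gcongr; linarith
  · have hle : ((p : ℕ) : ℝ) * m ≤ p * m := le_rfl
    exact hF.jlc_newResidual hT hε hτ (r := c) (by linarith)
      ((hA.jlc.mono (by omega) le_rfl (by linarith) hm).mono_set hτ)
      (((hū c (by linarith)).mono (by omega) le_rfl (by linarith) hm).mono_set hτ)
      ((hv.mono (by omega) le_rfl (by linarith) hm).mono_set hτ) hA.res_jlc (hg _ (by linarith))
  · exact hF.isJet_newResidual hT hε hτ (r := c) (by linarith)
      ((hA.jlc.mono (by omega) le_rfl (by linarith) hm).mono_set hτ)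
      (((hū c (by linarith)).mono (by omega) le_rfl (by linarith) hm).mono_set hτ)
      ((hv.mono (by omega) le_rfl (by linarith) hm).mono_set hτ)
      ((hA.jet.mono (by omega)).mono_set hτ) ((hdū.mono (by omega)).mono_set hτ)
      ((hdv.mono (by omega)).mono_set hτ) hA.res_jet hdg
  · gcongr; linarith
  · gcongr; linarith
  -- On `[0, τ]` the extended source is the smoothed residual itself; the new equation is claimed
  -- only there.
  · have := hveq t (hsub t ht)
    rw [Pi.neg_apply, hgdef, extend_of_le ht.2] at this
    exact (hA.eq t ht).add this

end BanachScale

/-! ### The Newton iteration and the passage to the limit. -/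

theorem exists_dependent_seq {σ : Type*} {P : ℕ → σ → Prop} {R : ℕ → σ → σ → Prop} {x₀ : σ}
    (h₀ : P 0 x₀) (h : ∀ n x, P n x → ∃ y, P (n + 1) y ∧ R n x y) :
    ∃ x : ℕ → σ, x 0 = x₀ ∧ ∀ n, P n (x n) ∧ R n (x n) (x (n + 1)) := by
  choose! f hf hR using h
  let x : ℕ → σ := fun n => Nat.rec x₀ (fun k y => f k y) n
  have hx : ∀ n, P n (x n) := fun n => by
    induction n with
    | zero => exact h₀
    | succ n ih => exact hf n _ ih
  exact ⟨x, rfl, fun n => ⟨hx n, hR n _ (hx n)⟩⟩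

theorem exists_tendstoUniformlyOn_of_le_geometric {E : Type*} [NormedAddCommGroup E]
    [CompleteSpace E] {α : Type*} [TopologicalSpace α] {S : Set α} {f : ℕ → α → E}
    (hc : ∀ n, ContinuousOn (f n) S) (h : ∀ n, ∀ t ∈ S, ‖f (n + 1) t - f n t‖ ≤ (1 / 2) ^ n) :
    ∃ g : α → E, ContinuousOn g S ∧ TendstoUniformlyOn f g atTop S := by
  have hd : ∀ t ∈ S, ∀ n, dist (f n t) (f (n + 1) t) ≤ 1 * (1 / 2) ^ n := fun t ht n => by
    rw [dist_comm, dist_eq_norm, one_mul]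
    exact h n t ht
  have hlim : ∀ t ∈ S, ∃ y, Tendsto (fun n => f n t) atTop (𝓝 y) := fun t ht =>
    cauchySeq_tendsto_of_complete (cauchySeq_of_le_geometric _ 1 (by norm_num) (hd t ht))
  choose! g hg using hlim
  have hu : TendstoUniformlyOn f g atTop S := by
    rw [Metric.tendstoUniformlyOn_iff]
    intro δ hδ
    have h2 : Tendsto (fun n : ℕ => (1 : ℝ) * (1 / 2) ^ n / (1 - 1 / 2)) atTop (𝓝 0) := by
      simpa using ((tendsto_pow_atTop_nhds_zero_of_lt_one (r := (1 / 2 : ℝ)) (by norm_num)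
        (by norm_num)).const_mul 1).div_const (1 - 1 / 2)
    filter_upwards [h2.eventually_lt_const hδ] with n hn t ht
    rw [dist_comm]
    exact (dist_le_of_le_geometric_of_tendsto _ _ (by norm_num) (hd t ht) (hg t ht) n).trans_lt hn
  exact ⟨g, hu.continuousOn (Frequently.of_forall hc), hu⟩

namespace BanachScale

variable {X : ℝ → Type*} [∀ s, NormedAddCommGroup (X s)] [∀ s, NormedSpace ℝ (X s)]
variable {B : BanachScale X} {m : ℝ} {hm : 0 ≤ m} {ε₀ T s₀ d₁ d₂ : ℝ} {hd₁ : 0 ≤ d₁}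
  {hd₂ : 0 ≤ d₂} {p : ℕ} {F : ℝ → ℝ → ∀ s, X (s + m) → X s}
  {L : ℝ → ℝ → ∀ s, X (s + m) →L[ℝ] X s}

/-- The Newton iteration. -/
theorem exists_newton_sequence [∀ s, CompleteSpace (X s)] (hε₀ : 0 < ε₀)
    (hLin : B.AssumptionLin ε₀ T s₀ hm hd₁ hd₂ p L F)
    (hL : B.AssumptionL ε₀ T s₀ hm p L) (hF : B.AssumptionF ε₀ T s₀ hm p F) (hT : 0 < T)
    {s a c ℓ η : ℝ} (hs : s₀ + (p + 1) * m ≤ s) (hη : 0 < η) (hℓ₁ : d₁ ≤ ℓ)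
    (hℓ₂ : d₂ + m + η ≤ ℓ) (ha : s + ℓ ≤ a) (hc : c = a + 5 * ℓ) {M₀ : ℝ} (hM₀ : 0 ≤ M₀) :
    ∃ κ, 0 < κ ∧ ∀ ε ∈ Ioo 0 ε₀, ∀ τ, 0 < τ → τ ≤ T → ∀ h u f : ℝ → ℕ → X s₀,
      B.JLC m c T (p + 1) u → IsJet T ε (p + 1) u →
      (∀ t ∈ Icc 0 T, B.pn m c (p + 1) (u t) ≤ M₀) →
      B.JLC m (c - m) τ p f → IsJet τ ε p f →
      (∀ t ∈ Icc 0 τ, B.pn m (c - m) p (f t) ≤ κ) →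
      (∀ t ∈ Icc 0 τ, B.ResEq hm T s₀ ε (L ε) (F ε) p t (h t) (u t) (f t)) →
      ∃ V G : ℕ → ℝ → ℕ → X s₀, (∀ n, B.JLC m a τ (p + 1) (V n)) ∧
        (∀ n, IsJet τ ε (p + 1) (V n)) ∧ (∀ n, V n 0 0 = u 0 0) ∧
        (∀ n, ∀ t ∈ Icc 0 τ, B.pn m a (p + 1) (V n t) ≤ M₀ + 1) ∧
        (∀ n, ∀ t ∈ Icc 0 τ, B.pn m a (p + 1) (V (n + 1) t - V n t) ≤ (1 / 2) ^ n) ∧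
        (∀ n, ∀ t ∈ Icc 0 τ, B.JMem m (a - m) p (G n t) ∧
          B.pn m (a - m) p (G n t) ≤ (1 / 2) ^ n) ∧
        ∀ n, ∀ t ∈ Icc 0 τ, B.ResEq hm T s₀ ε (L ε) (F ε) p t (h t) (V n t) (G n t) := by
  have hpm : 0 ≤ (p : ℝ) * m := by positivity
  have hcast : ((p + 1 : ℕ) : ℝ) * m = p * m + m := by push_cast; ring
  have hs' : s₀ + p * m + m ≤ s := by linarith
  obtain ⟨C, hC, hstep⟩ := exists_newton_step hε₀ hLin hL hF hT hs hη hℓ₁ hℓ₂ ha hc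
    (M := M₀ + 1) (by linarith)
  -- The ratio of the scales: `C ≤ μ` absorbs the high norm of the residual, and `μ²` absorbs the
  -- growth of the high norm of the solution.
  set μ := C + 2 with hμ
  have hμ2 : 2 ≤ μ := by linarith
  -- The factor `2 C μ³` ensures `C / Λ ≤ μ⁻³`, so that `C Λ⁻⁴ ≤ (μ Λ)⁻³`, and also that the
  -- corrections `C Λ⁻²` are at most `(1 / 2) ^ (n + 1)`.
  set Λ : ℕ → ℝ := fun n => 2 * C * μ ^ 3 * μ ^ n with hΛ
  have hΛs : ∀ n, Λ (n + 1) = μ * Λ n := fun n => by simp only [hΛ]; ring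
  have hμn : ∀ n, 1 ≤ μ ^ n := fun n => one_le_pow₀ (by linarith)
  have hΛge : ∀ n, 2 * C * μ ^ 3 ≤ Λ n := fun n =>
    le_mul_of_one_le_right (by positivity) (hμn n)
  have hμ3 : 1 ≤ μ ^ 3 := hμn 3
  have hCμ : 2 * C ≤ 2 * C * μ ^ 3 := le_mul_of_one_le_right (by positivity) hμ3
  have hΛ1 : ∀ n, 1 ≤ Λ n := fun n => by linarith [hΛge n]
  have hΛ2 : ∀ n, C * (Λ n)⁻¹ ^ 2 ≤ (1 / 2) * (1 / 2) ^ n := fun n => by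
    have h1 : 2 * C * 2 ^ n ≤ Λ n := by
      have : (2 : ℝ) ^ n ≤ μ ^ n := by gcongr
      calc 2 * C * 2 ^ n ≤ 2 * C * μ ^ 3 * μ ^ n := by gcongr
        _ = Λ n := rfl
    have h2 : Λ n ≤ Λ n ^ 2 := by nlinarith [hΛ1 n]
    rw [inv_pow, ← div_eq_mul_inv, div_le_iff₀ (by positivity [hΛ1 n])]
    have h3 : (1 / 2 : ℝ) ^ n * 2 ^ n = 1 := by rw [← mul_pow]; norm_num
    have h4 : 1 / 2 * (1 / 2) ^ n * (2 * C * 2 ^ n) = C := by linear_combination C * h3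
    calc C = 1 / 2 * (1 / 2) ^ n * (2 * C * 2 ^ n) := h4.symm
      _ ≤ 1 / 2 * (1 / 2) ^ n * Λ n ^ 2 := by gcongr; exact h1.trans h2
  have hΛ3 : ∀ n, (Λ n)⁻¹ ^ 3 ≤ (1 / 2) ^ n := fun n => by
    have h1 : (Λ n)⁻¹ ≤ 1 := inv_le_one_of_one_le₀ (hΛ1 n)
    have h0 : 0 ≤ (Λ n)⁻¹ := inv_nonneg.2 (by linarith [hΛ1 n])
    have h3 : (0 : ℝ) ≤ (1 / 2) ^ n := by positivity
    calc (Λ n)⁻¹ ^ 3 ≤ (Λ n)⁻¹ ^ 2 := pow_le_pow_of_le_one h0 h1 (by norm_num)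
      _ ≤ C * (Λ n)⁻¹ ^ 2 := le_mul_of_one_le_left (by positivity) hC
      _ ≤ _ := (hΛ2 n).trans (by linarith)
  have hΛ0 := hΛ1 0
  have hκ : (Λ 0)⁻¹ ^ 3 ≤ 1 := pow_le_one₀ (inv_nonneg.2 (by linarith)) (inv_le_one_of_one_le₀ hΛ0)
  -- The residual of the initial approximation has to meet the low bound at the first scale; its
  -- high bound `Λ 0` is then automatic.
  refine ⟨(Λ 0)⁻¹ ^ 3, by positivity, fun ε hε τ hτ0 hτ h u f hu hdu hMu hf hdf hκf heq => ?_⟩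
  -- The last clause keeps the budget for the remaining corrections: the step `n` consumes at most
  -- `(1 / 2) ^ (n + 1)`, so the low norm never exceeds `M₀ + 1`.
  let P : ℕ → (ℝ → ℕ → X s₀) × (ℝ → ℕ → X s₀) → Prop := fun n x =>
    B.Approx hm T s₀ ε (L ε) (F ε) p a c τ (M₀ + 1) (Λ n) h x.1 x.2 ∧ x.1 0 0 = u 0 0 ∧
      ∀ t ∈ Icc 0 T, B.pn m a (p + 1) (x.1 t) ≤ M₀ + 1 - (1 / 2) ^ n
  let R : ℕ → (ℝ → ℕ → X s₀) × (ℝ → ℕ → X s₀) → (ℝ → ℕ → X s₀) × (ℝ → ℕ → X s₀) → Prop :=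
    fun n x y => ∀ t ∈ Icc 0 T, B.pn m a (p + 1) (y.1 t - x.1 t) ≤ (1 / 2) ^ n
  have hsub : ∀ t ∈ Icc 0 τ, t ∈ Icc 0 T := fun t ht => ⟨ht.1, ht.2.trans hτ⟩
  have h₀ : P 0 (u, f) := by
    have hlow : ∀ t ∈ Icc 0 T, B.pn m a (p + 1) (u t) ≤ M₀ := fun t ht =>
      (pn_mono (hu.jmem ht) le_rfl (by linarith) (by rw [hcast]; linarith) hm).trans (hMu t ht)
    refine ⟨⟨hu, hdu, fun t ht => (hlow t ht).trans (by linarith), fun t ht => (hMu t ht).trans ?_,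
      hf, hdf, fun t ht => (pn_mono (hf.jmem ht) le_rfl (by linarith) (by linarith) hm).trans
        (hκf t ht), fun t ht => (hκf t ht).trans (hκ.trans hΛ0), heq⟩, rfl,
      fun t ht => (hlow t ht).trans (by norm_num)⟩
    nlinarith [one_le_pow₀ (n := 2) hΛ0]
  obtain ⟨x, hx0, hx⟩ := exists_dependent_seq (P := P) (R := R) h₀ (by
    rintro n ⟨v, g⟩ ⟨hA, hv0, hlow⟩
    dsimp only at hA hv0 hlow
    obtain ⟨w, g', hw, hdw, hw0, hwa, hwc, hg', hdg', hga, hgc, hweq⟩ :=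
      hstep ε hε τ hτ0 hτ h v g (Λ n) (hΛ1 n) hA
    have hwa' : ∀ t ∈ Icc 0 T, B.pn m a (p + 1) (w t) ≤ 1 / 2 * (1 / 2) ^ n := fun t ht =>
      (hwa t ht).trans (hΛ2 n)
    have hlow' : ∀ t ∈ Icc 0 T, B.pn m a (p + 1) (v t + w t) ≤ M₀ + 1 - (1 / 2) ^ (n + 1) :=
      fun t ht => by
        rw [pow_succ]
        linarith [pn_add_le (B := B) (m := m) (r := a) (j := p + 1) (x := v t) (y := w t),
          hwa' t ht, hlow t ht]
    have hz : 0 < (Λ n)⁻¹ := inv_pos.2 (by linarith [hΛ1 n])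
    have hΛn := hΛ1 n
    refine ⟨(v + w, g'), ⟨⟨hA.jlc.add hw, hA.jet.add hdw,
      fun t ht => (hlow' t ht).trans (by simp), fun t ht => ?_, hg', hdg',
      fun t ht => (hga t ht).trans ?_, fun t ht => (hgc t ht).trans ?_, hweq⟩, ?_, hlow'⟩,
      fun t ht => ?_⟩
    · refine pn_add_le.trans ((add_le_add (hA.high t ht) (hwc t ht)).trans ?_)
      rw [hΛs, mul_pow]
      have h1 : 1 + C ≤ μ ^ 2 := by rw [hμ]; nlinarith
      have h2 : (M₀ + 1) + C ≤ (M₀ + 1) * μ ^ 2 := by nlinarith [mul_nonneg hM₀ (by linarith : 0 ≤ C)]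
      nlinarith [mul_le_mul_of_nonneg_right h2 (sq_nonneg (Λ n))]
    · rw [hΛs, mul_inv μ, mul_pow μ⁻¹]
      have h1 : C * (Λ n)⁻¹ ≤ μ⁻¹ ^ 3 := by
        rw [inv_pow, ← div_eq_mul_inv, div_le_iff₀ (by linarith), ← div_eq_inv_mul,
          le_div_iff₀ (by positivity)]
        nlinarith [hΛge n, mul_nonneg (show 0 ≤ C by linarith) (show (0 : ℝ) ≤ μ ^ 3 by positivity)]
      calc C * (Λ n)⁻¹ ^ 4 = (C * (Λ n)⁻¹) * (Λ n)⁻¹ ^ 3 := by ring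
        _ ≤ _ := by gcongr
    · rw [hΛs]
      gcongr
      linarith
    · simp only [Pi.add_apply, hw0, hv0, add_zero]
    · simp only [Pi.add_apply, add_sub_cancel_left]
      exact (hwa' t ht).trans (by have : (0 : ℝ) ≤ (1 / 2) ^ n := by positivity
                                  linarith))
  refine ⟨fun n => (x n).1, fun n => (x n).2,
    fun n => ((hx n).1.1.jlc.mono le_rfl (by linarith) (by rw [hcast]; linarith) hm).mono_set hτ,
    fun n => (hx n).1.1.jet.mono_set hτ, fun n => (hx n).1.2.1,
    fun n t ht => (hx n).1.1.low t (hsub t ht), fun n t ht => (hx n).2 t (hsub t ht),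
    fun n t ht => ⟨((hx n).1.1.res_jlc.jmem ht).mono le_rfl (by linarith) (by linarith) hm,
      ((hx n).1.1.res_low t ht).trans (hΛ3 n)⟩, fun n t ht => (hx n).1.1.eq t ht⟩

/-- The problem `∂ₜ x + (1/ε) L(t) x + F[t, x] = h` on `[0, τ]`, read in `X s₀`. -/
def Solves (B : BanachScale X) {m : ℝ} (hm : 0 ≤ m) (T s₀ ε : ℝ)
    (L : ℝ → ∀ s, X (s + m) →L[ℝ] X s) (F : ℝ → ∀ s, X (s + m) → X s) (τ : ℝ)
    (h x : ℝ → X s₀) : Prop :=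
  ∀ t ∈ Icc 0 τ, HasDerivWithinAt x (h t - ε⁻¹ • B.opL s₀ ε L 0 t (x t) -
    B.jetN hm T s₀ ε F 0 t (fun _ => x t)) (Icc 0 τ) t

/-- The zeroth components converge uniformly in `X a`, the first ones in `X s₀`. The residual
equation passes to the limit pointwise and identifies the second limit through the first; the
integral form of the jet relation then shows that it is its derivative. -/
theorem exists_solves_of_approx [∀ s, CompleteSpace (X s)]
    (hL : B.AssumptionL ε₀ T s₀ hm p L) (hF : B.AssumptionF ε₀ T s₀ hm p F) (hT : 0 < T)
    {a τ ε M : ℝ} (ha : s₀ + m ≤ a) (hε : ε ∈ Ioo 0 ε₀) (hτ : τ ≤ T) {h : ℝ → ℕ → X s₀}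
    {V G : ℕ → ℝ → ℕ → X s₀} {x₀ : X s₀} (hV : ∀ n, B.JLC m a τ 1 (V n))
    (hdV : ∀ n, IsJet τ ε 1 (V n)) (hV0 : ∀ n, V n 0 0 = x₀)
    (hM : ∀ n, ∀ t ∈ Icc 0 τ, B.pn m a 1 (V n t) ≤ M)
    (hVV : ∀ n, ∀ t ∈ Icc 0 τ, B.pn m a 1 (V (n + 1) t - V n t) ≤ (1 / 2) ^ n)
    (hG : ∀ t ∈ Icc 0 τ, Tendsto (fun n => G n t 0) atTop (𝓝 0))
    (heq : ∀ n, ∀ t ∈ Icc 0 τ, B.ResEq hm T s₀ ε (L ε) (F ε) p t (h t) (V n t) (G n t))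
    (hτ0 : 0 ≤ τ) :
    ∃ x : ℝ → X s₀, B.LC a τ x ∧ (∀ t ∈ Icc 0 τ, B.nrm a (x t) ≤ M) ∧ x 0 = x₀ ∧
      B.Solves hm T s₀ ε (L ε) (F ε) τ (fun t => h t 0) x := by
  have hsa : s₀ ≤ a := by linarith
  have h00 : (0 : ℝ) ∈ Icc 0 τ := ⟨le_rfl, hτ0⟩
  have hV₀ : ∀ n, B.LC a τ (fun t => V n t 0) := fun n => by simpa using hV n 0 (by norm_num)
  have hV₁ : ∀ n, B.LC (a - m) τ (fun t => V n t 1) := fun n => by simpa using hV n 1 le_rfl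
  have k₀ : ∀ {x : ℕ → X s₀}, B.nrm a (x 0) ≤ B.pn m a 1 x := fun {x} => by
    simpa using nrm_le_pn (B := B) (m := m) (r := a) (x := x) (show 0 ≤ 1 by norm_num)
  have k₁ : ∀ {x : ℕ → X s₀}, B.nrm (a - m) (x 1) ≤ B.pn m a 1 x := fun {x} => by
    simpa using nrm_le_pn (B := B) (m := m) (r := a) (x := x) (show 1 ≤ 1 by norm_num)
  obtain ⟨x, hxc, hx⟩ := exists_tendstoUniformlyOn_of_le_geometric
    (f := fun n t => B.up s₀ a (V n t 0)) (fun n => (hV₀ n).2) (fun n t ht => by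
      rw [← map_sub]
      exact (k₀ (x := V (n + 1) t - V n t)).trans (hVV n t ht))
  obtain ⟨y, hyc, hy⟩ := exists_tendstoUniformlyOn_of_le_geometric
    (f := fun n t => V n t 1) (fun n => (hV₁ n).self (by linarith)) (fun n t ht =>
      (norm_le_nrm (((hV₁ (n + 1)).1 t ht).sub ((hV₁ n).1 t ht))).trans
        ((k₁ (x := V (n + 1) t - V n t)).trans (hVV n t ht)))
  have hxl : ∀ t ∈ Icc 0 τ, Tendsto (fun n => V n t 0) atTop (𝓝 (B.incl hsa (x t))) :=
    fun t ht => (((B.incl hsa).continuous.tendsto _).comp (hx.tendsto_at ht)).congr fun n =>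
      incl_up hsa ((hV₀ n).1 t ht)
  have hy_eq : ∀ t ∈ Icc 0 τ, ε⁻¹ • y t = h t 0 - ε⁻¹ • B.opL s₀ ε (L ε) 0 t (B.incl hsa (x t)) -
      B.jetN hm T s₀ ε (F ε) 0 t (fun _ => B.incl hsa (x t)) := fun t ht => by
    have htT : t ∈ Icc 0 T := ⟨ht.1, ht.2.trans hτ⟩
    have hmem : ∀ n, B.Mem (s₀ + m) (V n t 0) := fun n => ((hV₀ n).1 t ht).mono (by linarith) ha
    have hmx : B.Mem (s₀ + m) (B.incl hsa (x t)) := (mem_incl hsa _).mono (by linarith) ha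
    have hup : Tendsto (fun n => B.up s₀ (s₀ + m) (V n t 0)) atTop
        (𝓝 (B.up s₀ (s₀ + m) (B.incl hsa (x t)))) := by
      have e := (((B.incl ha).continuous.tendsto _).comp (hx.tendsto_at ht))
      rw [show B.up s₀ (s₀ + m) (B.incl hsa (x t)) = B.incl ha (x t) by
        rw [← incl_up_of_mem (mem_incl hsa _) (by linarith) ha, up_incl]]
      exact e.congr fun n => incl_up_of_mem ((hV₀ n).1 t ht) (by linarith) ha
    have l1 : Tendsto (fun n => B.opL s₀ ε (L ε) 0 t (V n t 0)) atTop
        (𝓝 (B.opL s₀ ε (L ε) 0 t (B.incl hsa (x t)))) := by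
      simp only [hL.opL_zero le_rfl hε t hmx, hL.opL_zero le_rfl hε t (hmem _)]
      exact (((B.incl (le_refl s₀)).comp (L ε t s₀)).continuous.tendsto _).comp hup
    have l2 : Tendsto (fun n => B.jetN hm T s₀ ε (F ε) 0 t (V n t)) atTop
        (𝓝 (B.jetN hm T s₀ ε (F ε) 0 t (fun _ => B.incl hsa (x t)))) := by
      rw [hF.jetN_zero hT le_rfl hε htT (u := fun _ => B.incl hsa (x t)) hmx]
      simp only [hF.jetN_zero hT le_rfl hε htT (hmem _)]
      exact (((B.incl (le_refl s₀)).continuous.comp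
        (hF.contDiff 0 (by omega) le_rfl hε htT).continuous).tendsto _).comp hup
    have l3 := ((hy.tendsto_at ht).add l1).add (l2.const_smul ε)
    have l4 : Tendsto (fun n => ε • (h t 0 + G n t 0)) atTop (𝓝 (ε • (h t 0 + 0))) :=
      (tendsto_const_nhds.add (hG t ht)).const_smul ε
    have e := tendsto_nhds_unique (l3.congr fun n => by
      have := heq n t ht 0 (by omega)
      rwa [jetL_zero] at this) l4
    rw [add_zero] at e
    have e' : y t = ε • h t 0 - B.opL s₀ ε (L ε) 0 t (B.incl hsa (x t)) -
        ε • B.jetN hm T s₀ ε (F ε) 0 t (fun _ => B.incl hsa (x t)) := by rw [← e]; abel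
    rw [e', smul_sub, smul_sub, inv_smul_smul₀ hε.1.ne', inv_smul_smul₀ hε.1.ne']
  refine ⟨fun t => B.incl hsa (x t), ⟨fun t _ => mem_incl hsa _, by simpa only [up_incl] using hxc⟩,
    fun t ht => ?_, tendsto_nhds_unique (hxl 0 h00) (by simp only [hV0]; exact tendsto_const_nhds),
    fun t ht => ?_⟩
  · refine le_of_tendsto ((hx.tendsto_at ht).norm.congr fun n => rfl) ?_ |>.trans_eq' ?_
    · exact Eventually.of_forall fun n => (k₀ (x := V n t)).trans (hM n t ht)
    · rw [nrm, up_incl]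
  · rw [← hy_eq t ht]
    refine hasDerivWithinAt_of_eq_integral (g := fun t => ε⁻¹ • y t) (hyc.const_smul _)
      (fun t ht => ?_) ht
    have hsub : Icc 0 t ⊆ Icc 0 τ := Icc_subset_Icc le_rfl ht.2
    have l1 : ∀ n, V n t 0 = V n 0 0 + ∫ r in (0 : ℝ)..t, ε⁻¹ • V n r 1 := fun n =>
      eq_integral_of_hasDerivWithinAt (((hV₁ n).self (by linarith)).const_smul _)
        (hdV n 0 (by norm_num)) ht
    have l2 : Tendsto (fun n => ∫ r in (0 : ℝ)..t, V n r 1) atTop (𝓝 (∫ r in (0 : ℝ)..t, y r)) := by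
      refine TendstoUniformlyOn.tendsto_intervalIntegral_of_continuousOn ?_ ?_
      · refine Eventually.of_forall fun n => ?_
        rw [uIcc_of_le ht.1]
        exact ((hV₁ n).self (by linarith)).mono hsub
      · rw [uIcc_of_le ht.1]
        exact hy.mono hsub
    refine tendsto_nhds_unique (hxl t ht) ?_
    rw [intervalIntegral.integral_smul]
    refine (((hxl 0 h00).add (l2.const_smul ε⁻¹))).congr fun n => ?_
    rw [l1 n, intervalIntegral.integral_smul]

end BanachScale

/-! ### An approximate solution with a residual that is flat at the time `0`. -/

namespace BanachScale

variable {X : ℝ → Type*} [∀ s, NormedAddCommGroup (X s)] [∀ s, NormedSpace ℝ (X s)]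
variable {B : BanachScale X} {m : ℝ} {hm : 0 ≤ m} {ε₀ T s₀ d₁ d₂ : ℝ} {hd₁ : 0 ≤ d₁}
  {hd₂ : 0 ≤ d₂} {p : ℕ} {F : ℝ → ℝ → ∀ s, X (s + m) → X s}
  {L : ℝ → ℝ → ∀ s, X (s + m) →L[ℝ] X s}

section LinearTerm

variable {r τ : ℝ}

theorem AssumptionL.jlc_jetL (hL : B.AssumptionL ε₀ T s₀ hm p L) {ε : ℝ} (hε : ε ∈ Ioo 0 ε₀)
    (hr : s₀ + (p + 1) * m ≤ r) {u : ℝ → ℕ → X s₀} (hu : B.JLC m r τ p u) :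
    B.JLC m (r - m) τ p (fun t k => B.jetL s₀ ε (L ε) k 0 t (u t)) := fun k hk => by
  have hkp : (k : ℝ) * m ≤ p * m := by gcongr
  have := hL.lc_jetL k hε (a := 0) (by omega) (r := r) (by linarith)
    (hu.mono hk le_rfl (by linarith) hm)
  rwa [show r - m - k * m = r - (k + 1) * m by ring]

theorem AssumptionL.isJet_jetL [∀ s, CompleteSpace (X s)] (hL : B.AssumptionL ε₀ T s₀ hm p L)
    {ε : ℝ} (hε : ε ∈ Ioo 0 ε₀) (hr : s₀ + (p + 1) * m ≤ r)
    {u : ℝ → ℕ → X s₀} (hu : B.JLC m r τ p u) (hdu : IsJet τ ε p u) :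
    IsJet τ ε p (fun t k => B.jetL s₀ ε (L ε) k 0 t (u t)) := fun k hk t ht => by
  have hkp : ((k + 1 : ℕ) : ℝ) * m ≤ p * m := by gcongr; omega
  push_cast at hkp
  exact hL.hasDerivWithinAt_jetL k hε (a := 0) (by omega) (r := r) (by linarith)
    (hu.mono hk le_rfl (by push_cast; linarith) hm) (hdu.mono hk) ht

theorem AssumptionL.pn_jetL_le (hL : B.AssumptionL ε₀ T s₀ hm p L)
    (hr : s₀ + (p + 1) * m ≤ r) : ∃ K, 0 ≤ K ∧ ∀ ε ∈ Ioo 0 ε₀, ∀ t ∈ Icc 0 T, ∀ u : ℕ → X s₀,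
      B.JMem m r p u →
      B.pn m (r - m) p (fun k => B.jetL s₀ ε (L ε) k 0 t u) ≤ K * B.pn m r p u := by
  have hkp : ∀ k ≤ p, (k : ℝ) * m ≤ p * m := fun k hk => by gcongr
  obtain ⟨K, hK0, hK⟩ := exists_uniform_bound p (fun k K => ∀ ε ∈ Ioo 0 ε₀, ∀ t ∈ Icc 0 T,
      ∀ u : ℕ → X s₀, B.JMem m r p u →
      B.nrm (r - (k + 1) * m) (B.jetL s₀ ε (L ε) k 0 t u) ≤ K * B.pn m r p u)
    (fun k C C' h hCC ε hε t ht u hu => (h ε hε t ht u hu).trans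
      (mul_le_mul_of_nonneg_right hCC (pn_nonneg _ _ _ _)))
    (fun k hk => by
      have := hkp k hk
      obtain ⟨K, hK0, hK⟩ := hL.jetL_bound k (a := 0) (by omega) (r := r) (by linarith)
      refine ⟨K, hK0, fun ε hε t ht u hu => ?_⟩
      exact (hK ε hε t ht u (hu.mono hk le_rfl (by linarith) hm)).2.trans
        (mul_le_mul_of_nonneg_left (pn_mono hu hk le_rfl (by linarith) hm) hK0))
  refine ⟨(p + 1) * K, by positivity, fun ε hε t ht u hu => ?_⟩
  rw [mul_assoc]
  exact pn_le_of_level fun k hk => hK k hk ε hε t ht u hu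

end LinearTerm

/-- The jets of the solutions of the homogeneous linear problem. -/
theorem AssumptionL.exists_jet_evolution [∀ s, CompleteSpace (X s)]
    (hL : B.AssumptionL ε₀ T s₀ hm p L) {R : ℝ} (hR : s₀ + (p + 1) * m ≤ R) (hT : 0 < T) :
    ∃ K, 0 ≤ K ∧ ∀ ε ∈ Ioo 0 ε₀, ∀ y : X s₀, B.Mem R y → ∃ c : ℝ → ℕ → X s₀,
      B.JLC m R T (p + 1) c ∧ IsJet T ε (p + 1) c ∧ c 0 0 = y ∧
      (∀ t ∈ Icc 0 T, B.pn m R (p + 1) (c t) ≤ K * B.nrm R y) ∧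
      ∀ t k, c t (k + 1) = -B.jetL s₀ ε (L ε) k 0 t (c t) := by
  have hpm : 0 ≤ (p : ℝ) * m := by positivity
  have hsR : s₀ ≤ R := by linarith
  have hsm : s₀ + m ≤ R := by linarith
  have hkp : ∀ k ≤ p, (k : ℝ) * m ≤ p * m := fun k hk => by gcongr
  -- The homogeneous equation makes each component a linear expression in the lower ones, so the
  -- zeroth component, which the evolution operator controls, bounds the whole jet.
  have hrec : ∀ j ≤ p + 1, ∃ K, 0 ≤ K ∧ ∀ ε ∈ Ioo 0 ε₀, ∀ t ∈ Icc 0 T, ∀ c : ℕ → X s₀,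
      B.JMem m R (p + 1) c → (∀ k, c (k + 1) = -B.jetL s₀ ε (L ε) k 0 t c) →
      B.pn m R j c ≤ K * B.nrm R (c 0) := by
    intro j
    induction j with
    | zero => exact fun _ => ⟨1, zero_le_one, fun ε _ t _ c _ _ => by rw [pn_zero_order, one_mul]⟩
    | succ j ih =>
      intro hj
      have := hkp j (by omega)
      obtain ⟨K, hK, h⟩ := ih (by omega)
      obtain ⟨K', hK', h'⟩ := hL.jetL_bound j (a := 0) (by omega) (r := R) (by linarith)
      refine ⟨K + K' * K, by positivity, fun ε hε t ht c hc hck => ?_⟩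
      have e1 := h ε hε t ht c hc hck
      have e2 := (h' ε hε t ht c (hc.mono (by omega) le_rfl (by linarith) hm)).2
      rw [pn_succ, hck j, nrm_neg]
      push_cast
      have e3 := mul_le_mul_of_nonneg_left e1 hK'
      linarith
  obtain ⟨K, hK, hKb⟩ := hrec (p + 1) le_rfl
  obtain ⟨U, hUc, hU, hUd, hUb⟩ := hL.2.2
  obtain ⟨K', hK'⟩ := hUb R hsR
  refine ⟨K * |K'|, by positivity, fun ε hε y hy => ?_⟩
  have hx : ∀ t, U ε t s₀ y = B.incl hsR (U ε t R (B.up s₀ R y)) := fun t => by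
    rw [← hUc ε hε t s₀ R le_rfl hsR, incl_up hsR hy]
  have hx' : ∀ t, U ε t s₀ y =
      B.incl (le_add_of_nonneg_right hm) (U ε t (s₀ + m) (B.up s₀ (s₀ + m) y)) := fun t => by
    rw [← hUc ε hε t s₀ (s₀ + m) le_rfl (by linarith), incl_up _ (hy.mono (by linarith) hsm)]
  have hlc : B.LC R T (fun t => U ε t s₀ y) := by
    refine ⟨fun t _ => by dsimp only; rw [hx]; exact mem_incl _ _, ?_⟩
    simp only [hx, up_incl]
    exact (hU R hsR ε hε _).1.continuousOn
  obtain ⟨c, hc0, hc, hdc, hck⟩ := exists_jet_of_eq (ε := ε) (j := p) hlc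
    (fun k t u => -B.jetL s₀ ε (L ε) k 0 t u)
    (fun k t u v h => by rw [jetL_congr ε h])
    (fun k hk u hu _ => (hL.lc_jetL k hε (by omega) (by have := hkp k hk; linarith) hu).neg)
    (fun k hk u hu hdu t ht => by
      have := hkp (k + 1) (by omega)
      push_cast at this
      have e := (hL.hasDerivWithinAt_jetL k hε (a := 0) (by omega) (r := R) (by linarith) hu hdu
        ht).neg
      exact e.congr_deriv (smul_neg _ _).symm)
    (fun u t ht h0 => by
      have e := hUd s₀ le_rfl ε hε (B.up s₀ (s₀ + m) y) t
      simp only [← hx'] at e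
      refine (e.hasDerivWithinAt).congr_deriv ?_
      rw [jetL_zero, h0, hL.opL_zero le_rfl hε t ((hlc.1 t ht).mono (by linarith) hsm)]
      dsimp only
      rw [hx' t, up_incl, B.incl_refl, one_div, smul_neg])
  refine ⟨c, hc, hdc, ?_, fun t ht => ?_, fun t k => hck k t⟩
  · rw [hc0, (hU s₀ le_rfl ε hε y).2]
  · refine (hKb ε hε t ht (c t) (hc.jmem ht) fun k => hck k t).trans ?_
    rw [mul_assoc]
    refine mul_le_mul_of_nonneg_left ?_ hK
    rw [hc0, hx, nrm_incl]
    refine ((U ε t R).le_opNorm _).trans (mul_le_mul_of_nonneg_right ?_ (norm_nonneg _))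
    exact (hK' ε hε t ⟨by linarith [ht.1], ht.2⟩).trans (le_abs_self _)

/-- The jet at the time `0` of the correction of the homogeneous solution. -/
theorem exists_initial_jet (hε₀ : 0 < ε₀)
    (hL : B.AssumptionL ε₀ T s₀ hm p L) (hF : B.AssumptionF ε₀ T s₀ hm p F) (hT : 0 < T) {R : ℝ}
    (hR : s₀ + (p + 1) * m ≤ R) (K : ℝ) : ∃ K', 0 ≤ K' ∧ ∀ ε ∈ Ioo 0 ε₀, ∀ h c : ℕ → X s₀,
      B.JMem m (R - m) p h → B.pn m (R - m) p h ≤ K → B.JMem m R (p + 1) c →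
      B.pn m R (p + 1) c ≤ K → ∃ b : ℕ → X s₀, B.JMem m R (p + 1) b ∧ B.pn m R (p + 1) b ≤ K' ∧
      b 0 = 0 ∧ ∀ k, b (k + 1) = h k - B.jetL s₀ ε (L ε) k 0 0 b -
        B.jetN hm T s₀ ε (F ε) k 0 (c + ε • b) := by
  have hpm : 0 ≤ (p : ℝ) * m := by positivity
  have hkp : ∀ k ≤ p, (k : ℝ) * m ≤ p * m := fun k hk => by gcongr
  have h0T : (0 : ℝ) ∈ Icc 0 T := ⟨le_rfl, hT.le⟩
  have hrec : ∀ j ≤ p + 1, ∃ K', 0 ≤ K' ∧ ∀ ε ∈ Ioo 0 ε₀, ∀ h c b : ℕ → X s₀,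
      B.JMem m (R - m) p h → B.pn m (R - m) p h ≤ K → B.JMem m R (p + 1) c →
      B.pn m R (p + 1) c ≤ K → b 0 = 0 → (∀ k, b (k + 1) = h k - B.jetL s₀ ε (L ε) k 0 0 b -
        B.jetN hm T s₀ ε (F ε) k 0 (c + ε • b)) → B.JMem m R j b ∧ B.pn m R j b ≤ K' := by
    intro j
    induction j with
    | zero =>
      refine fun _ => ⟨0, le_rfl, fun ε _ h c b _ _ _ _ hb0 _ => ⟨fun k hk => ?_, ?_⟩⟩
      · obtain rfl : k = 0 := by omega
        rw [hb0]
        exact mem_zero (by push_cast; linarith)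
      · rw [pn_zero_order, hb0, nrm_zero]
    | succ j ih =>
      intro hj
      have := hkp j (by omega)
      obtain ⟨K₁, hK₁, h₁⟩ := ih (by omega)
      obtain ⟨K₂, hK₂, h₂⟩ := hL.jetL_bound j (a := 0) (by omega) (r := R) (by linarith)
      -- The argument `K + ε₀ * K₁` bounds the jet of `c + ε • b` up to the order `j`. The
      -- correction carries the factor `ε`, so its recursion contains no power of `1/ε`.
      obtain ⟨K₃, hK₃, h₃⟩ := hF.jetN_bound hT (k := j) (by omega) (s := R) (r := R) (by linarith)
        le_rfl (K + ε₀ * K₁)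
      refine ⟨K₁ + (|K| + K₂ * K₁ + K₃ * |K + ε₀ * K₁|), by positivity,
        fun ε hε h c b hh hhK hc hcK hb0 hbk => ?_⟩
      obtain ⟨i1, i2⟩ := h₁ ε hε h c b hh hhK hc hcK hb0 hbk
      obtain ⟨l1, l2⟩ := h₂ ε hε 0 h0T b i1
      have hcj := hc.mono (show j ≤ p + 1 by omega) le_rfl (by linarith) hm
      have e1 : B.pn m R j (c + ε • b) ≤ K + ε₀ * K₁ := by
        refine pn_add_le.trans (add_le_add
          ((pn_mono hc (by omega) le_rfl (by linarith) hm).trans hcK) ?_)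
        rw [pn_smul, abs_of_pos hε.1]
        exact mul_le_mul hε.2.le i2 (pn_nonneg _ _ _ _) hε₀.le
      obtain ⟨n1, n2⟩ := h₃ ε hε 0 h0T (c + ε • b) (hcj.add (i1.smul ε)) e1
      have hhj : B.Mem (R - ((j + 1 : ℕ) : ℝ) * m) (h j) := by
        have := hh j (by omega)
        rwa [show R - m - j * m = R - ((j + 1 : ℕ) : ℝ) * m by push_cast; ring] at this
      have hhn : B.nrm (R - ((j + 1 : ℕ) : ℝ) * m) (h j) ≤ K := by
        have := (nrm_le_pn (B := B) (m := m) (r := R - m) (x := h) (show j ≤ p by omega)).trans hhK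
        rwa [show R - m - j * m = R - ((j + 1 : ℕ) : ℝ) * m by push_cast; ring] at this
      rw [show R - (j + 1) * m = R - ((j + 1 : ℕ) : ℝ) * m by push_cast; ring] at l1 l2 n1 n2
      constructor
      · intro k hk
        rcases Nat.lt_or_eq_of_le hk with h | rfl
        · exact i1 k (by omega)
        · rw [hbk j]
          exact (hhj.sub l1).sub n1
      · rw [pn_succ, hbk j]
        refine add_le_add i2 ((nrm_sub_le _ _ _).trans (add_le_add ((nrm_sub_le _ _ _).trans
          (add_le_add (hhn.trans (le_abs_self _)) (l2.trans ?_))) (n2.trans ?_)))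
        · gcongr
        · gcongr
          exact e1.trans (le_abs_self _)
  obtain ⟨K', hK', hb⟩ := hrec (p + 1) le_rfl
  refine ⟨K', hK', fun ε hε h c hh hhK hc hcK => ?_⟩
  obtain ⟨b, hb0, hbk⟩ := exists_seq_of_recursion (0 : X s₀) (fun k u => h k -
    B.jetL s₀ ε (L ε) k 0 0 u - B.jetN hm T s₀ ε (F ε) k 0 (c + ε • u)) (fun k u v huv => by
      rw [jetL_congr ε huv, jetN_congr ε (u := c + ε • u) (u' := c + ε • v)
        fun i hi => by simp only [Pi.add_apply, Pi.smul_apply, huv i hi]])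
  obtain ⟨b1, b2⟩ := hb ε hε h c b hh hhK hc hcK hb0 hbk
  exact ⟨b, b1, b2, hb0, hbk⟩

/-- An approximate solution whose residual vanishes to the order `p` at the time `0`. -/
theorem exists_flat_residual [∀ s, CompleteSpace (X s)] (hε₀ : 0 < ε₀)
    (hL : B.AssumptionL ε₀ T s₀ hm p L) (hF : B.AssumptionF ε₀ T s₀ hm p F) (hT : 0 < T) {R η : ℝ}
    (hη : 0 < η) (hR : s₀ + (p + 1) * m ≤ R - η) (K : ℝ) : ∃ K', 0 ≤ K' ∧ ∀ ε ∈ Ioo 0 ε₀,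
      ∀ (h : ℝ → ℕ → X s₀) (y : X s₀), B.JLC m (R - m) T p h → IsJet T ε p h →
      (∀ t ∈ Icc 0 T, B.pn m (R - m) p (h t) ≤ K) → B.Mem R y → B.nrm R y ≤ K →
      ∃ w f : ℝ → ℕ → X s₀, B.JLC m (R - η) T (p + 1) w ∧ IsJet T ε (p + 1) w ∧ w 0 0 = y ∧
      (∀ t ∈ Icc 0 T, B.pn m (R - η) (p + 1) (w t) ≤ K') ∧
      B.JLC m (R - η - m) T p f ∧ IsJet T ε p f ∧
      (∀ t ∈ Icc 0 T, B.pn m (R - η - m) p (f t) ≤ K') ∧ (∀ k ≤ p, f 0 k = 0) ∧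
      ∀ t ∈ Icc 0 T, B.ResEq hm T s₀ ε (L ε) (F ε) p t (h t) (w t) (f t) := by
  have hpm : 0 ≤ (p : ℝ) * m := by positivity
  have hcast : ((p + 1 : ℕ) : ℝ) * m = p * m + m := by push_cast; ring
  have h0T : (0 : ℝ) ∈ Icc 0 T := ⟨le_rfl, hT.le⟩
  obtain ⟨K₁, hK₁, h₁⟩ := hL.exists_jet_evolution (R := R) (by linarith) hT
  obtain ⟨K₂, hK₂, h₂⟩ := exists_initial_jet hε₀ hL hF hT (R := R) (by linarith) (|K| + K₁ * |K|)
  obtain ⟨C, hC, hlift⟩ := lift_spec B (b := s₀) (r := R) (j := p + 1) hη hm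
    (by rw [hcast]; linarith)
  obtain ⟨K₃, hK₃, h₃⟩ := hL.pn_jetL_le (r := R - η) (by linarith)
  set W := K₁ * |K| + ε₀ * (C * K₂) with hW
  have hW0 : 0 ≤ W := by positivity
  obtain ⟨K₄, hK₄, h₄⟩ := hF.pn_jetN_le hT (s := R - η) (r := R - η) (by linarith) le_rfl W
  refine ⟨W + (C * K₂ + K₃ * (C * K₂) + K₄ * W + |K|), by positivity,
    fun ε hε h y hh hdh hhK hy hyK => ?_⟩
  obtain ⟨c, hc, hdc, hc0, hcK, hck⟩ := h₁ ε hε y hy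
  have hcK' : ∀ t ∈ Icc 0 T, B.pn m R (p + 1) (c t) ≤ K₁ * |K| := fun t ht =>
    (hcK t ht).trans (mul_le_mul_of_nonneg_left (hyK.trans (le_abs_self _)) hK₁)
  obtain ⟨b, hb, hbK, hb0, hbk⟩ := h₂ ε hε (h 0) (c 0) (hh.jmem h0T)
    ((hhK 0 h0T).trans ((le_abs_self _).trans (le_add_of_nonneg_right (by positivity))))
    (hc.jmem h0T) ((hcK' 0 h0T).trans (le_add_of_nonneg_left (abs_nonneg _)))
  obtain ⟨z1, z2⟩ := hlift ε b hb
  -- The lift realises the jet `b` at time `0` by an actual curve, with bounds uniform in `ε` and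
  -- the loss `η`.
  set Z : ℝ → ℕ → X s₀ := B.lift m ε (p + 1) b with hZ
  have hZl : B.JLC m (R - η) T (p + 1) Z := fun k hk =>
    ⟨fun t _ => (z1 k hk).1 t, (z1 k hk).2.continuousOn⟩
  have hZd : IsJet T ε (p + 1) Z := fun k hk t _ =>
    (hasDerivAt_lift hη hm (by rw [hcast]; linarith) ε hb hk t).hasDerivWithinAt
  have hZK : ∀ t, B.pn m (R - η) (p + 1) (Z t) ≤ C * K₂ := fun t =>
    (z2 t).trans (mul_le_mul_of_nonneg_left hbK hC)
  have hZ0 : ∀ k ≤ p + 1, Z 0 k = b k := fun k hk =>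
    lift_zero (r := R) hm (by rw [hcast]; linarith) ε hb hk
  have hcl := hc.mono (r' := R - η) le_rfl (by linarith) (by rw [hcast]; linarith) hm
  have hwl : B.JLC m (R - η) T (p + 1) (c + ε • Z) := hcl.add (hZl.smul ε)
  have hwd : IsJet T ε (p + 1) (c + ε • Z) := hdc.add (hZd.smul ε)
  have hwK : ∀ t ∈ Icc 0 T, B.pn m (R - η) (p + 1) ((c + ε • Z) t) ≤ W := fun t ht => by
    refine (pn_add_le (x := c t) (y := ε • Z t)).trans (add_le_add
      ((pn_mono (hc.jmem ht) le_rfl (by linarith) (by rw [hcast]; linarith) hm).trans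
        (hcK' t ht)) ?_)
    rw [pn_smul, abs_of_pos hε.1]
    exact mul_le_mul hε.2.le (hZK t) (pn_nonneg _ _ _ _) hε₀.le
  have hZp := hZl.mono (show p ≤ p + 1 by omega) le_rfl (show s₀ ≤ R - η - p * m by linarith) hm
  have hwp := hwl.mono (show p ≤ p + 1 by omega) le_rfl (show s₀ ≤ R - η - p * m by linarith) hm
  have hhp := hh.mono (r' := R - η - m) le_rfl (by linarith) (by linarith) hm
  -- As `c` solves the homogeneous equation, the equation for `c + ε • Z` is divisible by `ε`. The
  -- quotient is this residual, and the recursion for `b` is precisely its vanishing at time `0`.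
  refine ⟨c + ε • Z, fun t => ((fun k => Z t (k + 1)) + (fun k => B.jetL s₀ ε (L ε) k 0 t (Z t)) +
    (fun k => B.jetN hm T s₀ ε (F ε) k t ((c + ε • Z) t)) - h t), hwl, hwd, ?_,
    fun t ht => (hwK t ht).trans (le_add_of_nonneg_right (by positivity)), ?_, ?_, fun t ht => ?_,
    fun k hk => ?_, fun t ht k hk => ?_⟩
  · simp [hc0, hZ0 0 (by omega), hb0]
  · exact ((hZl.shift.add (hL.jlc_jetL hε (by linarith) hZp)).add
      (hF.jlc_jetN hT hε le_rfl (by linarith) hwp)).sub hhp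
  · exact ((hZd.shift.add (hL.isJet_jetL hε (by linarith) hZp (hZd.mono (by omega)))).add
      (hF.isJet_jetN hT hε le_rfl (by linarith) hwp (hwd.mono (by omega)))).sub hdh
  · have hZm := hZp.jmem ht
    have hZKp : B.pn m (R - η) p (Z t) ≤ C * K₂ :=
      (pn_mono (hZl.jmem ht) (by omega) le_rfl (by linarith) hm).trans (hZK t)
    have hwKp : B.pn m (R - η) p ((c + ε • Z) t) ≤ W :=
      (pn_mono (hwl.jmem ht) (by omega) le_rfl (by linarith) hm).trans (hwK t ht)
    refine le_trans (pn_sub_le.trans (add_le_add (pn_add_le.trans (add_le_add (pn_add_le.trans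
      (add_le_add (pn_shift_le.trans (hZK t)) ((h₃ ε hε t ht _ hZm).trans
        (mul_le_mul_of_nonneg_left hZKp hK₃)))) ((h₄ ε hε t ht _ (hwp.jmem ht) hwKp).trans
        (mul_le_mul_of_nonneg_left hwKp hK₄))))
      ((pn_mono (hh.jmem ht) le_rfl (by linarith) (by linarith) hm).trans
        ((hhK t ht).trans (le_abs_self _))))) (le_add_of_nonneg_left hW0)
  · simp only [Pi.add_apply, Pi.sub_apply]
    rw [hZ0 (k + 1) (by omega), jetL_congr ε (v := b) (fun i hi => hZ0 i (by omega)),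
      jetN_congr ε (u' := c 0 + ε • b) (fun i hi => by
        simp only [Pi.add_apply, Pi.smul_apply, hZ0 i (show i ≤ p + 1 by omega)]), hbk k]
    abel
  · simp only [Pi.add_apply, Pi.sub_apply, Pi.smul_apply, hck t k]
    rw [jetL_add, jetL_smul]
    simp only [smul_add, smul_sub]
    abel

end BanachScale

/-! ### Smallness of the residual for short times. -/

namespace BanachScale

variable {X : ℝ → Type*} [∀ s, NormedAddCommGroup (X s)] [∀ s, NormedSpace ℝ (X s)]
variable {B : BanachScale X} {m : ℝ} {hm : 0 ≤ m} {ε₀ T s₀ d₁ d₂ : ℝ} {hd₁ : 0 ≤ d₁}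
  {hd₂ : 0 ≤ d₂} {p : ℕ} {F : ℝ → ℝ → ∀ s, X (s + m) → X s}
  {L : ℝ → ℝ → ∀ s, X (s + m) →L[ℝ] X s}

theorem nrm_sub_le_mul_of_hasDerivWithinAt [∀ s, CompleteSpace (X s)] {b r τ C : ℝ} (hb : b ≤ r)
    {g g' : ℝ → X b} (hg : B.LC r τ g) (hg' : B.LC r τ g')
    (hd : ∀ t ∈ Icc 0 τ, HasDerivWithinAt g (g' t) (Icc 0 τ) t)
    (hC : ∀ t ∈ Icc 0 τ, B.nrm r (g' t) ≤ C) {t : ℝ} (ht : t ∈ Icc 0 τ) :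
    B.nrm r (g t - g 0) ≤ C * t := by
  have := (convex_Icc 0 τ).norm_image_sub_le_of_norm_hasDerivWithin_le
    (fun t ht => hg.hasDerivWithinAt_up hb hg' hd ht) hC (⟨le_rfl, ht.1.trans ht.2⟩ : 0 ∈ Icc 0 τ)
    ht
  rw [← map_sub, sub_zero, Real.norm_of_nonneg ht.1] at this
  exact this

/-- An approximate solution on a short time interval, with a small residual. -/
theorem exists_small_residual [∀ s, CompleteSpace (X s)] (hε₀ : 0 < ε₀)
    (hLin : B.AssumptionLin ε₀ T s₀ hm hd₁ hd₂ p L F)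
    (hL : B.AssumptionL ε₀ T s₀ hm p L) (hF : B.AssumptionF ε₀ T s₀ hm p F) (hT : 0 < T)
    {R η c : ℝ} (hη : 0 < η) (hc : s₀ + (p + 1) * m ≤ c)
    (hR₁ : c + d₁ ≤ R - η) (hR₂ : c + d₂ ≤ R - η - m) (K : ℝ) :
    ∃ M₀, 0 ≤ M₀ ∧ ∀ κ, 0 < κ → ∃ τ, 0 < τ ∧ τ ≤ T ∧ ∀ ε ∈ Ioo 0 ε₀,
      ∀ (h : ℝ → ℕ → X s₀) (y : X s₀), B.JLC m (R - m) T p h → IsJet T ε p h →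
      (∀ t ∈ Icc 0 T, B.pn m (R - m) p (h t) ≤ K) → B.Mem R y → B.nrm R y ≤ K →
      ∃ u f : ℝ → ℕ → X s₀, B.JLC m c T (p + 1) u ∧ IsJet T ε (p + 1) u ∧ u 0 0 = y ∧
      (∀ t ∈ Icc 0 T, B.pn m c (p + 1) (u t) ≤ M₀) ∧
      B.JLC m (c - m) τ p f ∧ IsJet τ ε p f ∧
      (∀ t ∈ Icc 0 τ, B.pn m (c - m) p (f t) ≤ κ) ∧
      ∀ t ∈ Icc 0 τ, B.ResEq hm T s₀ ε (L ε) (F ε) p t (h t) (u t) (f t) := by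
  have hpm : 0 ≤ (p : ℝ) * m := by positivity
  have hcast : ((p + 1 : ℕ) : ℝ) * m = p * m + m := by push_cast; ring
  obtain ⟨K₁, hK₁, h₁⟩ := exists_flat_residual hε₀ hL hF hT (R := R) hη (by linarith) K
  obtain ⟨K₂, hK₂, h₂⟩ := hLin.pn_le hε₀ hL hF hT hc le_rfl K₁
  obtain ⟨K₃, hK₃, h₃⟩ := hLin.nrm_le hL hF hT hc le_rfl K₁
  obtain ⟨K₄, hK₄, h₄⟩ := LinEq.pn_le hL hF hT hc le_rfl K₁ p (by omega)
  set V := K₂ * (K₁ + K₁ * K₁) with hV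
  have hV0 : 0 ≤ V := by positivity
  obtain ⟨K₅, hK₅, h₅⟩ := hF.pn_newResidual_le hT hc le_rfl (K₁ + V)
  set A := K₄ * (K₃ * (K₁ + K₁ * K₁) + K₁) with hA
  have hA0 : 0 ≤ A := by positivity
  -- The slope of the bound of the new residual: the quadratic estimate with one factor `v` bounded
  -- by `V` and another by `A * t`. The time `κ / (C + 1)` then achieves the size `κ`.
  set C := K₅ * (2 * V * A + (K₁ + V) * (V * A)) with hC
  have hC0 : 0 ≤ C := by positivity
  refine ⟨K₁ + V, by positivity, fun κ hκ => ⟨min T (κ / (C + 1)), by positivity, min_le_left _ _,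
    fun ε hε h y hh hdh hhK hy hyK => ?_⟩⟩
  set τ := min T (κ / (C + 1)) with hτ
  have hτT : τ ≤ T := min_le_left _ _
  have hsub : ∀ t ∈ Icc 0 τ, t ∈ Icc 0 T := fun t ht => ⟨ht.1, ht.2.trans hτT⟩
  obtain ⟨w, f, hw, hdw, hw0, hwK, hf, hdf, hfK, hf0, hweq⟩ := h₁ ε hε h y hh hdh hhK hy hyK
  have hwd₁ := hw.mono (r' := c + d₁) le_rfl hR₁ (by rw [hcast]; linarith) hm
  have hfd₂ := (hf.mono (r' := c + d₂) le_rfl hR₂ (by linarith) hm).neg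
  obtain ⟨v, hv, hdv, hv0, hveq⟩ := hLin.exists_jet hL hF hT (r := c) hc hε hwd₁ hdw hfd₂ hdf.neg
  have hwd₁K : ∀ t ∈ Icc 0 T, B.pn m (c + d₁) (p + 1) (w t) ≤ K₁ := fun t ht =>
    (pn_mono (hw.jmem ht) le_rfl hR₁ (by rw [hcast]; linarith) hm).trans (hwK t ht)
  have hfd₂K : ∀ t ∈ Icc 0 T, B.pn m (c + d₂) p ((-f) t) ≤ K₁ := fun t ht => by
    rw [Pi.neg_apply, pn_neg]
    exact (pn_mono (hf.jmem ht) le_rfl hR₂ (by linarith) hm).trans (hfK t ht)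
  have hvK : ∀ t ∈ Icc 0 T, B.pn m c (p + 1) (v t) ≤ V := h₂ ε hε w (-f) v hwd₁ hdw hfd₂ hdf.neg hv
    hdv hv0 hveq K₁ K₁ K₁ hwd₁K hwd₁K hfd₂K hfd₂K
  have hwc : ∀ t ∈ Icc 0 T, B.pn m c (p + 1) (w t) ≤ K₁ := fun t ht =>
    (pn_mono (hwd₁.jmem ht) le_rfl (by linarith) (by rw [hcast]; linarith) hm).trans (hwd₁K t ht)
  have hwl := hw.mono (r' := c) le_rfl (by linarith) (by rw [hcast]; linarith) hm
  have hwp := hw.mono (r' := c) (show p ≤ p + 1 by omega) (by linarith) (by linarith) hm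
  have hvp := hv.mono (show p ≤ p + 1 by omega) le_rfl (show s₀ ≤ c - p * m by linarith) hm
  have hfc := hf.mono (r' := c - m) le_rfl (by linarith) (by linarith) hm
  -- the correction is small for small times
  have hvt : ∀ t ∈ Icc 0 T, B.pn m c p (v t) ≤ A * t := fun t ht => by
    have hint : ∀ c : ℝ, ∫ _ in (0 : ℝ)..t, c = t * c := fun c => by simp
    have e1 := h₃ ε hε w (-f) v hwd₁ hdw hfd₂ hdf.neg
      (hv.mono (by omega) le_rfl (by push_cast; linarith) hm) (hdv.mono (by omega)) hv0 hveq
      K₁ hwd₁K hwd₁K t ht (fun _ => K₁) (fun _ => K₁) continuousOn_const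
      monotoneOn_const continuousOn_const monotoneOn_const
      (fun t' ht' => hfd₂K t' ⟨ht'.1, ht'.2.trans ht.2⟩)
      (fun t' ht' => hfd₂K t' ⟨ht'.1, ht'.2.trans ht.2⟩)
    rw [hint] at e1
    -- Flatness is used here: `f k` vanishes at time `0` and its derivative `ε⁻¹ f (k + 1)` is at
    -- most `ε⁻¹ K₁`; the factor `ε` in front removes the singularity. The order `k + 1` must not
    -- exceed `p`.
    have e2 : ∀ k < p, ε * B.nrm (c - (k + 1) * m) ((-f) t k) ≤ K₁ * t := fun k hk => by
      have hkp : ((k + 1 : ℕ) : ℝ) * m ≤ p * m := by gcongr; omega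
      push_cast at hkp
      have hkm : (0 : ℝ) ≤ k * m := by positivity
      have g0 := (hf k hk.le).mono (r' := c - (k + 1) * m) (by linarith) (by linarith)
      have g1 := (hf (k + 1) (by omega)).mono (r' := c - (k + 1) * m) (by linarith)
        (by push_cast; linarith)
      have := nrm_sub_le_mul_of_hasDerivWithinAt (C := ε⁻¹ * K₁) (by linarith) g0 (g1.smul ε⁻¹)
        (hdf k hk) (fun t ht => by
          rw [nrm_smul, abs_of_pos (inv_pos.2 hε.1)]
          refine mul_le_mul_of_nonneg_left ((nrm_mono ((hf (k + 1) (by omega)).1 t ht)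
            (by linarith) (by push_cast; linarith)).trans ((nrm_le_pn (by omega)).trans
            (hfK t ht))) (inv_nonneg.2 hε.1.le)) ht
      rw [hf0 k hk.le, sub_zero] at this
      rw [Pi.neg_apply, Pi.neg_apply, nrm_neg]
      calc ε * B.nrm (c - (k + 1) * m) (f t k) ≤ ε * (ε⁻¹ * K₁ * t) :=
            mul_le_mul_of_nonneg_left this hε.1.le
        _ = K₁ * t := by rw [mul_assoc, mul_inv_cancel_left₀ hε.1.ne']
    -- Only the components of `v` up to the order `p` are shown to be small, for the next one
    -- involves `f p`; these are all that the new residual contains.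
    have e3 := (h₄ ε hε t ht (w t) ((-f) t) (v t) (hveq t ht) (hwp.jmem ht) (hv.jmem ht)
      ((pn_mono (hwl.jmem ht) (by omega) le_rfl (by linarith) hm).trans (hwc t ht)) (K₁ * t)
      (K₁ * t) (mul_nonneg hK₁ ht.1) (mul_nonneg hK₁ ht.1) e2 e2).1
    refine e3.trans ?_
    rw [hA, mul_assoc]
    refine mul_le_mul_of_nonneg_left ?_ hK₄
    linarith
  have htC : ∀ t ∈ Icc 0 τ, C * t ≤ κ := fun t ht => by
    have h1 : t ≤ κ / (C + 1) := ht.2.trans (min_le_right _ _)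
    rw [le_div_iff₀ (by linarith)] at h1
    nlinarith [ht.1]
  refine ⟨w + v, fun t => B.newResidual hm T s₀ ε (F ε) t (w t) (w t) (v t) (f t) (f t),
    hwl.add hv, hdw.add hdv, by simp [hw0, hv0], fun t ht =>
    pn_add_le.trans (add_le_add (hwc t ht) (hvK t ht)), ?_, ?_, fun t ht => ?_, fun t ht =>
    (hweq t (hsub t ht)).add (hveq t (hsub t ht))⟩
  · exact (hF.jlc_newResidual hT hε le_rfl hc hwp hwp hvp hfc hfc).mono_set hτT
  · exact (hF.isJet_newResidual hT hε le_rfl hc hwp hwp hvp (hdw.mono (by omega))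
      (hdw.mono (by omega)) (hdv.mono (by omega)) hdf hdf).mono_set hτT
  · have ht' := hsub t ht
    have n1 : B.pn m c p (w t) ≤ K₁ :=
      (pn_mono (hwl.jmem ht') (by omega) le_rfl (by linarith) hm).trans (hwc t ht')
    have n2 : B.pn m c p (v t) ≤ V :=
      (pn_mono (hv.jmem ht') (by omega) le_rfl (by linarith) hm).trans (hvK t ht')
    have z : ∀ r, B.pn m r p (0 : ℕ → X s₀) = 0 := fun r => by simp [pn]
    -- Without smoothing, `ū = w` and `g = f`, so of the three errors only the quadratic remainder
    -- remains.
    have e := h₅ ε hε t ht' (w t) (w t) (v t) (f t) (f t) (hwp.jmem ht') (hwp.jmem ht')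
      (hvp.jmem ht') (n1.trans (by linarith)) (n1.trans (by linarith)) (n2.trans (by linarith))
      (by rw [sub_self, z]; linarith)
    rw [sub_self, sub_self, z, z] at e
    refine e.trans (le_trans ?_ (htC t ht))
    rw [hC, zero_add, mul_assoc K₅]
    refine mul_le_mul_of_nonneg_left ?_ hK₅
    have a1 := pn_nonneg (B := B) m c p (v t)
    have a2 := pn_nonneg (B := B) m c p (w t)
    have a3 := hvt t ht'
    have q : B.pn m c p (v t) ^ 2 ≤ V * (A * t) := by
      rw [sq]
      exact mul_le_mul n2 a3 a1 hV0
    have q2 : (B.pn m c p (w t) + B.pn m c p (v t)) * B.pn m c p (v t) ^ 2 ≤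
        (K₁ + V) * (V * (A * t)) := mul_le_mul (by linarith) q (by positivity) (by positivity)
    calc _ = 2 * B.pn m c p (v t) ^ 2 +
          (B.pn m c p (w t) + B.pn m c p (v t)) * B.pn m c p (v t) ^ 2 := by ring
      _ ≤ 2 * (V * (A * t)) + (K₁ + V) * (V * (A * t)) := by linarith
      _ = _ := by ring

end BanachScale

/-! ### The original problem and its reading in the base space; existence. -/

namespace BanachScale

variable {X : ℝ → Type*} [∀ s, NormedAddCommGroup (X s)] [∀ s, NormedSpace ℝ (X s)]
variable {B : BanachScale X} {m : ℝ} {hm : 0 ≤ m} {ε₀ T s₀ d₁ d₂ : ℝ} {hd₁ : 0 ≤ d₁}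
  {hd₂ : 0 ≤ d₂} {p : ℕ} {F : ℝ → ℝ → ∀ s, X (s + m) → X s}
  {L : ℝ → ℝ → ∀ s, X (s + m) →L[ℝ] X s}

section Conversion

variable {r τ : ℝ}

theorem incl_solves_rhs (hL : B.AssumptionL ε₀ T s₀ hm p L) (hF : B.AssumptionF ε₀ T s₀ hm p F)
    (hT : 0 < T) (hr : s₀ ≤ r - m) {ε : ℝ} (hε : ε ∈ Ioo 0 ε₀) {t : ℝ} (ht : t ∈ Icc 0 T)
    (h : X (r - m)) (y : X r) :
    B.incl hr (h - (1 / ε) • L ε t (r - m) (B.incl (sub_add_cancel r m).le y) -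
        F ε t (r - m) (B.incl (sub_add_cancel r m).le y)) =
      B.incl hr h - ε⁻¹ • B.opL s₀ ε (L ε) 0 t (B.incl (hr.trans (sub_le_self r hm)) y) -
        B.jetN hm T s₀ ε (F ε) 0 t (fun _ => B.incl (hr.trans (sub_le_self r hm)) y) := by
  have e : B.incl (hr.trans (sub_le_self r hm)) y =
      B.incl (hr.trans (le_add_of_nonneg_right hm)) (B.incl (sub_add_cancel r m).le y) :=
    (B.incl_incl _ _ _).symm
  have hy : B.Mem (r - m + m) (B.incl (hr.trans (sub_le_self r hm)) y) := by
    rw [e]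
    exact mem_incl _ _
  rw [hL.opL_zero hr hε t hy, hF.jetN_zero hT hr hε ht (u := fun _ => _) hy, e, up_incl, map_sub,
    map_sub, map_smul, one_div]

theorem IsSolution.solves (hL : B.AssumptionL ε₀ T s₀ hm p L)
    (hF : B.AssumptionF ε₀ T s₀ hm p F) (hT : 0 < T) (hr : s₀ ≤ r - m) {ε : ℝ}
    (hε : ε ∈ Ioo 0 ε₀) (hτ : τ ≤ T) {a b : ℝ} {hra : r ≤ a} {hrb : r ≤ b} {h : ℝ → X a} {u₀ : X b}
    {u : ℝ → X r} (hu : B.IsSolution hm ε τ (L ε) (F ε) hra hrb h u₀ u) :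
    B.LC r τ (fun t => B.incl (hr.trans (sub_le_self r hm)) (u t)) ∧
      B.Solves hm T s₀ ε (L ε) (F ε) τ
        (fun t => B.incl ((hr.trans (sub_le_self r hm)).trans hra) (h t))
        (fun t => B.incl (hr.trans (sub_le_self r hm)) (u t)) := by
  refine ⟨⟨fun t _ => mem_incl _ _, by simpa only [up_incl] using hu.1⟩, fun t ht => ?_⟩
  have := (B.incl hr).hasFDerivAt.comp_hasDerivWithinAt t (hu.2.2 t ht)
  rw [incl_solves_rhs hL hF hT hr hε ⟨ht.1, ht.2.trans hτ⟩, B.incl_incl] at this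
  simpa only [Function.comp_def, B.incl_incl] using this

/-- The right-hand side is continuous in `X (r - m)`, which promotes the derivative from the base
space to that level. -/
theorem Solves.isSolution [∀ s, CompleteSpace (X s)] (hL : B.AssumptionL ε₀ T s₀ hm p L)
    (hF : B.AssumptionF ε₀ T s₀ hm p F) (hT : 0 < T) (hr : s₀ ≤ r - m) {ε : ℝ}
    (hε : ε ∈ Ioo 0 ε₀) (hτ : τ ≤ T) {a b : ℝ} {hra : r ≤ a} {hrb : r ≤ b}
    {h : ℝ → X a} {u₀ : X b} (hh : ContinuousOn h (Icc 0 τ)) {x : ℝ → X s₀} (hx : B.LC r τ x)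
    (hx0 : x 0 = B.incl ((hr.trans (sub_le_self r hm)).trans hrb) u₀)
    (hS : B.Solves hm T s₀ ε (L ε) (F ε) τ
        (fun t => B.incl ((hr.trans (sub_le_self r hm)).trans hra) (h t)) x) :
    B.IsSolution hm ε τ (L ε) (F ε) hra hrb h u₀ (fun t => B.up s₀ r (x t)) := by
  have hsr : s₀ ≤ r := hr.trans (sub_le_self r hm)
  refine ⟨hx.2, ?_, fun t ht => ?_⟩
  · dsimp only
    rw [hx0, ← B.incl_incl hsr hrb, up_incl]
  · set y : ℝ → X (r - m) := fun t => B.incl ((sub_le_self r hm).trans hra) (h t)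
      - (1 / ε) • L ε t (r - m) (B.incl (sub_add_cancel r m).le (B.up s₀ r (x t)))
      - F ε t (r - m) (B.incl (sub_add_cancel r m).le (B.up s₀ r (x t))) with hy
    have hyx : ∀ t ∈ Icc 0 τ, B.incl hr (y t) = B.incl (hsr.trans hra) (h t) -
        ε⁻¹ • B.opL s₀ ε (L ε) 0 t (x t) - B.jetN hm T s₀ ε (F ε) 0 t (fun _ => x t) :=
      fun t ht => by
        rw [hy, incl_solves_rhs hL hF hT hr hε ⟨ht.1, ht.2.trans hτ⟩, B.incl_incl,
          incl_up hsr (hx.1 t ht)]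
    have hlc : B.LC (r - m) τ (fun t => B.incl hr (y t)) := by
      have h1 : B.LC (r - m) τ (fun t => B.incl (hsr.trans hra) (h t)) :=
        LC.mono (r := a) ⟨fun t _ => mem_incl _ _, by simpa only [up_incl] using hh⟩ hr
          ((sub_le_self r hm).trans hra)
      have h2 := hL.lc_opL (a := 0) (by omega) hr hε (τ := τ) (x := x)
        (by rwa [sub_add_cancel])
      have h3 := hF.lc_jetN hT (k := 0) (by omega) hε hτ (r := r) (by push_cast; linarith)
        (u := fun t _ => x t) (fun k hk => by
          obtain rfl : k = 0 := by omega
          simpa using hx)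
      rw [show r - ((0 : ℕ) + 1 : ℝ) * m = r - m by push_cast; ring] at h3
      exact ((h1.sub (h2.smul ε⁻¹)).sub h3).congr fun t ht => hyx t ht
    have := LC.hasDerivWithinAt_up hr (hx.mono hr (sub_le_self r hm)) hlc
      (fun t ht => by rw [hyx t ht]; exact hS t ht) ht
    rw [up_incl] at this
    exact this.congr (fun t ht => incl_up_of_mem (hx.1 t ht) hr (sub_le_self r hm))
      (incl_up_of_mem (hx.1 t ht) hr (sub_le_self r hm))

end Conversion

/-- Existence of solutions on a time interval that does not depend on `ε`. -/
theorem exists_uniform_solution [∀ s, CompleteSpace (X s)] (hε₀ : 0 < ε₀)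
    (hLin : B.AssumptionLin ε₀ T s₀ hm hd₁ hd₂ p L F)
    (hL : B.AssumptionL ε₀ T s₀ hm p L) (hF : B.AssumptionF ε₀ T s₀ hm p F) (hT : 0 < T)
    {s a ℓ η R : ℝ} (hs : s₀ + (p + 1) * m ≤ s) (hη : 0 < η) (hℓ₁ : d₁ ≤ ℓ)
    (hℓ₂ : d₂ + m + η ≤ ℓ) (ha : s + ℓ ≤ a) (hR₁ : a + 5 * ℓ + d₁ ≤ R - η)
    (hR₂ : a + 5 * ℓ + d₂ ≤ R - η - m) (K : ℝ) :
    ∃ τ, 0 < τ ∧ τ ≤ T ∧ ∃ M, ∀ ε ∈ Ioo 0 ε₀, ∀ (h : ℝ → ℕ → X s₀) (y : X s₀),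
      B.JLC m (R - m) T p h → IsJet T ε p h → (∀ t ∈ Icc 0 T, B.pn m (R - m) p (h t) ≤ K) →
      B.Mem R y → B.nrm R y ≤ K → ∃ x : ℝ → X s₀, B.LC a τ x ∧ (∀ t ∈ Icc 0 τ, B.nrm a (x t) ≤ M) ∧
      x 0 = y ∧ B.Solves hm T s₀ ε (L ε) (F ε) τ (fun t => h t 0) x := by
  have hpm : 0 ≤ (p : ℝ) * m := by positivity
  have hℓ : 0 < ℓ := by linarith
  obtain ⟨M₀, hM₀, h₁⟩ := exists_small_residual hε₀ hLin hL hF hT (R := R) (c := a + 5 * ℓ) hη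
    (by linarith) hR₁ hR₂ K
  -- The threshold `κ` depends on `M₀` but not on the time, and `M₀` was fixed before the time was
  -- chosen; hence `τ` can be adapted to `κ`, uniformly in `ε`.
  obtain ⟨κ, hκ, h₂⟩ := exists_newton_sequence hε₀ hLin hL hF hT hs hη hℓ₁ hℓ₂ ha rfl hM₀
  obtain ⟨τ, hτ0, hτ, h₃⟩ := h₁ κ hκ
  refine ⟨τ, hτ0, hτ, M₀ + 1, fun ε hε h y hh hdh hhK hy hyK => ?_⟩
  obtain ⟨u, f, hu, hdu, hu0, huM, hf, hdf, hfκ, hueq⟩ := h₃ ε hε h y hh hdh hhK hy hyK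
  obtain ⟨V, G, hV, hdV, hV0, hVM, hVV, hG, heq⟩ := h₂ ε hε τ hτ0 hτ h u f hu hdu huM hf hdf hfκ hueq
  have hlow : ∀ {x : ℕ → X s₀}, B.JMem m a (p + 1) x → B.pn m a 1 x ≤ B.pn m a (p + 1) x :=
    fun hx => pn_mono hx (by omega) le_rfl (by push_cast; linarith) hm
  refine exists_solves_of_approx hL hF hT (by linarith) hε hτ (V := V) (G := G)
    (fun n => (hV n).mono (by omega) le_rfl (by push_cast; linarith) hm)
    (fun n => (hdV n).mono (by omega)) (fun n => (hV0 n).trans hu0)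
    (fun n t ht => (hlow ((hV n).jmem ht)).trans (hVM n t ht))
    (fun n t ht => (hlow (((hV (n + 1)).jmem ht).sub ((hV n).jmem ht))).trans (hVV n t ht))
    (fun t ht => ?_) heq hτ0.le
  refine squeeze_zero_norm (a := fun n : ℕ => (1 / 2 : ℝ) ^ n) (fun n => ?_)
    (tendsto_pow_atTop_nhds_zero_of_lt_one (by norm_num) (by norm_num))
  have h0 := (hG n t ht).1 0 (by omega)
  exact (norm_le_nrm h0).trans ((nrm_le_pn (by omega)).trans (hG n t ht).2)

end BanachScale

/-! ### Uniqueness. -/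

/-- A function that is bounded by the integral of each of its continuous monotone majorants
vanishes. -/
theorem nonpos_of_le_integral_of_majorant {τ C Y : ℝ} (hC : 0 ≤ C) (hY : 0 ≤ Y) {g : ℝ → ℝ}
    (hgY : ∀ t ∈ Icc 0 τ, g t ≤ Y)
    (h : ∀ φ : ℝ → ℝ, ContinuousOn φ (Icc 0 τ) → MonotoneOn φ (Icc 0 τ) →
      (∀ t ∈ Icc 0 τ, g t ≤ φ t) → ∀ t ∈ Icc 0 τ, g t ≤ C * ∫ t' in (0 : ℝ)..t, φ t')
    {t : ℝ} (ht : t ∈ Icc 0 τ) : g t ≤ 0 := by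
  -- Gronwall by iteration: each bound is itself a continuous monotone majorant, and integrating it
  -- gives the next term of the exponential series. No regularity of `g` is needed.
  have key : ∀ n : ℕ, ∀ t ∈ Icc 0 τ, g t ≤ Y * ((C * t) ^ n / (n.factorial : ℝ)) := by
    intro n
    induction n with
    | zero => simpa using hgY
    | succ n ih =>
      intro t ht
      refine (h (fun t => Y * ((C * t) ^ n / (n.factorial : ℝ))) (by fun_prop)
        (fun x hx y hy hxy => ?_) ih t ht).trans_eq ?_
      · have := hx.1
        dsimp only
        gcongr
      · have e : ∀ t' : ℝ, Y * ((C * t') ^ n / (n.factorial : ℝ)) =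
            (Y * C ^ n / (n.factorial : ℝ)) * t' ^ n := fun t' => by rw [mul_pow]; ring
        simp only [e]
        rw [intervalIntegral.integral_const_mul, integral_pow, Nat.factorial_succ]
        have : (n.factorial : ℝ) ≠ 0 := by positivity
        push_cast
        field_simp
        ring
  have hl := (FloorSemiring.tendsto_pow_div_factorial_atTop (C * t)).const_mul Y
  rw [mul_zero] at hl
  exact ge_of_tendsto' hl fun n => key n t ht

namespace BanachScale

variable {X : ℝ → Type*} [∀ s, NormedAddCommGroup (X s)] [∀ s, NormedSpace ℝ (X s)]
variable {B : BanachScale X} {m : ℝ} {hm : 0 ≤ m} {ε₀ T s₀ d₁ d₂ : ℝ} {hd₁ : 0 ≤ d₁}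
  {hd₂ : 0 ≤ d₂} {p : ℕ} {F : ℝ → ℝ → ∀ s, X (s + m) → X s}
  {L : ℝ → ℝ → ∀ s, X (s + m) →L[ℝ] X s}

theorem JLC.exists_bound {b r τ : ℝ} {j : ℕ} {u : ℝ → ℕ → X b} (hu : B.JLC m r τ j u) :
    ∃ K, 0 ≤ K ∧ ∀ t ∈ Icc 0 τ, B.pn m r j (u t) ≤ K := by
  have h : ∀ k, k ≤ j → ∃ K, 0 ≤ K ∧ ∀ t ∈ Icc 0 τ, B.nrm (r - k * m) (u t k) ≤ K :=
    fun k hk => (hu k hk).exists_bound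
  obtain ⟨K, hK, h⟩ := exists_uniform_bound j
    (fun k K => ∀ t ∈ Icc 0 τ, B.nrm (r - k * m) (u t k) ≤ K)
    (fun k C C' h hC t ht => (h t ht).trans hC) h
  exact ⟨(j + 1) * K, by positivity, fun t ht => pn_le_of_forall fun k hk => h k hk t ht⟩

section Uniqueness

variable {a τ : ℝ}

/-- The jets of a solution. -/
theorem Solves.exists_jet [∀ s, CompleteSpace (X s)] (hL : B.AssumptionL ε₀ T s₀ hm p L)
    (hF : B.AssumptionF ε₀ T s₀ hm p F) (hT : 0 < T) {ε : ℝ} (hε : ε ∈ Ioo 0 ε₀) (hτ : τ ≤ T)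
    (ha : s₀ + (p + 1) * m ≤ a) {h : ℝ → ℕ → X s₀} (hh : B.JLC m (a - m) τ p h)
    (hdh : IsJet τ ε p h) {x : ℝ → X s₀} (hx : B.LC a τ x)
    (hS : B.Solves hm T s₀ ε (L ε) (F ε) τ (fun t => h t 0) x) :
    ∃ u : ℝ → ℕ → X s₀, (∀ t, u t 0 = x t) ∧ B.JLC m a τ (p + 1) u ∧ IsJet τ ε (p + 1) u ∧
      ∀ k t, u t (k + 1) = ε • h t k - B.jetL s₀ ε (L ε) k 0 t (u t) -
        ε • B.jetN hm T s₀ ε (F ε) k t (u t) := by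
  have hkp : ∀ k ≤ p, (k : ℝ) * m ≤ p * m := fun k hk => by gcongr
  refine exists_jet_of_eq hx (fun k t u => ε • h t k - B.jetL s₀ ε (L ε) k 0 t u -
    ε • B.jetN hm T s₀ ε (F ε) k t u)
    (fun k t u v huv => by rw [jetL_congr ε huv, jetN_congr ε huv]) (fun k hk u hu _ => ?_)
    (fun k hk u hu hdu t ht => ?_) (fun u t ht h0 => ?_)
  · have := hkp k hk
    have e := hh k hk
    rw [show a - m - k * m = a - (k + 1) * m by ring] at e
    exact ((e.smul ε).sub (hL.lc_jetL k hε (by omega) (by linarith) hu)).sub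
      ((hF.lc_jetN hT hk hε hτ (by linarith) hu).smul ε)
  · have := hkp (k + 1) (by omega)
    push_cast at this
    refine ((((hdh k hk t ht).fun_const_smul ε).fun_sub (hL.hasDerivWithinAt_jetL k hε (a := 0)
      (by omega) (r := a) (by linarith) hu hdu ht)).fun_sub ((hF.hasDerivWithinAt_jetN hT hk hε hτ
      (by linarith) hu hdu ht).fun_const_smul ε)).congr_deriv ?_
    simp only [smul_sub, smul_comm ε ε⁻¹]
  · refine (hS t ht).congr_deriv ?_
    rw [jetL_zero, h0, jetN_congr ε (u := u) (u' := fun _ => x t)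
      (fun i hi => by obtain rfl : i = 0 := by omega
                      exact h0), smul_sub, smul_sub,
      inv_smul_smul₀ hε.1.ne', inv_smul_smul₀ hε.1.ne']

/-- The derivatives of the difference of two solutions are controlled by the difference. -/
theorem pn_sub_le_of_solves [∀ s, CompleteSpace (X s)] (hL : B.AssumptionL ε₀ T s₀ hm p L)
    (hF : B.AssumptionF ε₀ T s₀ hm p F) (hT : 0 < T) {s : ℝ} (hs : s₀ + (p + 1) * m ≤ s) (M : ℝ)
    (hM : 0 ≤ M) (hε₀ : 0 < ε₀) (j : ℕ) (hj : j ≤ p) : ∃ K, 0 ≤ K ∧ ∀ ε ∈ Ioo 0 ε₀, ∀ t ∈ Icc 0 T,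
      ∀ u z : ℕ → X s₀, B.JMem m s p u → B.JMem m s p z → B.pn m s p u ≤ M → B.pn m s p z ≤ M →
      (∀ k, z (k + 1) = -B.jetL s₀ ε (L ε) k 0 t z - ε • (B.jetN hm T s₀ ε (F ε) k t (u + z) -
        B.jetN hm T s₀ ε (F ε) k t u)) → B.pn m s j z ≤ K * B.nrm s (z 0) := by
  have hkp : ∀ k ≤ p, (k : ℝ) * m ≤ p * m := fun k hk => by gcongr
  induction j with
  | zero => exact ⟨1, zero_le_one, fun ε _ t _ u z _ _ _ _ _ => by rw [pn_zero_order, one_mul]⟩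
  | succ j ih =>
    have hjp := hkp j (by omega)
    obtain ⟨K, hK, h₀⟩ := ih (by omega)
    obtain ⟨K₁, hK₁, h₁⟩ := hL.jetL_bound j (a := 0) (by omega) (r := s) (by linarith)
    obtain ⟨K₂, hK₂, h₂⟩ := hF.jetN_sub_bound hT (k := j) (by omega) (s := s) (r := s)
      (by linarith) le_rfl M
    obtain ⟨K₃, hK₃, h₃⟩ := hF.jetD_bound hT (k := j) (by omega) (s := s) (r := s)
      (by linarith) le_rfl M
    refine ⟨K + (K₁ + ε₀ * (K₂ * (2 * M + (M + M) * M) + K₃ * (1 + M))) * K, by positivity,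
      fun ε hε t ht u z hu hz huM hzM hzk => ?_⟩
    have hb : s₀ ≤ s - j * m := by linarith
    have ju := hu.mono (show j ≤ p by omega) le_rfl hb hm
    have jz := hz.mono (show j ≤ p by omega) le_rfl hb hm
    have bu := (pn_mono hu (show j ≤ p by omega) le_rfl hb hm).trans huM
    have bz := (pn_mono hz (show j ≤ p by omega) le_rfl hb hm).trans hzM
    have i0 := h₀ ε hε t ht u z hu hz huM hzM hzk
    have i1 := (h₁ ε hε t ht z jz).2
    have i2 := h₂ ε hε t ht u z ju jz bu bz
    have i3 := (h₃ ε hε t ht u z ju jz bu).2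
    have z0 := pn_nonneg (B := B) m s j z
    have u0 := pn_nonneg (B := B) m s j u
    rw [show s - (j + 1) * m = s - ((j + 1 : ℕ) : ℝ) * m by push_cast; ring] at i1 i2 i3
    have q2 : 2 * B.pn m s j z * B.pn m s j z + (B.pn m s j u + B.pn m s j z) * B.pn m s j z ^ 2 ≤
        (2 * M + (M + M) * M) * B.pn m s j z := by
      calc _ = (2 * B.pn m s j z + (B.pn m s j u + B.pn m s j z) * B.pn m s j z) *
            B.pn m s j z := by ring
        _ ≤ _ := by gcongr
    have q3 : B.pn m s j z + B.pn m s j u * B.pn m s j z ≤ (1 + M) * B.pn m s j z := by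
      nlinarith
    have e : B.jetN hm T s₀ ε (F ε) j t (u + z) - B.jetN hm T s₀ ε (F ε) j t u =
        (B.jetN hm T s₀ ε (F ε) j t (u + z) - B.jetN hm T s₀ ε (F ε) j t u -
          B.jetD hm T s₀ ε (F ε) j t u z) + B.jetD hm T s₀ ε (F ε) j t u z := by abel
    have i4 : B.nrm (s - ((j + 1 : ℕ) : ℝ) * m) (B.jetN hm T s₀ ε (F ε) j t (u + z) -
        B.jetN hm T s₀ ε (F ε) j t u) ≤
        (K₂ * (2 * M + (M + M) * M) + K₃ * (1 + M)) * B.pn m s j z := by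
      rw [e]
      refine (nrm_add_le _ _ _).trans ((add_le_add i2 i3).trans ?_)
      nlinarith [mul_le_mul_of_nonneg_left q2 hK₂, mul_le_mul_of_nonneg_left q3 hK₃]
    rw [pn_succ, hzk j, add_mul K]
    refine add_le_add i0 ((nrm_sub_le _ _ _).trans ?_)
    rw [nrm_neg, nrm_smul, abs_of_pos hε.1]
    have hKK : 0 ≤ K₂ * (2 * M + (M + M) * M) + K₃ * (1 + M) := by positivity
    calc _ ≤ K₁ * B.pn m s j z + ε₀ * ((K₂ * (2 * M + (M + M) * M) + K₃ * (1 + M)) *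
          B.pn m s j z) := add_le_add i1 (mul_le_mul hε.2.le i4 (nrm_nonneg _ _) hε₀.le)
      _ = (K₁ + ε₀ * (K₂ * (2 * M + (M + M) * M) + K₃ * (1 + M))) * B.pn m s j z := by ring
      _ ≤ _ := by
        rw [mul_assoc]
        exact mul_le_mul_of_nonneg_left i0 (by positivity)

/-- The difference `z` of two solutions solves the linearized equation with the Taylor remainder as
source. One factor of the remainder is bounded crudely, the other by the jet of `z` in the low norm,
hence by `z` itself through the equation (`pn_sub_le_of_solves`). The energy estimate thus bounds
`|z|_s` by the integral of any monotone majorant of it. Since `ε` is fixed, these constants may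
depend on the two solutions. -/
theorem Solves.eqOn [∀ s, CompleteSpace (X s)] (hε₀ : 0 < ε₀)
    (hLin : B.AssumptionLin ε₀ T s₀ hm hd₁ hd₂ p L F)
    (hL : B.AssumptionL ε₀ T s₀ hm p L) (hF : B.AssumptionF ε₀ T s₀ hm p F) (hT : 0 < T)
    {s : ℝ} (hs : s₀ + (p + 1) * m ≤ s) (ha₁ : s + d₁ < a) (ha₂ : s + d₂ + m < a)
    {ε : ℝ} (hε : ε ∈ Ioo 0 ε₀) (hτ0 : 0 ≤ τ) (hτ : τ ≤ T) {h : ℝ → ℕ → X s₀}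
    (hh : B.JLC m (a - m) τ p h) (hdh : IsJet τ ε p h) {x y : ℝ → X s₀} (hx : B.LC a τ x)
    (hy : B.LC a τ y) (hxy : x 0 = y 0)
    (hSx : B.Solves hm T s₀ ε (L ε) (F ε) τ (fun t => h t 0) x)
    (hSy : B.Solves hm T s₀ ε (L ε) (F ε) τ (fun t => h t 0) y) : EqOn x y (Icc 0 τ) := by
  have hpm : 0 ≤ (p : ℝ) * m := by positivity
  have hcast : ((p + 1 : ℕ) : ℝ) * m = p * m + m := by push_cast; ring
  -- The strict inequalities leave room for the loss of the extension from `[0, τ]` to `[0, T]`.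
  obtain ⟨η, hη, hη₁, hη₂⟩ : ∃ η, 0 < η ∧ s + d₁ ≤ a - η ∧ s + d₂ + m ≤ a - η := by
    refine ⟨min (a - (s + d₁)) (a - (s + d₂ + m)), by simp [ha₁, ha₂], ?_, ?_⟩
    · linarith [min_le_left (a - (s + d₁)) (a - (s + d₂ + m))]
    · linarith [min_le_right (a - (s + d₁)) (a - (s + d₂ + m))]
  obtain ⟨w, hw0, hw, hdw, hwk⟩ := hSx.exists_jet hL hF hT hε hτ (by linarith) hh hdh hx
  obtain ⟨u, hu0, hu, hdu, huk⟩ := hSy.exists_jet hL hF hT hε hτ (by linarith) hh hdh hy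
  have hz := hw.sub hu
  have hdz := hdw.sub hdu
  set z := w - u with hzdef
  have huz : ∀ t, u t + z t = w t := fun t => by rw [hzdef, Pi.sub_apply, add_sub_cancel]
  have hzk : ∀ t k, z t (k + 1) = -B.jetL s₀ ε (L ε) k 0 t (z t) -
      ε • (B.jetN hm T s₀ ε (F ε) k t (u t + z t) - B.jetN hm T s₀ ε (F ε) k t (u t)) :=
    fun t k => by
      rw [huz]
      simp only [hzdef, Pi.sub_apply, hwk, huk]
      rw [jetL_sub, smul_sub]
      abel
  have hbl : s₀ ≤ a - η - ((p + 1 : ℕ) : ℝ) * m := by rw [hcast]; linarith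
  have hU := hu.extend (T := T) (ε := ε) hη hm hbl hτ0
  have hdU := hdu.extend (T := T) hη hm hbl hτ0 hu
  have hZ := hz.extend (T := T) (ε := ε) hη hm hbl hτ0
  have hdZ := hdz.extend (T := T) hη hm hbl hτ0 hz
  set U := B.extend m ε (p + 1) τ u with hUdef
  set Z := B.extend m ε (p + 1) τ z with hZdef
  have hUu : ∀ t ∈ Icc 0 τ, U t = u t := fun t ht => extend_of_le ht.2
  have hZz : ∀ t ∈ Icc 0 τ, Z t = z t := fun t ht => extend_of_le ht.2
  have hUp := hU.mono (show p ≤ p + 1 by omega) le_rfl (show s₀ ≤ a - η - p * m by linarith) hm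
  have hZp := hZ.mono (show p ≤ p + 1 by omega) le_rfl (show s₀ ≤ a - η - p * m by linarith) hm
  -- The source is defined on `[0, T]` so that the extended difference solves the linearized
  -- equation by construction; it is identified with the quadratic remainder only on `[0, τ]`.
  let f : ℝ → ℕ → X s₀ := ε⁻¹ • ((fun t k => Z t (k + 1)) +
    (fun t k => B.jetL s₀ ε (L ε) k 0 t (Z t))) +
    fun t k => B.jetD hm T s₀ ε (F ε) k t (U t) (Z t)
  have hf : B.JLC m (a - η - m) T p f :=
    ((hZ.shift.add (hL.jlc_jetL hε (by linarith) hZp)).smul ε⁻¹).add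
      (hF.jlc_jetD hT hε le_rfl (by linarith) hUp hZp)
  have hdf : IsJet T ε p f :=
    ((hdZ.shift.add (hL.isJet_jetL hε (by linarith) hZp (hdZ.mono (by omega)))).smul ε⁻¹).add
      (hF.isJet_jetD hT hε le_rfl (by linarith) hUp (hdU.mono (by omega)) hZp (hdZ.mono (by omega)))
  have hfeq : ∀ t ∈ Icc 0 T, B.LinEq hm T s₀ ε (L ε) (F ε) p t (U t) (f t) (Z t) :=
    fun t _ k _ => by
      simp only [f, Pi.add_apply, Pi.smul_apply, smul_add, smul_inv_smul₀ hε.1.ne']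
      abel
  have hfQ : ∀ t ∈ Icc 0 τ, f t = -(fun k => B.jetN hm T s₀ ε (F ε) k t (u t + z t) -
      B.jetN hm T s₀ ε (F ε) k t (u t) - B.jetD hm T s₀ ε (F ε) k t (u t) (z t)) := fun t ht => by
    funext k
    simp only [f, Pi.add_apply, Pi.smul_apply, Pi.neg_apply, hUu t ht, hZz t ht, hzk t k]
    rw [show ∀ A C : X s₀, -A - ε • C + A = -(ε • C) from fun A C => by abel, smul_neg,
      inv_smul_smul₀ hε.1.ne']
    abel
  have h0τ : (0 : ℝ) ∈ Icc 0 τ := ⟨le_rfl, hτ0⟩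
  have hZ0 : Z 0 0 = 0 := by
    rw [hZz 0 h0τ, hzdef, Pi.sub_apply, Pi.sub_apply, hw0, hu0, hxy, sub_self]
  -- the constants of the energy estimate
  obtain ⟨M₁, hM₁, hUM⟩ := (hU.mono (r' := s + d₁) le_rfl hη₁ (by rw [hcast]; linarith)
    hm).exists_bound
  obtain ⟨M₂, hM₂, huM⟩ := hu.exists_bound
  obtain ⟨M₃, hM₃, hzM⟩ := hz.exists_bound
  obtain ⟨K₁, hK₁, h₁⟩ := hLin.nrm_le hL hF hT hs le_rfl M₁
  -- At the level `s + d₂ + m`, the remainder lands in `s + d₂`, where the energy estimate requires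
  -- the source.
  obtain ⟨K₂, hK₂, h₂⟩ := hF.pn_jetN_sub_le hT (r := s + d₂ + m) hs (by linarith) (M₂ + M₃)
  obtain ⟨K₃, hK₃, h₃⟩ := pn_sub_le_of_solves hL hF hT hs (M₂ + M₃) (by positivity) hε₀ p le_rfl
  have hmono : ∀ {v : ℕ → X s₀} {r : ℝ}, B.JMem m a (p + 1) v → s ≤ r → r ≤ a →
      B.JMem m r p v ∧ B.pn m r p v ≤ B.pn m a (p + 1) v := fun hv hr hra =>
    ⟨hv.mono (by omega) hra (by linarith) hm, pn_mono hv (by omega) hra (by linarith) hm⟩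
  have hfz : ∀ t ∈ Icc 0 τ, B.pn m (s + d₂) p (f t) ≤
      K₂ * (2 * M₃ + (M₂ + M₃) * M₃) * K₃ * B.nrm s (z t 0) := fun t ht => by
    have htT : t ∈ Icc 0 T := ⟨ht.1, ht.2.trans hτ⟩
    obtain ⟨us, us'⟩ := hmono (r := s) (hu.jmem ht) le_rfl (by linarith)
    obtain ⟨zs, zs'⟩ := hmono (r := s) (hz.jmem ht) le_rfl (by linarith)
    obtain ⟨ur, ur'⟩ := hmono (r := s + d₂ + m) (hu.jmem ht) (by linarith) (by linarith)
    obtain ⟨zr, zr'⟩ := hmono (r := s + d₂ + m) (hz.jmem ht) (by linarith) (by linarith)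
    have bu := huM t ht
    have bz := hzM t ht
    have e1 := h₂ ε hε t htT (u t) (z t) ur zr (by linarith) (by linarith)
    have e2 := h₃ ε hε t htT (u t) (z t) us zs (by linarith) (by linarith) (hzk t)
    rw [add_sub_cancel_right] at e1
    rw [hfQ t ht, pn_neg]
    have z0 := pn_nonneg (B := B) m s p (z t)
    have u0 := pn_nonneg (B := B) m (s + d₂ + m) p (u t)
    have z1 := pn_nonneg (B := B) m (s + d₂ + m) p (z t)
    refine e1.trans ?_
    calc _ = K₂ * (2 * B.pn m (s + d₂ + m) p (z t) + (B.pn m (s + d₂ + m) p (u t) +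
          B.pn m (s + d₂ + m) p (z t)) * B.pn m s p (z t)) * B.pn m s p (z t) := by ring
      _ ≤ K₂ * (2 * M₃ + (M₂ + M₃) * M₃) * (K₃ * B.nrm s (z t 0)) := by
        have c1 := ur'.trans bu
        have c2 := zr'.trans bz
        have c3 := zs'.trans bz
        gcongr
      _ = _ := by ring
  set Q := K₂ * (2 * M₃ + (M₂ + M₃) * M₃) * K₃ with hQ
  have hQ0 : 0 ≤ Q := by positivity
  have hzs : ∀ t ∈ Icc 0 τ, B.nrm s (z t 0) ≤ M₃ := fun t ht => by
    have := hmono (r := s) (hz.jmem ht) le_rfl (by linarith)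
    refine le_trans ?_ (this.2.trans (hzM t ht))
    simpa using nrm_le_pn (B := B) (m := m) (r := s) (x := z t) (Nat.zero_le p)
  have hvan : ∀ t ∈ Icc 0 τ, B.nrm s (z t 0) ≤ 0 := fun t ht =>
    nonpos_of_le_integral_of_majorant (g := fun t => B.nrm s (z t 0))
      (C := K₁ * (1 + M₁) * Q) (by positivity) hM₃ hzs
      (fun φ hφc hφm hφ t ht => by
        have hsub : Icc 0 t ⊆ Icc 0 τ := Icc_subset_Icc le_rfl ht.2
        have hmaj : ∀ t' ∈ Icc 0 t, B.pn m (s + d₂) p (f t') ≤ Q * φ t' := fun t' ht' =>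
          (hfz t' (hsub ht')).trans (mul_le_mul_of_nonneg_left (hφ t' (hsub ht')) hQ0)
        have hc : ContinuousOn (fun t => Q * φ t) (Icc 0 t) := (hφc.mono hsub).const_smul Q
        have hmn : MonotoneOn (fun t => Q * φ t) (Icc 0 t) := fun x hx y hy hxy =>
          mul_le_mul_of_nonneg_left (hφm (hsub hx) (hsub hy) hxy) hQ0
        have := h₁ ε hε U f Z (hU.mono le_rfl hη₁ (by rw [hcast]; linarith) hm) hdU
          (hf.mono le_rfl (by linarith) (by linarith) hm) hdf
          (hZ.mono (by omega) (by linarith) (by push_cast; linarith) hm) (hdZ.mono (by omega)) hZ0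
          hfeq M₁ hUM hUM t ⟨ht.1, ht.2.trans hτ⟩ _ _ hc hmn hc hmn hmaj hmaj
        rw [hZz t ht, intervalIntegral.integral_const_mul] at this
        linarith) ht
  intro t ht
  have hmem : B.Mem s (z t 0) := by
    have := (hmono (r := s) (hz.jmem ht) le_rfl (by linarith)).1 0 (by omega)
    simpa using this
  have e := eq_zero_of_nrm_eq_zero hmem (le_antisymm (hvan t ht) (nrm_nonneg _ _))
  rw [hzdef, Pi.sub_apply, Pi.sub_apply, hw0, hu0] at e
  exact sub_eq_zero.1 e

end Uniqueness

end BanachScale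

/-! ### Arithmetic of the loss indices and conclusion. -/

theorem two_mul_add_le_of_Pmin_lt {m d₁ d₂ D P : ℝ} (hm : 0 ≤ m) (hd₂ : 0 ≤ d₂)
    (hD : lossIndex m d₁ d₂ < D) (hP : Pmin m d₁ d₂ D < P) :
    2 * D + 6 * lossIndex m d₁ d₂ ≤ P := by
  have h1 : d₂ + m ≤ lossIndex m d₁ d₂ := le_max_right _ _
  set δ := lossIndex m d₁ d₂ with hδdef
  have hq : 0 < D - m - d₂ := by linarith
  have hδ : 0 ≤ δ := by linarith
  set q := D - m - d₂ with hqdef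
  -- Since `√(2 (δ + q)) ≥ √δ`, the double product is at least `2 δ`. Multiplication by `D / q ≥ 1`
  -- then gives at least `2 D + 5 δ`, and `Pmin` contains one more `δ`.
  have hsq : 2 * q + 5 * δ ≤ (√δ + √(2 * (δ + q))) ^ 2 := by
    have e1 := Real.sq_sqrt hδ
    have e2 := Real.sq_sqrt (show 0 ≤ 2 * (δ + q) by linarith)
    have h3 : √δ ≤ √(2 * (δ + q)) := Real.sqrt_le_sqrt (by linarith)
    nlinarith [Real.sqrt_nonneg δ, mul_le_mul_of_nonneg_left h3 (Real.sqrt_nonneg δ)]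
  have h2 : D / q * (2 * q + 5 * δ) ≤ D / q * (√δ + √(2 * (δ + q))) ^ 2 :=
    mul_le_mul_of_nonneg_left hsq (div_nonneg (by linarith) hq.le)
  have h3 : D / q * (2 * q) = 2 * D := by
    field_simp
  have h4 : 5 * δ ≤ D / q * (5 * δ) :=
    le_mul_of_one_le_left (by linarith) ((one_le_div hq).2 (by linarith))
  unfold Pmin at hP
  rw [← hδdef, ← hqdef] at hP
  linarith

theorem theorem1 {X : ℝ → Type*} [∀ s, NormedAddCommGroup (X s)] [∀ s, NormedSpace ℝ (X s)]
    [∀ s, CompleteSpace (X s)] (B : BanachScale X)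
    (ε₀ : ℝ) (hε₀ : 0 < ε₀) (p : ℕ) (T s₀ m d₁ d₂ : ℝ) (hT : 0 < T)
    (hm : 0 ≤ m) (hd₁ : 0 ≤ d₁) (hd₂ : 0 ≤ d₂)
    (L : ℝ → ℝ → ∀ s, X (s + m) →L[ℝ] X s) (F : ℝ → ℝ → ∀ s, X (s + m) → X s)
    (hL : B.AssumptionL ε₀ T s₀ hm p L)
    (hF : B.AssumptionF ε₀ T s₀ hm p F)
    (hLin : B.AssumptionLin ε₀ T s₀ hm hd₁ hd₂ p L F)
    (D P s : ℝ) (hD : lossIndex m d₁ d₂ < D) (hP : Pmin m d₁ d₂ D < P)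
    (hs : s₀ + (p + 1) * m ≤ s)
    (h : ℝ → ℝ → X (s + P)) (u₀ : ℝ → X (s + P + m))
    (hmem : ∀ ε ∈ Set.Ioo 0 ε₀, B.MemX hm T p (h ε))
    (hbdd : ∃ K : ℝ, ∀ ε ∈ Set.Ioo 0 ε₀, B.normF hm T ε p (h ε) (u₀ ε) ≤ K) :
    ∃ T' : ℝ, 0 < T' ∧ T' ≤ T ∧ ∃ u : ℝ → ℝ → X (s + D),
      B.IsBoundedSolutionFamily hm ε₀ T' L F (add_le_add_of_Pmin_lt hm hd₂ hD hP s)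
        ((add_le_add_of_Pmin_lt hm hd₂ hD hP s).trans (le_add_of_nonneg_right hm)) h u₀ u ∧
      ∀ w : ℝ → ℝ → X (s + D),
        B.IsBoundedSolutionFamily hm ε₀ T' L F (add_le_add_of_Pmin_lt hm hd₂ hD hP s)
          ((add_le_add_of_Pmin_lt hm hd₂ hD hP s).trans (le_add_of_nonneg_right hm)) h u₀ w →
        ∀ ε ∈ Set.Ioo 0 ε₀, Set.EqOn (w ε) (u ε) (Set.Icc 0 T') := by
  have hpm : 0 ≤ (p : ℝ) * m := by positivity
  have hP2 := two_mul_add_le_of_Pmin_lt hm hd₂ hD hP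
  have hδ₁ : d₁ ≤ lossIndex m d₁ d₂ := le_max_left _ _
  have hδ₂ : d₂ + m ≤ lossIndex m d₁ d₂ := le_max_right _ _
  set δ := lossIndex m d₁ d₂ with hδ
  have hDP : s + D ≤ s + P := add_le_add_of_Pmin_lt hm hd₂ hD hP s
  have hsD : s₀ ≤ s + D - m := by linarith
  have hR : s₀ ≤ s + P + m := by linarith
  obtain ⟨K, hK⟩ := hbdd
  -- The gap `D - δ` is shared between `η` and the excess of `ℓ` over `δ`. The low level is `a = s +
  -- D`, the high one `a + 5 ℓ`, and `R = s + P + m` is the regularity of the initial datum. What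
  -- the construction consumes above `s` is at most `D + 6 δ + 6 (D - δ) / 16`, which is below `2 D
  -- + 6 δ`.
  obtain ⟨τ, hτ0, hτ, M, hex⟩ := BanachScale.exists_uniform_solution hε₀ hLin hL hF hT (s := s)
    (a := s + D) (ℓ := δ + (D - δ) / 16) (η := (D - δ) / 16) (R := s + P + m) hs (by linarith)
    (by linarith) (by linarith) (by linarith) (by linarith) (by linarith) K
  have hjet : ∀ ε ∈ Ioo 0 ε₀, ∃ H : ℝ → ℕ → X s₀, B.JLC m (s + P) T p H ∧
      BanachScale.IsJet T ε p H ∧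
      (∀ t, H t 0 = B.incl ((hsD.trans (sub_le_self _ hm)).trans hDP) (h ε t)) ∧
      ∀ t ∈ Icc 0 T, B.pn m (s + P) p (H t) ≤ B.normX hm T ε p (h ε) := fun ε hε =>
    (hmem ε hε).exists_jet hT hε.1 (by linarith)
  have hsol : ∀ ε ∈ Ioo 0 ε₀, ∃ u : ℝ → X (s + D),
      B.IsSolution hm ε τ (L ε) (F ε) hDP (hDP.trans (le_add_of_nonneg_right hm)) (h ε) (u₀ ε) u ∧
      ∀ t ∈ Icc 0 τ, ‖u t‖ ≤ M := fun ε hε => by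
    obtain ⟨H, hH, hdH, hH0, hHn⟩ := hjet ε hε
    have hn := hK ε hε
    rw [BanachScale.normF] at hn
    have hn0 : 0 ≤ B.normX hm T ε p (h ε) :=
      (BanachScale.pn_nonneg _ _ _ _).trans (hHn 0 ⟨le_rfl, hT.le⟩)
    have hn1 := norm_nonneg (u₀ ε)
    obtain ⟨x, hx, hxM, hx0, hS⟩ := hex ε hε H (B.incl hR (u₀ ε))
      (by rwa [add_sub_cancel_right]) hdH
      (fun t ht => by
        rw [add_sub_cancel_right]
        linarith [hHn t ht])
      (BanachScale.mem_incl hR _) (by rw [BanachScale.nrm_incl]; linarith)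
    refine ⟨fun t => B.up s₀ (s + D) (x t), BanachScale.Solves.isSolution hL hF hT hsD hε hτ
      ?_ hx hx0 (by simpa only [hH0] using hS), hxM⟩
    have h0 : B.LC (s + P) τ (fun t => H t 0) := by simpa using hH.mono_set hτ 0 (Nat.zero_le p)
    simpa only [hH0, BanachScale.up_incl] using h0.2
  choose! u hu huM using hsol
  refine ⟨τ, hτ0, hτ, u, ⟨hu, M, huM⟩, fun w hw ε hε t ht => ?_⟩
  obtain ⟨H, hH, hdH, hH0, -⟩ := hjet ε hε
  obtain ⟨hu1, hu2⟩ := (hu ε hε).solves hL hF hT hsD hε hτ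
  obtain ⟨hw1, hw2⟩ := (hw.1 ε hε).solves hL hF hT hsD hε hτ
  -- Uniqueness is applied for each `ε` separately, at the level `a = s + D`; its strict
  -- inequalities follow from `D > δ`.
  have e := BanachScale.Solves.eqOn hε₀ hLin hL hF hT hs (by linarith) (by linarith) hε hτ0.le hτ
    ((hH.mono (r' := s + D - m) le_rfl (by linarith) (by linarith) hm).mono_set hτ)
    (hdH.mono_set hτ) hw1 hu1
    (by rw [(hw.1 ε hε).2.1, (hu ε hε).2.1]) (by simpa only [hH0] using hw2)
    (by simpa only [hH0] using hu2) ht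
  exact B.incl_injective _ e
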